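/- Let $m,n\ge 0$, $k\in\mathbb C$, and $\mathfrak g=s\ell(m|n)$, realised by $(m+n)\times(m+n)$ matrices of supertrace $0$, with the form $\mathrm{str}(AB)$. Let $V_k(\mathfrak g)$ be the classical affine superalgebra at level $k$: the Poisson vertex superalgebra of supercommutative differential polynomials in the currents, with bracket $\{A_\lambda B\}=[A,B]+k\,\mathrm{str}(AB)\lambda$ on $\mathfrak g$. *Classical Hamiltonian reduction.* If $V$ is a Poisson vertex superalgebra and $C,S\subset V$ are sets (constraints and gauge generators), let $I$ be the differential ideal of $V$ generated by $C$; the reduction of $V$ by $(C,S)$ is $\{x\in V:\{s_\lambda x\}\in I[\lambda]\ \forall s\in S\}/I$, with the induced operations. A family of constraints is first class if the coefficients of their mutual $\lambda$-brackets lie in $I$; one then takes $S=C$. *Primary reductions.* A partition of the $m$ bosonic and of the $n$ fermionic indices into blocks defines the regular subalgebra $\mathcal H=\bigoplus_{\text{blocks}}s\ell(\text{block})$ of the bosonic part of $\mathfrak g$. Order each block by the order of the indices, let $\{E_-,H,E_+\}$ be the principal $s\ell(2)$ of $\mathcal H$ with $E_-$ having ones just below the diagonal of each block and $[H,E_\pm]=\pm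 E_\pm$, and grade $\mathfrak g=\bigoplus_{i\in\frac12\mathbb Z}\mathfrak g_i$ by $\mathrm{ad}\,H$. Then $\mathcal W(\mathfrak g,\mathcal H)$ is the reduction of $V_k(\mathfrak g)$ with $C=\{A-\mathrm{str}(E_-A):A\in\mathfrak g_{\ge1}\}$ and $S=\mathfrak g_{\ge 1/2}$. *Generalized horizontal gauge.* Order the blocks by their smallest index. The free ("star") entries of the current matrix $J$ are, in the submatrix with rows in a block of size $p$ and columns in a block of size $q$: the last $\min(p,q)$ entries of the first row, if the row block is equal to or precedes the column block; the first $\min(p,q)$ entries of the last column otherwise. The gauge slice is the set of $J=E_-+v$ with $v$ supported on star entries and $\mathrm{str}\,v=0$ (if $m=n$, where $J$ matters only up to multiples of the identity, take $\mathrm{tr}\,v=0$ instead). **Theorem.** Let $\mathcal H\subset\mathcal H'$ be two such subalgebras of $s\ell(m|n)$. Then: 1. the generalized horizontal gauge of $\mathcal H$ is a complete gauge fixing: restriction to the slice is a bijection from $\mathcal W(s\ell(m|n),\mathcal H)$ onto the differential polynomials on the slice; in particular each star entry $J_s$ in an off-diagonal submatrix is the restriction of a unique $W_s\in\mathcal W(s\ell(m|n),\mathcal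 H)$; 2. the classical secondary reduction $\mathcal W(s\ell(m|n),\mathcal H)\to\mathcal W(s\ell(m|n),\mathcal H')$ can be performed: there are a set $K$ of star entries in off-diagonal submatrices and constants $\chi_s\in\mathbb C$ ($s\in K$) such that the constraints $W_s-\chi_s$, $s\in K$, are first class, and the Hamiltonian reduction of $\mathcal W(s\ell(m|n),\mathcal H)$ by these constraints is isomorphic, as a Poisson vertex superalgebra, to $\mathcal W(s\ell(m|n),\mathcal H')$ (at the same level $k$). -/

import Mathlib

open scoped TensorProduct

noncomputable section

namespace ClassicalW

/-! ### Supercommutative differential polynomials -/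

/-- The underlying space of the free supercommutative algebra over `ℂ` on the symbols `g⁽ⁿ⁾`
(`g : G`, `n : ℕ`), where `g⁽ⁿ⁾` is odd if `p g = true` and even otherwise: polynomials in the even
symbols tensored with the exterior algebra on the odd ones. -/
abbrev RawPoly {G : Type} (p : G → Bool) : Type :=
  MvPolynomial ({g : G // p g = false} × ℕ) ℂ ⊗[ℂ]
    ExteriorAlgebra ℂ (({g : G // p g = true} × ℕ) →₀ ℂ)

variable {G : Type} (p : G → Bool)

/-- The symbol `g⁽ⁿ⁾`, for `u = (g, n)`. -/
def rawGen (u : G × ℕ) : RawPoly p :=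
  if h : p u.1 = true then
    1 ⊗ₜ ExteriorAlgebra.ι ℂ (Finsupp.single (⟨u.1, h⟩, u.2) 1)
  else
    MvPolynomial.X (⟨u.1, by simpa using h⟩, u.2) ⊗ₜ 1

/-- The left partial derivative with respect to the symbol `u`, a superderivation of the parity of
`u`: `∂ᴸ(xy) = ∂ᴸ(x) y ± x ∂ᴸ(y)`. -/
def leftDeriv (u : G × ℕ) : RawPoly p →ₗ[ℂ] RawPoly p :=
  if h : p u.1 = true then
    LinearMap.lTensor _ (CliffordAlgebra.contractLeft (Finsupp.lapply (⟨u.1, h⟩, u.2)))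
  else
    LinearMap.rTensor _ (MvPolynomial.pderiv (R := ℂ)
      ((⟨u.1, by simpa using h⟩, u.2) : {g : G // p g = false} × ℕ)).toLinearMap

/-- The right partial derivative with respect to the symbol `u`:
`∂ᴿ(xy) = x ∂ᴿ(y) ± ∂ᴿ(x) y`. -/
def rightDeriv (u : G × ℕ) : RawPoly p →ₗ[ℂ] RawPoly p :=
  if h : p u.1 = true then
    LinearMap.lTensor _ (CliffordAlgebra.contractRight.flip (Finsupp.lapply (⟨u.1, h⟩, u.2)))
  else
    LinearMap.rTensor _ (MvPolynomial.pderiv (R := ℂ)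
      ((⟨u.1, by simpa using h⟩, u.2) : {g : G // p g = false} × ℕ)).toLinearMap

theorem finite_contractLeft {O : Type} (x : ExteriorAlgebra ℂ (O →₀ ℂ)) :
    {o : O | CliffordAlgebra.contractLeft (Finsupp.lapply o) x ≠ 0}.Finite := by
  induction x using CliffordAlgebra.left_induction with
  | algebraMap r => simp
  | add x y hx hy =>
    refine (hx.union hy).subset fun o ho => ?_
    by_contra hc
    simp only [Set.mem_union, Set.mem_ofPred_eq, not_or, not_not] at hc
    exact ho (by rw [map_add, hc.1, hc.2, add_zero])
  | ι_mul x m hx =>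
    refine (hx.union m.support.finite_toSet).subset fun o ho => ?_
    by_contra hc
    simp only [Set.mem_union, Set.mem_ofPred_eq, not_or, not_not, Finset.mem_coe,
      Finsupp.mem_support_iff] at hc
    refine ho ?_
    rw [CliffordAlgebra.contractLeft_ι_mul, hc.1]
    simp [hc.2]

theorem finite_contractRight {O : Type} (x : ExteriorAlgebra ℂ (O →₀ ℂ)) :
    {o : O | CliffordAlgebra.contractRight x (Finsupp.lapply o) ≠ 0}.Finite := by
  refine (finite_contractLeft (CliffordAlgebra.reverse x)).subset fun o ho => ?_
  intro hc
  exact ho (by rw [CliffordAlgebra.contractRight_eq, hc, map_zero])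

theorem finite_deriv_aux (D : G × ℕ → RawPoly p →ₗ[ℂ] RawPoly p)
    (h : D = leftDeriv p ∨ D = rightDeriv p) (x : RawPoly p) :
    {u : G × ℕ | D u x ≠ 0}.Finite := by
  induction x using TensorProduct.induction_on with
  | zero => simp
  | add x y hx hy =>
    refine (hx.union hy).subset fun o ho => ?_
    by_contra hc
    simp only [Set.mem_union, Set.mem_ofPred_eq, not_or, not_not] at hc
    exact ho (by rw [map_add, hc.1, hc.2, add_zero])
  | tmul a b =>
    have h1 := (a.vars.finite_toSet).image
      (fun v : {g : G // p g = false} × ℕ => ((v.1 : G), v.2))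
    have h2 := (finite_contractLeft b).image
      (fun v : {g : G // p g = true} × ℕ => ((v.1 : G), v.2))
    have h3 := (finite_contractRight b).image
      (fun v : {g : G // p g = true} × ℕ => ((v.1 : G), v.2))
    refine ((h1.union h2).union h3).subset fun u hu => ?_
    by_contra hc
    simp only [Set.mem_union, not_or] at hc
    obtain ⟨⟨c1, c2⟩, c3⟩ := hc
    refine hu ?_
    by_cases hp : p u.1 = true
    · rcases h with rfl | rfl
      · have : CliffordAlgebra.contractLeft (Finsupp.lapply (⟨u.1, hp⟩, u.2)) b = 0 := by
          by_contra hne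
          exact c2 ⟨(⟨u.1, hp⟩, u.2), hne, rfl⟩
        simp only [leftDeriv, hp, dite_true, LinearMap.lTensor_tmul]
        rw [this, TensorProduct.tmul_zero]
      · have : CliffordAlgebra.contractRight b (Finsupp.lapply (⟨u.1, hp⟩, u.2)) = 0 := by
          by_contra hne
          exact c3 ⟨(⟨u.1, hp⟩, u.2), hne, rfl⟩
        simp only [rightDeriv, hp, dite_true, LinearMap.lTensor_tmul, LinearMap.flip_apply]
        rw [this, TensorProduct.tmul_zero]
    · have hp' : p u.1 = false := by simpa using hp
      have : MvPolynomial.pderiv (R := ℂ)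
          ((⟨u.1, hp'⟩, u.2) : {g : G // p g = false} × ℕ) a = 0 := by
        refine MvPolynomial.pderiv_eq_zero_of_notMem_vars fun hne => ?_
        exact c1 ⟨(⟨u.1, hp'⟩, u.2), hne, rfl⟩
      rcases h with rfl | rfl
      · rw [leftDeriv, dif_neg hp, LinearMap.rTensor_tmul, Derivation.coeFn_coe, this,
          TensorProduct.zero_tmul]
      · rw [rightDeriv, dif_neg hp, LinearMap.rTensor_tmul, Derivation.coeFn_coe, this,
          TensorProduct.zero_tmul]

/-- The free supercommutative algebra over `ℂ` on the symbols `g⁽ⁿ⁾`. -/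
def SuperDiffPoly {G : Type} (p : G → Bool) : Type := RawPoly p

instance : Ring (SuperDiffPoly p) := inferInstanceAs (Ring (RawPoly p))

instance : Algebra ℂ (SuperDiffPoly p) := inferInstanceAs (Algebra ℂ (RawPoly p))

/-- The symbol `g⁽ⁿ⁾`, for `u = (g, n)`. -/
def gen (u : G × ℕ) : SuperDiffPoly p := rawGen p u

/-- All left partial derivatives at once. -/
def leftGrad : SuperDiffPoly p →ₗ[ℂ] (G × ℕ →₀ SuperDiffPoly p) where
  toFun x := Finsupp.ofSupportFinite (fun u => leftDeriv p u x)
    (finite_deriv_aux p _ (Or.inl rfl) x)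
  map_add' x y := Finsupp.ext fun u => map_add (leftDeriv p u) x y
  map_smul' c x := Finsupp.ext fun u => map_smul (leftDeriv p u) c x

/-- All right partial derivatives at once. -/
def rightGrad : SuperDiffPoly p →ₗ[ℂ] (G × ℕ →₀ SuperDiffPoly p) where
  toFun x := Finsupp.ofSupportFinite (fun u => rightDeriv p u x)
    (finite_deriv_aux p _ (Or.inr rfl) x)
  map_add' x y := Finsupp.ext fun u => map_add (rightDeriv p u) x y
  map_smul' c x := Finsupp.ext fun u => map_smul (rightDeriv p u) c x

/-- The total derivative `∂`, the even derivation with `∂ g⁽ⁿ⁾ = g⁽ⁿ⁺¹⁾`. -/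
def totalDeriv : SuperDiffPoly p →ₗ[ℂ] SuperDiffPoly p :=
  Finsupp.lsum ℂ (fun u : G × ℕ => LinearMap.mulLeft ℂ (gen p (u.1, u.2 + 1))) ∘ₗ leftGrad p

/-- The parity automorphism: `+1` on even and `-1` on odd elements. -/
def parity : SuperDiffPoly p →ₐ[ℂ] SuperDiffPoly p :=
  (Algebra.TensorProduct.map (AlgHom.id ℂ _) CliffordAlgebra.involute : RawPoly p →ₐ[ℂ] RawPoly p)

/-! ### `λ`-brackets

The Poisson bracket of fields is encoded in a `λ`-bracket; a polynomial in `λ` with coefficients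
in the algebra is an element of `Polynomial`, with `λ` the polynomial variable. -/

/-- The operator `λ + ∂`. -/
def lamD (q : Polynomial (SuperDiffPoly p)) : Polynomial (SuperDiffPoly p) :=
  q.sum fun k c => Polynomial.monomial (k + 1) c + Polynomial.monomial k (totalDeriv p c)

/-- For `q = ∑ cₖ λᵏ`, the sum `∑ ((λ + ∂)ᵏ y) cₖ`, in which `∂` acts on `y` only. -/
def substLamD (y q : Polynomial (SuperDiffPoly p)) : Polynomial (SuperDiffPoly p) :=
  q.sum fun k c => (lamD p)^[k] y * Polynomial.C c

/-- The `λ`-bracket with prescribed values `B g h = {g_λ h}` on the generators, extended by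
sesquilinearity and the Leibniz rules (master formula):
`{x_λ y} = ∑ ((-λ-∂)ᵐ ∂ᴿx/∂g⁽ᵐ⁾) · ((λ+∂)ⁿ {g_λ h})|_{λ → λ+∂} · ∂ᴸy/∂h⁽ⁿ⁾`, where the `∂`
substituted in the middle factor acts on the first factor. -/
def bracket (B : G → G → Polynomial (SuperDiffPoly p)) (x : SuperDiffPoly p) :
    SuperDiffPoly p →ₗ[ℂ] Polynomial (SuperDiffPoly p) :=
  Finsupp.lsum ℂ (fun v : G × ℕ =>
    LinearMap.mulLeft ℂ ((rightGrad p x).sum fun u y =>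
      substLamD p ((-1 : ℂ) ^ u.2 • (lamD p)^[u.2] (Polynomial.C y))
        ((lamD p)^[v.2] (B u.1 v.1))) ∘ₗ
    (Polynomial.CAlgHom (R := ℂ)).toLinearMap) ∘ₗ leftGrad p

/-! ### The affine superalgebra of `sl(m|n)`

Indices `a : Fin (m + n)` are bosonic for `a < m` and fermionic for `m ≤ a`.  The generators of
`Currents m n` are the currents of `gl(m|n)`: `gen ((a, b), j)` is the `j`-th derivative of the
current attached to the matrix unit `E_{ab}`.  Those of `sl(m|n)` span a Poisson vertex
subsuperalgebra. -/

variable (m n : ℕ)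

/-- The parity of an index. -/
def idxOdd (a : Fin (m + n)) : Bool := decide (m ≤ (a : ℕ))

/-- The parity of a matrix unit. -/
def unitOdd (u : Fin (m + n) × Fin (m + n)) : Bool := xor (idxOdd m n u.1) (idxOdd m n u.2)

/-- Differential polynomials in the currents of `gl(m|n)`. -/
abbrev Currents : Type := SuperDiffPoly (unitOdd m n)

/-- The sign of an index. -/
def sgn (a : Fin (m + n)) : ℂ := if idxOdd m n a = true then -1 else 1

/-- The supertrace. -/
def str (A : Matrix (Fin (m + n)) (Fin (m + n)) ℂ) : ℂ := ∑ a, sgn m n a * A a a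

/-- The `j`-th derivative of the current attached to a matrix `A`. -/
def current (A : Matrix (Fin (m + n)) (Fin (m + n)) ℂ) (j : ℕ) : Currents m n :=
  ∑ a, ∑ b, A a b • gen (unitOdd m n) ((a, b), j)

/-- The affine bracket `{E_λ F} = [E, F] + k str(E F) λ` of two matrix units, with
`[E, F] = E F ∓ F E` the supercommutator. -/
def affineBracket (k : ℂ) (g h : Fin (m + n) × Fin (m + n)) : Polynomial (Currents m n) :=
  Polynomial.monomial 0
    ((if g.2 = h.1 then gen (unitOdd m n) ((g.1, h.2), 0) else 0) -
      (if unitOdd m n g = true ∧ unitOdd m n h = true then (-1 : ℂ) else 1) •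
        (if h.2 = g.1 then gen (unitOdd m n) ((h.1, g.2), 0) else 0)) +
  Polynomial.monomial 1
    (algebraMap ℂ (Currents m n) (k * if g.2 = h.1 ∧ h.2 = g.1 then sgn m n g.1 else 0))

/-- The classical affine `λ`-bracket at level `k`. -/
def lieBracket (k : ℂ) (x : Currents m n) :
    Currents m n →ₗ[ℂ] Polynomial (Currents m n) :=
  bracket (unitOdd m n) (affineBracket m n k) x

/-! ### Hamiltonian reduction -/

/-- A subquotient `num / (num ∩ den)` of the space of differential polynomials. -/
structure Subquotient where
  /-- the elements that represent a class -/
  num : Submodule ℂ (Currents m n)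
  /-- the elements that represent zero -/
  den : Submodule ℂ (Currents m n)

variable {m n}

/-- The differential ideal generated by a set `C` of constraints in the algebra `num / den`,
as the space of its representatives. -/
def Subquotient.diffIdeal (Q : Subquotient m n) (C : Set (Currents m n)) :
    Submodule ℂ (Currents m n) :=
  sInf {I | Q.num ⊓ Q.den ≤ I ∧ C ⊆ I ∧
    (∀ x ∈ I, totalDeriv (unitOdd m n) x ∈ I) ∧
    ∀ x ∈ I, ∀ y ∈ Q.num, x * y ∈ I ∧ y * x ∈ I}

/-- Classical Hamiltonian reduction: impose the constraints `x = 0` for `x ∈ C`, and keep the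
elements that are invariant, modulo the constraints, under the infinitesimal gauge transformations
`{s_λ ·}` with `s ∈ S`. -/
def Subquotient.reduce (k : ℂ) (Q : Subquotient m n) (C S : Set (Currents m n)) :
    Subquotient m n where
  num :=
    { carrier := {x | x ∈ Q.num ∧ ∀ s ∈ S, ∀ j, (lieBracket m n k s x).coeff j ∈ Q.diffIdeal C}
      add_mem' := fun {x y} hx hy => ⟨add_mem hx.1 hy.1, fun s hs j => by
        rw [map_add, Polynomial.coeff_add]
        exact add_mem (hx.2 s hs j) (hy.2 s hs j)⟩
      zero_mem' := ⟨zero_mem _, fun s _ j => by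
        rw [map_zero, Polynomial.coeff_zero]
        exact zero_mem _⟩
      smul_mem' := fun c x hx => ⟨Submodule.smul_mem _ c hx.1, fun s hs j => by
        rw [map_smul, Polynomial.coeff_smul]
        exact Submodule.smul_mem _ c (hx.2 s hs j)⟩ }
  den := Q.diffIdeal C

/-- Isomorphism of Poisson vertex superalgebras between two subquotients: a linear bijection of
the quotients compatible, on arbitrary representatives, with unit, product, derivation, parity
and `λ`-bracket.  In particular both numerators are closed under these operations. -/
def Subquotient.Isomorphic (k : ℂ) (Q Q' : Subquotient m n) : Prop :=
  ∃ Φ : (Q.num ⧸ Q.den.submoduleOf Q.num) ≃ₗ[ℂ] (Q'.num ⧸ Q'.den.submoduleOf Q'.num),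
  ∃ R : Currents m n → Currents m n → Prop,
    (∀ x y, R x y ↔ ∃ (hx : x ∈ Q.num) (hy : y ∈ Q'.num),
      Φ (Submodule.Quotient.mk ⟨x, hx⟩) = Submodule.Quotient.mk ⟨y, hy⟩) ∧
    R 1 1 ∧
    (∀ x y x' y', R x y → R x' y' → R (x * x') (y * y')) ∧
    (∀ x y, R x y → R (totalDeriv (unitOdd m n) x) (totalDeriv (unitOdd m n) y)) ∧
    (∀ x y, R x y → R (parity (unitOdd m n) x) (parity (unitOdd m n) y)) ∧
    (∀ x y x' y', R x y → R x' y' → ∀ j,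
      R ((lieBracket m n k x x').coeff j) ((lieBracket m n k y y').coeff j))

variable (m n)

/-- The classical affine superalgebra of `sl(m|n)`: differential polynomials in the currents of
the matrices of supertrace zero. -/
def affineSl : Subquotient m n where
  num := Subalgebra.toSubmodule
    (Algebra.adjoin ℂ {x | ∃ A j, str m n A = 0 ∧ x = current m n A j})
  den := ⊥

/-! ### Regular subalgebras and primary reductions

A regular subalgebra `H = ⊕ sl(m_i) ⊕ sl(n_j)` of the bosonic part of `sl(m|n)` is given by a
partition of the indices in which bosonic and fermionic indices are never in the same block. -/

variable {m n}

/-- No block contains both bosonic and fermionic indices. -/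
def RespectsParity (r : Setoid (Fin (m + n))) : Prop :=
  ∀ a b, r.r a b → idxOdd m n a = idxOdd m n b

section LieStructure

attribute [local instance] LieRing.ofAssociativeRing

/-- The direct sum of the `sl(block)`: the Lie algebra generated by the root vectors `E_{ab}`
with `a ≠ b` in the same block.  It consists of bosonic matrices, on which the superbracket is
the commutator. -/
def regularSubalgebra (r : Setoid (Fin (m + n))) :
    LieSubalgebra ℂ (Matrix (Fin (m + n)) (Fin (m + n)) ℂ) :=
  LieSubalgebra.lieSpan ℂ _ {A | ∃ a b, a ≠ b ∧ r.r a b ∧ A = Matrix.single a b 1}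

end LieStructure

/-- The number of elements of the block of `a`. -/
def blockSize (r : Setoid (Fin (m + n))) (a : Fin (m + n)) : ℕ := {c | r.r c a}.ncard

/-- The position of `a` in its block, counted from `0`. -/
def blockPos (r : Setoid (Fin (m + n))) (a : Fin (m + n)) : ℕ := {c | r.r c a ∧ c < a}.ncard

/-- The diagonal entries of the Cartan generator of the principal `sl(2)` in
`regularSubalgebra r`, normalised by `[H, E₋] = -E₋`. -/
def cartanEntry (r : Setoid (Fin (m + n))) (a : Fin (m + n)) : ℚ :=
  ((blockSize r a : ℚ) - 1) / 2 - blockPos r a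

open Classical in
/-- The lowering generator `E₋` of the principal `sl(2)` in `regularSubalgebra r`: ones just below
the diagonal of each block. -/
def lowering (r : Setoid (Fin (m + n))) : Matrix (Fin (m + n)) (Fin (m + n)) ℂ :=
  Matrix.of fun a b => if r.r a b ∧ blockPos r a = blockPos r b + 1 then 1 else 0

/-- The classical `W`-superalgebra `W(sl(m|n), H)` at level `k`, for `H = regularSubalgebra r`.
The constraints set the current `A` equal to `str(E₋ A)` for `A` of grade at least `1`, i.e. they
set the part of grade at most `-1` of the current matrix equal to `E₋`; the elements of
the algebra are the polynomials invariant under the gauge transformations of positive grade. -/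
def primaryW (k : ℂ) (r : Setoid (Fin (m + n))) : Subquotient m n :=
  (affineSl m n).reduce k
    {x | ∃ A, str m n A = 0 ∧ (∀ a b, A a b ≠ 0 → 1 ≤ cartanEntry r a - cartanEntry r b) ∧
      x = current m n A 0 - algebraMap ℂ _ (str m n (lowering r * A))}
    {x | ∃ A, str m n A = 0 ∧ (∀ a b, A a b ≠ 0 → 0 < cartanEntry r a - cartanEntry r b) ∧
      x = current m n A 0}

/-! ### The generalized horizontal gauge -/

/-- The block of `a` is the block of `b` or starts before it. -/
def BlockLE (r : Setoid (Fin (m + n))) (a b : Fin (m + n)) : Prop :=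
  ∃ c, r.r c a ∧ ∀ d, r.r d b → c ≤ d

/-- The positions of the entries that are not fixed by the generalized horizontal gauge.  In a
diagonal block this is the first row, in the off-diagonal blocks above the diagonal the last
entries of the first row, and below the diagonal the first entries of the last column; there are
as many of them as the smaller side of the block. -/
def IsStar (r : Setoid (Fin (m + n))) (a b : Fin (m + n)) : Prop :=
  (BlockLE r a b ∧ blockPos r a = 0 ∧ blockSize r b ≤ blockPos r b + blockSize r a) ∨
  (¬ BlockLE r a b ∧ blockPos r b + 1 = blockSize r b ∧ blockPos r a < blockSize r b)

/-- The directions of the gauge slice: star entries only, and supertrace zero.  For `m = n` the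
functions on the current matrix `J` are those invariant under `J ↦ J + u 1`, and the trace is used
instead to fix this ambiguity. -/
def IsSliceDirection (r : Setoid (Fin (m + n))) (v : Matrix (Fin (m + n)) (Fin (m + n)) ℂ) :
    Prop :=
  (∀ a b, ¬ IsStar r a b → v a b = 0) ∧ (if m = n then v.trace else str m n v) = 0

/-- The differential polynomials that vanish on the slice `J = E₋ + v`, `v` a combination of slice
directions: the differential ideal of its affine equations. -/
def horizontalIdeal (r : Setoid (Fin (m + n))) : Submodule ℂ (Currents m n) :=
  (affineSl m n).diffIdeal
    {x | ∃ A, str m n A = 0 ∧ (∀ v, IsSliceDirection r v → str m n (v * A) = 0) ∧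
      x = current m n A 0 - algebraMap ℂ _ (str m n (lowering r * A))}

/-- The entry `J_{ab}` of the current matrix, `a ≠ b`: the function `± E_{ba}`, as
`str(J E_{ba}) = ± J_{ab}`. -/
def entry (s : Fin (m + n) × Fin (m + n)) : Currents m n :=
  sgn m n s.1 • gen (unitOdd m n) ((s.2, s.1), 0)

/-- The ideal `I` of the affine superalgebra describes a complete gauge fixing of the reduced
algebra `Q`: restriction to the slice is a bijection from `Q` onto all differential polynomials on
the slice. -/
def IsGaugeFixing (Q : Subquotient m n) (I : Submodule ℂ (Currents m n)) : Prop :=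
  (∀ x ∈ Q.num, x ∈ Q.den ↔ x ∈ I) ∧
  ∀ y ∈ (affineSl m n).num, ∃ x ∈ Q.num, x - y ∈ I

end ClassicalW
end

noncomputable section
namespace ClassicalW

/-! Collect the currents into an even supermatrix `J` (`curMat`). Bracketing with a differential
polynomial `x` acts on `J` as an infinitesimal gauge transformation `δJ = [J, X] + k ∇X`, whose
parameter `X` is the variational gradient of `x` (`bracket_eq_act`, `actSDer_mat`). Both sides of an
identity between brackets are superderivations in the second argument, so they need only be compared
on `J` (`SDer.ext_mat`), and the theorem becomes a question about matrices. Differential ideals of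
affine constraints become kernels of restriction homomorphisms `J ↦ base + proj J`
(`AffSlice.diffIdeal_eq`). The Jacobi identity, needed with one generator only (`IsAffine.jacobi`),
shows that invariants are closed under the bracket.

Below, the degree of the entry `(a, b)` is the difference of the values of `grade` at `a` and `b`;
it is twice the `ad H` eigenvalue, hence an integer.

Part 1. Let `E` be the lowering matrix. A matrix commutes with `E` iff its blocks are constant along
diagonals, with the evident boundary conditions. Therefore the centraliser of `E` has no part of
positive degree, a commutator with `E` that lies in the star directions vanishes, and an element of
the centraliser orthogonal to the star directions vanishes. By duality every matrix unit of degree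
at least -1 can be moved into the star directions by a commutator with `E`
(`exists_comm_mem_slice`). Correcting degree by degree gives a unipotent gauge transformation `g`
over the currents that carries the constrained `J` to a matrix `Y` in the slice (`exists_isGauge`).
Substituting `Y` for `J` turns a polynomial on the slice into an invariant, because a variation of
`Y` stays in the slice and the slice is transverse to the orbits (`slice_transverse`,
`IsGauge.isInv_hom`). The substitution does not change invariants, since they are constant along the
path `1 + t (g - 1)` (`IsGauge.hom_eq`).

Part 2. Inside each block of `r'` put the blocks of `r` one after the other. The lowering matrix
`E'` of `r'` in this numbering is `E` plus ones at star positions of `r`. Half-integral eigenvalues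
are removed by an integral refinement `refGrade` of the grading. The secondary constraints set the
star entries of negative refined degree to their values in `E'`; they cut the horizontal slice of
`r` down to an affine space `T` (`tanSlice`), which also lies in the constraint surface of `r'`. The
space `T` need not be a slice for the gauge group of `r'`, but every constrained `J` of `r'` can be
moved into it, so the elements of `W(r')` are determined by their restrictions to `T`. The
isomorphism pairs an `x` in `W(r)` with a `y` in `W(r')` when they agree on `T` (`Agree`).

Three facts make this work. First, at `T` the gradient of `x`, transported so that it preserves the
horizontal slice of `r`, differs from the gradient of `y` by a matrix of positive refined degree
(`IsGauge.tangent`, by `tangent_grade`), and elements of `W(r')` do not vary under such parameters;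
so the brackets agree on `T`. Secondly, the constraints agree with constants, and constants are
central: hence they are first class, and every `x` with a partner `y` survives the reduction.
Thirdly, an `x` that commutes with the constraints on `T` has a partner: subtracting the
contributions of the constraints from a gauge parameter of `r'` leaves one of `r`, under which `x`
is invariant (`IsGauge.isInv_hom_second`).

The numbering of the blocks of `r'` used here differs from the standard one by a permutation inside
the blocks, which is an automorphism of the affine superalgebra. -/

/-- Square matrices over the indices of `gl(m|n)`. -/
abbrev IndexMat (m n : ℕ) (N : Type*) : Type _ := Matrix (Fin (m + n)) (Fin (m + n)) N

/-! ### Supercommutative differential polynomials: derivatives, parity and signs -/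

section Algebra

variable {G : Type} (p : G → Bool)

/-- The `b`-th power of the parity automorphism. -/
def tw (b : Bool) : SuperDiffPoly p →ₐ[ℂ] SuperDiffPoly p :=
  if b then parity p else AlgHom.id ℂ _

@[simp] theorem tw_true (x : SuperDiffPoly p) : tw p true x = parity p x := rfl
@[simp] theorem tw_false (x : SuperDiffPoly p) : tw p false x = x := rfl

/-- A pure tensor, as a differential polynomial. -/
def pureT (a : MvPolynomial ({g : G // p g = false} × ℕ) ℂ)
    (b : ExteriorAlgebra ℂ (({g : G // p g = true} × ℕ) →₀ ℂ)) : SuperDiffPoly p :=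
  (a ⊗ₜ[ℂ] b : RawPoly p)

theorem pureT_mul (a a' b b') : pureT p a b * pureT p a' b' = pureT p (a * a') (b * b') :=
  Algebra.TensorProduct.tmul_mul_tmul a a' b b'

theorem pureT_induction {P : SuperDiffPoly p → Prop} (x : SuperDiffPoly p)
    (zero : P 0) (tmul : ∀ a b, P (pureT p a b))
    (add : ∀ x y, P x → P y → P (x + y)) : P x :=
  TensorProduct.induction_on (motive := P) x zero tmul add

theorem parity_pureT (a b) : parity p (pureT p a b) = pureT p a (CliffordAlgebra.involute b) := by
  change (Algebra.TensorProduct.map (AlgHom.id ℂ _) CliffordAlgebra.involute : RawPoly p →ₐ[ℂ] RawPoly p) (a ⊗ₜ b) = _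
  rw [Algebra.TensorProduct.map_tmul]; rfl

theorem parity_parity (x : SuperDiffPoly p) : parity p (parity p x) = x := by
  induction x using pureT_induction p with
  | zero => simp
  | tmul a b => rw [parity_pureT, parity_pureT, CliffordAlgebra.involute_involute]
  | add x y hx hy => rw [map_add, map_add, hx, hy]

theorem tw_tw (b c : Bool) (x : SuperDiffPoly p) : tw p b (tw p c x) = tw p (xor b c) x := by
  cases b <;> cases c <;> simp [parity_parity]

theorem leftGrad_even (u : G × ℕ) (h : p u.1 = false) (a b) :
    leftGrad p (pureT p a b) u = pureT p (MvPolynomial.pderiv (R := ℂ) ((⟨u.1, h⟩, u.2)) a) b := by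
  change leftDeriv p u _ = _
  rw [leftDeriv, dif_neg (by simp [h])]
  exact LinearMap.rTensor_tmul _ _ _ _

theorem leftGrad_odd (u : G × ℕ) (h : p u.1 = true) (a b) :
    leftGrad p (pureT p a b) u =
      pureT p a (CliffordAlgebra.contractLeft (Finsupp.lapply (⟨u.1, h⟩, u.2)) b) := by
  change leftDeriv p u _ = _
  rw [leftDeriv, dif_pos h]
  exact LinearMap.lTensor_tmul _ _ _ _

theorem rightGrad_even (u : G × ℕ) (h : p u.1 = false) (a b) :
    rightGrad p (pureT p a b) u = pureT p (MvPolynomial.pderiv (R := ℂ) ((⟨u.1, h⟩, u.2)) a) b := by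
  change rightDeriv p u _ = _
  rw [rightDeriv, dif_neg (by simp [h])]
  exact LinearMap.rTensor_tmul _ _ _ _

theorem rightGrad_odd (u : G × ℕ) (h : p u.1 = true) (a b) :
    rightGrad p (pureT p a b) u =
      pureT p a (CliffordAlgebra.contractRight b (Finsupp.lapply (⟨u.1, h⟩, u.2))) := by
  change rightDeriv p u _ = _
  rw [rightDeriv, dif_pos h]
  exact LinearMap.lTensor_tmul _ _ _ _

theorem contractLeft_mul {M : Type*} [AddCommGroup M] [Module ℂ M] (d : Module.Dual ℂ M)
    (x y : ExteriorAlgebra ℂ M) :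
    CliffordAlgebra.contractLeft d (x * y) = CliffordAlgebra.contractLeft d x * y +
      CliffordAlgebra.involute x * CliffordAlgebra.contractLeft d y := by
  induction x using CliffordAlgebra.left_induction with
  | algebraMap r => simp [CliffordAlgebra.contractLeft_algebraMap_mul]
  | add x y hx hy => rw [add_mul, map_add, hx, hy, map_add, map_add]; noncomm_ring
  | ι_mul x m hx =>
    rw [mul_assoc, CliffordAlgebra.contractLeft_ι_mul, CliffordAlgebra.contractLeft_ι_mul, hx,
      map_mul, CliffordAlgebra.involute_ι, sub_mul, mul_add, smul_mul_assoc]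
    noncomm_ring

theorem contractRight_mul {M : Type*} [AddCommGroup M] [Module ℂ M] (d : Module.Dual ℂ M)
    (x y : ExteriorAlgebra ℂ M) :
    CliffordAlgebra.contractRight (x * y) d = x * CliffordAlgebra.contractRight y d +
      CliffordAlgebra.contractRight x d * CliffordAlgebra.involute y := by
  rw [CliffordAlgebra.contractRight_eq, CliffordAlgebra.reverse.map_mul, contractLeft_mul,
    map_add, CliffordAlgebra.reverse.map_mul, CliffordAlgebra.reverse.map_mul,
    CliffordAlgebra.reverse_reverse, CliffordAlgebra.contractRight_eq,
    CliffordAlgebra.contractRight_eq, ← CliffordAlgebra.reverse_involute,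
    CliffordAlgebra.reverse_reverse]

theorem leftGrad_mul (x y : SuperDiffPoly p) (u : G × ℕ) :
    leftGrad p (x * y) u = leftGrad p x u * y + tw p (p u.1) x * leftGrad p y u := by
  induction x using pureT_induction p with
  | zero => simp
  | add x x' hx hx' => simp only [add_mul, map_add, Finsupp.add_apply, hx, hx']; abel
  | tmul a b =>
    induction y using pureT_induction p with
    | zero => simp
    | add x x' hx hx' => simp only [mul_add, map_add, Finsupp.add_apply, hx, hx']; abel
    | tmul a' b' =>
      rw [pureT_mul]
      cases h : p u.1
      · rw [leftGrad_even p u h, leftGrad_even p u h, leftGrad_even p u h, tw_false, pureT_mul,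
          pureT_mul, Derivation.leibniz, smul_eq_mul, smul_eq_mul, add_comm, mul_comm a']
        exact TensorProduct.add_tmul _ _ _
      · rw [leftGrad_odd p u h, leftGrad_odd p u h, leftGrad_odd p u h, tw_true, pureT_mul,
          parity_pureT, pureT_mul, contractLeft_mul]
        exact TensorProduct.tmul_add _ _ _

theorem rightGrad_mul (x y : SuperDiffPoly p) (u : G × ℕ) :
    rightGrad p (x * y) u = x * rightGrad p y u + rightGrad p x u * tw p (p u.1) y := by
  induction x using pureT_induction p with
  | zero => simp
  | add x x' hx hx' => simp only [add_mul, map_add, Finsupp.add_apply, hx, hx']; abel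
  | tmul a b =>
    induction y using pureT_induction p with
    | zero => simp
    | add x x' hx hx' => simp only [mul_add, map_add, Finsupp.add_apply, hx, hx']; abel
    | tmul a' b' =>
      rw [pureT_mul]
      cases h : p u.1
      · rw [rightGrad_even p u h, rightGrad_even p u h, rightGrad_even p u h, tw_false, pureT_mul,
          pureT_mul, Derivation.leibniz, smul_eq_mul, smul_eq_mul, mul_comm a']
        exact TensorProduct.add_tmul _ _ _
      · rw [rightGrad_odd p u h, rightGrad_odd p u h, rightGrad_odd p u h, tw_true, pureT_mul,
          parity_pureT, pureT_mul, contractRight_mul]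
        exact TensorProduct.tmul_add _ _ _

theorem algebraMap_eq_pureT (c : ℂ) :
    algebraMap ℂ (SuperDiffPoly p) c = pureT p (algebraMap ℂ _ c) 1 := rfl

@[simp] theorem leftGrad_algebraMap (c : ℂ) : leftGrad p (algebraMap ℂ _ c) = 0 := by
  ext u
  cases h : p u.1
  · rw [algebraMap_eq_pureT, leftGrad_even p u h, Derivation.map_algebraMap]
    exact TensorProduct.zero_tmul _ _
  · rw [algebraMap_eq_pureT, leftGrad_odd p u h, CliffordAlgebra.contractLeft_one]
    exact TensorProduct.tmul_zero _ _

@[simp] theorem rightGrad_algebraMap (c : ℂ) : rightGrad p (algebraMap ℂ _ c) = 0 := by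
  ext u
  cases h : p u.1
  · rw [algebraMap_eq_pureT, rightGrad_even p u h, Derivation.map_algebraMap]
    exact TensorProduct.zero_tmul _ _
  · rw [algebraMap_eq_pureT, rightGrad_odd p u h, CliffordAlgebra.contractRight_one]
    exact TensorProduct.tmul_zero _ _

theorem gen_even (u : G × ℕ) (h : p u.1 = false) :
    gen p u = pureT p (MvPolynomial.X (⟨u.1, h⟩, u.2)) 1 := by
  change rawGen p u = _
  rw [rawGen, dif_neg (by simp [h])]; rfl

theorem gen_odd (u : G × ℕ) (h : p u.1 = true) :
    gen p u = pureT p 1 (ExteriorAlgebra.ι ℂ (Finsupp.single (⟨u.1, h⟩, u.2) 1)) := by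
  change rawGen p u = _
  rw [rawGen, dif_pos h]; rfl

open Classical in
theorem leftGrad_gen (v : G × ℕ) : leftGrad p (gen p v) = Finsupp.single v 1 := by
  ext u
  rw [Finsupp.single_apply]
  cases h : p u.1 <;> cases h' : p v.1
  · rw [gen_even p v h', leftGrad_even p u h, MvPolynomial.pderiv_X]
    by_cases e : v = u
    · subst e; simp only [Pi.single_eq_same, if_true]; rfl
    · rw [if_neg e, Pi.single_eq_of_ne]
      · exact TensorProduct.zero_tmul _ _
      · intro hc; apply e; simp only [Prod.mk.injEq, Subtype.mk.injEq] at hc; exact Prod.ext hc.1 hc.2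
  · rw [gen_odd p v h', leftGrad_even p u h, if_neg (by rintro rfl; simp_all)]
    rw [Derivation.map_one_eq_zero]
    exact TensorProduct.zero_tmul _ _
  · rw [gen_even p v h', leftGrad_odd p u h, if_neg (by rintro rfl; simp_all),
      CliffordAlgebra.contractLeft_one]
    exact TensorProduct.tmul_zero _ _
  · rw [gen_odd p v h', leftGrad_odd p u h, ExteriorAlgebra.ι, CliffordAlgebra.contractLeft_ι]
    by_cases e : v = u
    · subst e; simp only [Finsupp.lapply_apply, Finsupp.single_eq_same, if_true, map_one]; rfl
    · rw [if_neg e, Finsupp.lapply_apply, Finsupp.single_eq_of_ne, map_zero]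
      · exact TensorProduct.tmul_zero _ _
      · intro hc; apply e; simp only [Prod.mk.injEq, Subtype.mk.injEq] at hc; exact (Prod.ext hc.1 hc.2).symm

open Classical in
theorem rightGrad_gen (v : G × ℕ) : rightGrad p (gen p v) = Finsupp.single v 1 := by
  ext u
  rw [Finsupp.single_apply]
  cases h : p u.1 <;> cases h' : p v.1
  · rw [gen_even p v h', rightGrad_even p u h, MvPolynomial.pderiv_X]
    by_cases e : v = u
    · subst e; simp only [Pi.single_eq_same, if_true]; rfl
    · rw [if_neg e, Pi.single_eq_of_ne]
      · exact TensorProduct.zero_tmul _ _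
      · intro hc; apply e; simp only [Prod.mk.injEq, Subtype.mk.injEq] at hc; exact Prod.ext hc.1 hc.2
  · rw [gen_odd p v h', rightGrad_even p u h, if_neg (by rintro rfl; simp_all)]
    rw [Derivation.map_one_eq_zero]
    exact TensorProduct.zero_tmul _ _
  · rw [gen_even p v h', rightGrad_odd p u h, if_neg (by rintro rfl; simp_all),
      CliffordAlgebra.contractRight_one]
    exact TensorProduct.tmul_zero _ _
  · rw [gen_odd p v h', rightGrad_odd p u h, ExteriorAlgebra.ι, CliffordAlgebra.contractRight_ι]
    by_cases e : v = u
    · subst e; simp only [Finsupp.lapply_apply, Finsupp.single_eq_same, if_true, map_one]; rfl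
    · rw [if_neg e, Finsupp.lapply_apply, Finsupp.single_eq_of_ne, map_zero]
      · exact TensorProduct.tmul_zero _ _
      · intro hc; apply e; simp only [Prod.mk.injEq, Subtype.mk.injEq] at hc; exact (Prod.ext hc.1 hc.2).symm

/-- The symbols generate the algebra. -/
theorem adjoin_gen : Algebra.adjoin ℂ (Set.range (gen p)) = ⊤ := by
  rw [eq_top_iff]
  rintro x -
  induction x using pureT_induction p with
  | zero => exact zero_mem _
  | add x y hx hy => exact add_mem hx hy
  | tmul a b =>
    have : pureT p a b = pureT p a 1 * pureT p 1 b := by rw [pureT_mul, mul_one, one_mul]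
    rw [this]
    clear this
    refine mul_mem ?_ ?_
    · induction a using MvPolynomial.induction_on with
      | C c => exact Subalgebra.algebraMap_mem _ c
      | add a b ha hb =>
        have : pureT p (a + b) 1 = pureT p a 1 + pureT p b 1 := TensorProduct.add_tmul _ _ _
        rw [this]; exact add_mem ha hb
      | mul_X a v ha =>
        have : pureT p (a * MvPolynomial.X v) 1 = pureT p a 1 * gen p (v.1, v.2) := by
          rw [gen_even p _ v.1.2, pureT_mul, mul_one]
        rw [this]
        exact mul_mem ha (Algebra.subset_adjoin ⟨_, rfl⟩)
    · induction b using CliffordAlgebra.left_induction with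
      | algebraMap c =>
        have : pureT p 1 (algebraMap ℂ _ c) = algebraMap ℂ _ c := by
          rw [Algebra.algebraMap_eq_smul_one, Algebra.algebraMap_eq_smul_one]
          exact TensorProduct.tmul_smul _ _ _
        rw [this]; exact Subalgebra.algebraMap_mem _ c
      | add a b ha hb =>
        have : pureT p 1 (a + b) = pureT p 1 a + pureT p 1 b := TensorProduct.tmul_add _ _ _
        rw [this]; exact add_mem ha hb
      | ι_mul x m hx =>
        have h1 : pureT p 1 (CliffordAlgebra.ι _ m * x) = pureT p 1 (ExteriorAlgebra.ι ℂ m) * pureT p 1 x := by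
          rw [pureT_mul, one_mul]
        rw [h1]
        refine mul_mem ?_ hx
        clear h1
        induction m using Finsupp.induction_linear with
        | zero =>
          rw [map_zero]
          have : pureT p 1 0 = 0 := TensorProduct.tmul_zero _ _
          rw [this]; exact zero_mem _
        | add m m' h h' =>
          rw [map_add]
          have : ∀ a b, pureT p 1 (a + b) = pureT p 1 a + pureT p 1 b := fun a b => TensorProduct.tmul_add _ _ _
          rw [this]; exact add_mem h h'
        | single v c =>
          have : pureT p 1 (ExteriorAlgebra.ι ℂ (Finsupp.single v c)) = c • gen p (v.1, v.2) := by
            rw [gen_odd p _ v.1.2, ← mul_one c, ← smul_eq_mul, ← Finsupp.smul_single, map_smul, smul_eq_mul, mul_one]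
            exact TensorProduct.tmul_smul _ _ _
          rw [this]
          exact Subalgebra.smul_mem _ (Algebra.subset_adjoin (Set.mem_range_self _)) _

theorem gen_induction {P : SuperDiffPoly p → Prop} (x : SuperDiffPoly p)
    (algebraMap : ∀ c, P (algebraMap ℂ _ c)) (gen : ∀ u, P (gen p u))
    (add : ∀ x y, P x → P y → P (x + y)) (mul : ∀ x y, P x → P y → P (x * y)) : P x := by
  have hx : x ∈ Algebra.adjoin ℂ (Set.range (ClassicalW.gen p)) := adjoin_gen p ▸ trivial
  induction hx using Algebra.adjoin_induction with
  | mem x h => obtain ⟨u, rfl⟩ := h; exact gen u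
  | algebraMap c => exact algebraMap c
  | add x y _ _ hx hy => exact add x y hx hy
  | mul x y _ _ hx hy => exact mul x y hx hy

theorem algHom_ext_gen {T : Type*} [Ring T] [Algebra ℂ T] {f g : SuperDiffPoly p →ₐ[ℂ] T}
    (h : ∀ u, f (gen p u) = g (gen p u)) : f = g :=
  AlgHom.ext_of_adjoin_eq_top (adjoin_gen p) (by rintro _ ⟨u, rfl⟩; exact h u)

/-- The sign `(-1)^b`. -/
def sg (b : Bool) : ℂ := if b then -1 else 1

@[simp] theorem sg_true : sg true = -1 := rfl
@[simp] theorem sg_false : sg false = 1 := rfl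
theorem sg_mul_self (b : Bool) : sg b * sg b = 1 := by cases b <;> simp
theorem sg_xor (b c : Bool) : sg (xor b c) = sg b * sg c := by cases b <;> cases c <;> simp

theorem tw_gen (b : Bool) (u : G × ℕ) : tw p b (gen p u) = sg (b && p u.1) • gen p u := by
  cases b
  · simp
  · rw [tw_true, Bool.true_and]
    cases h : p u.1
    · rw [gen_even p u h, parity_pureT, map_one, sg_false, one_smul]
    · rw [gen_odd p u h, parity_pureT, ExteriorAlgebra.ι, CliffordAlgebra.involute_ι, sg_true, neg_one_smul]
      exact TensorProduct.tmul_neg _ _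

theorem gen_mul_gen (u v : G × ℕ) :
    gen p u * gen p v = sg (p u.1 && p v.1) • (gen p v * gen p u) := by
  cases h : p u.1 <;> cases h' : p v.1
  · rw [gen_even p u h, gen_even p v h', pureT_mul, pureT_mul, mul_comm]; simp
  · rw [gen_even p u h, gen_odd p v h', pureT_mul, pureT_mul]; simp
  · rw [gen_odd p u h, gen_even p v h', pureT_mul, pureT_mul]; simp
  · rw [gen_odd p u h, gen_odd p v h', pureT_mul, pureT_mul, Bool.true_and, sg_true, neg_one_smul,
      eq_neg_of_add_eq_zero_left (ExteriorAlgebra.ι_add_mul_swap _ _)]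
    exact TensorProduct.tmul_neg _ _

theorem gen_mul (u : G × ℕ) (y : SuperDiffPoly p) : gen p u * y = tw p (p u.1) y * gen p u := by
  induction y using gen_induction p with
  | algebraMap c => rw [AlgHom.commutes, Algebra.commutes]
  | gen v => rw [gen_mul_gen, tw_gen, smul_mul_assoc]
  | add x y hx hy => rw [mul_add, hx, hy, map_add, add_mul]
  | mul x y hx hy => rw [← mul_assoc, hx, mul_assoc, hy, map_mul, mul_assoc]

/-- Elements of parity `b`. -/
def IsPar (b : Bool) (x : SuperDiffPoly p) : Prop := parity p x = sg b • x

/-- Twice the even part of `x` is central, and twice the odd part moves past `y` at the cost of the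
parity automorphism. No homogeneity is assumed, so induction over products is possible. -/
theorem parity_mul_comm (x : SuperDiffPoly p) : ∀ y,
    (x + parity p x) * y = y * (x + parity p x) ∧
      (x - parity p x) * y = parity p y * (x - parity p x) := by
  induction x using gen_induction p with
  | algebraMap c =>
    intro y
    simp only [AlgHom.commutes, ← map_add, sub_self, zero_mul, mul_zero, and_true]
    exact Algebra.commutes _ _
  | gen u =>
    intro y
    have h := gen_mul p u y
    have h2 := tw_gen p true u
    rw [tw_true, Bool.true_and] at h2
    rw [h2]
    cases hu : p u.1
    · rw [hu, tw_false] at h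
      simp only [sg_false, one_smul, sub_self, zero_mul, mul_zero, and_true]
      rw [add_mul, h, mul_add]
    · rw [hu, tw_true] at h
      simp only [sg_true, neg_one_smul, add_neg_cancel, zero_mul, mul_zero,
        true_and, sub_neg_eq_add]
      rw [add_mul, h, mul_add]
  | add x x' hx hx' =>
    intro y
    have a := hx y; have b := hx' y
    rw [map_add]
    constructor
    · rw [add_add_add_comm, add_mul, mul_add, a.1, b.1]
    · rw [add_sub_add_comm, add_mul, mul_add, a.2, b.2]
  | mul x x' hx hx' =>
    intro y
    rw [map_mul]
    have key : ∀ a b : SuperDiffPoly p, (2 : ℂ) • a = (2 : ℂ) • b → a = b := fun a b h =>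
      smul_right_injective _ (two_ne_zero) h
    set e := x + parity p x with he
    set o := x - parity p x with ho
    set e' := x' + parity p x' with he'
    set o' := x' - parity p x' with ho'
    -- The even part of a product is even times even plus odd times odd, and the odd part consists
    -- of the mixed products.
    have e1 : (2 : ℂ) • (x * x' + parity p x * parity p x') = e * e' + o * o' := by
      rw [two_smul, he, ho, he', ho']; noncomm_ring
    have e2 : (2 : ℂ) • (x * x' - parity p x * parity p x') = e * o' + o * e' := by
      rw [two_smul, he, ho, he', ho']; noncomm_ring
    constructor
    · apply key
      rw [← smul_mul_assoc, ← mul_smul_comm, e1, add_mul, mul_add y, mul_assoc e, (hx' y).1,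
        ← mul_assoc, (hx y).1, mul_assoc, mul_assoc o, (hx' y).2, ← mul_assoc, (hx _).2,
        map_mul, parity_parity, mul_assoc, mul_assoc y (parity p o'), ← (hx o').2, mul_add]
    · apply key
      rw [← smul_mul_assoc, ← mul_smul_comm, e2, add_mul, mul_add (parity p y), mul_assoc e, (hx' y).2,
        ← mul_assoc, (hx _).1, mul_assoc, mul_assoc o, (hx' y).1, ← mul_assoc, (hx _).2,
        map_mul, mul_assoc _ (parity p e'), ← (hx e').2]

theorem IsPar.mul_comm {p : G → Bool} {b : Bool} {x : SuperDiffPoly p} (h : IsPar p b x) (y : SuperDiffPoly p) :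
    x * y = tw p b y * x := by
  have key : ∀ a b : SuperDiffPoly p, (2 : ℂ) • a = (2 : ℂ) • b → a = b := fun a b h =>
    smul_right_injective _ (two_ne_zero) h
  have := parity_mul_comm p x y
  rw [IsPar] at h
  rw [h] at this
  apply key
  cases b
  · simp only [sg_false, one_smul, ← two_smul ℂ x] at this
    simpa using this.1
  · simp only [sg_true, neg_one_smul, sub_neg_eq_add, ← two_smul ℂ x] at this
    simpa using this.2

theorem isPar_iff_tw {p : G → Bool} {b : Bool} {x : SuperDiffPoly p} :
    IsPar p b x ↔ ∀ c, tw p c x = sg (c && b) • x :=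
  ⟨fun h c => by cases c <;> simp [show parity p x = _ from h], fun h => by
    have := h true
    rwa [tw_true, Bool.true_and] at this⟩

theorem IsPar.tw_eq {p : G → Bool} {b : Bool} {x : SuperDiffPoly p} (h : IsPar p b x) (c : Bool) :
    tw p c x = sg (c && b) • x := isPar_iff_tw.1 h c

theorem IsPar.add {p : G → Bool} {b : Bool} {x y : SuperDiffPoly p} (hx : IsPar p b x) (hy : IsPar p b y) :
    IsPar p b (x + y) := by rw [IsPar, map_add, hx, hy, smul_add]

theorem IsPar.smul {p : G → Bool} {b : Bool} {x : SuperDiffPoly p} (hx : IsPar p b x) (c : ℂ) :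
    IsPar p b (c • x) := by rw [IsPar, map_smul, hx, smul_comm]

theorem isPar_zero (b : Bool) : IsPar p b 0 := by simp [IsPar]

theorem isPar_gen (u : G × ℕ) : IsPar p (p u.1) (gen p u) := by
  have := tw_gen p true u
  rwa [tw_true, Bool.true_and] at this

theorem isPar_algebraMap (c : ℂ) : IsPar p false (algebraMap ℂ _ c) := by simp [IsPar]

/-- The component of parity `b`. -/
def parPart (b : Bool) : SuperDiffPoly p →ₗ[ℂ] SuperDiffPoly p :=
  (2⁻¹ : ℂ) • (LinearMap.id + sg b • (parity p).toLinearMap)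

theorem isPar_parPart (b : Bool) (x : SuperDiffPoly p) : IsPar p b (parPart p b x) := by
  have : parPart p b x = (2⁻¹ : ℂ) • (x + sg b • parity p x) := rfl
  rw [IsPar, this, map_smul, map_add, map_smul, parity_parity, smul_comm (sg b)]
  congr 1
  rw [smul_add, smul_smul, sg_mul_self, one_smul, add_comm]

theorem parPart_add (x : SuperDiffPoly p) : parPart p false x + parPart p true x = x := by
  have : ∀ b, parPart p b x = (2⁻¹ : ℂ) • (x + sg b • parity p x) := fun _ => rfl
  rw [this, this, sg_false, sg_true, ← smul_add]
  have : x + (1 : ℂ) • parity p x + (x + (-1 : ℂ) • parity p x) = (2 : ℂ) • x := by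
    rw [two_smul, one_smul, neg_one_smul]; abel
  rw [this, smul_smul]; norm_num

theorem parity_leftGrad (x : SuperDiffPoly p) (u : G × ℕ) :
    parity p (leftGrad p x u) = sg (p u.1) • leftGrad p (parity p x) u := by
  classical
  induction x using gen_induction p with
  | algebraMap c => simp
  | gen v =>
    have := tw_gen p true v
    rw [tw_true, Bool.true_and] at this
    rw [this, map_smul, leftGrad_gen, Finsupp.smul_apply, Finsupp.single_apply]
    split_ifs with h
    · subst h; simp [smul_smul, sg_mul_self]
    · simp
  | add x y hx hy => simp only [map_add, Finsupp.add_apply, hx, hy, smul_add]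
  | mul x y hx hy =>
    rw [leftGrad_mul, map_add, map_mul, map_mul, map_mul, leftGrad_mul, hx, hy, smul_add,
      smul_mul_assoc, mul_smul_comm]
    cases p u.1 <;> simp

theorem parity_rightGrad (x : SuperDiffPoly p) (u : G × ℕ) :
    parity p (rightGrad p x u) = sg (p u.1) • rightGrad p (parity p x) u := by
  classical
  induction x using gen_induction p with
  | algebraMap c => simp
  | gen v =>
    have := tw_gen p true v
    rw [tw_true, Bool.true_and] at this
    rw [this, map_smul, rightGrad_gen, Finsupp.smul_apply, Finsupp.single_apply]
    split_ifs with h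
    · subst h; simp [smul_smul, sg_mul_self]
    · simp
  | add x y hx hy => simp only [map_add, Finsupp.add_apply, hx, hy, smul_add]
  | mul x y hx hy =>
    rw [rightGrad_mul, map_add, map_mul, map_mul, map_mul, rightGrad_mul, hx, hy, smul_add,
      smul_mul_assoc, mul_smul_comm]
    cases p u.1 <;> simp

/-- Right derivatives in terms of left derivatives. -/
theorem rightGrad_eq {b : Bool} {x : SuperDiffPoly p} (h : IsPar p b x) (u : G × ℕ) :
    rightGrad p x u = sg (p u.1 && !b) • leftGrad p x u := by
  classical
  cases hu : p u.1
  · have : ∀ x : SuperDiffPoly p, rightGrad p x u = leftGrad p x u := by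
      intro x
      induction x using pureT_induction p with
      | zero => simp
      | add x y hx hy => simp only [map_add, Finsupp.add_apply, hx, hy]
      | tmul a c => rw [rightGrad_even p u hu, leftGrad_even p u hu]
    simp [this]
  -- The parity twist makes the sign independent of the parity of `x`; the identity then holds for
  -- all `x`, by induction over products.
  · have : ∀ x : SuperDiffPoly p, rightGrad p x u = - leftGrad p (parity p x) u := by
      intro x
      induction x using gen_induction p with
      | algebraMap c => simp
      | gen v =>
        have := tw_gen p true v
        rw [tw_true, Bool.true_and] at this
        rw [this, map_smul, rightGrad_gen, leftGrad_gen, Finsupp.smul_apply, Finsupp.single_apply]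
        split_ifs with e
        · subst e; simp [hu]
        · simp
      | add x y hx hy => simp only [map_add, Finsupp.add_apply, hx, hy]; abel
      | mul x y hx hy =>
        have hl := leftGrad_mul p (parity p x) (parity p y) u
        rw [map_mul (parity p), hl, rightGrad_mul, hx, hy, hu]
        simp only [tw_true, parity_parity]
        noncomm_ring
    rw [this, show parity p x = _ from h, map_smul, Finsupp.smul_apply, ← neg_smul, Bool.true_and]
    cases b <;> simp

theorem totalDeriv_apply (x : SuperDiffPoly p) :
    totalDeriv p x = (leftGrad p x).sum fun u y => gen p (u.1, u.2 + 1) * y := by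
  rw [totalDeriv, LinearMap.comp_apply, Finsupp.lsum_apply]; rfl

@[simp] theorem totalDeriv_gen (u : G × ℕ) : totalDeriv p (gen p u) = gen p (u.1, u.2 + 1) := by
  rw [totalDeriv_apply, leftGrad_gen, Finsupp.sum_single_index] <;> simp

@[simp] theorem totalDeriv_algebraMap (c : ℂ) : totalDeriv p (algebraMap ℂ _ c) = 0 := by
  rw [totalDeriv_apply, leftGrad_algebraMap, Finsupp.sum_zero_index]

@[simp] theorem totalDeriv_one : totalDeriv p 1 = 0 := by
  simpa using totalDeriv_algebraMap p 1

/-- Sums over the gradient can be taken over any larger finite set. -/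
theorem sum_eq_of_support_subset {α M N : Type*} [Zero M] [AddCommMonoid N] (f : α →₀ M)
    (s : Finset α) (h : f.support ⊆ s) (F : α → M → N) (hF : ∀ a, F a 0 = 0) :
    f.sum F = ∑ a ∈ s, F a (f a) :=
  Finsupp.sum_of_support_subset f h F fun a _ => hF a

theorem totalDeriv_mul (x y : SuperDiffPoly p) :
    totalDeriv p (x * y) = totalDeriv p x * y + x * totalDeriv p y := by
  classical
  set s := (leftGrad p x).support ∪ (leftGrad p y).support ∪ (leftGrad p (x * y)).support
  have h : ∀ z, (leftGrad p z).support ⊆ s →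
      totalDeriv p z = ∑ u ∈ s, gen p (u.1, u.2 + 1) * leftGrad p z u := fun z hz => by
    rw [totalDeriv_apply]
    exact sum_eq_of_support_subset _ s hz _ (by simp)
  rw [h x (by simp [s, Finset.union_assoc]), h y (by
      intro a ha; simp only [s, Finset.mem_union]; tauto), h (x * y) (by
      intro a ha; simp only [s, Finset.mem_union]; tauto), Finset.sum_mul, Finset.mul_sum,
    ← Finset.sum_add_distrib]
  refine Finset.sum_congr rfl fun u _ => ?_
  rw [leftGrad_mul, mul_add, ← mul_assoc, ← mul_assoc, ← mul_assoc]
  congr 2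
  -- The sign from the Leibniz rule for the derivative by `u` is undone when the next symbol, of the
  -- same parity as `u`, moves past `x`.
  have := gen_mul p (u.1, u.2 + 1) (tw p (p u.1) x)
  rw [this, tw_tw]; simp

theorem parity_totalDeriv (x : SuperDiffPoly p) :
    parity p (totalDeriv p x) = totalDeriv p (parity p x) := by
  induction x using gen_induction p with
  | algebraMap c => simp
  | gen v =>
    have h1 := tw_gen p true v
    have h2 := tw_gen p true (v.1, v.2 + 1)
    rw [tw_true, Bool.true_and] at h1 h2
    rw [totalDeriv_gen, h1, h2, map_smul, totalDeriv_gen]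
  | add x y hx hy => simp only [map_add, hx, hy]
  | mul x y hx hy => simp only [totalDeriv_mul, map_add, map_mul, hx, hy]

theorem tw_totalDeriv (b : Bool) (x : SuperDiffPoly p) :
    tw p b (totalDeriv p x) = totalDeriv p (tw p b x) := by
  cases b
  · rfl
  · exact parity_totalDeriv p x

end Algebra


/-! ### The universal property of the algebra of currents -/

section Universal

variable {G : Type} (p : G → Bool)

/-- The universal property: supercommuting values on the symbols extend to a homomorphism. -/
theorem exists_algHom {T : Type*} [Ring T] [Algebra ℂ T] (f : G × ℕ → T)
    (hf : ∀ u v, f u * f v = sg (p u.1 && p v.1) • (f v * f u)) :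
    ∃ φ : SuperDiffPoly p →ₐ[ℂ] T, ∀ u, φ (gen p u) = f u := by
  let fe : {g : G // p g = false} × ℕ → T := fun v => f (v.1, v.2)
  -- Evaluation of polynomials needs a commutative target, so the even symbols are first sent to the
  -- commutative subalgebra generated by their values.
  let E := Algebra.adjoin ℂ (Set.range fe)
  have hcomm : ∀ a ∈ Set.range fe, ∀ b ∈ Set.range fe, a * b = b * a := by
    rintro _ ⟨u, rfl⟩ _ ⟨v, rfl⟩
    have := hf (u.1, u.2) (v.1, v.2)
    simpa [u.1.2, v.1.2] using this
  let _ : CommRing E := { (inferInstance : Ring E) with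
    mul_comm := (Algebra.isMulCommutative_adjoin ℂ hcomm).is_comm.comm }
  let φe' : MvPolynomial ({g : G // p g = false} × ℕ) ℂ →ₐ[ℂ] E :=
    MvPolynomial.aeval fun v => ⟨fe v, Algebra.subset_adjoin ⟨v, rfl⟩⟩
  let φe : MvPolynomial ({g : G // p g = false} × ℕ) ℂ →ₐ[ℂ] T := E.val.comp φe'
  have hφe : ∀ v, φe (MvPolynomial.X v) = fe v := fun v => by
    change E.val (φe' _) = _
    rw [MvPolynomial.aeval_X]; rfl
  let l : (({g : G // p g = true} × ℕ) →₀ ℂ) →ₗ[ℂ] T :=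
    Finsupp.lsum ℂ fun v => LinearMap.toSpanSingleton ℂ T (f (v.1, v.2))
  have hls : ∀ v c, l (Finsupp.single v c) = c • f (v.1, v.2) := fun v c => by
    simp [l]
  have anti : ∀ x y, l x * l y + l y * l x = 0 := by
    intro x y
    induction x using Finsupp.induction_linear with
    | zero => simp
    | add x x' hx hx' =>
      rw [map_add, add_mul, mul_add, add_add_add_comm, hx, hx', add_zero]
    | single v c =>
      induction y using Finsupp.induction_linear with
      | zero => simp
      | add x x' hx hx' =>
        rw [map_add, add_mul, mul_add, add_add_add_comm, hx, hx', add_zero]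
      | single w d =>
        have := hf (v.1, v.2) (w.1, w.2)
        simp only [v.1.2, w.1.2, Bool.and_self, sg_true, neg_one_smul] at this
        rw [hls, hls, smul_mul_smul_comm, smul_mul_smul_comm, this, mul_comm d c, ← smul_add,
          neg_add_cancel, smul_zero]
  have hsq : ∀ x, l x * l x = 0 := fun x => by
    have := anti x x
    rw [← two_smul ℂ] at this
    exact (smul_eq_zero.1 this).resolve_left two_ne_zero
  let φo : ExteriorAlgebra ℂ (({g : G // p g = true} × ℕ) →₀ ℂ) →ₐ[ℂ] T :=
    ExteriorAlgebra.lift ℂ ⟨l, hsq⟩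
  have hφo : ∀ m, φo (ExteriorAlgebra.ι ℂ m) = l m := fun m => by
    simp [φo]
  have hc1 : ∀ v m, Commute (fe v) (l m) := fun v m => by
    induction m using Finsupp.induction_linear with
    | zero => rw [map_zero]; exact Commute.zero_right _
    | add m m' h h' => rw [map_add]; exact h.add_right h'
    | single w c =>
      rw [hls]
      refine Commute.smul_right ?_ c
      have := hf (v.1, v.2) (w.1, w.2)
      change f _ * f _ = f _ * f _
      simpa [v.1.2] using this
  have hc2 : ∀ v y, Commute (fe v) (φo y) := fun v y => by
    induction y using CliffordAlgebra.left_induction with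
    | algebraMap c => rw [AlgHom.commutes]; exact (Algebra.commutes c _).symm
    | add x y hx hy => rw [map_add]; exact hx.add_right hy
    | ι_mul x m hx =>
      rw [map_mul]
      refine Commute.mul_right ?_ hx
      exact (hφo m).symm ▸ hc1 v m
  have hc3 : ∀ x y, Commute (φe x) (φo y) := fun x y => by
    induction x using MvPolynomial.induction_on with
    | C c =>
      have : φe (MvPolynomial.C c) = algebraMap ℂ T c := φe.commutes c
      rw [this]; exact Algebra.commutes c _
    | add x y hx hy => rw [map_add]; exact hx.add_left hy
    | mul_X x v hx => rw [map_mul, hφe]; exact hx.mul_left (hc2 v y)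
  let φ : RawPoly p →ₐ[ℂ] T := Algebra.TensorProduct.lift φe φo hc3
  refine ⟨φ, fun u => ?_⟩
  cases h : p u.1
  · rw [gen_even p u h]
    refine (Algebra.TensorProduct.lift_tmul φe φo hc3 _ _).trans ?_
    rw [map_one, mul_one, hφe]
  · rw [gen_odd p u h]
    refine (Algebra.TensorProduct.lift_tmul φe φo hc3 _ _).trans ?_
    rw [map_one, one_mul, hφo, hls, one_smul]

end Universal


/-! ### Calculus with `λ + ∂`; the bracket as a gauge variation -/

section LambdaCalculus

variable {G : Type} (p : G → Bool)

open Polynomial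

/-- The parity automorphism, on polynomials in `λ`. -/
def parX : (SuperDiffPoly p)[X] →ₐ[ℂ] (SuperDiffPoly p)[X] := Polynomial.mapAlgHom (parity p)

@[simp] theorem coeff_parX (q : (SuperDiffPoly p)[X]) (j : ℕ) :
    (parX p q).coeff j = parity p (q.coeff j) := by
  simp [parX]

@[simp] theorem parX_C (v : SuperDiffPoly p) : parX p (C v) = C (parity p v) := by simp [parX]

@[simp] theorem parX_X : parX p X = X := by simp [parX]

/-- Polynomials of parity `b`. -/
def IsParX (b : Bool) (q : (SuperDiffPoly p)[X]) : Prop := parX p q = sg b • q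

variable {p} in
theorem isParX_iff {b : Bool} {q : (SuperDiffPoly p)[X]} :
    IsParX p b q ↔ ∀ j, IsPar p b (q.coeff j) := by
  rw [IsParX, Polynomial.ext_iff]
  simp only [coeff_parX, coeff_smul, IsPar]

/-- The `b`-th power of the parity automorphism, on polynomials. -/
def twX (b : Bool) : (SuperDiffPoly p)[X] →ₐ[ℂ] (SuperDiffPoly p)[X] :=
  if b then parX p else AlgHom.id ℂ _

@[simp] theorem twX_true (x) : twX p true x = parX p x := rfl
@[simp] theorem twX_false (x) : twX p false x = x := rfl

@[simp] theorem coeff_twX (b : Bool) (q : (SuperDiffPoly p)[X]) (j : ℕ) :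
    (twX p b q).coeff j = tw p b (q.coeff j) := by
  cases b
  · simp
  · rw [twX_true, coeff_parX, tw_true]

@[simp] theorem twX_C (b : Bool) (v : SuperDiffPoly p) : twX p b (C v) = C (tw p b v) := by
  cases b
  · simp
  · rw [twX_true, parX_C, tw_true]

variable {p} in
theorem IsParX.mul_comm {b : Bool} {x : (SuperDiffPoly p)[X]} (h : IsParX p b x)
    (y : (SuperDiffPoly p)[X]) : x * y = twX p b y * x := by
  rw [isParX_iff] at h
  ext j
  rw [coeff_mul, coeff_mul, ← Finset.Nat.sum_antidiagonal_swap]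
  refine Finset.sum_congr rfl fun k _ => ?_
  rw [coeff_twX]
  exact (h _).mul_comm _

variable {p} in
theorem IsParX.smul {b : Bool} {x : (SuperDiffPoly p)[X]} (hx : IsParX p b x) (c : ℂ) :
    IsParX p b (c • x) := by rw [IsParX, map_smul, hx, smul_comm]

variable {p} in
theorem IsParX.sub {b : Bool} {x y : (SuperDiffPoly p)[X]} (hx : IsParX p b x) (hy : IsParX p b y) :
    IsParX p b (x - y) := by rw [IsParX, map_sub, hx, hy, smul_sub]

variable {p} in
theorem IsParX.mul {b c : Bool} {x y : (SuperDiffPoly p)[X]} (hx : IsParX p b x)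
    (hy : IsParX p c y) : IsParX p (xor b c) (x * y) := by
  rw [IsParX, map_mul, hx, hy, sg_xor, smul_mul_smul_comm]

theorem isParX_zero (b : Bool) : IsParX p b 0 := by simp [IsParX]

variable {p} in
theorem IsParX.sum {ι : Type*} {b : Bool} (s : Finset ι) {f : ι → (SuperDiffPoly p)[X]}
    (h : ∀ i ∈ s, IsParX p b (f i)) : IsParX p b (∑ i ∈ s, f i) := by
  rw [IsParX, map_sum, Finset.smul_sum]
  exact Finset.sum_congr rfl h

variable {p} in
theorem IsPar.isParX_C {b : Bool} {v : SuperDiffPoly p} (h : IsPar p b v) : IsParX p b (C v) := by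
  rw [IsParX, parX_C, show parity p v = _ from h, smul_C]

theorem isParX_one : IsParX p false 1 := by simp [IsParX]

/-- The total derivative of the coefficients. -/
def dX : (SuperDiffPoly p)[X] →ₗ[ℂ] (SuperDiffPoly p)[X] :=
  Polynomial.lsum fun k => ((monomial k).restrictScalars ℂ) ∘ₗ totalDeriv p

@[simp] theorem dX_monomial (k : ℕ) (v : SuperDiffPoly p) :
    dX p (monomial k v) = monomial k (totalDeriv p v) := by
  rw [dX, lsum_apply, sum_monomial_index _ _ (by simp)]; rfl

@[simp] theorem dX_C (v : SuperDiffPoly p) : dX p (C v) = C (totalDeriv p v) := dX_monomial p 0 v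

@[simp] theorem coeff_dX (q : (SuperDiffPoly p)[X]) (j : ℕ) :
    (dX p q).coeff j = totalDeriv p (q.coeff j) := by
  induction q using Polynomial.induction_on' with
  | add q r hq hr => simp only [map_add, coeff_add, hq, hr]
  | monomial k v =>
    rw [dX_monomial, coeff_monomial, coeff_monomial]; split_ifs <;> simp

theorem dX_mul (q r : (SuperDiffPoly p)[X]) : dX p (q * r) = dX p q * r + q * dX p r := by
  ext j
  rw [coeff_add, coeff_dX, coeff_mul, coeff_mul, coeff_mul, map_sum, ← Finset.sum_add_distrib]
  refine Finset.sum_congr rfl fun k _ => ?_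
  rw [totalDeriv_mul, coeff_dX, coeff_dX]

theorem parX_dX (q : (SuperDiffPoly p)[X]) : parX p (dX p q) = dX p (parX p q) := by
  ext j
  rw [coeff_parX, coeff_dX, coeff_dX, coeff_parX, parity_totalDeriv]

theorem lamD_eq (q : (SuperDiffPoly p)[X]) : lamD p q = X * q + dX p q := by
  rw [lamD]
  induction q using Polynomial.induction_on' with
  | add q r hq hr =>
    rw [Polynomial.sum_add_index, hq, hr, map_add, mul_add]
    · abel
    · simp
    · intro a b c; simp only [map_add]; abel
  | monomial k v =>
    rw [sum_monomial_index _ _ (by simp), dX_monomial, X_mul_monomial]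

/-- The operator `λ + ∂`, as a linear map. -/
def lamL : (SuperDiffPoly p)[X] →ₗ[ℂ] (SuperDiffPoly p)[X] := LinearMap.mulLeft ℂ X + dX p

@[simp] theorem lamL_apply (q) : lamL p q = X * q + dX p q := rfl

theorem lamD_eq_lamL (q : (SuperDiffPoly p)[X]) : lamD p q = lamL p q := lamD_eq p q

theorem lamD_iterate (k : ℕ) (q : (SuperDiffPoly p)[X]) : (lamD p)^[k] q = (lamL p ^ k) q := by
  rw [Module.End.pow_apply]
  exact congrFun (congrArg (fun f => f^[k]) (funext (lamD_eq_lamL p))) q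

theorem lamL_mul (q r : (SuperDiffPoly p)[X]) : lamL p (q * r) = lamL p q * r + q * dX p r := by
  simp only [lamL_apply, dX_mul]; noncomm_ring

theorem lamL_mul' (q r : (SuperDiffPoly p)[X]) : lamL p (q * r) = dX p q * r + q * lamL p r := by
  have h : X * (q * r) = q * (X * r) := by rw [← mul_assoc, X_mul, mul_assoc]
  rw [lamL_apply, lamL_apply, dX_mul, mul_add, h]; abel

theorem parX_lamL (q : (SuperDiffPoly p)[X]) : parX p (lamL p q) = lamL p (parX p q) := by
  simp only [lamL_apply, map_add, map_mul, parX_X, parX_dX]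

variable {p} in
theorem IsParX.lamL {b : Bool} {q : (SuperDiffPoly p)[X]} (h : IsParX p b q) :
    IsParX p b (lamL p q) := by
  rw [IsParX, parX_lamL, show parX p q = _ from h, map_smul]

variable {p} in
theorem IsParX.lamL_pow {b : Bool} {q : (SuperDiffPoly p)[X]} (h : IsParX p b q) (k : ℕ) :
    IsParX p b ((ClassicalW.lamL p ^ k) q) := by
  induction k with
  | zero => simpa using h
  | succ k ih => rw [pow_succ', Module.End.mul_apply]; exact ih.lamL

/-- A homomorphism to polynomials over differential polynomials, together with an operator
compatible with the total derivative. -/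
structure Pt where
  /-- the homomorphism -/
  hom : SuperDiffPoly p →ₐ[ℂ] (SuperDiffPoly p)[X]
  /-- the operator -/
  nab : (SuperDiffPoly p)[X] →ₗ[ℂ] (SuperDiffPoly p)[X]
  nab_hom_mul : ∀ v q, nab (hom v * q) = hom (totalDeriv p v) * q + hom v * nab q
  nab_mul_hom : ∀ q v, nab (q * hom v) = nab q * hom v + q * hom (totalDeriv p v)
  parX_hom : ∀ v, parX p (hom v) = hom (parity p v)
  parX_nab : ∀ q, parX p (nab q) = nab (parX p q)

/-- The point of `λ`-polynomials attached to an endomorphism. -/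
def lamPt (ψ : SuperDiffPoly p →ₐ[ℂ] SuperDiffPoly p)
    (hd : ∀ v, ψ (totalDeriv p v) = totalDeriv p (ψ v))
    (hp : ∀ v, ψ (parity p v) = parity p (ψ v)) : Pt p where
  hom := (Polynomial.CAlgHom (R := ℂ)).comp ψ
  nab := lamL p
  nab_hom_mul v q := by
    simp only [AlgHom.comp_apply, CAlgHom_apply]
    rw [lamL_mul', dX_C, hd]
  nab_mul_hom q v := by
    simp only [AlgHom.comp_apply, CAlgHom_apply]
    rw [lamL_mul, dX_C, hd]
  parX_hom v := by simp [hp]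
  parX_nab q := parX_lamL p q

/-- The tautological point. -/
def idPt : Pt p := lamPt p (AlgHom.id ℂ _) (fun _ => rfl) (fun _ => rfl)

@[simp] theorem lamPt_hom (ψ hd hp) (v : SuperDiffPoly p) : (lamPt p ψ hd hp).hom v = C (ψ v) := rfl
@[simp] theorem lamPt_nab (ψ hd hp) : (lamPt p ψ hd hp).nab = lamL p := rfl
@[simp] theorem idPt_hom (v : SuperDiffPoly p) : (idPt p).hom v = C v := rfl
@[simp] theorem idPt_nab : (idPt p).nab = lamL p := rfl

variable {p}

theorem Pt.twX_hom (P : Pt p) (b : Bool) (v : SuperDiffPoly p) :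
    twX p b (P.hom v) = P.hom (tw p b v) := by
  cases b
  · rfl
  · exact P.parX_hom v

theorem Pt.isParX_hom (P : Pt p) {b : Bool} {v : SuperDiffPoly p} (h : IsPar p b v) :
    IsParX p b (P.hom v) := by
  rw [IsParX, P.parX_hom, show parity p v = _ from h, map_smul]

theorem Pt.isParX_nab_pow (P : Pt p) {b : Bool} {q : (SuperDiffPoly p)[X]} (h : IsParX p b q)
    (k : ℕ) : IsParX p b ((P.nab ^ k) q) := by
  induction k with
  | zero => simpa using h
  | succ k ih =>
    rw [pow_succ', Module.End.mul_apply, IsParX, P.parX_nab, show parX p _ = _ from ih, map_smul]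

/-- For `q = ∑ cₖ λᵏ`, the sum `∑ ∇ᵏ(x) cₖ`. -/
def Pt.subst (P : Pt p) (x : (SuperDiffPoly p)[X]) :
    (SuperDiffPoly p)[X] →ₗ[ℂ] (SuperDiffPoly p)[X] :=
  Polynomial.lsum fun k => LinearMap.mulLeft ℂ ((P.nab ^ k) x) ∘ₗ P.hom.toLinearMap

@[simp] theorem Pt.subst_monomial (P : Pt p) (x) (k : ℕ) (v) :
    P.subst x (monomial k v) = (P.nab ^ k) x * P.hom v := by
  rw [subst, lsum_apply, sum_monomial_index _ _ (by simp)]; rfl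

@[simp] theorem Pt.subst_C (P : Pt p) (x) (v) : P.subst x (C v) = x * P.hom v := by
  simpa using P.subst_monomial x 0 v

theorem Pt.subst_eq_sum (P : Pt p) (x q) :
    P.subst x q = q.sum fun k c => (P.nab ^ k) x * P.hom c := by
  rw [subst, lsum_apply]; rfl

theorem Pt.subst_add_left (P : Pt p) (x y q) : P.subst (x + y) q = P.subst x q + P.subst y q := by
  induction q using Polynomial.induction_on' with
  | add q r hq hr => simp only [map_add, hq, hr]; abel
  | monomial k v => simp only [subst_monomial, map_add, add_mul]

theorem Pt.subst_smul_left (P : Pt p) (c : ℂ) (x q) : P.subst (c • x) q = c • P.subst x q := by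
  induction q using Polynomial.induction_on' with
  | add q r hq hr => simp only [map_add, hq, hr, smul_add]
  | monomial k v => simp only [subst_monomial, map_smul, smul_mul_assoc]

/-- Substitution, as a bilinear map. -/
def Pt.substL (P : Pt p) :
    (SuperDiffPoly p)[X] →ₗ[ℂ] (SuperDiffPoly p)[X] →ₗ[ℂ] (SuperDiffPoly p)[X] where
  toFun := P.subst
  map_add' x y := LinearMap.ext fun q => P.subst_add_left x y q
  map_smul' c x := LinearMap.ext fun q => P.subst_smul_left c x q

theorem Pt.substL_apply (P : Pt p) (x q) : P.substL x q = P.subst x q := rfl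

@[simp] theorem Pt.subst_zero_left (P : Pt p) (q) : P.subst 0 q = 0 := by
  rw [← substL_apply, map_zero, LinearMap.zero_apply]

theorem Pt.subst_sum_left (P : Pt p) {ι : Type*} (s : Finset ι) (f : ι → (SuperDiffPoly p)[X]) (q) :
    P.subst (∑ i ∈ s, f i) q = ∑ i ∈ s, P.subst (f i) q := by
  rw [← substL_apply, map_sum, LinearMap.sum_apply]; rfl

theorem Pt.subst_mul_C (P : Pt p) (x q) (v : SuperDiffPoly p) :
    P.subst x (q * C v) = P.subst x q * P.hom v := by
  induction q using Polynomial.induction_on' with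
  | add q r hq hr => simp only [add_mul, map_add, hq, hr]
  | monomial k w => rw [monomial_mul_C, subst_monomial, subst_monomial, map_mul, mul_assoc]

/-- A factor `λ` becomes `∇` on the first factor and `∂` on the coefficients becomes `∇` on the
second; by the Leibniz rule the sum is `∇` of the product. -/
theorem Pt.subst_lamL (P : Pt p) (x q) : P.subst x (lamL p q) = P.nab (P.subst x q) := by
  induction q using Polynomial.induction_on' with
  | add q r hq hr => simp only [map_add, hq, hr]
  | monomial k w =>
    rw [lamL_apply, X_mul_monomial, dX_monomial, map_add, subst_monomial, subst_monomial,
      subst_monomial, P.nab_mul_hom, pow_succ', Module.End.mul_apply]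

theorem Pt.subst_lamL_pow (P : Pt p) (x q) (k : ℕ) :
    P.subst x ((lamL p ^ k) q) = (P.nab ^ k) (P.subst x q) := by
  induction k with
  | zero => rfl
  | succ k ih => rw [pow_succ', Module.End.mul_apply, subst_lamL, ih, pow_succ', Module.End.mul_apply]

/-- Substitution is associative. -/
theorem Pt.subst_subst (P : Pt p) (x y q) :
    P.subst x ((idPt p).subst y q) = P.subst (P.subst x y) q := by
  induction q using Polynomial.induction_on' with
  | add q r hq hr => simp only [map_add, hq, hr]
  | monomial k w =>
    rw [subst_monomial, subst_monomial, idPt_hom, P.subst_mul_C, idPt_nab, subst_lamL_pow]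

/-- Holds because `(λ + ∂)ᵏ 1 = λᵏ`. -/
theorem idPt_subst_one (q) : (idPt p).subst 1 q = q := by
  have h : ∀ k, (lamL p ^ k) 1 = X ^ k := fun k => by
    induction k with
    | zero => rfl
    | succ k ih =>
      rw [pow_succ', Module.End.mul_apply, ih, lamL_apply, ← pow_succ']
      have : dX p (X ^ k) = 0 := by rw [X_pow_eq_monomial, dX_monomial]; simp
      rw [this, add_zero]
  induction q using Polynomial.induction_on' with
  | add q r hq hr => simp only [map_add, hq, hr]
  | monomial k w => rw [Pt.subst_monomial, idPt_nab, h, idPt_hom, X_pow_mul_C, C_mul_X_pow_eq_monomial]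

theorem Pt.isParX_subst (P : Pt p) {b c : Bool} {x q : (SuperDiffPoly p)[X]} (hx : IsParX p b x)
    (hq : IsParX p c q) : IsParX p (xor b c) (P.subst x q) := by
  rw [subst_eq_sum, Polynomial.sum_def]
  exact IsParX.sum _ fun k _ => (P.isParX_nab_pow hx k).mul (P.isParX_hom (isParX_iff.1 hq k))

/-- Substitution and multiplication by a homogeneous argument. -/
theorem Pt.subst_C_mul (P : Pt p) {b : Bool} {x : (SuperDiffPoly p)[X]} (hx : IsParX p b x) (q)
    (v : SuperDiffPoly p) : P.subst x (C v * q) = P.hom (tw p b v) * P.subst x q := by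
  induction q using Polynomial.induction_on' with
  | add q r hq hr => simp only [mul_add, map_add, hq, hr]
  | monomial k w =>
    rw [C_mul_monomial, subst_monomial, subst_monomial, map_mul, ← mul_assoc,
      (P.isParX_nab_pow hx k).mul_comm, P.twX_hom, mul_assoc]

/-! ### Brackets with generators -/

variable (p) (B : G → G → (SuperDiffPoly p)[X])

/-- The bracket with a generator. -/
def genBr (g : G) : SuperDiffPoly p →ₗ[ℂ] (SuperDiffPoly p)[X] := bracket p B (gen p (g, 0))

theorem substLamD_eq (y q : (SuperDiffPoly p)[X]) : substLamD p y q = (idPt p).subst y q := by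
  rw [Pt.subst_eq_sum, substLamD]
  simp only [lamD_iterate]; rfl

theorem bracket_apply (x y : SuperDiffPoly p) :
    bracket p B x y = (leftGrad p y).sum fun v d =>
      ((rightGrad p x).sum fun u w => (idPt p).subst ((-1 : ℂ) ^ u.2 • (lamL p ^ u.2) (C w))
        ((lamL p ^ v.2) (B u.1 v.1))) * C d := by
  rw [bracket, LinearMap.comp_apply, Finsupp.lsum_apply]
  simp only [lamD_iterate, substLamD_eq]
  rfl

theorem genBr_apply (g : G) (y : SuperDiffPoly p) :
    genBr p B g y = (leftGrad p y).sum fun v d => (lamL p ^ v.2) (B g v.1) * C d := by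
  classical
  rw [genBr, bracket_apply]
  refine Finsupp.sum_congr fun v _ => ?_
  rw [rightGrad_gen, Finsupp.sum_single_index (by simp)]
  simp only [pow_zero, one_smul, Module.End.one_apply, C_1]
  rw [idPt_subst_one]

theorem genBr_gen (g : G) (v : G × ℕ) : genBr p B g (gen p v) = (lamL p ^ v.2) (B g v.1) := by
  classical
  rw [genBr_apply, leftGrad_gen, Finsupp.sum_single_index (by simp), C_1, mul_one]

@[simp] theorem genBr_algebraMap (g : G) (c : ℂ) : genBr p B g (algebraMap ℂ _ c) = 0 := by
  rw [genBr_apply, leftGrad_algebraMap, Finsupp.sum_zero_index]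

section Leibniz

variable {B} (hB : ∀ g h, IsParX p (xor (p g) (p h)) (B g h))
include hB

theorem genBr_mul (g : G) (x y : SuperDiffPoly p) :
    genBr p B g (x * y) = genBr p B g x * C y + C (tw p (p g) x) * genBr p B g y := by
  classical
  set s := (leftGrad p x).support ∪ ((leftGrad p y).support ∪ (leftGrad p (x * y)).support)
  have h : ∀ z, (leftGrad p z).support ⊆ s →
      genBr p B g z = ∑ v ∈ s, (lamL p ^ v.2) (B g v.1) * C (leftGrad p z v) := fun z hz => by
    rw [genBr_apply]
    exact sum_eq_of_support_subset _ s hz _ (by simp)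
  rw [h x Finset.subset_union_left, h y (by
      intro a ha; simp only [s, Finset.mem_union]; tauto), h (x * y) (by
      intro a ha; simp only [s, Finset.mem_union]; tauto), Finset.sum_mul, Finset.mul_sum,
    ← Finset.sum_add_distrib]
  refine Finset.sum_congr rfl fun v _ => ?_
  rw [leftGrad_mul, C_add, mul_add, C_mul, C_mul, mul_assoc]
  congr 1
  rw [← mul_assoc, ((hB g v.1).lamL_pow v.2).mul_comm, twX_C, tw_tw, ← mul_assoc]
  simp

theorem genBr_totalDeriv (g : G) (x : SuperDiffPoly p) :
    genBr p B g (totalDeriv p x) = lamL p (genBr p B g x) := by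
  induction x using gen_induction p with
  | algebraMap c => simp
  | gen u => rw [totalDeriv_gen, genBr_gen, genBr_gen, pow_succ', Module.End.mul_apply]
  | add x y hx hy => simp only [map_add, hx, hy]
  | mul x y hx hy =>
    rw [totalDeriv_mul, map_add, genBr_mul p hB, genBr_mul p hB, genBr_mul p hB, hx, hy, map_add,
      lamL_mul, lamL_mul', dX_C, dX_C, tw_totalDeriv]
    abel

theorem parX_genBr (g : G) (x : SuperDiffPoly p) :
    parX p (genBr p B g x) = sg (p g) • genBr p B g (parity p x) := by
  induction x using gen_induction p with
  | algebraMap c => simp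
  | gen u =>
    have h : parX p _ = _ := (hB g u.1).lamL_pow u.2
    rw [genBr_gen, h, show parity p _ = _ from isPar_gen p u, map_smul, genBr_gen, smul_smul, sg_xor]
  | add x y hx hy => simp only [map_add, hx, hy, smul_add]
  | mul x y hx hy =>
    rw [genBr_mul p hB, map_add, map_mul, map_mul, map_mul, genBr_mul p hB, hx, hy, smul_add,
      parX_C, parX_C, smul_mul_assoc, mul_smul_comm]
    cases p g <;> simp

theorem isParX_genBr (g : G) {b : Bool} {x : SuperDiffPoly p} (h : IsPar p b x) :
    IsParX p (xor (p g) b) (genBr p B g x) := by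
  rw [IsParX, parX_genBr p hB, show parity p x = _ from h, map_smul, smul_smul, sg_xor]

end Leibniz

/-! ### Variational gradients -/

variable [Fintype G] [DecidableEq G]

/-- The variational derivative of `x` with respect to `g`: `∑ (-λ-∂)ᵐ ∂ᴿx/∂g⁽ᵐ⁾`. -/
def vgrad (g : G) : SuperDiffPoly p →ₗ[ℂ] (SuperDiffPoly p)[X] :=
  Finsupp.lsum ℂ (fun u : G × ℕ => if u.1 = g then
    (-1 : ℂ) ^ u.2 • (lamL p ^ u.2) ∘ₗ (Polynomial.CAlgHom (R := ℂ)).toLinearMap else 0) ∘ₗ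
    rightGrad p

omit [Fintype G] in
theorem vgrad_apply (g : G) (x : SuperDiffPoly p) :
    vgrad p g x = (rightGrad p x).sum fun u w =>
      if u.1 = g then (-1 : ℂ) ^ u.2 • (lamL p ^ u.2) (C w) else 0 := by
  rw [vgrad, LinearMap.comp_apply, Finsupp.lsum_apply]
  refine Finsupp.sum_congr fun u _ => ?_
  split_ifs <;> rfl

variable {p} in
/-- The gauge variation with parameters `x`. -/
def Pt.act (P : Pt p) (x : G → (SuperDiffPoly p)[X]) :
    SuperDiffPoly p →ₗ[ℂ] (SuperDiffPoly p)[X] :=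
  ∑ g, P.subst (x g) ∘ₗ genBr p B g

omit [DecidableEq G] in
variable {p} in
theorem Pt.act_apply (P : Pt p) (x : G → (SuperDiffPoly p)[X]) (y : SuperDiffPoly p) :
    P.act B x y = ∑ g, P.subst (x g) (genBr p B g y) := by
  simp [Pt.act]

/-- The master formula, grouped by the generator differentiated in `x`. It reduces all brackets to
brackets with generators. -/
theorem bracket_eq_act (x y : SuperDiffPoly p) :
    bracket p B x y = (idPt p).act B (fun g => vgrad p g x) y := by
  rw [bracket_apply, Pt.act_apply]
  simp only [genBr_apply, Finsupp.sum, map_sum, Pt.subst_mul_C, idPt_hom]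
  rw [Finset.sum_comm]
  refine Finset.sum_congr rfl fun v _ => ?_
  rw [← Finset.sum_mul]
  congr 1
  simp only [vgrad_apply, Finsupp.sum, Pt.subst_sum_left]
  rw [Finset.sum_comm]
  refine Finset.sum_congr rfl fun u _ => ?_
  rw [Finset.sum_eq_single u.1]
  · simp
  · intro g _ hg
    rw [if_neg (Ne.symm hg), Pt.subst_zero_left]
  · simp

variable {p} in
theorem isParX_vgrad (g : G) {b : Bool} {x : SuperDiffPoly p} (h : IsPar p b x) :
    IsParX p (xor b (p g)) (vgrad p g x) := by
  rw [vgrad_apply, Finsupp.sum]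
  refine IsParX.sum _ fun u _ => ?_
  split_ifs with hu
  · refine IsParX.smul (IsParX.lamL_pow (IsPar.isParX_C ?_) _) _
    rw [IsPar, parity_rightGrad, show parity p x = _ from h, map_smul, Finsupp.smul_apply,
      smul_smul, sg_xor, hu, mul_comm]
  · exact isParX_zero p _

omit [DecidableEq G] in
variable {p B} in
theorem Pt.act_mul (P : Pt p) (hB : ∀ g h, IsParX p (xor (p g) (p h)) (B g h))
    {x : G → (SuperDiffPoly p)[X]} {b : Bool} (hx : ∀ g, IsParX p (xor b (p g)) (x g))
    (y z : SuperDiffPoly p) :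
    P.act B x (y * z) = P.act B x y * P.hom z + P.hom (tw p b y) * P.act B x z := by
  simp only [act_apply, Finset.sum_mul, Finset.mul_sum, ← Finset.sum_add_distrib]
  refine Finset.sum_congr rfl fun g _ => ?_
  rw [genBr_mul p hB, map_add, P.subst_mul_C, P.subst_C_mul (hx g), tw_tw]
  simp

omit [DecidableEq G] in
variable {p B} in
theorem Pt.act_totalDeriv (P : Pt p) (hB : ∀ g h, IsParX p (xor (p g) (p h)) (B g h))
    (x : G → (SuperDiffPoly p)[X]) (y : SuperDiffPoly p) :
    P.act B x (totalDeriv p y) = P.nab (P.act B x y) := by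
  simp only [act_apply, map_sum]
  refine Finset.sum_congr rfl fun g _ => ?_
  rw [genBr_totalDeriv p hB, P.subst_lamL]

omit [DecidableEq G] in
variable {p B} in
theorem Pt.act_algebraMap (P : Pt p) (x : G → (SuperDiffPoly p)[X]) (c : ℂ) :
    P.act B x (algebraMap ℂ _ c) = 0 := by
  simp [act_apply]

end LambdaCalculus


/-! ### Skew-symmetry and the Jacobi identity with one generator -/

section Jacobi

open Polynomial

/-- The sequence `0, f 0, f 1, …`. -/
def shiftSeq {M : Type*} [Zero M] (f : ℕ → M) (i : ℕ) : M := Nat.casesOn i 0 f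

@[simp] theorem shiftSeq_zero {M : Type*} [Zero M] (f : ℕ → M) : shiftSeq f 0 = 0 := rfl
@[simp] theorem shiftSeq_succ {M : Type*} [Zero M] (f : ℕ → M) (i : ℕ) :
    shiftSeq f (i + 1) = f i := rfl

/-- In terms of generating series `shiftSeq` is multiplication by the variable, so it can be taken
out of a convolution. -/
theorem sum_shiftSeq_snd {M : Type*} [AddCommMonoid M] (f : ℕ → ℕ → M) (i : ℕ) :
    ∑ x ∈ Finset.HasAntidiagonal.antidiagonal i, shiftSeq (f x.1) x.2 =
      shiftSeq (fun i => ∑ x ∈ Finset.HasAntidiagonal.antidiagonal i, f x.1 x.2) i := by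
  cases i with
  | zero => simp
  | succ i => rw [Finset.Nat.sum_antidiagonal_succ']; simp

theorem sum_shiftSeq_fst {M : Type*} [AddCommMonoid M] (f : ℕ → ℕ → M) (i : ℕ) :
    ∑ x ∈ Finset.HasAntidiagonal.antidiagonal i, shiftSeq (fun j => f j x.2) x.1 =
      shiftSeq (fun i => ∑ x ∈ Finset.HasAntidiagonal.antidiagonal i, f x.1 x.2) i := by
  cases i with
  | zero => simp
  | succ i => rw [Finset.Nat.sum_antidiagonal_succ]; simp

variable {G : Type} (p : G → Bool)

/-- A linear operator applied to the coefficients. -/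
def mapX (D : SuperDiffPoly p →ₗ[ℂ] SuperDiffPoly p) :
    (SuperDiffPoly p)[X] →ₗ[ℂ] (SuperDiffPoly p)[X] :=
  Polynomial.lsum fun k => ((monomial k).restrictScalars ℂ) ∘ₗ D

@[simp] theorem mapX_monomial (D) (k : ℕ) (v : SuperDiffPoly p) :
    mapX p D (monomial k v) = monomial k (D v) := by
  rw [mapX, lsum_apply, sum_monomial_index _ _ (by simp)]; rfl

@[simp] theorem mapX_C (D) (v : SuperDiffPoly p) : mapX p D (C v) = C (D v) := mapX_monomial p D 0 v

@[simp] theorem coeff_mapX (D) (q : (SuperDiffPoly p)[X]) (j : ℕ) :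
    (mapX p D q).coeff j = D (q.coeff j) := by
  induction q using Polynomial.induction_on' with
  | add q r hq hr => simp only [map_add, coeff_add, hq, hr]
  | monomial k v =>
    rw [mapX_monomial, coeff_monomial, coeff_monomial]; split_ifs <;> simp

theorem mapX_X_mul (D) (q : (SuperDiffPoly p)[X]) : mapX p D (X * q) = X * mapX p D q := by
  induction q using Polynomial.induction_on' with
  | add q r hq hr => simp only [map_add, mul_add, hq, hr]
  | monomial k v => simp only [X_mul_monomial, mapX_monomial]

/-- The divided derivatives in `λ`. -/
def hasse (k : ℕ) : (SuperDiffPoly p)[X] →ₗ[ℂ] (SuperDiffPoly p)[X] :=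
  (Polynomial.hasseDeriv k).restrictScalars ℂ

theorem coeff_hasse (k : ℕ) (q : (SuperDiffPoly p)[X]) (n : ℕ) :
    (hasse p k q).coeff n = ((n + k).choose k : SuperDiffPoly p) * q.coeff (n + k) :=
  hasseDeriv_coeff k q n

theorem hasse_C (k : ℕ) (v : SuperDiffPoly p) : hasse p k (C v) = if k = 0 then C v else 0 := by
  ext n
  rw [coeff_hasse, coeff_C]
  rcases Nat.eq_zero_or_pos k with rfl | hk
  · simp [coeff_C]
  · rw [if_neg (by omega), if_neg (by omega)]; simp

theorem hasse_mul_C (k : ℕ) (q : (SuperDiffPoly p)[X]) (v : SuperDiffPoly p) :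
    hasse p k (q * C v) = hasse p k q * C v := by
  ext n; simp only [coeff_hasse, coeff_mul_C, mul_assoc]

theorem hasse_C_mul (k : ℕ) (q : (SuperDiffPoly p)[X]) (v : SuperDiffPoly p) :
    hasse p k (C v * q) = C v * hasse p k q := by
  ext n
  rw [coeff_hasse, coeff_C_mul, coeff_C_mul, coeff_hasse, ← mul_assoc, Nat.cast_comm, mul_assoc]

/-- `hasse p k q` is the coefficient of `μᵏ` in `q(λ + μ)`, and the two terms come from the two
summands of the factor `λ + μ`. -/
theorem hasse_X_mul (k : ℕ) (q : (SuperDiffPoly p)[X]) :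
    hasse p k (X * q) = X * hasse p k q + shiftSeq (hasse p) k q := by
  ext n
  rw [coeff_add, coeff_hasse]
  cases k with
  | zero =>
    rw [shiftSeq_zero, LinearMap.zero_apply, coeff_zero]
    cases n with
    | zero => simp
    | succ n => simp [coeff_X_mul, coeff_hasse]
  | succ k =>
    rw [shiftSeq_succ, coeff_hasse]
    cases n with
    | zero =>
      rw [mul_coeff_zero, coeff_X_zero, zero_mul, zero_add, zero_add, coeff_X_mul]
      simp
    | succ n =>
      rw [coeff_X_mul, coeff_hasse, ← add_assoc, coeff_X_mul, show n + (k + 1) = n + 1 + k by omega,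
        ← add_mul, Nat.choose_succ_succ (n + 1 + k) k, Nat.cast_add, add_comm]

theorem hasse_dX (k : ℕ) (q : (SuperDiffPoly p)[X]) : hasse p k (dX p q) = dX p (hasse p k q) := by
  ext n
  rw [coeff_dX, coeff_hasse, coeff_hasse, coeff_dX, totalDeriv_mul]
  have : totalDeriv p (((n + k).choose k : ℕ) : SuperDiffPoly p) = 0 := by
    rw [← map_natCast (algebraMap ℂ (SuperDiffPoly p)), totalDeriv_algebraMap]
  rw [this, zero_mul, zero_add]

theorem hasse_lamL (k : ℕ) (q : (SuperDiffPoly p)[X]) :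
    hasse p k (lamL p q) = lamL p (hasse p k q) + shiftSeq (hasse p) k q := by
  rw [lamL_apply, map_add, hasse_X_mul, hasse_dX, lamL_apply]; abel

/-- The substitution `λ ↦ -λ-∂`, with `∂` acting on the coefficients. -/
def antip : (SuperDiffPoly p)[X] →ₗ[ℂ] (SuperDiffPoly p)[X] :=
  Polynomial.lsum fun k => ((-lamL p) ^ k) ∘ₗ (Polynomial.CAlgHom (R := ℂ)).toLinearMap

theorem antip_monomial (k : ℕ) (v : SuperDiffPoly p) :
    antip p (monomial k v) = ((-lamL p) ^ k) (C v) := by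
  rw [antip, lsum_apply, sum_monomial_index _ _ (by simp)]; rfl

@[simp] theorem antip_C (v : SuperDiffPoly p) : antip p (C v) = C v := antip_monomial p 0 v

theorem antip_X_mul (q : (SuperDiffPoly p)[X]) : antip p (X * q) = -lamL p (antip p q) := by
  induction q using Polynomial.induction_on' with
  | add q r hq hr => rw [mul_add, map_add, hq, hr, map_add, map_add, neg_add]
  | monomial k v =>
    rw [X_mul_monomial, antip_monomial, antip_monomial, pow_succ', Module.End.mul_apply]; rfl

theorem dX_lamL (q : (SuperDiffPoly p)[X]) : dX p (lamL p q) = lamL p (dX p q) := by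
  have : dX p X = 0 := by rw [← monomial_one_one_eq_X, dX_monomial]; simp
  rw [lamL_apply, map_add, dX_mul, this, zero_mul, zero_add, lamL_apply]

theorem dX_neg_lamL_pow (k : ℕ) (q : (SuperDiffPoly p)[X]) :
    dX p (((-lamL p) ^ k) q) = ((-lamL p) ^ k) (dX p q) := by
  induction k with
  | zero => rfl
  | succ k ih =>
    simp only [pow_succ', Module.End.mul_apply, LinearMap.neg_apply]
    rw [map_neg, dX_lamL, ih]

theorem antip_dX (q : (SuperDiffPoly p)[X]) : antip p (dX p q) = dX p (antip p q) := by
  induction q using Polynomial.induction_on' with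
  | add q r hq hr => simp only [map_add, hq, hr]
  | monomial k v => rw [dX_monomial, antip_monomial, antip_monomial, dX_neg_lamL_pow, dX_C]

theorem antip_lamL (q : (SuperDiffPoly p)[X]) : antip p (lamL p q) = -(X * antip p q) := by
  rw [lamL_apply, map_add, antip_X_mul, antip_dX, lamL_apply]; abel

/-- Integration by parts: after `λ ↦ -λ-∂`, with `∂` acting on the whole product, `λ` plus the
derivative of `b` becomes `-λ` minus the derivative of `q`. -/
theorem antip_lamL_pow_mul (m : ℕ) (b : SuperDiffPoly p) : ∀ q : SuperDiffPoly p,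
    antip p ((lamL p ^ m) (C b) * C q) = C b * ((-lamL p) ^ m) (C q) := by
  induction m with
  | zero => intro q; rw [pow_zero, pow_zero, Module.End.one_apply, Module.End.one_apply, ← C_mul, antip_C]
  | succ m ih =>
    intro q
    have h : (lamL p ^ (m + 1)) (C b) * C q = lamL p ((lamL p ^ m) (C b) * C q) -
        (lamL p ^ m) (C b) * C (totalDeriv p q) := by
      rw [lamL_mul, dX_C, pow_succ', Module.End.mul_apply]; abel
    rw [h, map_sub, antip_lamL, ih, ih, pow_succ', Module.End.mul_apply, LinearMap.neg_apply,
      lamL_apply, dX_neg_lamL_pow, dX_C, mul_neg, mul_add, neg_add, ← mul_assoc, ← mul_assoc, X_mul]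
    abel

theorem lamL_pow_X_mul (m : ℕ) (q : (SuperDiffPoly p)[X]) :
    (lamL p ^ m) (X * q) = X * (lamL p ^ m) q := by
  induction m with
  | zero => rfl
  | succ m ih =>
    have : dX p X = 0 := by rw [← monomial_one_one_eq_X, dX_monomial]; simp
    rw [pow_succ', Module.End.mul_apply, ih, lamL_mul', this, zero_mul, zero_add,
      Module.End.mul_apply]

theorem neg_lamL_pow (m : ℕ) (q : (SuperDiffPoly p)[X]) :
    ((-lamL p) ^ m) q = (-1 : ℂ) ^ m • (lamL p ^ m) q := by
  induction m with
  | zero => simp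
  | succ m ih =>
    rw [pow_succ', Module.End.mul_apply, ih, pow_succ' (lamL p), Module.End.mul_apply, pow_succ',
      mul_smul, LinearMap.neg_apply, map_smul, neg_one_smul]

/-- Operators `Dᵢ` on the coefficients with `D_μ ∂ = (μ + ∂) D_μ`, and the substitution
`λ ↦ -λ-∂`. -/
theorem mapX_antip (D : ℕ → SuperDiffPoly p →ₗ[ℂ] SuperDiffPoly p)
    (hD : ∀ i v, D i (totalDeriv p v) = totalDeriv p (D i v) + shiftSeq D i v) (i : ℕ)
    (q : (SuperDiffPoly p)[X]) :
    mapX p (D i) (antip p q) = ∑ x ∈ Finset.HasAntidiagonal.antidiagonal i,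
      hasse p x.2 (antip p (mapX p (D x.1) q)) := by
  have hl : ∀ i q, mapX p (D i) (lamL p q) = lamL p (mapX p (D i) q) +
      shiftSeq (fun i => mapX p (D i) q) i := by
    intro i q
    rw [lamL_apply, map_add, mapX_X_mul, lamL_apply, add_assoc]
    congr 1
    ext n
    cases i <;> simp [hD]
  induction q using Polynomial.induction_on' generalizing i with
  | add q r hq hr => simp only [map_add, hq, hr, Finset.sum_add_distrib]
  | monomial k v =>
    induction k generalizing i with
    | zero =>
      simp only [monomial_zero_left, antip_C, mapX_C, hasse_C]
      rw [Finset.sum_eq_single (i, 0)]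
      · simp
      · rintro ⟨a, b⟩ h hne
        rw [Finset.HasAntidiagonal.mem_antidiagonal] at h
        refine if_neg fun h0 => hne ?_
        simp only at h h0
        ext <;> simp <;> omega
      · simp
    | succ k ih =>
      have h1 := fun j => sum_shiftSeq_snd (fun j k' => hasse p k' (antip p (mapX p (D j) (monomial k v)))) j
      rw [← X_mul_monomial, antip_X_mul, map_neg, hl, ih]
      simp only [mapX_X_mul, antip_X_mul, map_neg, hasse_lamL, Finset.sum_neg_distrib,
        Finset.sum_add_distrib, map_sum]
      congr 2
      have h2 : ∀ x : ℕ × ℕ, (shiftSeq (hasse p) x.2) (antip p (mapX p (D x.1) (monomial k v))) =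
        shiftSeq (fun k' => hasse p k' (antip p (mapX p (D x.1) (monomial k v)))) x.2 := by
        rintro ⟨a, b⟩; cases b <;> rfl
      simp only [h2, h1]
      congr 1
      funext j
      exact ih j

/-- The sum is the coefficient of `μⁱ` in the result of shifting `λ` by `μ`, substituting `-λ-∂` and
shifting by `μ` again; the two shifts cancel. -/
theorem hasse_antip_hasse (i : ℕ) (q : (SuperDiffPoly p)[X]) :
    ∑ x ∈ Finset.HasAntidiagonal.antidiagonal i, hasse p x.2 (antip p (hasse p x.1 q)) =
      if i = 0 then antip p q else 0 := by
  induction q using Polynomial.induction_on' generalizing i with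
  | add q r hq hr => simp only [map_add, Finset.sum_add_distrib, hq, hr]; split_ifs <;> simp
  | monomial k v =>
    induction k generalizing i with
    | zero =>
      simp only [monomial_zero_left, hasse_C]
      rw [Finset.sum_eq_single (0, i)]
      · simp [hasse_C]
      · rintro ⟨a, b⟩ h hne
        rw [Finset.HasAntidiagonal.mem_antidiagonal] at h
        rw [if_neg, map_zero, map_zero]
        intro h0; apply hne
        simp only at h h0
        ext <;> simp <;> omega
      · simp
    | succ k ih =>
      rw [← X_mul_monomial]
      generalize monomial k v = m at ih ⊢
      have h1 := fun j => sum_shiftSeq_snd (fun j k' => hasse p k' (antip p (hasse p j m))) j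
      have h2 := fun j => sum_shiftSeq_fst (fun j k' => hasse p k' (antip p (hasse p j m))) j
      have e1 : ∀ x : ℕ × ℕ, (shiftSeq (hasse p) x.2) (antip p (hasse p x.1 m)) =
        shiftSeq (fun k' => hasse p k' (antip p (hasse p x.1 m))) x.2 := by
        rintro ⟨a, b⟩; cases b <;> rfl
      have e2 : ∀ x : ℕ × ℕ, hasse p x.2 (antip p (shiftSeq (hasse p) x.1 m)) =
        shiftSeq (fun j => hasse p x.2 (antip p (hasse p j m))) x.1 := by
        rintro ⟨a, b⟩; cases a <;> simp
      simp only [hasse_X_mul, map_add, antip_X_mul, map_neg, hasse_lamL, Finset.sum_add_distrib,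
        Finset.sum_neg_distrib, e1, e2, h1, h2, ← map_sum, ih]
      split_ifs <;> simp

/-! ### Skew-symmetry -/

variable {p} [Fintype G] [DecidableEq G] (B : G → G → (SuperDiffPoly p)[X])

omit [DecidableEq G] in
theorem Pt.act_add_left (P : Pt p) (x x' : G → (SuperDiffPoly p)[X]) (y : SuperDiffPoly p) :
    P.act B (x + x') y = P.act B x y + P.act B x' y := by
  simp only [Pt.act_apply, Pi.add_apply, Pt.subst_add_left, Finset.sum_add_distrib]

omit [DecidableEq G] in
theorem Pt.act_smul_left (P : Pt p) (c : ℂ) (x : G → (SuperDiffPoly p)[X]) (y : SuperDiffPoly p) :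
    P.act B (c • x) y = c • P.act B x y := by
  simp only [Pt.act_apply, Pi.smul_apply, Pt.subst_smul_left, Finset.smul_sum]

theorem bracket_add_left (x x' y : SuperDiffPoly p) :
    bracket p B (x + x') y = bracket p B x y + bracket p B x' y := by
  simp only [bracket_eq_act, map_add]
  exact Pt.act_add_left B _ _ _ _

theorem bracket_smul_left (c : ℂ) (x y : SuperDiffPoly p) :
    bracket p B (c • x) y = c • bracket p B x y := by
  simp only [bracket_eq_act, map_smul]
  exact Pt.act_smul_left B _ _ _ _

/-- The bracket as a bilinear map. -/
def bracketL : SuperDiffPoly p →ₗ[ℂ] SuperDiffPoly p →ₗ[ℂ] (SuperDiffPoly p)[X] where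
  toFun := bracket p B
  map_add' x x' := LinearMap.ext (bracket_add_left B x x')
  map_smul' c x := LinearMap.ext (bracket_smul_left B c x)

theorem bracketL_apply (x y : SuperDiffPoly p) : bracketL B x y = bracket p B x y := rfl

/-- Operator coefficients of the bracket with a generator. -/
def genCoeff (g : G) (i : ℕ) : SuperDiffPoly p →ₗ[ℂ] SuperDiffPoly p :=
  ((lcoeff (SuperDiffPoly p) i).restrictScalars ℂ) ∘ₗ genBr p B g

omit [Fintype G] [DecidableEq G] in
theorem genCoeff_apply (g : G) (i : ℕ) (y : SuperDiffPoly p) :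
    genCoeff B g i y = (genBr p B g y).coeff i := rfl

/-- Brackets of generators that are linear in the generators, with a central term. -/
structure IsAffine (b0 : G → G → SuperDiffPoly p) (b1 : G → G → ℂ) : Prop where
  eq : ∀ g h, B g h = C (b0 g h) + monomial 1 (algebraMap ℂ _ (b1 g h))
  par : ∀ g h, IsParX p (xor (p g) (p h)) (B g h)
  skew0 : ∀ g h, b0 h g = -(sg (p g && p h) • b0 g h)
  skew1 : ∀ g h, b1 h g = sg (p g && p h) * b1 g h
  par1 : ∀ g h, b1 g h ≠ 0 → p g = p h
  span0 : ∀ g h, b0 g h ∈ Submodule.span ℂ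
    {x | ∃ u, p u = xor (p g) (p h) ∧ x = gen p (u, 0)}
  jac : ∀ a h g i, mapX p (genCoeff B a i) (genBr p B h (gen p (g, 0))) -
    sg (p a && p h) • genBr p B h (genCoeff B a i (gen p (g, 0))) =
      hasse p i (bracket p B (b0 a h) (gen p (g, 0)))

section Affine

variable {B} {b0 : G → G → SuperDiffPoly p} {b1 : G → G → ℂ} (H : IsAffine B b0 b1)
include H

omit [Fintype G] in
theorem IsAffine.isPar_b0 (g h : G) : IsPar p (xor (p g) (p h)) (b0 g h) := by
  have h1 := isParX_iff.1 (H.par g h) 0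
  rw [H.eq, coeff_add, coeff_C_zero, coeff_monomial, if_neg (by omega), add_zero] at h1
  exact h1

omit [Fintype G] in
theorem IsAffine.subst_B (P : Pt p) (x) (g h : G) :
    P.subst x (B g h) = x * P.hom (b0 g h) + b1 g h • P.nab x := by
  rw [H.eq, map_add, P.subst_C, P.subst_monomial, pow_one, AlgHom.commutes,
    ← Algebra.commutes, ← Algebra.smul_def]

omit [Fintype G] in
theorem IsAffine.antip_B (g : G) (v : G × ℕ) (d : SuperDiffPoly p) :
    antip p ((lamL p ^ v.2) (B g v.1) * C d) =
      C (b0 g v.1) * ((-lamL p) ^ v.2) (C d) - b1 g v.1 • lamL p (((-lamL p) ^ v.2) (C d)) := by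
  have h1 : monomial 1 (algebraMap ℂ (SuperDiffPoly p) (b1 g v.1)) =
      b1 g v.1 • (X * C (1 : SuperDiffPoly p)) := by
    rw [C_1, mul_one, Algebra.algebraMap_eq_smul_one, ← smul_monomial, monomial_one_one_eq_X]
  rw [H.eq, map_add, add_mul, map_add, antip_lamL_pow_mul, h1, map_smul, lamL_pow_X_mul,
    smul_mul_assoc, mul_assoc, map_smul, antip_X_mul, antip_lamL_pow_mul, C_1, one_mul, smul_neg,
    sub_eq_add_neg]

theorem sum_vgrad (F : G → (SuperDiffPoly p)[X] →ₗ[ℂ] (SuperDiffPoly p)[X]) (x : SuperDiffPoly p) :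
    ∑ g, F g (vgrad p g x) = (rightGrad p x).sum fun u w => F u.1 (((-lamL p) ^ u.2) (C w)) := by
  simp only [vgrad_apply, Finsupp.sum, map_sum]
  rw [Finset.sum_comm]
  refine Finset.sum_congr rfl fun u _ => ?_
  rw [Finset.sum_eq_single u.1]
  · simp [neg_lamL_pow]
  · intro g _ hg
    rw [if_neg (Ne.symm hg), map_zero]
  · simp

/-- Skew-symmetry of the bracket with a generator. -/
theorem IsAffine.skew {b : Bool} {w : SuperDiffPoly p} (hw : IsPar p b w) (g : G) :
    bracket p B w (gen p (g, 0)) = -(sg (b && p g) • antip p (genBr p B g w)) := by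
  rw [bracket_eq_act, Pt.act_apply]
  simp only [genBr_gen, pow_zero, Module.End.one_apply, H.subst_B, idPt_hom, idPt_nab]
  rw [genBr_apply, Finsupp.sum, map_sum]
  simp only [H.antip_B]
  have h0 := sum_vgrad H (fun u => LinearMap.mulRight ℂ (C (b0 u g)) + b1 u g • lamL p) w
  simp only [LinearMap.add_apply, LinearMap.mulRight_apply, LinearMap.smul_apply] at h0
  rw [h0, sum_eq_of_support_subset (rightGrad p w)
    ((rightGrad p w).support ∪ (leftGrad p w).support) Finset.subset_union_left _ (by simp),
    Finset.sum_subset (s₁ := (leftGrad p w).support)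
    (s₂ := (rightGrad p w).support ∪ (leftGrad p w).support) Finset.subset_union_right]
  · rw [Finset.smul_sum, ← Finset.sum_neg_distrib]
    refine Finset.sum_congr rfl fun v _ => ?_
    rw [rightGrad_eq p hw]
    set d := leftGrad p w v
    have hd : IsPar p (xor b (p v.1)) d := by
      rw [IsPar, parity_leftGrad, show parity p w = _ from hw, map_smul, Finsupp.smul_apply,
        smul_smul, sg_xor, mul_comm]
    have hq : IsParX p (xor b (p v.1)) (((-lamL p) ^ v.2) (C d)) := by
      rw [neg_lamL_pow]; exact (hd.isParX_C.lamL_pow _).smul _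
    rw [← smul_C, map_smul, map_smul, smul_mul_assoc, hq.mul_comm, twX_C, H.skew0 g v.1,
      H.skew1 g v.1]
    set Q := ((-lamL p) ^ v.2) (C d)
    rw [map_neg, map_smul, (H.isPar_b0 g v.1).tw_eq, smul_smul, map_neg, ← smul_C,
      smul_sub, neg_sub, neg_mul, smul_neg, smul_mul_assoc, smul_smul, smul_smul,
      smul_smul, sub_eq_add_neg, add_comm]
    congr 1
    · by_cases hb : b1 g v.1 = 0
      · simp [hb]
      · have := H.par1 g v.1 hb
        congr 1
        rw [← this]
        cases b <;> cases p g <;> simp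
    · congr 2
      cases b <;> cases p g <;> cases p v.1 <;> simp
  · intro v _ hv
    rw [Finsupp.notMem_support_iff.1 hv]; simp

/-! ### The Jacobi identity with a generator -/

omit [Fintype G] in
theorem IsAffine.genCoeff_mul (a : G) (i : ℕ) (y z : SuperDiffPoly p) :
    genCoeff B a i (y * z) = genCoeff B a i y * z + tw p (p a) y * genCoeff B a i z := by
  simp only [genCoeff_apply, genBr_mul p H.par, coeff_add, coeff_mul_C, coeff_C_mul]

omit [Fintype G] in
theorem IsAffine.genCoeff_totalDeriv (a : G) (i : ℕ) (y : SuperDiffPoly p) :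
    genCoeff B a i (totalDeriv p y) =
      totalDeriv p (genCoeff B a i y) + shiftSeq (genCoeff B a) i y := by
  rw [genCoeff_apply, genBr_totalDeriv p H.par, lamL_apply, coeff_add, coeff_dX, add_comm]
  congr 1
  cases i with
  | zero => simp
  | succ i => rw [coeff_X_mul]; rfl

omit [Fintype G] in
theorem IsAffine.isPar_genCoeff (a : G) (i : ℕ) {b : Bool} {y : SuperDiffPoly p} (h : IsPar p b y) :
    IsPar p (xor (p a) b) (genCoeff B a i y) :=
  isParX_iff.1 (isParX_genBr p H.par a h) i

omit [Fintype G] in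
theorem IsAffine.tw_genCoeff (a : G) (i : ℕ) (b : Bool) (y : SuperDiffPoly p) :
    tw p b (genCoeff B a i y) = sg (b && p a) • genCoeff B a i (tw p b y) := by
  cases b
  · simp
  · have := congrArg (fun q => q.coeff i) (parX_genBr p H.par a y)
    simpa [genCoeff_apply] using this

omit [Fintype G] in
theorem IsAffine.mapX_genCoeff_mul (a : G) (i : ℕ) (q r : (SuperDiffPoly p)[X]) :
    mapX p (genCoeff B a i) (q * r) =
      mapX p (genCoeff B a i) q * r + twX p (p a) q * mapX p (genCoeff B a i) r := by
  ext j
  rw [coeff_add, coeff_mapX, coeff_mul, coeff_mul, coeff_mul, map_sum, ← Finset.sum_add_distrib]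
  refine Finset.sum_congr rfl fun k _ => ?_
  rw [H.genCoeff_mul, coeff_mapX, coeff_mapX, coeff_twX]

omit [Fintype G] in
theorem IsAffine.mapX_genCoeff_lamL (a : G) (i : ℕ) (q : (SuperDiffPoly p)[X]) :
    mapX p (genCoeff B a i) (lamL p q) = lamL p (mapX p (genCoeff B a i) q) +
      shiftSeq (fun i => mapX p (genCoeff B a i) q) i := by
  rw [lamL_apply, map_add, mapX_X_mul, lamL_apply, add_assoc]
  congr 1
  ext n
  cases i <;> simp [H.genCoeff_totalDeriv]

omit [Fintype G] in
theorem IsAffine.twX_genBr (g : G) (b : Bool) (y : SuperDiffPoly p) :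
    twX p b (genBr p B g y) = sg (b && p g) • genBr p B g (tw p b y) := by
  cases b
  · simp
  · rw [twX_true, parX_genBr p H.par, Bool.true_and, tw_true]

theorem IsAffine.bracket_mul {b : Bool} {x : SuperDiffPoly p} (hx : IsPar p b x)
    (y z : SuperDiffPoly p) :
    bracket p B x (y * z) = bracket p B x y * C z + C (tw p b y) * bracket p B x z := by
  simp only [bracket_eq_act]
  exact (idPt p).act_mul H.par (fun g => isParX_vgrad g hx) y z

theorem IsAffine.bracket_totalDeriv (x y : SuperDiffPoly p) :
    bracket p B x (totalDeriv p y) = lamL p (bracket p B x y) := by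
  simp only [bracket_eq_act]
  exact (idPt p).act_totalDeriv H.par _ y

theorem IsAffine.twX_bracket {b : Bool} {x : SuperDiffPoly p} (hx : IsPar p b x) (c : Bool)
    (y : SuperDiffPoly p) :
    twX p c (bracket p B x y) = sg (c && b) • bracket p B x (tw p c y) := by
  cases c
  · simp
  rw [twX_true, tw_true, Bool.true_and]
  induction y using gen_induction p with
  | algebraMap c => simp [bracket_eq_act, Pt.act_algebraMap]
  | gen u =>
    have h : IsParX p (xor b (p u.1)) (bracket p B x (gen p u)) := by
      rw [bracket_eq_act, Pt.act_apply]
      refine IsParX.sum _ fun g _ => ?_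
      have := (idPt p).isParX_subst (isParX_vgrad g hx) (isParX_genBr p H.par g (isPar_gen p u))
      simpa [← Bool.xor_assoc] using this
    rw [show parX p _ = _ from h, show parity p _ = _ from isPar_gen p u, map_smul, smul_smul,
      sg_xor]
  | add y z hy hz => simp only [map_add, hy, hz, smul_add]
  | mul y z hy hz =>
    rw [H.bracket_mul hx, map_add, map_mul, map_mul, map_mul, H.bracket_mul hx, hy, hz, parX_C,
      parX_C, smul_add, smul_mul_assoc, mul_smul_comm]
    cases b <;> simp

/-- The Jacobi identity for two generators. -/
theorem IsAffine.jacobi_gen (a h : G) (y : SuperDiffPoly p) : ∀ i,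
    mapX p (genCoeff B a i) (genBr p B h y) - sg (p a && p h) • genBr p B h (genCoeff B a i y) =
      hasse p i (bracket p B (b0 a h) y) := by
  have hpar := H.isPar_b0 a h
  induction y using gen_induction p with
  | algebraMap c => intro i; simp [genCoeff_apply, bracket_eq_act, Pt.act_algebraMap]
  | gen u =>
    obtain ⟨g, n⟩ := u
    induction n with
    | zero => exact H.jac a h g
    | succ n ih =>
      intro i
      have e : gen p (g, n + 1) = totalDeriv p (gen p (g, n)) := by simp
      have e2 : shiftSeq (hasse p) i (bracket p B (b0 a h) (gen p (g, n))) =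
          shiftSeq (fun i => mapX p (genCoeff B a i) (genBr p B h (gen p (g, n)))) i -
          sg (p a && p h) • genBr p B h (shiftSeq (genCoeff B a) i (gen p (g, n))) := by
        cases i with
        | zero => simp
        | succ i => exact (ih i).symm
      rw [e, genBr_totalDeriv p H.par, H.mapX_genCoeff_lamL, H.genCoeff_totalDeriv, map_add,
        genBr_totalDeriv p H.par, H.bracket_totalDeriv, hasse_lamL, ← ih i, map_sub, map_smul, e2,
        smul_add]
      abel
  | add y z hy hz => 
    intro i
    have h1 := hy i; have h2 := hz i
    simp only [map_add, smul_add, ← h1, ← h2]; abel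
  | mul y z hy hz =>
    intro i
    rw [genBr_mul p H.par, map_add, H.mapX_genCoeff_mul, H.mapX_genCoeff_mul, H.genCoeff_mul,
      map_add, genBr_mul p H.par, genBr_mul p H.par, H.bracket_mul hpar, map_add, hasse_mul_C,
      hasse_C_mul, ← hy i, ← hz i, H.twX_genBr, mapX_C, mapX_C, twX_C, tw_tw, tw_tw, H.tw_genCoeff,
      ← smul_C]
    have s1 : sg (p h && p a) = sg (p a && p h) := by rw [Bool.and_comm]
    have s2 : sg (p a && p h) * sg (p a && p h) = 1 := sg_mul_self _
    rw [s1, Bool.xor_comm (p h) (p a)]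
    simp only [smul_add, sub_mul, mul_sub, smul_mul_assoc, mul_smul_comm, smul_smul, s2, one_smul]
    abel

omit [DecidableEq G] in
theorem IsAffine.skew_linear [DecidableEq G] {b c : Bool} {w l : SuperDiffPoly p} (hw : IsPar p b w)
    (hl : l ∈ Submodule.span ℂ {x | ∃ u, p u = c ∧ x = gen p (u, 0)}) :
    bracket p B w l = -(sg (b && c) • antip p (bracket p B l w)) := by
  induction hl using Submodule.span_induction with
  | mem x hx => obtain ⟨u, rfl, rfl⟩ := hx; exact H.skew hw u
  | zero => rw [← bracketL_apply B 0]; simp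
  | add x y _ _ hx hy => rw [map_add, hx, hy, bracket_add_left, map_add, smul_add, neg_add]
  | smul d x _ hx => rw [map_smul, hx, bracket_smul_left, map_smul, smul_neg, smul_comm]

/-- The Jacobi identity with one generator. -/
theorem IsAffine.jacobi (a : G) {b : Bool} {y : SuperDiffPoly p} (hy : IsPar p b y)
    (z : SuperDiffPoly p) : ∀ i,
    mapX p (genCoeff B a i) (bracket p B y z) =
      sg (p a && b) • bracket p B y (genCoeff B a i z) +
      ∑ x ∈ Finset.HasAntidiagonal.antidiagonal i, hasse p x.2 (bracket p B (genCoeff B a x.1 y) z) := by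
  have hD := fun j => H.isPar_genCoeff a j hy
  induction z using gen_induction p with
  | algebraMap c => intro i; simp [genCoeff_apply, bracket_eq_act, Pt.act_algebraMap]
  | gen u =>
    obtain ⟨g, n⟩ := u
    induction n with
    | zero =>
      intro i
      -- Skew-symmetry turns brackets into which `g` is inserted on the right into brackets with the
      -- generator `g`. The Jacobi identity for the two generators `a` and `g` then applies;
      -- `mapX_antip` and `hasse_antip_hasse` sum up the result.
      have e1 : ∀ x : ℕ × ℕ, hasse p x.2 (bracket p B (genCoeff B a x.1 y) (gen p (g, 0))) =
          -(sg (b && p g) • (hasse p x.2 (antip p (mapX p (genCoeff B a x.1) (genBr p B g y))) -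
            hasse p x.2 (antip p (hasse p x.1 (bracket p B (b0 a g) y))))) := by
        intro x
        rw [H.skew (hD x.1), ← H.jacobi_gen a g y x.1]
        simp only [map_sub, map_smul, map_neg, smul_sub, sub_sub_cancel, smul_smul]
        congr 2
        cases p a <;> cases b <;> cases p g <;> simp
      have e2 : sg (p a && b) • bracket p B y (genCoeff B a i (gen p (g, 0))) =
          if i = 0 then -(sg (b && p g) • antip p (bracket p B (b0 a g) y)) else 0 := by
        have : genCoeff B a i (gen p (g, 0)) =
            if i = 0 then b0 a g else algebraMap ℂ _ (if i = 1 then b1 a g else 0) := by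
          rw [genCoeff_apply, genBr_gen, pow_zero, Module.End.one_apply, H.eq, coeff_add, coeff_C,
            coeff_monomial]
          rcases i with _ | _ | i <;> simp
        rw [this]
        split_ifs
        · rw [H.skew_linear hy (H.span0 a g), smul_neg, smul_smul]
          congr 2
          cases p a <;> cases b <;> cases p g <;> simp
        · simp [bracket_eq_act, Pt.act_algebraMap]
        · simp
      rw [e2, H.skew hy, map_neg, map_smul, mapX_antip p _ (H.genCoeff_totalDeriv a)]
      simp only [e1, Finset.sum_neg_distrib, ← Finset.smul_sum, Finset.sum_sub_distrib,
        hasse_antip_hasse]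
      split_ifs
      · rw [smul_sub]; abel
      · simp
    | succ n ih =>
      intro i
      have e : gen p (g, n + 1) = totalDeriv p (gen p (g, n)) := by simp
      have e1 : ∀ x : ℕ × ℕ, (shiftSeq (hasse p) x.2) (bracket p B (genCoeff B a x.1 y) (gen p (g, n))) =
        shiftSeq (fun k => hasse p k (bracket p B (genCoeff B a x.1 y) (gen p (g, n)))) x.2 := by
        rintro ⟨a, b⟩; cases b <;> rfl
      have e2 := sum_shiftSeq_snd (fun j k => hasse p k (bracket p B (genCoeff B a j y) (gen p (g, n)))) i
      have e3 : shiftSeq (fun i => mapX p (genCoeff B a i) (bracket p B y (gen p (g, n)))) i =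
          sg (p a && b) • bracket p B y (shiftSeq (genCoeff B a) i (gen p (g, n))) +
          shiftSeq (fun i => ∑ x ∈ Finset.HasAntidiagonal.antidiagonal i,
            hasse p x.2 (bracket p B (genCoeff B a x.1 y) (gen p (g, n)))) i := by
        cases i with
        | zero => simp
        | succ i => exact ih i
      rw [e, H.bracket_totalDeriv, H.mapX_genCoeff_lamL, ih i, H.genCoeff_totalDeriv, map_add]
      simp only [H.bracket_totalDeriv, hasse_lamL, Finset.sum_add_distrib, e1, e2, e3, map_add,
        map_smul, map_sum, smul_add]
      abel
  | add z z' hz hz' =>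
    intro i
    simp only [map_add, smul_add, hz i, hz' i, Finset.sum_add_distrib]; abel
  | mul z z' hz hz' =>
    intro i
    have e : ∀ x : ℕ × ℕ, hasse p x.2 (bracket p B (genCoeff B a x.1 y) (z * z')) =
        hasse p x.2 (bracket p B (genCoeff B a x.1 y) z) * C z' + C (tw p (xor (p a) b) z) *
          hasse p x.2 (bracket p B (genCoeff B a x.1 y) z') := fun x => by
      rw [H.bracket_mul (hD x.1), map_add, hasse_mul_C, hasse_C_mul]
    simp only [e, Finset.sum_add_distrib, ← Finset.sum_mul, ← Finset.mul_sum]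
    rw [H.bracket_mul hy, map_add, H.mapX_genCoeff_mul, H.mapX_genCoeff_mul, hz i, hz' i, mapX_C,
      mapX_C, twX_C, tw_tw, H.twX_bracket hy, H.genCoeff_mul, map_add, H.bracket_mul hy,
      H.bracket_mul hy, H.tw_genCoeff, ← smul_C, tw_tw]
    have s1 : sg (b && p a) = sg (p a && b) := by rw [Bool.and_comm]
    have s2 : sg (p a && b) * sg (p a && b) = 1 := sg_mul_self _
    rw [s1, Bool.xor_comm b (p a)]
    simp only [smul_add, add_mul, mul_add, smul_mul_assoc, mul_smul_comm, smul_smul, s2, one_smul]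
    abel

end Affine

end Jacobi


/-! ### The affine bracket satisfies the axioms -/

section AffineBracket

open Polynomial

variable (m n : ℕ) (k : ℂ)

/-- The Kronecker symbol. -/
def kron (a b : Fin (m + n)) : ℂ := if a = b then 1 else 0

/-- The supercommutator of two matrix units, as a current. -/
def affineZero (g h : Fin (m + n) × Fin (m + n)) : Currents m n :=
  kron m n g.2 h.1 • gen (unitOdd m n) ((g.1, h.2), 0) -
    (sg (unitOdd m n g && unitOdd m n h) * kron m n h.2 g.1) • gen (unitOdd m n) ((h.1, g.2), 0)

/-- The central term of the affine bracket of two matrix units. -/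
def affineOne (g h : Fin (m + n) × Fin (m + n)) : ℂ :=
  k * (kron m n g.2 h.1 * kron m n h.2 g.1 * sgn m n g.1)

variable {m n}

/-- On the support of the Kronecker symbol the parity of `E_{xy}` is the sum of those of `E_{xa}`
and `E_{by}`. With the Kronecker symbol as a factor this is a polynomial identity, usable by
`linear_combination`. -/
theorem kron_sg {a b : Fin (m + n)} (c : Bool) (x y : Fin (m + n)) :
    kron m n a b * sg (c && unitOdd m n (x, y)) =
      kron m n a b * (sg (c && unitOdd m n (x, a)) * sg (c && unitOdd m n (b, y))) := by
  unfold kron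
  split_ifs with h
  · subst h
    simp only [unitOdd]
    cases c <;> cases idxOdd m n x <;> cases idxOdd m n y <;> cases idxOdd m n a <;> simp
  · simp

theorem sgn_eq (a : Fin (m + n)) : sgn m n a = sg (idxOdd m n a) := by
  unfold sgn; cases idxOdd m n a <;> simp

theorem sgn_mul_self (a : Fin (m + n)) : sgn m n a * sgn m n a = 1 := by
  rw [sgn_eq, sg_mul_self]

theorem affineBracket_eq (g h : Fin (m + n) × Fin (m + n)) :
    affineBracket m n k g h =
      C (affineZero m n g h) + monomial 1 (algebraMap ℂ _ (affineOne m n k g h)) := by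
  have e : (if unitOdd m n g = true ∧ unitOdd m n h = true then (-1 : ℂ) else 1) =
      sg (unitOdd m n g && unitOdd m n h) := by
    generalize unitOdd m n g = x, unitOdd m n h = y
    cases x <;> cases y <;> simp
  rw [affineBracket, affineZero, affineOne, monomial_zero_left, e]
  congr 2
  · unfold kron
    congr 1
    · split_ifs <;> simp
    · split_ifs <;> simp
  · unfold kron
    by_cases h1 : g.2 = h.1 <;> by_cases h2 : h.2 = g.1 <;> simp [h1, h2]

theorem affine_genBr (a u : Fin (m + n) × Fin (m + n)) :
    genBr (unitOdd m n) (affineBracket m n k) a (gen _ (u, 0)) =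
      C (affineZero m n a u) + monomial 1 (algebraMap ℂ _ (affineOne m n k a u)) := by
  rw [genBr_gen, pow_zero, Module.End.one_apply, affineBracket_eq]

/-- Invariance of the form: `⟨a, [h, g]⟩ = ⟨[a, h], g⟩`. -/
theorem affineOne_cyclic (a h g : Fin (m + n) × Fin (m + n)) :
    kron m n h.2 g.1 * affineOne m n k a (h.1, g.2) -
        sg (unitOdd m n h && unitOdd m n g) * kron m n g.2 h.1 * affineOne m n k a (g.1, h.2) =
      kron m n a.2 h.1 * affineOne m n k (a.1, h.2) g -
        sg (unitOdd m n a && unitOdd m n h) * kron m n h.2 a.1 * affineOne m n k (h.1, a.2) g := by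
  have h2 : sg (unitOdd m n h && unitOdd m n g) * (kron m n g.2 h.1 * kron m n a.2 g.1 *
      kron m n h.2 a.1) * sgn m n a.1 = sg (unitOdd m n a && unitOdd m n h) * (kron m n g.2 h.1 *
      kron m n a.2 g.1 * kron m n h.2 a.1) * sgn m n h.1 := by
    obtain ⟨a1, a2⟩ := a; obtain ⟨h1, h2⟩ := h; obtain ⟨g1, g2⟩ := g
    simp only [kron]
    split_ifs with e1 e2 e3 <;> simp only [mul_one, mul_zero, zero_mul]
    subst e1 e2 e3
    simp only [sgn_eq, unitOdd]
    cases idxOdd m n g2 <;> cases idxOdd m n a2 <;> cases idxOdd m n h2 <;> simp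
  unfold affineOne
  linear_combination (-k) * h2

/-- Invariance of the form once more, with `a` moved past `h`: `∓⟨h, [a, g]⟩ = ⟨[a, h], g⟩`. -/
theorem affineOne_invariant (a h g : Fin (m + n) × Fin (m + n)) :
    -(sg (unitOdd m n a && unitOdd m n h) * (kron m n a.2 g.1 * affineOne m n k h (a.1, g.2) -
        sg (unitOdd m n a && unitOdd m n g) * kron m n g.2 a.1 * affineOne m n k h (g.1, a.2))) =
      kron m n a.2 h.1 * affineOne m n k (a.1, h.2) g -
        sg (unitOdd m n a && unitOdd m n h) * kron m n h.2 a.1 * affineOne m n k (h.1, a.2) g := by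
  have h2 : sg (unitOdd m n a && unitOdd m n h) * sg (unitOdd m n a && unitOdd m n g) *
      (kron m n g.2 a.1 * kron m n h.2 g.1 * kron m n a.2 h.1) * sgn m n h.1 =
      (kron m n g.2 a.1 * kron m n h.2 g.1 * kron m n a.2 h.1) * sgn m n a.1 := by
    obtain ⟨a1, a2⟩ := a; obtain ⟨h1, h2⟩ := h; obtain ⟨g1, g2⟩ := g
    simp only [kron]
    split_ifs with e1 e2 e3 <;> simp only [mul_one, mul_zero, zero_mul]
    subst e1 e2 e3
    simp only [sgn_eq, unitOdd]
    cases idxOdd m n g2 <;> cases idxOdd m n a2 <;> cases idxOdd m n h2 <;> simp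
  unfold affineOne
  linear_combination k * h2

theorem affineZero_jacobi (a h g : Fin (m + n) × Fin (m + n)) :
    (kron m n h.2 g.1 • affineZero m n a (h.1, g.2) -
      (sg (unitOdd m n h && unitOdd m n g) * kron m n g.2 h.1) • affineZero m n a (g.1, h.2)) -
      sg (unitOdd m n a && unitOdd m n h) • (kron m n a.2 g.1 • affineZero m n h (a.1, g.2) -
        (sg (unitOdd m n a && unitOdd m n g) * kron m n g.2 a.1) • affineZero m n h (g.1, a.2)) =
      kron m n a.2 h.1 • affineZero m n (a.1, h.2) g -
        (sg (unitOdd m n a && unitOdd m n h) * kron m n h.2 a.1) • affineZero m n (h.1, a.2) g := by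
  obtain ⟨a1, a2⟩ := a; obtain ⟨h1, h2⟩ := h; obtain ⟨g1, g2⟩ := g
  have e1 := kron_sg (a := h2) (b := g1) (unitOdd m n (a1, a2)) h1 g2
  have e2 := kron_sg (a := g2) (b := h1) (unitOdd m n (a1, a2)) g1 h2
  have e3 := kron_sg (a := a2) (b := g1) (unitOdd m n (h1, h2)) a1 g2
  have e4 := kron_sg (a := g2) (b := a1) (unitOdd m n (h1, h2)) g1 a2
  have e5 := kron_sg (a := a2) (b := h1) (unitOdd m n (g1, g2)) a1 h2
  have e6 := kron_sg (a := h2) (b := a1) (unitOdd m n (g1, g2)) h1 a2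
  simp only [affineZero, smul_sub, smul_smul, ← mul_assoc]
  simp only [Bool.and_comm (unitOdd m n (g1, g2)), Bool.and_comm (unitOdd m n (h1, h2))
    (unitOdd m n (a1, a2))] at e1 e2 e3 e4 e5 e6 ⊢
  have s1 := sg_mul_self (unitOdd m n (a1, a2) && unitOdd m n (h1, h2))
  have s2 := sg_mul_self (unitOdd m n (a1, a2) && unitOdd m n (g1, g2))
  have s3 := sg_mul_self (unitOdd m n (h1, h2) && unitOdd m n (g1, g2))
  generalize sg (unitOdd m n (a1, a2) && unitOdd m n (h1, h2)) = A at *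
  generalize sg (unitOdd m n (a1, a2) && unitOdd m n (g1, g2)) = D at *
  generalize sg (unitOdd m n (h1, h2) && unitOdd m n (g1, g2)) = E at *
  -- Each of the six orders in which the three units can be multiplied gives one equation between
  -- signs.
  match_scalars
  · ring
  · linear_combination (-kron m n g2 a1) * e1
  · linear_combination (A * kron m n g2 h1) * e3 + (E * kron m n g2 h1 * kron m n a2 g1) * s1
  · linear_combination (E * kron m n h2 a1) * e2 - (A * kron m n g2 h1) * e6
  · ring
  · linear_combination (-A * D * kron m n a2 h1) * e4 + kron m n g2 a1 * e5 -
      (D * E * kron m n g2 a1 * kron m n a2 h1) * s1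

theorem unitOdd_trans (a b c d : Fin (m + n)) :
    b = c → unitOdd m n (a, d) = xor (unitOdd m n (a, b)) (unitOdd m n (c, d)) := by
  rintro rfl
  simp only [unitOdd]
  cases idxOdd m n a <;> cases idxOdd m n b <;> simp

theorem genBr_affineZero (a h g : Fin (m + n) × Fin (m + n)) :
    genBr (unitOdd m n) (affineBracket m n k) a (affineZero m n h g) =
      C (kron m n h.2 g.1 • affineZero m n a (h.1, g.2) - (sg (unitOdd m n h && unitOdd m n g) *
        kron m n g.2 h.1) • affineZero m n a (g.1, h.2)) + monomial 1 (algebraMap ℂ _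
      (kron m n h.2 g.1 * affineOne m n k a (h.1, g.2) - sg (unitOdd m n h && unitOdd m n g) *
        kron m n g.2 h.1 * affineOne m n k a (g.1, h.2))) := by
  rw [affineZero, map_sub, map_smul, map_smul, affine_genBr, affine_genBr]
  simp only [Algebra.algebraMap_eq_smul_one, ← smul_monomial, C_sub, ← smul_C, map_smul]
  module

theorem affineBracket_isAffine :
    IsAffine (p := unitOdd m n) (affineBracket m n k) (affineZero m n) (affineOne m n k) where
  eq := affineBracket_eq k
  par g h := by
    have h0 : IsPar (unitOdd m n) (xor (unitOdd m n g) (unitOdd m n h)) (affineZero m n g h) := by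
      rw [affineZero, sub_eq_add_neg, ← neg_smul]
      refine IsPar.add ?_ ?_
      · by_cases e : g.2 = h.1
        · have := isPar_gen (unitOdd m n) ((g.1, h.2), 0)
          rw [unitOdd_trans g.1 g.2 h.1 h.2 e] at this
          exact this.smul _
        · simp [kron, e, isPar_zero]
      · by_cases e : h.2 = g.1
        · have := isPar_gen (unitOdd m n) ((h.1, g.2), 0)
          rw [unitOdd_trans h.1 h.2 g.1 g.2 e, Bool.xor_comm] at this
          exact this.smul _
        · simp [kron, e, isPar_zero]
    rw [affineBracket_eq, isParX_iff]
    intro j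
    rw [coeff_add, coeff_C, coeff_monomial]
    by_cases hp : unitOdd m n g = unitOdd m n h
    · rw [hp, Bool.xor_self] at h0 ⊢
      refine IsPar.add ?_ ?_
      · split_ifs
        exacts [h0, isPar_zero _ _]
      · split_ifs
        exacts [isPar_algebraMap _ _, isPar_zero _ _]
    · have : affineOne m n k g h = 0 := by
        by_contra hne
        have h1 : g.2 = h.1 := by by_contra h1; simp [affineOne, kron, h1] at hne
        have h2 : h.2 = g.1 := by by_contra h1; simp [affineOne, kron, h1] at hne
        exact hp (by simp [unitOdd, h1, h2, Bool.xor_comm])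
      rw [this, map_zero, ite_self, add_zero]
      split_ifs
      exacts [h0, isPar_zero _ _]
  skew0 g h := by
    have s1 := sg_mul_self (unitOdd m n g && unitOdd m n h)
    rw [affineZero, affineZero, Bool.and_comm (unitOdd m n h)]
    match_scalars
    · linear_combination (-kron m n h.2 g.1) * s1
    · ring
  skew1 g h := by
    unfold affineOne kron
    by_cases e1 : g.2 = h.1 <;> by_cases e2 : h.2 = g.1 <;>
      simp only [e1, e2, if_true, if_false, mul_one, mul_zero, zero_mul]
    simp only [sgn_eq, unitOdd, e1, e2]
    cases idxOdd m n h.1 <;> cases idxOdd m n g.1 <;> simp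
  par1 g h hne := by
    have h1 : g.2 = h.1 := by by_contra h1; simp [affineOne, kron, h1] at hne
    have h2 : h.2 = g.1 := by by_contra h1; simp [affineOne, kron, h1] at hne
    simp [unitOdd, h1, h2, Bool.xor_comm]
  span0 g h := by
    refine sub_mem ?_ ?_
    · by_cases e : g.2 = h.1
      · exact Submodule.smul_mem _ _ (Submodule.subset_span
          ⟨_, unitOdd_trans g.1 g.2 h.1 h.2 e, rfl⟩)
      · simp [kron, e]
    · by_cases e : h.2 = g.1
      · exact Submodule.smul_mem _ _ (Submodule.subset_span
          ⟨_, (unitOdd_trans h.1 h.2 g.1 g.2 e).trans (Bool.xor_comm _ _), rfl⟩)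
      · simp [kron, e]
  jac a h g i := by
    have e0 : bracket (unitOdd m n) (affineBracket m n k) (affineZero m n a h) (gen _ (g, 0)) =
        C (kron m n a.2 h.1 • affineZero m n (a.1, h.2) g - (sg (unitOdd m n a && unitOdd m n h) *
          kron m n h.2 a.1) • affineZero m n (h.1, a.2) g) + monomial 1 (algebraMap ℂ _
        (kron m n a.2 h.1 * affineOne m n k (a.1, h.2) g - sg (unitOdd m n a && unitOdd m n h) *
          kron m n h.2 a.1 * affineOne m n k (h.1, a.2) g)) := by
      rw [affineZero, ← bracketL_apply, map_sub, map_smul, map_smul, LinearMap.sub_apply,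
        LinearMap.smul_apply, LinearMap.smul_apply, bracketL_apply, bracketL_apply]
      change _ • genBr _ _ _ _ - _ • genBr _ _ _ _ = _
      rw [affine_genBr, affine_genBr]
      simp only [Algebra.algebraMap_eq_smul_one, ← smul_monomial, C_sub, ← smul_C, map_smul]
      module
    have e1 : ∀ c : ℂ, genCoeff (affineBracket m n k) a i (algebraMap ℂ _ c) = 0 := fun c => by
      rw [genCoeff_apply, genBr_algebraMap, coeff_zero]
    rw [e0, affine_genBr, map_add, mapX_C, mapX_monomial, e1, map_zero, add_zero, map_add,
      hasse_C, genCoeff_apply, genCoeff_apply, genBr_affineZero, affine_genBr, coeff_add,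
      coeff_add, coeff_C, coeff_C, coeff_monomial, coeff_monomial, ← affineZero_jacobi]
    -- Degree 0 in the second parameter contains the Jacobi identity and the invariance of the form,
    -- degree 1 the invariance for the central term of the bracket with `a`; there are no higher
    -- degrees.
    rcases i with _ | _ | i
    · simp only [if_true, one_ne_zero, if_false, add_zero]
      rw [genBr_affineZero, ← affineOne_invariant]
      simp only [Algebra.algebraMap_eq_smul_one, ← smul_monomial, C_sub, ← smul_C, map_smul,
        hasse, hasseDeriv_zero', LinearMap.restrictScalars_apply]
      module
    · rw [← affineOne_cyclic]
      simp [hasse, hasseDeriv_monomial, genBr_algebraMap]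
    · simp [hasse, hasseDeriv_monomial, Nat.choose_eq_zero_of_lt (show 1 < i + 1 + 1 by omega)]

end AffineBracket


/-! ### Rectangular arrays and their diagonals -/

section DoubleSequences

variable {N : Type*} [AddCommGroup N] {P Q : ℕ} {z w : ℕ → ℕ → N}

theorem diagonal_eq (h1 : ∀ i j, i + 1 < P → j < Q → z i j = z (i + 1) (j + 1)) (i j e : ℕ)
    (hi : i + e < P) (hj : j + e ≤ Q) : z i j = z (i + e) (j + e) := by
  induction e with
  | zero => rfl
  | succ e ih => rw [ih (by omega) (by omega), h1 _ _ (by omega) (by omega)]; rfl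

/-- The array is constant along diagonals. If `i < j`, the diagonal starts in the first row to the
right of the corner, where `h0` applies; in the other case it leaves the array through the last
column, beyond which the array is zero. -/
theorem diagonal_eq_zero (hz : ∀ i j, P ≤ i ∨ Q ≤ j → z i j = 0)
    (h0 : ∀ j < Q, 0 < P → z 0 (j + 1) = 0)
    (h1 : ∀ i j, i + 1 < P → j < Q → z i j = z (i + 1) (j + 1)) (i j : ℕ)
    (h : i < j ∨ i + Q < P + j) : z i j = 0 := by
  by_cases hP : P ≤ i
  · exact hz _ _ (Or.inl hP)
  by_cases hQ : Q ≤ j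
  · exact hz _ _ (Or.inr hQ)
  rcases h with h | h
  · have := diagonal_eq h1 0 (j - i) i (by omega) (by omega)
    rw [show j - i + i = j by omega, zero_add] at this
    rw [← this, show j - i = j - i - 1 + 1 by omega]
    exact h0 _ (by omega) (by omega)
  · rw [diagonal_eq h1 i j (Q - j) (by omega) (by omega)]
    exact hz _ _ (Or.inr (by omega))

/-- A telescoping sum. It is applied with `z` a block of a matrix `Z` and `w` the same block of the
commutator of the lowering matrix with `Z`. -/
theorem diagonal_sum (h0 : ∀ j < Q, w 0 j = -z 0 (j + 1))
    (h1 : ∀ i j, i + 1 < P → j < Q → w (i + 1) j = z i j - z (i + 1) (j + 1)) (j e : ℕ)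
    (he : e < P) (hj : j + e < Q) :
    ∑ t ∈ Finset.range (e + 1), w t (j + t) = -z e (j + e + 1) := by
  induction e with
  | zero => simp [h0 j (by omega)]
  | succ e ih =>
    rw [Finset.sum_range_succ, ih (by omega) (by omega), h1 e _ he (by omega), ← add_assoc]
    abel

end DoubleSequences

/-! ### The lowering matrix, its centraliser and the star entries -/

section Blocks

variable {m n : ℕ}

/-- `pos` numbers the elements of each block. -/
structure IsPos (r : Setoid (Fin (m + n))) (pos : Fin (m + n) → ℕ) : Prop where
  lt : ∀ a, pos a < blockSize r a
  inj : ∀ a b, r.r a b → pos a = pos b → a = b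

theorem blockSize_congr {r : Setoid (Fin (m + n))} {a b : Fin (m + n)} (h : r.r a b) :
    blockSize r a = blockSize r b := by
  unfold blockSize
  congr 1
  ext c
  exact ⟨fun hc => r.trans' hc h, fun hc => r.trans' hc (r.symm' h)⟩

theorem isPos_blockPos (r : Setoid (Fin (m + n))) : IsPos r (blockPos r) where
  lt a := Set.ncard_lt_ncard ⟨fun _ hc => hc.1, fun h => lt_irrefl a (h (r.refl' a)).2⟩
    (Set.toFinite _)
  inj := by
    have key : ∀ a b, r.r a b → a < b → blockPos r a < blockPos r b := fun a b hab hlt =>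
      Set.ncard_lt_ncard ⟨fun _ hc => ⟨r.trans' hc.1 hab, hc.2.trans hlt⟩,
        fun h => lt_irrefl a (h ⟨hab, hlt⟩).2⟩ (Set.toFinite _)
    intro a b hab he
    rcases lt_trichotomy a b with h | h | h
    · exact absurd he (key a b hab h).ne
    · exact h
    · exact absurd he (key b a (r.symm' hab) h).ne'

variable {r : Setoid (Fin (m + n))} {pos : Fin (m + n) → ℕ} (hpos : IsPos r pos)

theorem IsPos.exists_eq (hpos : IsPos r pos) (a : Fin (m + n)) {i : ℕ} (hi : i < blockSize r a) :
    ∃ c, r.r c a ∧ pos c = i := by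
  have h : pos '' {c | r.r c a} = Set.Iio (blockSize r a) := by
    refine Set.eq_of_subset_of_ncard_le ?_ ?_ (Set.finite_Iio _)
    · rintro _ ⟨c, hc, rfl⟩
      exact (blockSize_congr hc) ▸ hpos.lt c
    · rw [Set.InjOn.ncard_image (s := {c | r.r c a}) fun c hc d hd h =>
        hpos.inj c d (r.trans' hc (r.symm' hd)) h]
      simp [Set.ncard_eq_toFinset_card', blockSize]
  have : i ∈ pos '' {c | r.r c a} := h ▸ hi
  exact this

open Classical in
/-- The lowering matrix for the numbering `pos` of the blocks of `r`. -/
def lower (N : Type*) [Zero N] [One N] (r : Setoid (Fin (m + n))) (pos : Fin (m + n) → ℕ) :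
    IndexMat m n N :=
  Matrix.of fun a b => if r.r a b ∧ pos a = pos b + 1 then 1 else 0

variable {N : Type*} [Ring N] (Z : IndexMat m n N)

include hpos in
theorem lower_mul_succ {c c' b : Fin (m + n)} (hc : r.r c' c) (h : pos c = pos c' + 1) :
    (lower N r pos * Z) c b = Z c' b := by
  rw [Matrix.mul_apply, Finset.sum_eq_single c']
  · simp [lower, h, r.symm' hc]
  · intro d _ hd
    rw [lower, Matrix.of_apply, if_neg, zero_mul]
    rintro ⟨h1, h2⟩
    exact hd (hpos.inj _ _ (r.trans' (r.symm' h1) (r.symm' hc)) (by omega))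
  · simp

theorem lower_mul_zero {c b : Fin (m + n)} (h : pos c = 0) : (lower N r pos * Z) c b = 0 := by
  rw [Matrix.mul_apply]
  exact Finset.sum_eq_zero fun d _ => by simp [lower, h]

include hpos in
theorem mul_lower_succ {c b b' : Fin (m + n)} (hb : r.r b' b) (h : pos b' = pos b + 1) :
    (Z * lower N r pos) c b = Z c b' := by
  rw [Matrix.mul_apply, Finset.sum_eq_single b']
  · simp [lower, h, hb]
  · intro d _ hd
    rw [lower, Matrix.of_apply, if_neg, mul_zero]
    rintro ⟨h1, h2⟩
    exact hd (hpos.inj _ _ (r.trans' h1 (r.symm' hb)) (by omega))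
  · simp

include hpos in
theorem mul_lower_last {c b : Fin (m + n)} (h : pos b + 1 = blockSize r b) :
    (Z * lower N r pos) c b = 0 := by
  rw [Matrix.mul_apply]
  refine Finset.sum_eq_zero fun d _ => ?_
  rw [lower, Matrix.of_apply, if_neg, mul_zero]
  rintro ⟨h1, h2⟩
  have := hpos.lt d
  rw [blockSize_congr h1] at this
  omega

open Classical in
/-- The submatrix of `Z` with rows in the block of `a` and columns in the block of `b`, indexed by
positions. -/
def blockFun (r : Setoid (Fin (m + n))) (pos : Fin (m + n) → ℕ) (a b : Fin (m + n)) (i j : ℕ) : N :=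
  if h : (∃ c, r.r c a ∧ pos c = i) ∧ ∃ d, r.r d b ∧ pos d = j then Z h.1.choose h.2.choose else 0

variable {Z}

include hpos in
theorem blockFun_pos {a b c d : Fin (m + n)} (hc : r.r c a) (hd : r.r d b) :
    blockFun Z r pos a b (pos c) (pos d) = Z c d := by
  have h : (∃ c', r.r c' a ∧ pos c' = pos c) ∧ ∃ d', r.r d' b ∧ pos d' = pos d :=
    ⟨⟨c, hc, rfl⟩, ⟨d, hd, rfl⟩⟩
  rw [blockFun, dif_pos h, hpos.inj _ c (r.trans' h.1.choose_spec.1 (r.symm' hc)) h.1.choose_spec.2,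
    hpos.inj _ d (r.trans' h.2.choose_spec.1 (r.symm' hd)) h.2.choose_spec.2]

include hpos in
theorem blockFun_eq_zero (a b : Fin (m + n)) (i j : ℕ)
    (h : blockSize r a ≤ i ∨ blockSize r b ≤ j) : blockFun Z r pos a b i j = 0 := by
  rw [blockFun, dif_neg]
  rintro ⟨⟨c, hc, rfl⟩, ⟨d, hd, rfl⟩⟩
  have h1 := hpos.lt c
  have h2 := hpos.lt d
  rw [blockSize_congr hc] at h1
  rw [blockSize_congr hd] at h2
  omega

-- Multiplication by the lowering matrix shifts rows down from the left and columns to the left from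
-- the right, so the commutator is a difference along diagonals. In the first row only the second
-- term is present; in the last column the entry `j + 1` is zero by the convention in `blockFun`.
include hpos in
theorem blockFun_comm_zero (a b : Fin (m + n)) (j : ℕ) (hj : j < blockSize r b) :
    blockFun (lower N r pos * Z - Z * lower N r pos) r pos a b 0 j =
      -blockFun Z r pos a b 0 (j + 1) := by
  have h0 := hpos.lt a
  obtain ⟨c, hc, h1⟩ := hpos.exists_eq a (show 0 < _ by omega)
  obtain ⟨d, hd, rfl⟩ := hpos.exists_eq b hj
  rw [← h1, blockFun_pos hpos hc hd, Matrix.sub_apply, lower_mul_zero _ h1, zero_sub]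
  congr 1
  by_cases h : pos d + 1 < blockSize r b
  · obtain ⟨d', hd', h2⟩ := hpos.exists_eq b h
    rw [← h2, blockFun_pos hpos hc hd', mul_lower_succ hpos Z (r.trans' hd' (r.symm' hd)) h2]
  · rw [blockFun_eq_zero hpos _ _ _ _ (Or.inr (by omega)), mul_lower_last hpos]
    rw [blockSize_congr hd]; omega

include hpos in
theorem blockFun_comm_succ (a b : Fin (m + n)) (i j : ℕ) (hi : i + 1 < blockSize r a)
    (hj : j < blockSize r b) :
    blockFun (lower N r pos * Z - Z * lower N r pos) r pos a b (i + 1) j =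
      blockFun Z r pos a b i j - blockFun Z r pos a b (i + 1) (j + 1) := by
  obtain ⟨c, hc, h1⟩ := hpos.exists_eq a hi
  obtain ⟨c', hc', rfl⟩ := hpos.exists_eq a (show i < _ by omega)
  obtain ⟨d, hd, rfl⟩ := hpos.exists_eq b hj
  rw [← h1, blockFun_pos hpos hc hd, Matrix.sub_apply, blockFun_pos hpos hc' hd,
    lower_mul_succ hpos _ (r.trans' hc' (r.symm' hc)) h1]
  congr 1
  by_cases h : pos d + 1 < blockSize r b
  · obtain ⟨d', hd', h2⟩ := hpos.exists_eq b h
    rw [← h2, blockFun_pos hpos hc hd', mul_lower_succ hpos Z (r.trans' hd' (r.symm' hd)) h2]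
  · rw [blockFun_eq_zero hpos _ _ _ _ (Or.inr (by omega)), mul_lower_last hpos]
    rw [blockSize_congr hd]; omega

/-- Twice the diagonal entry of the Cartan generator. -/
def grade (r : Setoid (Fin (m + n))) (pos : Fin (m + n) → ℕ) (a : Fin (m + n)) : ℤ :=
  blockSize r a - 1 - 2 * pos a

section Commuting

variable (hZ : lower N r pos * Z = Z * lower N r pos)
include hpos hZ

theorem blockFun_zero_succ (a b : Fin (m + n)) (j : ℕ) (hj : j < blockSize r b) :
    blockFun Z r pos a b 0 (j + 1) = 0 := by
  have := blockFun_comm_zero (Z := Z) hpos a b j hj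
  rw [hZ, sub_self] at this
  rw [← neg_eq_zero, ← this]
  simp [blockFun]

theorem blockFun_diag (a b : Fin (m + n)) (i j : ℕ) (hi : i + 1 < blockSize r a)
    (hj : j < blockSize r b) :
    blockFun Z r pos a b i j = blockFun Z r pos a b (i + 1) (j + 1) := by
  have := blockFun_comm_succ (Z := Z) hpos a b i j hi hj
  rw [hZ, sub_self] at this
  rw [← sub_eq_zero, ← this]
  simp [blockFun]

theorem commute_eq_zero {c d : Fin (m + n)}
    (h : pos c < pos d ∨ pos c + blockSize r d < blockSize r c + pos d) : Z c d = 0 := by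
  rw [← blockFun_pos (Z := Z) hpos (r.refl' c) (r.refl' d)]
  exact diagonal_eq_zero (blockFun_eq_zero hpos c d)
    (fun j hj _ => blockFun_zero_succ hpos hZ c d j hj) (blockFun_diag hpos hZ c d) _ _ h

/-- The centraliser of the lowering matrix has no part of positive grade. -/
theorem commute_grade {c d : Fin (m + n)} (h : grade r pos d < grade r pos c) : Z c d = 0 := by
  refine commute_eq_zero hpos hZ ?_
  unfold grade at h
  omega

end Commuting

/-! ### Star entries and the slice -/

theorem blockPos_lt (a : Fin (m + n)) : blockPos r a < blockSize r a := (isPos_blockPos r).lt a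

theorem blockLE_congr {a b c d : Fin (m + n)} (h1 : r.r a c) (h2 : r.r b d) :
    BlockLE r a b ↔ BlockLE r c d := by
  constructor
  · rintro ⟨e, he, h⟩
    exact ⟨e, r.trans' he h1, fun f hf => h f (r.trans' hf (r.symm' h2))⟩
  · rintro ⟨e, he, h⟩
    exact ⟨e, r.trans' he (r.symm' h1), fun f hf => h f (r.trans' hf h2)⟩

theorem exists_first (r : Setoid (Fin (m + n))) (a : Fin (m + n)) :
    ∃ c, r.r c a ∧ ∀ d, r.r d a → c ≤ d := by
  classical
  have hne : (Finset.univ.filter fun c => r.r c a).Nonempty := ⟨a, by simp⟩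
  refine ⟨_, (Finset.mem_filter.1 (Finset.min'_mem _ hne)).2, fun d hd => ?_⟩
  exact Finset.min'_le _ _ (by simpa using hd)

theorem blockLE_of_rel {a b : Fin (m + n)} (h : r.r a b) : BlockLE r a b := by
  obtain ⟨c, h1, h2⟩ := exists_first r b
  exact ⟨c, r.trans' h1 (r.symm' h), h2⟩

theorem isStar_diag {a : Fin (m + n)} : IsStar r a a ↔ blockPos r a = 0 := by
  have h := blockLE_of_rel (r.refl' a)
  simp only [IsStar, h, not_true, true_and, false_and, or_false, and_iff_left_iff_imp]
  omega

/-- Hence in negative degree a matrix of the slice coincides with the lowering matrix. -/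
theorem grade_of_isStar {a b : Fin (m + n)} (h : IsStar r a b) :
    grade r (blockPos r) b ≤ grade r (blockPos r) a := by
  have h1 := blockPos_lt (r := r) a
  have h2 := blockPos_lt (r := r) b
  unfold grade
  rcases h with h | h <;> omega

/-- The weight of a diagonal entry in the normalisation of the slice. -/
def traceWeight (m n : ℕ) (a : Fin (m + n)) : ℂ := if m = n then 1 else sgn m n a

theorem traceWeight_mul_self (a : Fin (m + n)) : traceWeight m n a * traceWeight m n a = 1 := by
  unfold traceWeight
  split_ifs
  exacts [one_mul 1, sgn_mul_self a]

theorem sum_sgn (m n : ℕ) : ∑ a, sgn m n a = m - n := by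
  rw [Fin.sum_univ_add]
  have h : ∀ i : Fin m, sgn m n (Fin.castAdd n i) = 1 := fun i =>
    if_neg (by simp [idxOdd])
  simp only [h]
  simp [sgn, idxOdd, sub_eq_add_neg]

/-- The identity must be complementary to the slice directions; its supertrace is `m - n`, which is
why the trace is used for `m = n`. The argument `a` only guarantees `m + n > 0`. -/
theorem sum_traceWeight (a : Fin (m + n)) : ∑ b, traceWeight m n b ≠ 0 := by
  unfold traceWeight
  split_ifs with h
  · have := a.pos
    simp only [Finset.sum_const, Finset.card_univ, Fintype.card_fin, nsmul_eq_mul, mul_one]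
    exact_mod_cast this.ne'
  · rw [sum_sgn, sub_ne_zero]
    exact_mod_cast h

theorem traceWeight_congr {a b : Fin (m + n)} (h : idxOdd m n a = idxOdd m n b) :
    traceWeight m n a = traceWeight m n b := by
  simp only [traceWeight, sgn, h]

variable [Algebra ℂ N]

/-- The condition on the diagonal of an element of the slice, up to multiples of the identity. -/
def IsSliceDiag (r : Setoid (Fin (m + n))) (w : Fin (m + n) → N) : Prop :=
  ∃ u : N, (∀ a, blockPos r a ≠ 0 → w a = u) ∧ ∑ a, traceWeight m n a • (w a - u) = 0

/-- Directions of the slice, up to multiples of the identity. -/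
def InSlice (r : Setoid (Fin (m + n))) (W : IndexMat m n N) : Prop :=
  (∀ a b, a ≠ b → ¬ IsStar r a b → W a b = 0) ∧ IsSliceDiag r fun a => W a a

open Classical in
include hpos in
theorem sum_block (w : ℕ → N) (a : Fin (m + n)) :
    ∑ t ∈ Finset.range (blockSize r a), w t =
      ∑ c with r.r c a, w (pos c) := by
  symm
  refine Finset.sum_bij (fun c _ => pos c) ?_ ?_ ?_ ?_
  · intro c hc
    rw [Finset.mem_range, ← blockSize_congr (Finset.mem_filter.1 hc).2]
    exact hpos.lt c
  · intro c hc d hd h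
    exact hpos.inj c d (r.trans' (Finset.mem_filter.1 hc).2 (r.symm' (Finset.mem_filter.1 hd).2)) h
  · intro t ht
    obtain ⟨c, hc, rfl⟩ := hpos.exists_eq a (Finset.mem_range.1 ht)
    exact ⟨c, by simpa using hc, rfl⟩
  · intro c _; rfl

/-- A commutator with the lowering matrix that lies in the slice vanishes off the diagonal. -/
theorem comm_offDiag_eq_zero {W : IndexMat m n N}
    (hW : lower N r (blockPos r) * Z - Z * lower N r (blockPos r) = W)
    (h : ∀ a b, a ≠ b → ¬ IsStar r a b → W a b = 0) (a b : Fin (m + n)) (hab : a ≠ b) :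
    W a b = 0 := by
  by_cases hs : IsStar r a b
  swap
  · exact h a b hab hs
  have hp := isPos_blockPos r
  have h0 := blockFun_comm_zero (Z := Z) hp a b
  have h1 := blockFun_comm_succ (Z := Z) hp a b
  rw [hW] at h0 h1
  have pa := hp.lt a
  have pb := hp.lt b
  have van : ∀ i j, (∀ c d, r.r c a → r.r d b → blockPos r c = i → blockPos r d = j →
      c ≠ d ∧ ¬ IsStar r c d) → blockFun W r (blockPos r) a b i j = 0 := by
    intro i j hij
    by_cases hi : blockSize r a ≤ i ∨ blockSize r b ≤ j
    · exact blockFun_eq_zero hp _ _ _ _ hi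
    · obtain ⟨c, hc, h3⟩ := hp.exists_eq a (show i < _ by omega)
      obtain ⟨d, hd, h4⟩ := hp.exists_eq b (show j < _ by omega)
      rw [← h3, ← h4, blockFun_pos hp hc hd]
      exact h c d (hij c d hc hd h3 h4).1 (hij c d hc hd h3 h4).2
  rw [← blockFun_pos (Z := W) hp (r.refl' a) (r.refl' b)]
  -- The star entry is alone on its diagonal: in the first case it is the upper end of a diagonal
  -- that runs to the last column, in the second it is the end, in the last column, of a diagonal
  -- that starts in the first row. The sum of `W` along the diagonal telescopes to an entry of `Z`
  -- beyond the last column, which is zero, and all other summands vanish because they are not at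
  -- star positions.
  rcases hs with ⟨hle, ha, hb⟩ | ⟨hle, hb, ha⟩
  · have key := diagonal_sum h0 h1 (blockPos r b) (blockSize r b - 1 - blockPos r b)
      (by omega) (by omega)
    rw [blockFun_eq_zero hp _ _ _ _ (Or.inr (by omega)), neg_zero, Finset.sum_range_succ',
      Finset.sum_eq_zero, zero_add] at key
    · rw [ha]; exact key
    · intro t _
      refine van _ _ fun c d hc hd h3 h4 => ⟨?_, ?_⟩
      · rintro rfl
        have hr := r.trans' (r.symm' hc) hd
        have : blockPos r b = 0 := by omega
        exact hab (hp.inj a b hr (by omega))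
      · rintro (⟨_, h5, _⟩ | ⟨h5, _⟩)
        · omega
        · exact h5 ((blockLE_congr hc hd).2 hle)
  · have key := diagonal_sum h0 h1 (blockPos r b - blockPos r a) (blockPos r a)
      (by omega) (by omega)
    rw [blockFun_eq_zero hp _ _ _ _ (Or.inr (by omega)), neg_zero, Finset.sum_range_succ,
      Finset.sum_eq_zero, zero_add] at key
    · rw [show blockPos r b - blockPos r a + blockPos r a = blockPos r b by omega] at key
      exact key
    · intro t ht
      rw [Finset.mem_range] at ht
      refine van _ _ fun c d hc hd h3 h4 => ⟨?_, ?_⟩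
      · rintro rfl
        exact hle (blockLE_of_rel (r.trans' (r.symm' hc) hd))
      · rintro (⟨h5, _⟩ | ⟨_, h5, _⟩)
        · exact hle ((blockLE_congr hc hd).1 h5)
        · have := blockSize_congr hd
          omega

/-- A commutator with the lowering matrix that lies in the slice vanishes. -/
theorem comm_eq_zero (hr : RespectsParity r)
    (h : InSlice r (lower N r (blockPos r) * Z - Z * lower N r (blockPos r))) :
    lower N r (blockPos r) * Z - Z * lower N r (blockPos r) = 0 := by
  classical
  set W := lower N r (blockPos r) * Z - Z * lower N r (blockPos r) with hW
  have hp := isPos_blockPos r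
  have hoff := comm_offDiag_eq_zero hW.symm h.1
  -- The trace of `W` over each diagonal block vanishes, by telescoping along the main diagonal of
  -- the block.
  have hsum : ∀ a, ∑ c with r.r c a, W c c = 0 := by
    intro a
    have h0 := blockFun_comm_zero (Z := Z) hp a a
    have h1 := blockFun_comm_succ (Z := Z) hp a a
    rw [← hW] at h0 h1
    have pa := hp.lt a
    have key := diagonal_sum h0 h1 0 (blockSize r a - 1) (by omega) (by omega)
    rw [blockFun_eq_zero hp _ _ _ _ (Or.inr (by omega)), neg_zero,
      show blockSize r a - 1 + 1 = blockSize r a by omega] at key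
    have e := sum_block hp (fun t => blockFun W r (blockPos r) a a t (0 + t)) a
    rw [key] at e
    rw [e]
    refine Finset.sum_congr rfl fun c hc => ?_
    have hc := (Finset.mem_filter.1 hc).2
    rw [zero_add, blockFun_pos hp hc hc]
  obtain ⟨u, hu1, hu2⟩ := h.2
  have htot : ∑ a, traceWeight m n a • W a a = 0 := by
    -- Summing over all `a` counts each block once for each of its elements, whence the division by
    -- the block size. The weight is constant on blocks because blocks respect the parity.
    have e1 : ∀ a, ∑ c with r.r c a, ((traceWeight m n c / blockSize r c) • W c c) = 0 := by
      intro a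
      rw [← smul_zero (traceWeight m n a / (blockSize r a : ℂ)), ← hsum a, Finset.smul_sum]
      refine Finset.sum_congr rfl fun c hc => ?_
      have hc := (Finset.mem_filter.1 hc).2
      rw [traceWeight_congr (hr c a hc), blockSize_congr hc]
    have e2 := Finset.sum_eq_zero fun a (_ : a ∈ Finset.univ) => e1 a
    simp only [Finset.sum_filter] at e2
    rw [Finset.sum_comm] at e2
    rw [← e2]
    refine Finset.sum_congr rfl fun c _ => ?_
    have hc : blockSize r c = (Finset.univ.filter fun a => r.r c a).card := by
      rw [blockSize, Set.ncard_eq_toFinset_card']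
      congr 1
      ext a
      simpa using ⟨fun h => r.symm' h, fun h => r.symm' h⟩
    have hc0 : (blockSize r c : ℂ) ≠ 0 := by
      have := hp.lt c
      exact_mod_cast (show blockSize r c ≠ 0 by omega)
    rw [← Finset.sum_filter, Finset.sum_const, ← hc, ← Nat.cast_smul_eq_nsmul ℂ, smul_smul,
      mul_div_cancel₀ _ hc0]
  -- The weighted trace of `W` vanishes, hence so does the multiple of the identity, whose weighted
  -- trace is a nonzero multiple of `u`.
  have hu : ∀ a : Fin (m + n), u = 0 := by
    intro a
    simp only [smul_sub, Finset.sum_sub_distrib, htot, zero_sub, neg_eq_zero, ← Finset.sum_smul]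
      at hu2
    exact (smul_eq_zero.1 hu2).resolve_left (sum_traceWeight a)
  ext a b
  rw [Matrix.zero_apply]
  by_cases hab : a = b
  swap
  · exact hoff a b hab
  subst hab
  by_cases ha : blockPos r a = 0
  · have := hsum a
    rw [Finset.sum_eq_single a] at this
    · exact this
    · intro c hc hca
      rw [show W c c = u from hu1 c ?_, hu a]
      exact fun h0 => hca (hp.inj c a (Finset.mem_filter.1 hc).2 (by omega))
    · intro h; exact absurd (by simp) h
  · rw [show W a a = u from hu1 a ha, hu a]

/-- An element of the centraliser of the lowering matrix that is orthogonal to the slice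
vanishes. -/
theorem commute_orthogonal_eq_zero (hr : RespectsParity r)
    (hZ : lower N r (blockPos r) * Z = Z * lower N r (blockPos r))
    (h1 : ∀ a b, a ≠ b → IsStar r b a → Z a b = 0) (σ : Fin (m + n) → ℂ)
    (hσ : ∀ a b, r.r a b → σ a = σ b) (hσ0 : ∀ a, σ a ≠ 0)
    (h2 : ∀ w : Fin (m + n) → ℂ, IsSliceDiag r w → ∑ a, (σ a * w a) • Z a a = 0) : Z = 0 := by
  classical
  have hp := isPos_blockPos r
  have hdiag := blockFun_diag hp hZ
  have hoff : ∀ a b, a ≠ b → Z a b = 0 := by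
    intro a b hab
    have hz := fun h => commute_eq_zero (c := a) (d := b) hp hZ h
    by_cases hcase : blockPos r a < blockPos r b ∨
      blockPos r a + blockSize r b < blockSize r a + blockPos r b
    · exact hz hcase
    have pa := hp.lt a
    have pb := hp.lt b
    rw [← blockFun_pos (Z := Z) hp (r.refl' a) (r.refl' b)]
    -- The entry is slid along its diagonal to a position whose transpose is a star: to the first
    -- column if the block of `b` does not come after that of `a`, to the last row otherwise.
    by_cases hle : BlockLE r b a
    · obtain ⟨c, hc, h3⟩ := hp.exists_eq a (show blockPos r a - blockPos r b < _ by omega)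
      obtain ⟨d, hd, h4⟩ := hp.exists_eq b (show 0 < _ by omega)
      have := diagonal_eq (hdiag a b) (blockPos r a - blockPos r b) 0 (blockPos r b) (by omega)
        (by omega)
      rw [show blockPos r a - blockPos r b + blockPos r b = blockPos r a by omega, zero_add] at this
      rw [← this, ← h3, ← h4, blockFun_pos hp hc hd]
      refine h1 c d ?_ (Or.inl ⟨(blockLE_congr (r.symm' hd) (r.symm' hc)).1 hle, h4, ?_⟩)
      · rintro rfl
        exact hab (hp.inj a b (r.trans' (r.symm' hc) hd) (by omega))
      · rw [blockSize_congr hc, blockSize_congr hd]; omega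
    · obtain ⟨c, hc, h3⟩ := hp.exists_eq a (show blockSize r a - 1 < _ by omega)
      obtain ⟨d, hd, h4⟩ := hp.exists_eq b
        (show blockPos r b + (blockSize r a - 1 - blockPos r a) < _ by omega)
      have := diagonal_eq (hdiag a b) (blockPos r a) (blockPos r b)
        (blockSize r a - 1 - blockPos r a) (by omega) (by omega)
      rw [show blockPos r a + (blockSize r a - 1 - blockPos r a) = blockSize r a - 1 by omega]
        at this
      rw [this, ← h4, ← h3, blockFun_pos hp hc hd]
      refine h1 c d ?_ (Or.inr ⟨fun h => hle ((blockLE_congr hd hc).1 h), ?_, ?_⟩)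
      · rintro rfl
        exact hle (blockLE_of_rel (r.trans' (r.symm' hd) hc))
      · rw [blockSize_congr hc]; omega
      · rw [blockSize_congr hc]; omega
  have hconst : ∀ a b, r.r a b → Z a a = Z b b := by
    have key : ∀ a b, r.r a b → blockPos r a ≤ blockPos r b → Z a a = Z b b := by
      intro a b hab hle
      have pb := hp.lt b
      rw [← blockSize_congr hab] at pb
      have := diagonal_eq (hdiag a a) (blockPos r a) (blockPos r a) (blockPos r b - blockPos r a)
        (by omega) (by omega)
      rw [show blockPos r a + (blockPos r b - blockPos r a) = blockPos r b by omega,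
        blockFun_pos hp (r.refl' a) (r.refl' a), blockFun_pos hp (r.symm' hab) (r.symm' hab)]
        at this
      exact this
    intro a b hab
    rcases le_total (blockPos r a) (blockPos r b) with h | h
    · exact key a b hab h
    · exact (key b a (r.symm' hab) h).symm
  have hfirst : ∀ a b, blockPos r a = 0 → blockPos r b = 0 →
      (σ a * traceWeight m n a) • Z a a = (σ b * traceWeight m n b) • Z b b := by
    intro a b ha hb
    by_cases hab : a = b
    · rw [hab]
    -- A diagonal slice direction supported at the first elements of two blocks; the coefficients
    -- make its weighted trace zero.
    have := h2 (Pi.single a (traceWeight m n b) - Pi.single b (traceWeight m n a))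
      ⟨0, fun c hc => ?_, ?_⟩
    · rw [← Finset.sum_subset (Finset.subset_univ {a, b}), Finset.sum_pair hab] at this
      · simp only [Pi.sub_apply, Pi.single_eq_same, Pi.single_eq_of_ne hab, sub_zero,
          Pi.single_eq_of_ne (Ne.symm hab), zero_sub, mul_neg, neg_smul, add_neg_eq_zero] at this
        have ta := traceWeight_mul_self a
        have tb := traceWeight_mul_self b
        have e := congrArg (fun x => (traceWeight m n a * traceWeight m n b) • x) this
        simp only [smul_smul] at e
        rw [show traceWeight m n a * traceWeight m n b * (σ a * traceWeight m n b) =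
            σ a * traceWeight m n a by linear_combination (σ a * traceWeight m n a) * tb,
          show traceWeight m n a * traceWeight m n b * (σ b * traceWeight m n a) =
            σ b * traceWeight m n b by linear_combination (σ b * traceWeight m n b) * ta] at e
        exact e
      · intro c _ hc
        simp only [Finset.mem_insert, Finset.mem_singleton, not_or] at hc
        simp [hc.1, hc.2]
    · have h3 : c ≠ a := by rintro rfl; exact hc ha
      have h4 : c ≠ b := by rintro rfl; exact hc hb
      simp [h3, h4]
    · simp only [sub_zero, Pi.sub_apply, smul_eq_mul]
      simp [mul_sub, Finset.sum_sub_distrib, Pi.single_apply, mul_comm]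
  have hall : ∀ a b, (σ a * traceWeight m n a) • Z a a = (σ b * traceWeight m n b) • Z b b := by
    intro a b
    obtain ⟨c, hc, h3⟩ := hp.exists_eq a (show 0 < _ from (Nat.zero_le _).trans_lt (hp.lt a))
    obtain ⟨d, hd, h4⟩ := hp.exists_eq b (show 0 < _ from (Nat.zero_le _).trans_lt (hp.lt b))
    rw [← hconst c a hc, ← hconst d b hd, ← hσ c a hc, ← hσ d b hd,
      ← traceWeight_congr (hr c a hc), ← traceWeight_congr (hr d b hd)]
    exact hfirst c d h3 h4
  ext a b
  rw [Matrix.zero_apply]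
  by_cases hab : a = b
  swap
  · exact hoff a b hab
  subst hab
  -- All the numbers in `hall` are equal. Testing against the identity, with `u = 1` in
  -- `IsSliceDiag`, shows that the nonzero total weight annihilates their common value.
  have h3 := h2 1 ⟨1, fun _ _ => rfl, by simp only [Pi.one_apply, sub_self, smul_zero, Finset.sum_const_zero]⟩
  have h4 : ∀ b, (σ b * (1 : Fin (m + n) → ℂ) b) • Z b b =
      traceWeight m n b • (σ a * traceWeight m n a) • Z a a := fun b => by
    rw [hall a b, smul_smul, Pi.one_apply]
    congr 1
    linear_combination (-σ b) * traceWeight_mul_self b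
  rw [Finset.sum_congr rfl fun b _ => h4 b, ← Finset.sum_smul] at h3
  have h5 := (smul_eq_zero.1 h3).resolve_left (sum_traceWeight a)
  refine (smul_eq_zero.1 h5).resolve_left (mul_ne_zero (hσ0 a) fun h => ?_)
  have := traceWeight_mul_self a
  rw [h] at this
  simp at this

end Blocks


/-! ### Two nested partitions: the refined grading and transversality -/

section Refinement

variable {m n : ℕ}

theorem isPos_ncard {L : Type*} [LinearOrder L] (r : Setoid (Fin (m + n))) (f : Fin (m + n) → L)
    (hf : Function.Injective f) : IsPos r fun a => {c | r.r c a ∧ f c < f a}.ncard where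
  lt a := Set.ncard_lt_ncard ⟨fun _ hc => hc.1, fun h => lt_irrefl (f a) (h (r.refl' a)).2⟩
    (Set.toFinite _)
  inj := by
    have key : ∀ a b, r.r a b → f a < f b →
        {c | r.r c a ∧ f c < f a}.ncard < {c | r.r c b ∧ f c < f b}.ncard := fun a b hab hlt =>
      Set.ncard_lt_ncard ⟨fun _ hc => ⟨r.trans' hc.1 hab, hc.2.trans hlt⟩,
        fun h => lt_irrefl (f a) (h ⟨hab, hlt⟩).2⟩ (Set.toFinite _)
    intro a b hab he
    rcases lt_trichotomy (f a) (f b) with h | h | h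
    · exact absurd he (key a b hab h).ne
    · exact hf h
    · exact absurd he (key b a (r.symm' hab) h).ne'

/-- The smallest element of the block of `a`. -/
def blockMin (r : Setoid (Fin (m + n))) (a : Fin (m + n)) : Fin (m + n) :=
  (exists_first r a).choose

theorem blockMin_rel (r : Setoid (Fin (m + n))) (a : Fin (m + n)) : r.r (blockMin r a) a :=
  (exists_first r a).choose_spec.1

theorem blockMin_le {r : Setoid (Fin (m + n))} {a b : Fin (m + n)} (h : r.r b a) :
    blockMin r a ≤ b :=
  (exists_first r a).choose_spec.2 b h

theorem blockMin_eq_iff {r : Setoid (Fin (m + n))} {a b : Fin (m + n)} :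
    blockMin r a = blockMin r b ↔ r.r a b := by
  refine ⟨fun h => r.trans' (r.symm' (blockMin_rel r a)) (h ▸ blockMin_rel r b), fun h => ?_⟩
  exact le_antisymm (blockMin_le (r.trans' (blockMin_rel r b) (r.symm' h)))
    (blockMin_le (r.trans' (blockMin_rel r a) h))

/-- The position of `a` in its block of `r'`, when the blocks of the finer relation `r` inside it
are put one after the other. -/
def refPos (r r' : Setoid (Fin (m + n))) (a : Fin (m + n)) : ℕ :=
  {c | r'.r c a ∧ toLex (blockMin r c, c) < toLex (blockMin r a, a)}.ncard

theorem isPos_refPos (r r' : Setoid (Fin (m + n))) : IsPos r' (refPos r r') :=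
  isPos_ncard r' (fun a => toLex (blockMin r a, a)) fun a b h => by
    simpa using congrArg (fun x => (ofLex x).2) h

theorem refPos_self (r : Setoid (Fin (m + n))) : refPos r r = blockPos r := by
  funext a
  unfold refPos blockPos
  congr 1
  ext c
  refine and_congr_right fun h => ?_
  rw [Prod.Lex.toLex_lt_toLex]
  simp [blockMin_eq_iff.2 h]

variable {r r' : Setoid (Fin (m + n))} (hle : ∀ a b, r.r a b → r'.r a b)

include hle in
theorem refPos_eq_add (a : Fin (m + n)) :
    refPos r r' a = {c | r'.r c a ∧ blockMin r c < blockMin r a}.ncard + blockPos r a := by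
  rw [refPos, blockPos, ← Set.ncard_union_eq ?_ (Set.toFinite _) (Set.toFinite _)]
  · congr 1
    ext c
    simp only [Prod.Lex.toLex_lt_toLex, Set.mem_ofPred_eq, Set.mem_union]
    constructor
    · rintro ⟨h, h1 | ⟨h1, h2⟩⟩
      · exact Or.inl ⟨h, h1⟩
      · exact Or.inr ⟨blockMin_eq_iff.1 h1, h2⟩
    · rintro (⟨h, h1⟩ | ⟨h, h1⟩)
      · exact ⟨h, Or.inl h1⟩
      · exact ⟨hle _ _ h, Or.inr ⟨blockMin_eq_iff.2 h, h1⟩⟩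
  · rw [Set.disjoint_left]
    rintro c ⟨_, h1⟩ ⟨h2, _⟩
    rw [blockMin_eq_iff.2 h2] at h1
    exact lt_irrefl _ h1

-- On each block of `r` the two numberings differ by a constant; the form avoids natural
-- subtraction.
include hle in
theorem refPos_sub {a b : Fin (m + n)} (h : r.r a b) :
    refPos r r' a + blockPos r b = refPos r r' b + blockPos r a := by
  rw [refPos_eq_add hle, refPos_eq_add hle, blockMin_eq_iff.2 h]
  have : {c | r'.r c a ∧ blockMin r c < blockMin r b} = {c | r'.r c b ∧ blockMin r c < blockMin r b} := by
    ext c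
    exact and_congr_left fun _ => ⟨fun hc => r'.trans' hc (hle _ _ h),
      fun hc => r'.trans' hc (r'.symm' (hle _ _ h))⟩
  rw [this]
  omega

include hle in
/-- Consecutive positions for `r'` are either consecutive for `r` or at a star position. -/
theorem refPos_succ_cases {a b : Fin (m + n)} (h : r'.r a b)
    (hab : refPos r r' a = refPos r r' b + 1) :
    (r.r a b ∧ blockPos r a = blockPos r b + 1) ∨ (¬ r.r a b ∧ IsStar r a b) := by
  by_cases hr : r.r a b
  · have := refPos_sub hle hr
    exact Or.inl ⟨hr, by omega⟩
  refine Or.inr ⟨hr, Or.inr ?_⟩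
  have hp := isPos_blockPos r
  have hp' := isPos_refPos r r'
  -- Otherwise the predecessor of `a` in its block of `r` would have the same position in the block
  -- of `r'` as `b`.
  have ha : blockPos r a = 0 := by
    by_contra h0
    obtain ⟨c, hc, h1⟩ := hp.exists_eq a (i := blockPos r a - 1) (by have := hp.lt a; omega)
    have h2 := refPos_sub hle hc
    have h3 : c = b := hp'.inj _ _ (r'.trans' (hle _ _ hc) h) (by omega)
    exact hr (h3 ▸ r.symm' hc)
  have hb : blockPos r b + 1 = blockSize r b := by
    by_contra h0
    obtain ⟨c, hc, h1⟩ := hp.exists_eq b (i := blockPos r b + 1) (by have := hp.lt b; omega)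
    have h2 := refPos_sub hle hc
    have h3 : c = a := hp'.inj _ _ (r'.trans' (hle _ _ hc) (r'.symm' h)) (by omega)
    exact hr (h3 ▸ hc)
  refine ⟨?_, hb, by omega⟩
  rintro ⟨c, hc, h1⟩
  have h2 : blockMin r a ≤ blockMin r b :=
    (blockMin_le hc).trans (h1 _ (blockMin_rel r b))
  have h3 : toLex (blockMin r a, a) < toLex (blockMin r b, b) := by
    rw [Prod.Lex.toLex_lt_toLex]
    exact Or.inl (lt_of_le_of_ne h2 fun h => hr (blockMin_eq_iff.1 h))
  have h4 : refPos r r' a ≤ refPos r r' b := by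
    refine Set.ncard_le_ncard (fun d hd => ⟨r'.trans' hd.1 h, hd.2.trans h3⟩) (Set.toFinite _)
  omega

open Classical in
/-- An integral grading between the half-integral grading of `r'` and the slice of `r`. -/
def refGrade (r r' : Setoid (Fin (m + n))) (a : Fin (m + n)) : ℤ :=
  grade r' (refPos r r') a + if Odd (blockSize r' a) then 1 else 0

/-- In a block of `r'` the values of `grade` have the parity of the size minus 1, and the correction
makes them all odd. Refined degrees are therefore even, that is, integral eigenvalues. -/
theorem refGrade_odd (a : Fin (m + n)) : refGrade r r' a % 2 = 1 := by
  unfold refGrade grade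
  split_ifs with h
  · rw [Nat.odd_iff] at h; omega
  · rw [Nat.not_odd_iff] at h; omega

theorem refGrade_le (a : Fin (m + n)) : refGrade r r' a ≤ grade r' (refPos r r') a + 1 := by
  unfold refGrade; split_ifs <;> omega

theorem le_refGrade (a : Fin (m + n)) : grade r' (refPos r r') a ≤ refGrade r r' a := by
  unfold refGrade; split_ifs <;> omega

/-- A negative refined degree is at most -2, and it differs from the degree for `r'` by at most 1.
-/
theorem refGrade_lt_grade {a b : Fin (m + n)} (h : refGrade r r' a < refGrade r r' b) :
    grade r' (refPos r r') a < grade r' (refPos r r') b := by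
  have h1 := refGrade_odd (r := r) (r' := r') a
  have h2 := refGrade_odd (r := r) (r' := r') b
  have h3 := refGrade_le (r := r) (r' := r') b
  have h4 := le_refGrade (r := r) (r' := r') a
  omega

theorem refGrade_le_of_grade {a b : Fin (m + n)}
    (h : grade r' (refPos r r') a ≤ grade r' (refPos r r') b) :
    refGrade r r' a ≤ refGrade r r' b := by
  by_contra h1
  have := refGrade_lt_grade (not_le.1 h1)
  omega

variable {N : Type*} [Ring N]

/-- The lowering matrix of `r'`, conjugated by a permutation so that it extends that of `r`. -/
abbrev refLower (N : Type*) [Zero N] [One N] (r r' : Setoid (Fin (m + n))) :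
    IndexMat m n N :=
  lower N r' (refPos r r')

theorem lower_grade {pos : Fin (m + n) → ℕ} {a b : Fin (m + n)} (h : lower N r pos a b ≠ 0) :
    r.r a b ∧ pos a = pos b + 1 ∧ grade r pos a = grade r pos b - 2 := by
  have h1 : r.r a b ∧ pos a = pos b + 1 := by
    by_contra h1
    exact h (if_neg h1)
  refine ⟨h1.1, h1.2, ?_⟩
  unfold grade
  rw [blockSize_congr h1.1, h1.2]
  push_cast; ring

theorem refLower_refGrade {a b : Fin (m + n)} (h : refLower N r r' a b ≠ 0) :
    refGrade r r' a = refGrade r r' b - 2 := by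
  obtain ⟨h1, _, h3⟩ := lower_grade h
  unfold refGrade
  rw [h3, blockSize_congr h1]; ring

include hle in
theorem refLower_eq_one {a b : Fin (m + n)} (h : r.r a b) (h1 : blockPos r a = blockPos r b + 1) :
    refLower N r r' a b = 1 := by
  have := refPos_sub hle h
  exact if_pos ⟨hle _ _ h, by omega⟩

-- By `refPos_succ_cases`, the lowering matrix of `r'` differs from that of `r` only at star
-- positions outside the diagonal blocks of `r`.
include hle in
theorem refLower_eq_lower {a b : Fin (m + n)} (h : r.r a b ∨ ¬ IsStar r a b) :
    refLower N r r' a b = lower N r (blockPos r) a b := by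
  by_cases h1 : r.r a b ∧ blockPos r a = blockPos r b + 1
  · exact (refLower_eq_one hle h1.1 h1.2).trans (if_pos h1).symm
  · refine (if_neg ?_).trans (if_neg h1).symm
    rintro ⟨h2, h3⟩
    rcases refPos_succ_cases hle h2 h3 with h4 | h4
    · exact h1 h4
    · tauto

include hle in
theorem lower_refGrade {a b : Fin (m + n)} (h : lower N r (blockPos r) a b ≠ 0) :
    refGrade r r' a = refGrade r r' b - 2 := by
  obtain ⟨h1, h2, _⟩ := lower_grade h
  refine refLower_refGrade (N := N) ?_
  rw [refLower_eq_lower hle (Or.inl h1)]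
  exact h

variable [Algebra ℂ N]

include hle in
/-- An infinitesimal gauge transformation that is orthogonal to the part of the slice of
nonnegative grade, and whose effect lies in the slice in negative grade, is of positive grade. -/
theorem tangent_grade (hr : RespectsParity r) {J X D : IndexMat m n N}
    (hJ1 : ∀ a b, grade r (blockPos r) a < grade r (blockPos r) b →
      J a b = lower N r (blockPos r) a b)
    (hJ2 : ∀ a b, refGrade r r' a < refGrade r r' b - 2 → J a b = 0)
    (hD : ∀ a b, X a b = 0 → D a b = 0)
    (hT : ∀ a b, refGrade r r' a < refGrade r r' b → ¬ IsStar r a b → (J * X - X * J + D) a b = 0)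
    (hX1 : ∀ a b, a ≠ b → IsStar r b a → refGrade r r' a ≤ refGrade r r' b → X a b = 0)
    (σ : Fin (m + n) → ℂ) (hσ : ∀ a b, r.r a b → σ a = σ b) (hσ0 : ∀ a, σ a ≠ 0)
    (hX2 : ∀ w : Fin (m + n) → ℂ, IsSliceDiag r w → ∑ a, (σ a * w a) • X a a = 0) :
    ∀ a b, refGrade r r' a ≤ refGrade r r' b → X a b = 0 := by
  classical
  by_contra hne
  push Not at hne
  set γ := refGrade r r'
  set h := grade r (blockPos r)
  -- Among the nonzero entries of nonpositive refined degree, those of lowest `r`-degree `e` form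
  -- the leading part `X'`. It will be shown to commute with the lowering matrix `L` and to be
  -- orthogonal to the slice.
  set S : Finset (Fin (m + n) × Fin (m + n)) :=
    Finset.univ.filter fun u => γ u.1 ≤ γ u.2 ∧ X u.1 u.2 ≠ 0 with hS
  have hSne : S.Nonempty := by
    obtain ⟨a, b, h1, h2⟩ := hne
    exact ⟨(a, b), by simp [hS, h1, h2]⟩
  obtain ⟨⟨a0, b0⟩, hmem, hmin⟩ := S.exists_min_image (fun u => h u.1 - h u.2) hSne
  set e := h a0 - h b0 with he
  have hlow : ∀ a b, h a - h b < e → γ a ≤ γ b → X a b = 0 := by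
    intro a b h1 h2
    by_contra h3
    have := hmin (a, b) (by simp [hS, h2, h3])
    simp only at this
    omega
  set X' : IndexMat m n N := Matrix.of fun a b =>
    if γ a ≤ γ b ∧ h a - h b = e then X a b else 0 with hX'
  have hX'a : ∀ a b, X' a b = if γ a ≤ γ b ∧ h a - h b = e then X a b else 0 := fun _ _ => rfl
  set L := lower N r (blockPos r)
  have hL : ∀ a b, L a b ≠ 0 → h a = h b - 2 ∧ γ a = γ b - 2 := fun a b h1 =>
    ⟨(lower_grade h1).2.2, lower_refGrade hle h1⟩
  have hγ2 : ∀ a b, γ a < γ b → γ a ≤ γ b - 2 := by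
    intro a b h1
    have h2 : γ a % 2 = 1 := refGrade_odd a
    have h3 : γ b % 2 = 1 := refGrade_odd b
    omega
  -- In `r`-degree `e - 2` only `L` contributes from `J`: any other entry of `J` has nonnegative
  -- `r`-degree, and it either vanishes by `hJ2` or meets an entry of `X` of `r`-degree below `e`
  -- and nonpositive refined degree.
  have hC1 : ∀ a b, h a - h b = e - 2 → γ a < γ b → (L * X' - X' * L) a b =
      (J * X - X * J + D) a b := by
    intro a b h1 h2
    have h2 := hγ2 a b h2
    rw [Matrix.add_apply, hD a b (hlow a b (by omega) (by omega)), add_zero, Matrix.sub_apply,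
      Matrix.sub_apply]
    congr 1
    · rw [Matrix.mul_apply, Matrix.mul_apply]
      refine Finset.sum_congr rfl fun c _ => ?_
      by_cases h3 : h a < h c
      · rw [hJ1 a c h3]
        by_cases h4 : L a c = 0
        · rw [h4, zero_mul, zero_mul]
        · have := hL a c h4
          rw [hX'a, if_pos (by omega)]
      · have h4 : L a c = 0 := by
          by_contra h4
          have := hL a c h4
          omega
        rw [h4, zero_mul]
        by_cases h5 : γ a < γ c - 2
        · rw [hJ2 a c h5, zero_mul]
        · rw [hlow c b (by omega) (by omega), mul_zero]
    · rw [Matrix.mul_apply, Matrix.mul_apply]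
      refine Finset.sum_congr rfl fun c _ => ?_
      by_cases h3 : h c < h b
      · rw [hJ1 c b h3]
        by_cases h4 : L c b = 0
        · rw [h4, mul_zero, mul_zero]
        · have := hL c b h4
          rw [hX'a, if_pos (by omega)]
      · have h4 : L c b = 0 := by
          by_contra h4
          have := hL c b h4
          omega
        rw [h4, mul_zero]
        by_cases h5 : γ c < γ b - 2
        · rw [hJ2 c b h5, mul_zero]
        · rw [hlow a c (by omega) (by omega), zero_mul]
  have hC2 : ∀ a b, ¬ (h a - h b = e - 2 ∧ γ a < γ b) → (L * X' - X' * L) a b = 0 := by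
    intro a b h1
    rw [Matrix.sub_apply, Matrix.mul_apply, Matrix.mul_apply, Finset.sum_eq_zero,
      Finset.sum_eq_zero, sub_zero]
    · intro c _
      by_cases h4 : L c b = 0
      · rw [h4, mul_zero]
      · have := hL c b h4
        rw [hX'a, if_neg (by omega), zero_mul]
    · intro c _
      by_cases h4 : L a c = 0
      · rw [h4, zero_mul]
      · have := hL a c h4
        rw [hX'a, if_neg (by omega), mul_zero]
  -- Off the diagonal the commutator is supported on star entries by `hT`, so `comm_offDiag_eq_zero`
  -- applies; on the diagonal it vanishes because only negative refined degrees occur.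
  have hC : L * X' = X' * L := by
    rw [← sub_eq_zero]
    ext a b
    rw [Matrix.zero_apply]
    by_cases hab : a = b
    · exact hC2 a b (by rw [hab]; omega)
    · refine comm_offDiag_eq_zero (Z := X') rfl (fun c d _ hs => ?_) a b hab
      by_cases h1 : h c - h d = e - 2 ∧ γ c < γ d
      · rw [hC1 c d h1.1 h1.2, hT c d h1.2 hs]
      · exact hC2 c d h1
  have hX0 : X' = 0 := by
    refine commute_orthogonal_eq_zero hr hC (fun a b hab hs => ?_) σ hσ hσ0 fun w hw => ?_
    · rw [hX'a]
      split_ifs with h1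
      exacts [hX1 a b hab hs h1.1, rfl]
    · by_cases h0 : e = 0
      · rw [← hX2 w hw]
        refine Finset.sum_congr rfl fun a _ => ?_
        rw [hX'a, if_pos (by omega)]
      · refine Finset.sum_eq_zero fun a _ => ?_
        rw [hX'a, if_neg (by omega), smul_zero]
  have h1 := congrFun (congrFun hX0 a0) b0
  simp only [hS, Finset.mem_filter, Finset.mem_univ, true_and] at hmem
  rw [hX'a, if_pos ⟨hmem.1, rfl⟩] at h1
  exact hmem.2 h1

/-- An infinitesimal gauge transformation of positive grade that preserves the part of nonnegative
integral grade is itself of positive integral grade. -/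
theorem half_step {Y X D : IndexMat m n N}
    (hX : ∀ a b, grade r' (refPos r r') a ≤ grade r' (refPos r r') b → X a b = 0)
    (hY : ∀ a b, refGrade r r' a < refGrade r r' b → Y a b = refLower N r r' a b)
    (hD : ∀ a b, X a b = 0 → D a b = 0)
    (hT : ∀ a b, refGrade r r' a < refGrade r r' b → (Y * X - X * Y + D) a b = 0) :
    ∀ a b, refGrade r r' a ≤ refGrade r r' b → X a b = 0 := by
  classical
  set γ := refGrade r r'
  set L := refLower N r r'
  have hL : ∀ a b, L a b ≠ 0 → γ a = γ b - 2 := fun a b h1 => refLower_refGrade h1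
  have hXγ : ∀ a b, γ a < γ b → X a b = 0 := fun a b h => hX a b (refGrade_lt_grade h).le
  set X' : IndexMat m n N := Matrix.of fun a b =>
    if γ a = γ b then X a b else 0 with hX'
  have hX'a : ∀ a b, X' a b = if γ a = γ b then X a b else 0 := fun _ _ => rfl
  -- The part `X'` of refined degree 0 is the lowest part of `X`, so in refined degree -2 only its
  -- commutator with `L` appears.
  have hC : L * X' = X' * L := by
    rw [← sub_eq_zero]
    ext a b
    rw [Matrix.zero_apply]
    by_cases hab : γ a = γ b - 2
    · rw [← hT a b (by omega), Matrix.add_apply, hD a b (hXγ a b (by omega)), add_zero,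
        Matrix.sub_apply, Matrix.sub_apply]
      congr 1
      · rw [Matrix.mul_apply, Matrix.mul_apply]
        refine Finset.sum_congr rfl fun c _ => ?_
        by_cases h3 : γ a < γ c
        · rw [hY a c h3]
          by_cases h4 : L a c = 0
          · rw [h4, zero_mul, zero_mul]
          · have := hL a c h4
            rw [hX'a, if_pos (by omega)]
        · rw [hX'a, if_neg (by omega), hXγ c b (by omega), mul_zero, mul_zero]
      · rw [Matrix.mul_apply, Matrix.mul_apply]
        refine Finset.sum_congr rfl fun c _ => ?_
        by_cases h3 : γ c < γ b
        · rw [hY c b h3]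
          by_cases h4 : L c b = 0
          · rw [h4, mul_zero, mul_zero]
          · have := hL c b h4
            rw [hX'a, if_pos (by omega)]
        · rw [hX'a, if_neg (by omega), hXγ a c (by omega), zero_mul, zero_mul]
    · rw [Matrix.sub_apply, Matrix.mul_apply, Matrix.mul_apply, Finset.sum_eq_zero,
        Finset.sum_eq_zero, sub_zero]
      · intro c _
        by_cases h4 : L c b = 0
        · rw [h4, mul_zero]
        · have := hL c b h4
          rw [hX'a, if_neg (by omega), zero_mul]
      · intro c _
        by_cases h4 : L a c = 0
        · rw [h4, zero_mul]
        · have := hL a c h4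
          rw [hX'a, if_neg (by omega), mul_zero]
  intro a b hab
  rcases hab.lt_or_eq with h | h
  · exact hXγ a b h
  -- By `hX` only entries of positive `r'`-degree remain, and the centraliser of `L` has none.
  · by_cases h1 : grade r' (refPos r r') a ≤ grade r' (refPos r r') b
    · exact hX a b h1
    · have h2 := commute_grade (isPos_refPos r r') hC (not_le.1 h1)
      rwa [hX'a, if_pos h] at h2

/-- The slice is transverse to the gauge orbits. -/
theorem slice_transverse (hr : RespectsParity r) {Y X D : IndexMat m n N}
    (hX : ∀ a b, grade r (blockPos r) a ≤ grade r (blockPos r) b → X a b = 0)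
    (hY : ∀ a b, grade r (blockPos r) a < grade r (blockPos r) b →
      Y a b = lower N r (blockPos r) a b)
    (hD : ∀ a b, X a b = 0 → D a b = 0)
    (σ : Fin (m + n) → ℂ) (hσ : ∀ a b, r.r a b → σ a = σ b) (hσ0 : ∀ a, σ a ≠ 0)
    (hT : InSlice r (Matrix.of fun a b => σ a • (Y * X - X * Y + D) a b)) : X = 0 := by
  classical
  by_contra hne
  set h := grade r (blockPos r)
  -- The leading part `X'`, of lowest degree `e`, satisfies `[L, X'] = ` the part of degree `e - 2`
  -- of a slice direction. By `comm_eq_zero` it lies in the centraliser of `L`, which has no part of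
  -- positive degree.
  set S : Finset (Fin (m + n) × Fin (m + n)) :=
    Finset.univ.filter fun u => X u.1 u.2 ≠ 0 with hS
  have hSne : S.Nonempty := by
    by_contra hS0
    refine hne (Matrix.ext fun a b => ?_)
    by_contra h1
    exact hS0 ⟨(a, b), by simpa [hS] using h1⟩
  obtain ⟨⟨a0, b0⟩, hmem, hmin⟩ := S.exists_min_image (fun u => h u.1 - h u.2) hSne
  set e := h a0 - h b0 with he
  have hlow : ∀ a b, h a - h b < e → X a b = 0 := by
    intro a b h1
    by_contra h3
    have := hmin (a, b) (by simp [hS, h3])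
    simp only at this
    omega
  set X' : IndexMat m n N := Matrix.of fun a b =>
    if h a - h b = e then σ a • X a b else 0 with hX'
  have hX'a : ∀ a b, X' a b = if h a - h b = e then σ a • X a b else 0 := fun _ _ => rfl
  set L := lower N r (blockPos r)
  have hL : ∀ a b, L a b ≠ 0 → h a = h b - 2 := fun a b h1 => (lower_grade h1).2.2
  have hLσ : ∀ a b, L a b ≠ 0 → σ a = σ b := fun a b h1 => hσ a b (lower_grade h1).1
  have hC1 : ∀ a b, h a - h b = e - 2 → (L * X' - X' * L) a b =
      σ a • (Y * X - X * Y + D) a b := by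
    intro a b h1
    rw [Matrix.add_apply, hD a b (hlow a b (by omega)), add_zero, Matrix.sub_apply,
      Matrix.sub_apply, smul_sub]
    congr 1
    · rw [Matrix.mul_apply, Matrix.mul_apply, Finset.smul_sum]
      refine Finset.sum_congr rfl fun c _ => ?_
      by_cases h3 : h a < h c
      · rw [hY a c h3]
        by_cases h4 : L a c = 0
        · rw [h4, zero_mul, zero_mul, smul_zero]
        · have := hL a c h4
          rw [hX'a, if_pos (by omega), mul_smul_comm, hLσ a c h4]
      · rw [hX'a, if_neg (by omega), hlow c b (by omega), mul_zero, mul_zero, smul_zero]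
    · rw [Matrix.mul_apply, Matrix.mul_apply, Finset.smul_sum]
      refine Finset.sum_congr rfl fun c _ => ?_
      by_cases h3 : h c < h b
      · rw [hY c b h3]
        by_cases h4 : L c b = 0
        · rw [h4, mul_zero, mul_zero, smul_zero]
        · have := hL c b h4
          rw [hX'a, if_pos (by omega), smul_mul_assoc]
      · rw [hX'a, if_neg (by omega), hlow a c (by omega), zero_mul, zero_mul, smul_zero]
  have hC2 : ∀ a b, h a - h b ≠ e - 2 → (L * X' - X' * L) a b = 0 := by
    intro a b h1
    rw [Matrix.sub_apply, Matrix.mul_apply, Matrix.mul_apply, Finset.sum_eq_zero,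
      Finset.sum_eq_zero, sub_zero]
    · intro c _
      by_cases h4 : L c b = 0
      · rw [h4, mul_zero]
      · have := hL c b h4
        rw [hX'a, if_neg (by omega), zero_mul]
    · intro c _
      by_cases h4 : L a c = 0
      · rw [h4, zero_mul]
      · have := hL a c h4
        rw [hX'a, if_neg (by omega), mul_zero]
  have hC : L * X' - X' * L = 0 := by
    refine comm_eq_zero hr ⟨fun c d hcd hs => ?_, ?_⟩
    · by_cases h1 : h c - h d = e - 2
      · exact (hC1 c d h1).trans (hT.1 c d hcd hs)
      · exact hC2 c d h1
    -- The commutator has degree `e - 2`, so only for `e = 2` does it reach the diagonal.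
    · by_cases h1 : e = 2
      · obtain ⟨u, h2, h3⟩ := hT.2
        have h4 : ∀ a, (L * X' - X' * L) a a = σ a • (Y * X - X * Y + D) a a := fun a =>
          hC1 a a (by omega)
        refine ⟨u, fun a ha => (h4 a).trans (h2 a ha), ?_⟩
        rw [← h3]
        exact Finset.sum_congr rfl fun a _ => congrArg (fun x => traceWeight m n a • (x - u)) (h4 a)
      · have h4 : ∀ a, (L * X' - X' * L) a a = 0 := fun a => hC2 a a (by omega)
        exact ⟨0, fun a _ => h4 a, Finset.sum_eq_zero fun a _ => by
          rw [sub_zero]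
          exact (congrArg (traceWeight m n a • ·) (h4 a)).trans (smul_zero _)⟩
  simp only [hS, Finset.mem_filter, Finset.mem_univ, true_and] at hmem
  have h1 := commute_grade (isPos_blockPos r) (sub_eq_zero.1 hC) (c := a0) (d := b0) (by
    by_contra h1
    exact hmem (hX a0 b0 (not_lt.1 h1)))
  rw [hX'a, if_pos rfl] at h1
  exact (smul_ne_zero (hσ0 a0) hmem) h1

include hle in
/-- Each matrix unit of grade at least `-1/2` can be moved into the slice by a commutator with the
lowering matrix, without changing the grading or the parity. -/
theorem exists_comm_mem_slice (hr : RespectsParity r) (hr' : RespectsParity r') {c d : Fin (m + n)}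
    (hcd : grade r' (refPos r r') d - 1 ≤ grade r' (refPos r r') c) :
    ∃ B T : IndexMat m n ℂ,
      (∀ a b, B a b ≠ 0 → grade r' (refPos r r') a - grade r' (refPos r r') b =
          grade r' (refPos r r') c - grade r' (refPos r r') d + 2 ∧
        unitOdd m n (a, b) = unitOdd m n (c, d)) ∧
      T = Matrix.single c d 1 + (B * refLower ℂ r r' - refLower ℂ r r' * B) ∧ InSlice r T ∧
      ∀ a b, refGrade r r' a < refGrade r r' b → T a b = 0 := by
  classical
  set γ := refGrade r r' with hγ
  set g := grade r' (refPos r r') with hg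
  set L := refLower ℂ r r' with hLdef
  have hL : ∀ a b, L a b ≠ 0 → g a = g b - 2 ∧ γ a = γ b - 2 := fun a b h1 =>
    ⟨(lower_grade h1).2.2, refLower_refGrade h1⟩
  let T : Submodule ℂ (IndexMat m n ℂ) :=
    { carrier := {W | InSlice r W ∧ ∀ a b, γ a < γ b → W a b = 0}
      add_mem' := by
        rintro W W' ⟨⟨h1, u, h2, h3⟩, h4⟩ ⟨⟨h1', u', h2', h3'⟩, h4'⟩
        refine ⟨⟨fun a b hab hs => ?_, u + u', fun a ha => ?_, ?_⟩, fun a b hab => ?_⟩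
        · rw [Matrix.add_apply, h1 a b hab hs, h1' a b hab hs, add_zero]
        · exact congrArg₂ (· + ·) (h2 a ha) (h2' a ha)
        · rw [← add_zero (0 : ℂ)]
          nth_rewrite 1 [← h3]
          rw [← h3', ← Finset.sum_add_distrib]
          refine Finset.sum_congr rfl fun a _ => ?_
          simp only [Matrix.add_apply, smul_eq_mul]; ring
        · rw [Matrix.add_apply, h4 a b hab, h4' a b hab, add_zero]
      zero_mem' := ⟨⟨fun _ _ _ _ => rfl, 0, fun _ _ => rfl, by simp⟩, fun _ _ _ => rfl⟩
      smul_mem' := by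
        rintro x W ⟨⟨h1, u, h2, h3⟩, h4⟩
        refine ⟨⟨fun a b hab hs => ?_, x * u, fun a ha => ?_, ?_⟩, fun a b hab => ?_⟩
        · rw [Matrix.smul_apply, h1 a b hab hs, smul_zero]
        · exact congrArg (x * ·) (h2 a ha)
        · rw [← mul_zero x, ← h3, Finset.mul_sum]
          refine Finset.sum_congr rfl fun a _ => ?_
          simp only [Matrix.smul_apply, smul_eq_mul]; ring
        · rw [Matrix.smul_apply, h4 a b hab, smul_zero] }
  let A : Submodule ℂ (IndexMat m n ℂ) :=
    { carrier := {B | ∀ a b, g a ≤ g b → B a b = 0}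
      add_mem' := fun {B B'} h h' a b hab => by rw [Matrix.add_apply, h a b hab, h' a b hab, add_zero]
      zero_mem' := fun _ _ _ => rfl
      smul_mem' := fun x B h a b hab => by rw [Matrix.smul_apply, h a b hab, smul_zero] }
  let ad : IndexMat m n ℂ →ₗ[ℂ] IndexMat m n ℂ :=
    LinearMap.mulRight ℂ L - LinearMap.mulLeft ℂ L
  have hmem : Matrix.single c d (1 : ℂ) ∈ T ⊔ A.map ad := by
    -- By duality: a linear form that vanishes on the slice directions and on the commutators is `W
    -- ↦ tr (W X)`, where `[L, X]` vanishes in negative degree and `X` is orthogonal to the slice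
    -- directions of nonnegative refined degree. It is shown that `X d c = 0`.
    by_contra hnot
    obtain ⟨f, hf0, hf⟩ := Submodule.exists_le_ker_of_notMem hnot
    have hfT : ∀ W ∈ T, f W = 0 := fun W hW => hf (Submodule.mem_sup_left hW)
    have hfA : ∀ B ∈ A, f (B * L - L * B) = 0 := fun B hB =>
      hf (Submodule.mem_sup_right ⟨B, hB, rfl⟩)
    set X : IndexMat m n ℂ :=
      Matrix.of fun a b => f (Matrix.single b a 1) with hX
    have hXa : ∀ a b, X a b = f (Matrix.single b a 1) := fun _ _ => rfl
    have hfX : ∀ W, f W = ∑ a, ∑ b, W a b * X b a := by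
      intro W
      conv_lhs => rw [Matrix.matrix_eq_sum_single W]
      simp only [map_sum, hXa]
      refine Finset.sum_congr rfl fun a _ => Finset.sum_congr rfl fun b _ => ?_
      rw [← smul_eq_mul, ← map_smul, Matrix.smul_single, smul_eq_mul, mul_one]
    have hcomm : ∀ a b, g a < g b → (L * X - X * L) a b = 0 := by
      intro a b hab
      have h1 := hfA (Matrix.single b a 1) (fun a' b' h => by
        rw [Matrix.single_apply, if_neg]
        rintro ⟨rfl, rfl⟩
        omega)
      have h2 : f (Matrix.single b a 1 * L - L * Matrix.single b a 1) =
          (Matrix.single b a 1 * (L * X - X * L)).trace := by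
        have : ∀ W, f W = (W * X).trace := fun W => by
          rw [hfX, Matrix.trace]
          rfl
        rw [this, Matrix.sub_mul, Matrix.mul_sub, Matrix.trace_sub, Matrix.trace_sub,
          Matrix.mul_assoc, Matrix.mul_assoc, Matrix.trace_mul_comm L, Matrix.mul_assoc]
      rw [h1, Matrix.trace_single_mul, one_smul] at h2
      exact h2.symm
    have hXγ : ∀ a b, γ a ≤ γ b → X a b = 0 := by
      refine tangent_grade hle hr (J := L) (D := 0) (fun a b hab => ?_) (fun a b hab => ?_)
        (fun _ _ _ => rfl) (fun a b hab _ => ?_) (fun a b hne hs hab => ?_) 1 (fun _ _ _ => rfl)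
        (fun _ => one_ne_zero) fun w hw => ?_
      · refine refLower_eq_lower hle ?_
        by_contra hc
        push Not at hc
        have := grade_of_isStar hc.2
        omega
      · by_contra h1
        have := (hL a b h1).2
        change γ a < γ b - 2 at hab
        omega
      · rw [add_zero]
        exact hcomm a b (refGrade_lt_grade hab)
      · refine hfT _ ⟨⟨fun a' b' hab' hs' => ?_, 0, fun a' ha' => ?_, ?_⟩, fun a' b' hab' => ?_⟩
        · rw [Matrix.single_apply, if_neg]
          rintro ⟨rfl, rfl⟩
          exact hs' hs
        · simp only [Matrix.single_apply]
          rw [if_neg]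
          rintro ⟨rfl, rfl⟩
          exact hne rfl
        · refine Finset.sum_eq_zero fun a' _ => ?_
          simp only [Matrix.single_apply]
          rw [if_neg, sub_zero, smul_zero]
          rintro ⟨rfl, rfl⟩
          exact hne rfl
        · rw [Matrix.single_apply, if_neg]
          rintro ⟨rfl, rfl⟩
          exact absurd hab (not_le.2 hab')
      · have h1 : f (Matrix.diagonal w) = 0 := by
          refine hfT _ ⟨⟨fun a b hab _ => Matrix.diagonal_apply_ne _ hab, ?_⟩, fun a b hab =>
            Matrix.diagonal_apply_ne _ (by rintro rfl; exact lt_irrefl _ hab)⟩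
          simpa only [Matrix.diagonal_apply_eq] using hw
        rw [← h1, hfX]
        refine Finset.sum_congr rfl fun a _ => ?_
        rw [Finset.sum_eq_single a]
        · simp
        · intro b _ hb
          rw [Matrix.diagonal_apply_ne _ (Ne.symm hb), zero_mul]
        · simp
    -- `tangent_grade` settles nonpositive refined degree. By `hcd` the only other possibility for
    -- `(d, c)` is degree exactly 1, and this part of `X` commutes with `L`.
    set X' : IndexMat m n ℂ := Matrix.of fun a b =>
      if g a - g b = 1 then X a b else 0 with hX'
    have hX'a : ∀ a b, X' a b = if g a - g b = 1 then X a b else 0 := fun _ _ => rfl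
    have hC : L * X' = X' * L := by
      rw [← sub_eq_zero]
      ext a b
      rw [Matrix.zero_apply]
      by_cases hab : g a - g b = -1
      · rw [← hcomm a b (by omega), Matrix.sub_apply, Matrix.sub_apply, Matrix.mul_apply,
          Matrix.mul_apply, Matrix.mul_apply, Matrix.mul_apply]
        congr 1
        · refine Finset.sum_congr rfl fun x _ => ?_
          by_cases h4 : L a x = 0
          · rw [h4, zero_mul, zero_mul]
          · have := hL a x h4
            rw [hX'a, if_pos (by omega)]
        · refine Finset.sum_congr rfl fun x _ => ?_
          by_cases h4 : L x b = 0
          · rw [h4, mul_zero, mul_zero]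
          · have := hL x b h4
            rw [hX'a, if_pos (by omega)]
      · rw [Matrix.sub_apply, Matrix.mul_apply, Matrix.mul_apply, Finset.sum_eq_zero,
          Finset.sum_eq_zero, sub_zero]
        · intro x _
          by_cases h4 : L x b = 0
          · rw [h4, mul_zero]
          · have := hL x b h4
            rw [hX'a, if_neg (by omega), zero_mul]
        · intro x _
          by_cases h4 : L a x = 0
          · rw [h4, zero_mul]
          · have := hL a x h4
            rw [hX'a, if_neg (by omega), mul_zero]
    refine hf0 ?_
    rw [← hXa d c]
    by_cases h1 : γ d ≤ γ c
    · exact hXγ d c h1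
    · have h2 : g c < g d := refGrade_lt_grade (r := r) (r' := r') (not_le.1 h1)
      have h3 := commute_grade (isPos_refPos r r') hC h2
      rwa [hX'a, if_pos (by omega)] at h3
  obtain ⟨W, hW, _, ⟨B, hB, rfl⟩, hsum⟩ := Submodule.mem_sup.1 hmem
  have hsum' : W + (B * L - L * B) = Matrix.single c d 1 := hsum
  -- `B` and `W` need not be homogeneous. As `L` is even and of degree -2, keeping only the entries
  -- with the required degree and parity preserves the relation between them.
  set P : Fin (m + n) → Fin (m + n) → ℤ → Prop := fun a b e =>
    g a - g b = g c - g d + e ∧ unitOdd m n (a, b) = unitOdd m n (c, d) with hP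
  set B' : IndexMat m n ℂ := Matrix.of fun a b =>
    if P a b 2 then -B a b else 0 with hB'
  have hB'a : ∀ a b, B' a b = if P a b 2 then -B a b else 0 := fun _ _ => rfl
  have hodd : ∀ a b, L a b ≠ 0 → ∀ x, unitOdd m n (a, x) = unitOdd m n (b, x) ∧
      unitOdd m n (x, a) = unitOdd m n (x, b) := by
    intro a b h1 x
    simp only [unitOdd, hr' a b (lower_grade h1).1, and_self]
  obtain ⟨T', hT'⟩ : ∃ T', T' = Matrix.single c d 1 + (B' * L - L * B') := ⟨_, rfl⟩
  have hmask : ∀ a b, T' a b = if P a b 0 then W a b else 0 := by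
    intro a b
    rw [hT', Matrix.add_apply, Matrix.sub_apply, Matrix.mul_apply, Matrix.mul_apply]
    by_cases hp : P a b 0
    · rw [if_pos hp, ← hsum', Matrix.add_apply, Matrix.sub_apply, Matrix.mul_apply,
        Matrix.mul_apply]
      have e1 : ∀ x, B' a x * L x b = -(B a x * L x b) := fun x => by
        by_cases h4 : L x b = 0
        · simp [h4]
        · have h5 := hL x b h4
          have h6 := (hodd x b h4 a).2
          rw [hB'a, if_pos ⟨by have := hp.1; omega, h6.trans hp.2⟩, neg_mul]
      have e2 : ∀ x, L a x * B' x b = -(L a x * B x b) := fun x => by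
        by_cases h4 : L a x = 0
        · simp [h4]
        · have h5 := hL a x h4
          have h6 := (hodd a x h4 b).1
          rw [hB'a, if_pos ⟨by have := hp.1; omega, h6.symm.trans hp.2⟩, mul_neg]
      simp only [e1, e2, Finset.sum_neg_distrib]
      ring
    · rw [if_neg hp, Finset.sum_eq_zero, Finset.sum_eq_zero, Matrix.single_apply, if_neg]
      · ring
      · rintro ⟨rfl, rfl⟩
        exact hp ⟨by omega, rfl⟩
      · intro x _
        by_cases h4 : L a x = 0
        · simp [h4]
        · have h5 := hL a x h4
          have h6 := (hodd a x h4 b).1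
          rw [hB'a, if_neg, mul_zero]
          rintro ⟨h7, h8⟩
          exact hp ⟨by omega, h6.trans h8⟩
      · intro x _
        by_cases h4 : L x b = 0
        · simp [h4]
        · have h5 := hL x b h4
          have h6 := (hodd x b h4 a).2
          rw [hB'a, if_neg, zero_mul]
          rintro ⟨h7, h8⟩
          exact hp ⟨by omega, h6.symm.trans h8⟩
  refine ⟨B', T', fun a b hab => ?_, hT', ⟨fun a b hab hs => ?_, ?_⟩, fun a b hab => ?_⟩
  · by_contra h1
    exact hab (if_neg h1)
  · rw [hmask]
    split_ifs
    exacts [hW.1.1 a b hab hs, rfl]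
  · by_cases h0 : g c - g d = 0 ∧ unitOdd m n (c, d) = false
    · have h1 : ∀ a, T' a a = W a a := fun a => by
        rw [hmask, if_pos ⟨by omega, by rw [h0.2]; simp [unitOdd]⟩]
      simp only [h1]
      exact hW.1.2
    · have h1 : ∀ a, T' a a = 0 := fun a => by
        rw [hmask, if_neg]
        rintro ⟨h2, h3⟩
        exact h0 ⟨by omega, by rw [← h3]; simp [unitOdd]⟩
      simp only [h1]
      exact ⟨0, fun _ _ => rfl, by simp⟩
  · rw [hmask]
    split_ifs
    exacts [hW.2 a b hab, rfl]

end Refinement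


/-! ### Even supermatrices and homomorphisms given by their value on `J` -/

section SuperAlgebra

open Polynomial

/-- A superalgebra with an even derivation, commutative in the graded sense. -/
class SuperAlg (N : Type) [Ring N] [Algebra ℂ N] where
  /-- the parity automorphism -/
  par : N →ₐ[ℂ] N
  /-- the derivation -/
  der : N →ₗ[ℂ] N
  comm : ∀ (b : Bool) (x y : N), par x = sg b • x → x * y = (if b then par y else y) * x
  der_mul : ∀ x y, der (x * y) = der x * y + x * der y
  par_der : ∀ x, par (der x) = der (par x)

open SuperAlg

instance {G : Type} (p : G → Bool) : SuperAlg (SuperDiffPoly p) where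
  par := parity p
  der := totalDeriv p
  comm b x y h := by
    rw [IsPar.mul_comm (p := p) (b := b) h y]
    cases b <;> simp
  der_mul := totalDeriv_mul p
  par_der := parity_totalDeriv p

instance {G : Type} (p : G → Bool) : SuperAlg (SuperDiffPoly p)[X] where
  par := parX p
  der := dX p
  comm b x y h := by
    rw [IsParX.mul_comm (p := p) (b := b) h y]
    cases b <;> simp
  der_mul := dX_mul p
  par_der := parX_dX p

theorem par_eq {G : Type} (p : G → Bool) (x : SuperDiffPoly p) : par x = parity p x := rfl
theorem der_eq {G : Type} (p : G → Bool) (x : SuperDiffPoly p) : der x = totalDeriv p x := rfl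
theorem parX_eq {G : Type} (p : G → Bool) (x : (SuperDiffPoly p)[X]) : par x = parX p x := rfl
theorem derX_eq {G : Type} (p : G → Bool) (x : (SuperDiffPoly p)[X]) : der x = dX p x := rfl

variable {m n : ℕ} {N : Type} [Ring N] [Algebra ℂ N]

/-- Even matrices of constants. -/
def IsEvenMat (A : IndexMat m n ℂ) : Prop :=
  ∀ a b, A a b ≠ 0 → unitOdd m n (a, b) = false

/-- A matrix of constants, with entries in an algebra. -/
def constMat (N : Type) [Ring N] [Algebra ℂ N] (A : IndexMat m n ℂ) :
    IndexMat m n N :=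
  A.map (algebraMap ℂ N)

theorem constMat_apply (A : IndexMat m n ℂ) (a b : Fin (m + n)) :
    constMat N A a b = algebraMap ℂ N (A a b) := rfl

theorem constMat_one : constMat N (1 : IndexMat m n ℂ) = 1 :=
  Matrix.map_one _ (map_zero _) (map_one _)

variable [SuperAlg N]

/-- The derivation, entry by entry. -/
def matDer (M : IndexMat m n N) : IndexMat m n N :=
  M.map der

theorem matDer_mul (M M' : IndexMat m n N) :
    matDer (M * M') = matDer M * M' + M * matDer M' := by
  ext a b
  simp only [matDer, Matrix.map_apply, Matrix.mul_apply, Matrix.add_apply, map_sum, der_mul,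
    Finset.sum_add_distrib]

theorem der_algebraMap (c : ℂ) : der (algebraMap ℂ N c) = 0 := by
  have h : der (1 : N) = 0 := by simpa using der_mul (1 : N) 1
  rw [Algebra.algebraMap_eq_smul_one, map_smul, h, smul_zero]

theorem matDer_one : matDer (1 : IndexMat m n N) = 0 := by
  ext a b
  have h : der (1 : N) = 0 := by simpa using der_algebraMap (N := N) 1
  by_cases hab : a = b <;> simp [matDer, hab, h]

theorem matDer_add (M M' : IndexMat m n N) :
    matDer (M + M') = matDer M + matDer M' := by
  ext a b; simp [matDer]

/-- The entries have the parity of the matrix unit, shifted by `c`. -/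
def ParMat (c : Bool) (M : IndexMat m n N) : Prop :=
  ∀ a b, par (M a b) = sg (xor c (unitOdd m n (a, b))) • M a b

theorem ParMat.mul {c c' : Bool} {M M' : IndexMat m n N} (h : ParMat c M)
    (h' : ParMat c' M') : ParMat (xor c c') (M * M') := by
  intro a b
  rw [Matrix.mul_apply, map_sum, Finset.smul_sum]
  refine Finset.sum_congr rfl fun d _ => ?_
  rw [map_mul, h, h', smul_mul_smul_comm]
  congr 1
  rw [← sg_xor]
  congr 1
  simp only [unitOdd]
  cases c <;> cases c' <;> cases idxOdd m n a <;> cases idxOdd m n b <;> cases idxOdd m n d <;> rfl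

theorem ParMat.add {c : Bool} {M M' : IndexMat m n N} (h : ParMat c M)
    (h' : ParMat c M') : ParMat c (M + M') := fun a b => by
  rw [Matrix.add_apply, map_add, h, h', smul_add]

theorem ParMat.smul {c : Bool} {M : IndexMat m n N} (h : ParMat c M) (z : ℂ) :
    ParMat c (z • M) := fun a b => by
  rw [Matrix.smul_apply, map_smul, h, smul_comm]

theorem ParMat.neg {c : Bool} {M : IndexMat m n N} (h : ParMat c M) :
    ParMat c (-M) := fun a b => by
  rw [Matrix.neg_apply, map_neg, h, smul_neg]

theorem ParMat.sub {c : Bool} {M M' : IndexMat m n N} (h : ParMat c M)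
    (h' : ParMat c M') : ParMat c (M - M') := sub_eq_add_neg M M' ▸ h.add h'.neg

theorem ParMat.der {c : Bool} {M : IndexMat m n N} (h : ParMat c M) :
    ParMat c (matDer M) := fun a b => by
  rw [matDer, Matrix.map_apply, par_der, h, map_smul]

theorem parMat_const {A : IndexMat m n ℂ} (h : IsEvenMat A) :
    ParMat false (constMat N A) := fun a b => by
  by_cases hab : A a b = 0
  · simp [constMat, hab]
  · simp [constMat, h a b hab, AlgHom.commutes]

theorem parMat_one : ParMat false (1 : IndexMat m n N) := by
  rw [← constMat_one]
  refine parMat_const fun a b h => ?_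
  have : a = b := by
    by_contra hab
    exact h (Matrix.one_apply_ne hab)
  subst this
  simp [unitOdd]

/-- The sign that turns the currents into the entries of an even matrix. -/
def eps (a b : Fin (m + n)) : ℂ := sg (idxOdd m n a && idxOdd m n b)

theorem eps_mul_self (a b : Fin (m + n)) : eps a b * eps a b = 1 := sg_mul_self _

theorem eps_comm (a b : Fin (m + n)) : eps a b = eps b a := by
  unfold eps; rw [Bool.and_comm]

theorem eps_self (a : Fin (m + n)) : eps a a = sgn m n a := by
  rw [sgn_eq, eps, Bool.and_self]

theorem eps_smul_eps_smul {M : Type*} [AddCommGroup M] [Module ℂ M] (a b : Fin (m + n)) (x : M) :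
    eps a b • eps a b • x = x := by
  rw [smul_smul, eps_mul_self, one_smul]

/-- The current matrix. -/
def curMat (m n : ℕ) : IndexMat m n (Currents m n) :=
  Matrix.of fun a b => eps a b • gen (unitOdd m n) ((b, a), 0)

theorem curMat_apply (a b : Fin (m + n)) :
    curMat m n a b = eps a b • gen (unitOdd m n) ((b, a), 0) := rfl

theorem gen_zero_eq (a b : Fin (m + n)) :
    gen (unitOdd m n) ((a, b), 0) = eps b a • curMat m n b a := by
  rw [curMat_apply, eps_smul_eps_smul]

theorem unitOdd_comm (a b : Fin (m + n)) : unitOdd m n (a, b) = unitOdd m n (b, a) :=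
  Bool.xor_comm _ _

theorem parMat_curMat : ParMat false (curMat m n) := fun a b => by
  rw [curMat_apply, map_smul, par_eq, Bool.false_xor, unitOdd_comm]
  have := isPar_gen (unitOdd m n) ((b, a), 0)
  rw [IsPar] at this
  rw [this, smul_comm]

/-- Homomorphisms of differential superalgebras from the currents. -/
structure DHom (m n : ℕ) (N : Type) [Ring N] [Algebra ℂ N] [SuperAlg N] where
  /-- the algebra homomorphism -/
  hom : Currents m n →ₐ[ℂ] N
  map_der : ∀ x, hom (totalDeriv _ x) = der (hom x)
  map_par : ∀ x, hom (parity _ x) = par (hom x)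

/-- The image of a matrix. -/
def DHom.mat (φ : DHom m n N) (M : IndexMat m n (Currents m n)) :
    IndexMat m n N := M.map φ.hom

theorem DHom.mat_apply (φ : DHom m n N) (M : IndexMat m n (Currents m n))
    (a b) : φ.mat M a b = φ.hom (M a b) := rfl

theorem DHom.mat_mul (φ : DHom m n N) (M M' : IndexMat m n (Currents m n)) :
    φ.mat (M * M') = φ.mat M * φ.mat M' := Matrix.map_mul

theorem DHom.mat_add (φ : DHom m n N) (M M' : IndexMat m n (Currents m n)) :
    φ.mat (M + M') = φ.mat M + φ.mat M' := by ext a b; simp [mat]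

theorem DHom.mat_sub (φ : DHom m n N) (M M' : IndexMat m n (Currents m n)) :
    φ.mat (M - M') = φ.mat M - φ.mat M' := by ext a b; simp [mat]

theorem DHom.mat_smul (φ : DHom m n N) (c : ℂ)
    (M : IndexMat m n (Currents m n)) :
    φ.mat (c • M) = c • φ.mat M := by ext a b; simp [mat]

theorem DHom.mat_const (φ : DHom m n N) (A : IndexMat m n ℂ) :
    φ.mat (constMat _ A) = constMat N A := by ext a b; simp [mat, constMat, AlgHom.commutes]

theorem DHom.mat_one (φ : DHom m n N) : φ.mat 1 = 1 := by
  rw [← constMat_one, φ.mat_const, constMat_one]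

theorem DHom.mat_matDer (φ : DHom m n N) (M : IndexMat m n (Currents m n)) :
    φ.mat (matDer M) = matDer (φ.mat M) := by
  ext a b; simp [mat, matDer, der_eq, φ.map_der]

theorem DHom.parMat (φ : DHom m n N) {c : Bool}
    {M : IndexMat m n (Currents m n)} (h : ParMat c M) :
    ParMat c (φ.mat M) := fun a b => by
  rw [φ.mat_apply, ← φ.map_par, ← par_eq, h, map_smul]

theorem DHom.map_gen (φ : DHom m n N) (a b : Fin (m + n)) (j : ℕ) :
    φ.hom (gen _ ((a, b), j)) = eps b a • der^[j] (φ.hom (curMat m n b a)) := by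
  induction j with
  | zero => rw [gen_zero_eq, map_smul]; rfl
  | succ j ih =>
    rw [← totalDeriv_gen _ ((a, b), j), φ.map_der, ih, map_smul, Function.iterate_succ_apply']

theorem DHom.ext_mat {φ ψ : DHom m n N} (h : φ.mat (curMat m n) = ψ.mat (curMat m n)) : φ = ψ := by
  have : φ.hom = ψ.hom := by
    refine algHom_ext_gen _ fun u => ?_
    obtain ⟨⟨a, b⟩, j⟩ := u
    rw [φ.map_gen, ψ.map_gen, ← φ.mat_apply, h, ψ.mat_apply]
  cases φ; cases ψ; cases this; rfl

/-- The identity. -/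
def DHom.id (m n : ℕ) : DHom m n (Currents m n) := ⟨AlgHom.id ℂ _, fun _ => rfl, fun _ => rfl⟩

/-- Composition. -/
def DHom.comp (φ : DHom m n N) (ψ : DHom m n (Currents m n)) : DHom m n N where
  hom := φ.hom.comp ψ.hom
  map_der x := by rw [AlgHom.comp_apply, ψ.map_der, der_eq, φ.map_der]; rfl
  map_par x := by rw [AlgHom.comp_apply, ψ.map_par, par_eq, φ.map_par]; rfl

theorem DHom.comp_apply (φ : DHom m n N) (ψ : DHom m n (Currents m n)) (x) :
    (φ.comp ψ).hom x = φ.hom (ψ.hom x) := rfl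

theorem DHom.comp_mat (φ : DHom m n N) (ψ : DHom m n (Currents m n)) (M) :
    (φ.comp ψ).mat M = φ.mat (ψ.mat M) := rfl

theorem exists_dHom {Y : IndexMat m n N} (hY : ParMat false Y) :
    ∃ φ : DHom m n N, φ.mat (curMat m n) = Y := by
  have hder (j : ℕ) (a b : Fin (m + n)) :
      par (der^[j] (Y a b)) = sg (unitOdd m n (a, b)) • der^[j] (Y a b) := by
    induction j with
    | zero => simpa using hY a b
    | succ j ih => rw [Function.iterate_succ_apply', par_der, ih, map_smul]
  obtain ⟨φ, hφ⟩ := exists_algHom (unitOdd m n)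
    (fun u => eps u.1.2 u.1.1 • der^[u.2] (Y u.1.2 u.1.1)) (fun u v => by
      have h1 := hder u.2 u.1.2 u.1.1
      have h2 := hder v.2 v.1.2 v.1.1
      rw [unitOdd_comm] at h1 h2
      rw [smul_mul_smul_comm, smul_mul_smul_comm, SuperAlg.comm _ _ _ h1, smul_comm,
        mul_comm (eps _ _)]
      congr 1
      cases hu : unitOdd m n u.1
      · simp [hu]
      · rw [if_pos rfl, h2, smul_mul_assoc, Bool.true_and])
  have hd (x) : φ (totalDeriv _ x) = der (φ x) := by
    induction x using gen_induction (unitOdd m n) with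
    | algebraMap c => simp [AlgHom.commutes, der_algebraMap]
    | gen u => rw [totalDeriv_gen, hφ, hφ, map_smul, Function.iterate_succ_apply']
    | add x y hx hy => simp only [map_add, hx, hy]
    | mul x y hx hy => rw [totalDeriv_mul, map_add, map_mul, map_mul, hx, hy, map_mul, der_mul]
  have hp (x) : φ (parity _ x) = par (φ x) := by
    induction x using gen_induction (unitOdd m n) with
    | algebraMap c => simp [AlgHom.commutes]
    | gen u =>
      have := isPar_gen (unitOdd m n) u
      rw [IsPar] at this
      rw [this, map_smul, hφ, map_smul, hder, unitOdd_comm, smul_comm]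
    | add x y hx hy => simp only [map_add, hx, hy]
    | mul x y hx hy => simp only [map_mul, hx, hy]
  refine ⟨⟨φ, hd, hp⟩, ?_⟩
  ext a b
  rw [DHom.mat_apply, curMat_apply]
  change φ _ = _
  rw [map_smul, hφ]
  exact eps_smul_eps_smul a b _

/-- The homomorphism with prescribed values on the current matrix. -/
def evalHom {Y : IndexMat m n N} (hY : ParMat false Y) : DHom m n N :=
  (exists_dHom hY).choose

theorem evalHom_mat {Y : IndexMat m n N} (hY : ParMat false Y) :
    (evalHom hY).mat (curMat m n) = Y := (exists_dHom hY).choose_spec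

end SuperAlgebra

/-! ### Superderivations given by their value on `J` -/

section SuperDerivation

open Polynomial SuperAlg

variable {m n : ℕ}

/-- The point of `λ`-polynomials attached to an endomorphism. -/
abbrev DHom.pt (φ : DHom m n (Currents m n)) : Pt (unitOdd m n) :=
  lamPt _ φ.hom φ.map_der φ.map_par

/-- A homomorphism to polynomials in a parameter. -/
def DHom.pathPt (φ : DHom m n (Currents m n)[X]) : Pt (unitOdd m n) where
  hom := φ.hom
  nab := dX _
  nab_hom_mul v q := by rw [dX_mul, φ.map_der]; rfl
  nab_mul_hom q v := by rw [dX_mul, φ.map_der]; rfl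
  parX_hom v := (φ.map_par v).symm
  parX_nab q := parX_dX _ q

/-- A homomorphism, coefficient by coefficient. -/
def DHom.onX (φ : DHom m n (Currents m n)) : (Currents m n)[X] →ₐ[ℂ] (Currents m n)[X] :=
  Polynomial.mapAlgHom φ.hom

theorem DHom.onX_C (φ : DHom m n (Currents m n)) (x) : φ.onX (C x) = C (φ.hom x) := by
  simp [onX]

theorem DHom.onX_X (φ : DHom m n (Currents m n)) : φ.onX X = X := by simp [onX]

theorem DHom.coeff_onX (φ : DHom m n (Currents m n)) (q) (j : ℕ) :
    (φ.onX q).coeff j = φ.hom (q.coeff j) := by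
  simp [onX]

theorem DHom.onX_dX (φ : DHom m n (Currents m n)) (q) : φ.onX (dX _ q) = dX _ (φ.onX q) := by
  ext j; simp [coeff_onX, φ.map_der, der_eq]

theorem DHom.onX_lamL (φ : DHom m n (Currents m n)) (q) :
    φ.onX (lamL _ q) = lamL _ (φ.onX q) := by
  simp [φ.onX_dX, φ.onX_X]

theorem DHom.onX_lamL_pow (φ : DHom m n (Currents m n)) (q) (j : ℕ) :
    φ.onX ((lamL _ ^ j) q) = (lamL _ ^ j) (φ.onX q) := by
  induction j generalizing q with
  | zero => rfl
  | succ j ih => rw [pow_succ, Module.End.mul_apply, ih, onX_lamL]; rfl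

theorem DHom.onX_parX (φ : DHom m n (Currents m n)) (q) : φ.onX (parX _ q) = parX _ (φ.onX q) := by
  ext j; simp [coeff_onX, φ.map_par, par_eq]

theorem DHom.onX_subst (φ ψ : DHom m n (Currents m n)) (x q) :
    φ.onX (ψ.pt.subst x q) = (φ.comp ψ).pt.subst (φ.onX x) q := by
  rw [Pt.subst_eq_sum, Pt.subst_eq_sum, Polynomial.sum, Polynomial.sum, map_sum]
  refine Finset.sum_congr rfl fun j _ => ?_
  rw [map_mul, lamPt_nab, lamPt_nab, φ.onX_lamL_pow, lamPt_hom, φ.onX_C]; rfl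

/-- Superderivations of parity `b` at a point. -/
structure SDer (P : Pt (unitOdd m n)) (b : Bool) where
  /-- the underlying map -/
  map : Currents m n →ₗ[ℂ] (Currents m n)[X]
  map_mul : ∀ y z, map (y * z) = map y * P.hom z + P.hom (tw _ b y) * map z
  map_der : ∀ y, map (totalDeriv _ y) = P.nab (map y)

variable {P : Pt (unitOdd m n)} {b : Bool}

theorem SDer.map_algebraMap (δ : SDer P b) (c : ℂ) : δ.map (algebraMap ℂ _ c) = 0 := by
  have h := δ.map_mul 1 1
  simp only [map_one, mul_one, one_mul, left_eq_add] at h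
  rw [Algebra.algebraMap_eq_smul_one, map_smul, h, smul_zero]

/-- A superderivation on matrices, with signs that make it a derivation on even matrices. -/
def SDer.mat (δ : SDer P b) (M : IndexMat m n (Currents m n)) :
    IndexMat m n (Currents m n)[X] :=
  Matrix.of fun a c => sg (b && idxOdd m n a) • δ.map (M a c)

theorem SDer.mat_apply (δ : SDer P b) (M : IndexMat m n (Currents m n))
    (a c : Fin (m + n)) : δ.mat M a c = sg (b && idxOdd m n a) • δ.map (M a c) := rfl

theorem SDer.map_entry (δ : SDer P b) (M : IndexMat m n (Currents m n))
    (a c : Fin (m + n)) : δ.map (M a c) = sg (b && idxOdd m n a) • δ.mat M a c := by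
  rw [mat_apply, smul_smul, sg_mul_self, one_smul]

theorem SDer.mat_sub (δ : SDer P b) (M M' : IndexMat m n (Currents m n)) :
    δ.mat (M - M') = δ.mat M - δ.mat M' := by
  ext1 a c; simp [mat_apply, smul_sub]

theorem SDer.mat_smul (δ : SDer P b) (z : ℂ)
    (M : IndexMat m n (Currents m n)) : δ.mat (z • M) = z • δ.mat M := by
  ext1 a c; simp [mat_apply, smul_comm z]

theorem SDer.mat_const (δ : SDer P b) (A : IndexMat m n ℂ) :
    δ.mat (constMat _ A) = 0 := by
  ext1 a c; simp [mat_apply, constMat, δ.map_algebraMap]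

/-- Moving `δ` past the entry `(a, d)` of an even matrix gives the sign of that unit, which turns
the row sign of `a` into the row sign of `d`. -/
theorem SDer.mat_mul (δ : SDer P b) {M M' : IndexMat m n (Currents m n)}
    (hM : ParMat false M) : δ.mat (M * M') = δ.mat M * M'.map P.hom + M.map P.hom * δ.mat M' := by
  ext1 a c
  simp only [mat_apply, Matrix.mul_apply, Matrix.add_apply, map_sum, δ.map_mul, Matrix.map_apply,
    Finset.smul_sum, ← Finset.sum_add_distrib, smul_add, smul_mul_assoc, mul_smul_comm]
  refine Finset.sum_congr rfl fun d _ => ?_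
  congr 1
  have h : IsPar (unitOdd m n) (unitOdd m n (a, d)) (M a d) := by
    have := hM a d
    rwa [Bool.false_xor] at this
  rw [h.tw_eq, map_smul, smul_mul_assoc, smul_smul, ← sg_xor]
  congr 2
  simp only [unitOdd]
  cases b <;> cases idxOdd m n a <;> cases idxOdd m n d <;> rfl

theorem SDer.mat_matDer (δ : SDer P b) (M : IndexMat m n (Currents m n)) :
    δ.mat (matDer M) = (δ.mat M).map P.nab := by
  ext1 a c
  simp [mat_apply, matDer, δ.map_der, der_eq]

theorem SDer.ext_mat {δ δ' : SDer P b} (h : δ.mat (curMat m n) = δ'.mat (curMat m n))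
    (x : Currents m n) : δ.map x = δ'.map x := by
  induction x using gen_induction (unitOdd m n) with
  | algebraMap c => rw [δ.map_algebraMap, δ'.map_algebraMap]
  | gen u =>
    obtain ⟨⟨a, c⟩, j⟩ := u
    induction j with
    | zero => rw [gen_zero_eq, map_smul, map_smul, δ.map_entry, δ'.map_entry, h]
    | succ j ih => rw [← totalDeriv_gen _ ((a, c), j), δ.map_der, δ'.map_der, ih]
  | add x y hx hy => rw [map_add, map_add, hx, hy]
  | mul x y hx hy => rw [δ.map_mul, δ'.map_mul, hx, hy]

/-- The composition of a superderivation with homomorphisms. -/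
def SDer.conj {φ : DHom m n (Currents m n)} (δ : SDer φ.pt b) (ρ ψ χ : DHom m n (Currents m n))
    (h : (ρ.comp φ).comp ψ = χ) : SDer χ.pt b where
  map := ρ.onX.toLinearMap ∘ₗ δ.map ∘ₗ ψ.hom.toLinearMap
  map_mul y z := by
    subst h
    simp only [LinearMap.comp_apply, AlgHom.toLinearMap_apply, _root_.map_mul, δ.map_mul, map_add,
      lamPt_hom, DHom.onX_C]
    congr 3
    have h : tw _ b (ψ.hom y) = ψ.hom (tw _ b y) := by
      cases b
      · rfl
      · exact (ψ.map_par y).symm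
    rw [h]; rfl
  map_der y := by
    simp only [LinearMap.comp_apply, AlgHom.toLinearMap_apply, ψ.map_der, der_eq, δ.map_der,
      lamPt_nab, DHom.onX_lamL]

theorem SDer.conj_map {φ : DHom m n (Currents m n)} (δ : SDer φ.pt b)
    (ρ ψ χ : DHom m n (Currents m n)) (h : (ρ.comp φ).comp ψ = χ) (x : Currents m n) :
    (δ.conj ρ ψ χ h).map x = ρ.onX (δ.map (ψ.hom x)) := rfl

end SuperDerivation


/-! ### The gauge variation of the current matrix -/

section GaugeAction

open Polynomial SuperAlg

variable {m n : ℕ} (k : ℂ)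

/-- Gauge parameters from a matrix. -/
def gaugeParam (b : Bool) (X : IndexMat m n (Currents m n)[X])
    (g : Fin (m + n) × Fin (m + n)) : (Currents m n)[X] :=
  (sg (!b && idxOdd m n g.1) * eps g.1 g.2) • X g.1 g.2

/-- The gauge variation with a matrix of parameters. -/
def actMat (P : Pt (unitOdd m n)) (b : Bool)
    (X : IndexMat m n (Currents m n)[X]) :
    Currents m n →ₗ[ℂ] (Currents m n)[X] :=
  P.act (affineBracket m n k) (gaugeParam b X)

variable {P : Pt (unitOdd m n)} {b : Bool}
  {X : IndexMat m n (Currents m n)[X]}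

theorem isParX_gaugeParam (hX : ParMat b X) (g : Fin (m + n) × Fin (m + n)) :
    IsParX (unitOdd m n) (xor b (unitOdd m n g)) (gaugeParam b X g) :=
  IsParX.smul (hX g.1 g.2) _

/-- The gauge variation is a superderivation. -/
def actSDer (P : Pt (unitOdd m n)) (hX : ParMat b X) : SDer P b where
  map := actMat k P b X
  map_mul := P.act_mul (affineBracket_isAffine k).par (isParX_gaugeParam hX)
  map_der := P.act_totalDeriv (affineBracket_isAffine k).par _

theorem actSDer_map (hX : ParMat b X) (y : Currents m n) :
    (actSDer k P hX).map y = actMat k P b X y := rfl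

/-- The signs in `curMat`, `gaugeParam` and `SDer.mat` are chosen so that all supersigns cancel and
the variation of `J` is the ordinary commutator with `X` plus the central term. -/
theorem actSDer_mat (hX : ParMat b X) :
    (actSDer k P hX).mat (curMat m n) =
      (curMat m n).map P.hom * X - X * (curMat m n).map P.hom + k • X.map P.nab := by
  ext1 d c
  have hB := affineBracket_isAffine (m := m) (n := n) k
  rw [SDer.mat_apply, actSDer_map, actMat, curMat_apply, map_smul, Pt.act_apply]
  simp only [genBr_gen, pow_zero, Module.End.one_apply, hB.subst_B, Matrix.add_apply,
    Matrix.sub_apply, Matrix.mul_apply, Matrix.smul_apply, Matrix.map_apply]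
  rw [Fintype.sum_prod_type]
  have comm (a e f g : Fin (m + n)) : X a e * P.hom (gen _ ((f, g), 0)) =
      sg (xor b (unitOdd m n (a, e)) && unitOdd m n (f, g)) • (P.hom (gen _ ((f, g), 0)) * X a e) := by
    have h : IsParX (unitOdd m n) (xor b (unitOdd m n (a, e))) (X a e) := hX a e
    rw [h.mul_comm, P.twX_hom, tw_gen, map_smul, smul_mul_assoc]
  -- `t1`, `t2` and `t3` are the contributions of the two halves of the supercommutator and of the
  -- central term; they become `J X`, `X J` and `k ∇X`.
  have t1 (a e : Fin (m + n)) : (sg (b && idxOdd m n d) * eps d c) • (gaugeParam b X (a, e) *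
      P.hom (kron m n e c • gen _ ((a, d), 0))) =
        kron m n e c • (P.hom (curMat m n d a) * X a c) := by
    by_cases hec : e = c
    · subst hec
      simp only [gaugeParam, map_smul, smul_mul_assoc, mul_smul_comm, comm, curMat_apply, smul_smul]
      congr 1
      simp only [eps, unitOdd]
      cases b <;> cases idxOdd m n a <;> cases idxOdd m n d <;> cases idxOdd m n e <;> simp
    · simp [kron, hec]
  have t2 (a e : Fin (m + n)) : (sg (b && idxOdd m n d) * eps d c) • (gaugeParam b X (a, e) *
      P.hom ((sg (unitOdd m n (a, e) && unitOdd m n (c, d)) * kron m n d a) •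
        gen _ ((c, e), 0))) = kron m n d a • (X d e * P.hom (curMat m n e c)) := by
    by_cases hda : d = a
    · subst hda
      simp only [gaugeParam, map_smul, smul_mul_assoc, mul_smul_comm, curMat_apply, smul_smul]
      congr 1
      simp only [eps, unitOdd]
      cases b <;> cases idxOdd m n c <;> cases idxOdd m n d <;> cases idxOdd m n e <;> simp
    · simp [kron, hda]
  have t3 (a e : Fin (m + n)) : (sg (b && idxOdd m n d) * eps d c) •
      affineOne m n k (a, e) (c, d) • P.nab (gaugeParam b X (a, e)) =
        (kron m n e c * kron m n d a) • (k • P.nab (X d c)) := by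
    by_cases hda : d = a
    · by_cases hec : e = c
      · subst hda hec
        simp only [gaugeParam, map_smul, smul_smul, affineOne, sgn_eq, eps]
        congr 1
        cases b <;> cases idxOdd m n e <;> cases idxOdd m n d <;> simp [kron]
      · simp [kron, affineOne, hec]
    · simp [kron, affineOne, hda]
  rw [smul_smul, Finset.smul_sum]
  simp only [Finset.smul_sum, smul_add, affineZero, map_sub, mul_sub, smul_sub, t1, t2, t3,
    Finset.sum_add_distrib, Finset.sum_sub_distrib]
  simp [kron, ite_smul, ite_and]

theorem gaugeParam_add (X' : IndexMat m n (Currents m n)[X]) :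
    gaugeParam b (X + X') = gaugeParam b X + gaugeParam b X' := by
  ext1 g; simp [gaugeParam]

theorem actMat_add (X' : IndexMat m n (Currents m n)[X]) (y : Currents m n) :
    actMat k P b (X + X') y = actMat k P b X y + actMat k P b X' y := by
  rw [actMat, gaugeParam_add, Pt.act_add_left]; rfl

theorem actMat_apply (y : Currents m n) : actMat k P b X y =
    ∑ g, P.subst (gaugeParam b X g) (genBr (unitOdd m n) (affineBracket m n k) g y) := by
  rw [actMat, Pt.act_apply]

/-- The matrix with prescribed gauge parameters. -/
def paramMat (b : Bool) (f : Fin (m + n) × Fin (m + n) → (Currents m n)[X]) :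
    IndexMat m n (Currents m n)[X] :=
  Matrix.of fun d c => (sg (!b && idxOdd m n d) * eps d c) • f (d, c)

theorem paramMat_apply (b : Bool) (f : Fin (m + n) × Fin (m + n) → (Currents m n)[X]) (d c) :
    paramMat b f d c = (sg (!b && idxOdd m n d) * eps d c) • f (d, c) := rfl

theorem gaugeParam_paramMat (b : Bool) (f : Fin (m + n) × Fin (m + n) → (Currents m n)[X]) :
    gaugeParam b (paramMat b f) = f := by
  ext1 g
  simp only [gaugeParam, paramMat_apply, smul_smul]
  rw [mul_mul_mul_comm, sg_mul_self, eps_mul_self, one_mul, one_smul]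

theorem parMat_paramMat (b : Bool) (f : Fin (m + n) × Fin (m + n) → (Currents m n)[X])
    (h : ∀ g, IsParX (unitOdd m n) (xor b (unitOdd m n g)) (f g)) : ParMat b (paramMat b f) :=
  fun d c => (h (d, c)).smul _

/-- The gradient of a polynomial, as a matrix of gauge parameters. -/
def gradMat (b : Bool) (x : Currents m n) :
    IndexMat m n (Currents m n)[X] :=
  paramMat b fun g => vgrad (unitOdd m n) g x

/-- The label `b` enters the gradient matrix and the action through the same signs, so it is
arbitrary here. It has to be the parity of `x` only when the action is used as a superderivation. -/
theorem lieBracket_eq_actMat (b : Bool) (x y : Currents m n) :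
    lieBracket m n k x y = actMat k (DHom.id m n).pt b (gradMat b x) y := by
  rw [lieBracket, bracket_eq_act, actMat, gradMat, gaugeParam_paramMat]; rfl

theorem parMat_gradMat {x : Currents m n} (h : IsPar (unitOdd m n) b x) :
    ParMat b (gradMat b x) :=
  parMat_paramMat b _ fun g => isParX_vgrad g h

theorem DHom.comp_id (φ : DHom m n (Currents m n)) : φ.comp (DHom.id m n) = φ := rfl

theorem onX_actMat (ρ φ : DHom m n (Currents m n)) (y : Currents m n) :
    ρ.onX (actMat k φ.pt b X y) = actMat k (ρ.comp φ).pt b (X.map ρ.onX) y := by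
  rw [actMat_apply, actMat_apply, map_sum]
  refine Finset.sum_congr rfl fun g _ => ?_
  rw [DHom.onX_subst]
  simp [gaugeParam]

theorem onX_lieBracket (ρ : DHom m n (Currents m n)) (b : Bool) (x y : Currents m n) :
    ρ.onX (lieBracket m n k x y) = actMat k ρ.pt b ((gradMat b x).map ρ.onX) y := by
  rw [lieBracket_eq_actMat k b, onX_actMat]; rfl

/-- The gauge parameters of a single generator. -/
def unitParam (d c : Fin (m + n)) : IndexMat m n (Currents m n)[X] :=
  paramMat (unitOdd m n (d, c)) (Pi.single (d, c) 1)

theorem parMat_unitParam (d c : Fin (m + n)) : ParMat (unitOdd m n (d, c)) (unitParam d c) := by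
  refine parMat_paramMat _ _ fun g => ?_
  by_cases h : g = (d, c)
  · rw [h, Bool.xor_self, Pi.single_eq_same]; exact isParX_one _
  · rw [Pi.single_eq_of_ne h]; exact isParX_zero _ _

theorem unitParam_apply_ne {d c a e : Fin (m + n)} (h : (a, e) ≠ (d, c)) :
    (unitParam d c : IndexMat m n (Currents m n)[X]) a e = 0 := by
  rw [unitParam, paramMat_apply, Pi.single_eq_of_ne h, smul_zero]

theorem onX_genBr (ρ : DHom m n (Currents m n)) (d c : Fin (m + n)) (y : Currents m n) :
    ρ.onX (genBr (unitOdd m n) (affineBracket m n k) (d, c) y) =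
      actMat k ρ.pt (unitOdd m n (d, c)) (unitParam d c) y := by
  rw [actMat_apply, unitParam, gaugeParam_paramMat, Finset.sum_eq_single (d, c)]
  · rw [Pi.single_eq_same]
    have := DHom.onX_subst ρ (DHom.id m n) 1 (genBr _ (affineBracket m n k) (d, c) y)
    rw [map_one, DHom.comp_id] at this
    rw [← this]
    exact congrArg _ (idPt_subst_one _).symm
  · intro g _ hg
    rw [Pi.single_eq_of_ne hg, Pt.subst_zero_left]
  · simp

end GaugeAction


/-! ### Restriction to affine subspaces, and the currents of supertrace zero -/

section AffineSlices

open Polynomial SuperAlg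

variable {m n : ℕ} {N : Type} [Ring N] [Algebra ℂ N]

/-- An affine subspace `base + range proj` of the space of matrices. -/
structure AffSlice (m n : ℕ) where
  /-- the base point -/
  base : IndexMat m n ℂ
  /-- the projection to the directions -/
  proj : IndexMat m n ℂ →ₗ[ℂ] IndexMat m n ℂ
  base_even : IsEvenMat base
  proj_base : proj base = 0
  proj_proj : ∀ A, proj (proj A) = proj A
  proj_one : proj 1 = 1
  proj_par : ∀ a b c d, proj (Matrix.single c d 1) a b ≠ 0 → unitOdd m n (a, b) = unitOdd m n (c, d)

/-- A linear operator on matrices, with entries in an algebra. -/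
def onMat (π : IndexMat m n ℂ →ₗ[ℂ] IndexMat m n ℂ)
    (M : IndexMat m n N) : IndexMat m n N :=
  Matrix.of fun a b => ∑ c, ∑ d, π (Matrix.single c d 1) a b • M c d

variable (π π' : IndexMat m n ℂ →ₗ[ℂ] IndexMat m n ℂ)

theorem onMat_apply (M : IndexMat m n N) (a b : Fin (m + n)) :
    onMat π M a b = ∑ c, ∑ d, π (Matrix.single c d 1) a b • M c d := rfl

theorem map_matrix_apply (A : IndexMat m n ℂ) (a b : Fin (m + n)) :
    π A a b = ∑ c, ∑ d, A c d * π (Matrix.single c d 1) a b := by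
  conv_lhs => rw [Matrix.matrix_eq_sum_single A]
  simp only [map_sum, Matrix.sum_apply]
  refine Finset.sum_congr rfl fun c _ => Finset.sum_congr rfl fun d _ => ?_
  have : Matrix.single c d (A c d) = A c d • Matrix.single c d (1 : ℂ) := by simp
  rw [this, map_smul, Matrix.smul_apply, smul_eq_mul]

theorem onMat_add (M M' : IndexMat m n N) :
    onMat π (M + M') = onMat π M + onMat π M' := by
  ext a b; simp only [onMat_apply, Matrix.add_apply, smul_add, Finset.sum_add_distrib]

theorem onMat_sub (M M' : IndexMat m n N) :
    onMat π (M - M') = onMat π M - onMat π M' := by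
  ext a b; simp only [onMat_apply, Matrix.sub_apply, smul_sub, Finset.sum_sub_distrib]

theorem onMat_const (A : IndexMat m n ℂ) :
    onMat π (constMat N A) = constMat N (π A) := by
  ext a b
  rw [onMat_apply, constMat_apply, map_matrix_apply, map_sum]
  refine Finset.sum_congr rfl fun c _ => ?_
  rw [map_sum]
  refine Finset.sum_congr rfl fun d _ => ?_
  rw [constMat_apply, Algebra.smul_def, ← map_mul, mul_comm]

theorem onMat_smul_const (x : N) (A : IndexMat m n ℂ) :
    onMat π (Matrix.of fun a b => A a b • x) = Matrix.of fun a b => π A a b • x := by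
  ext a b
  simp only [onMat_apply, Matrix.of_apply, map_matrix_apply π A a b, Finset.sum_smul, smul_smul]
  simp only [mul_comm]

theorem onMat_sum {ι : Type*} (s : Finset ι) (M : ι → IndexMat m n N) :
    onMat π (∑ i ∈ s, M i) = ∑ i ∈ s, onMat π (M i) := by
  classical
  induction s using Finset.induction_on with
  | empty => ext a b; simp [onMat_apply]
  | insert i s hi ih => rw [Finset.sum_insert hi, Finset.sum_insert hi, onMat_add, ih]

theorem onMat_eq_sum (M : IndexMat m n N) :
    onMat π M = ∑ c, ∑ d, Matrix.of fun a b => π (Matrix.single c d 1) a b • M c d := by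
  ext a b; simp only [onMat_apply, Matrix.sum_apply, Matrix.of_apply]

theorem onMat_onMat (M : IndexMat m n N) :
    onMat π (onMat π' M) = onMat (π ∘ₗ π') M := by
  conv_lhs => rw [onMat_eq_sum π' M]
  rw [onMat_sum, onMat_eq_sum (π ∘ₗ π')]
  simp only [onMat_sum, onMat_smul_const]; rfl

theorem onMat_map {N' : Type} [Ring N'] [Algebra ℂ N'] (f : N →ₗ[ℂ] N')
    (M : IndexMat m n N) : (onMat π M).map f = onMat π (M.map f) := by
  ext a b; simp [onMat_apply]

theorem DHom.mat_onMat [SuperAlg N] (φ : DHom m n N)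
    (M : IndexMat m n (Currents m n)) :
    φ.mat (onMat π M) = onMat π (φ.mat M) := onMat_map π φ.hom.toLinearMap M

/-- The operator that keeps some of the entries. -/
def maskMap (S : Fin (m + n) → Fin (m + n) → Prop) [∀ a b, Decidable (S a b)] :
    IndexMat m n ℂ →ₗ[ℂ] IndexMat m n ℂ where
  toFun A := Matrix.of fun a b => if S a b then A a b else 0
  map_add' A B := by ext a b; by_cases h : S a b <;> simp [h]
  map_smul' c A := by ext a b; by_cases h : S a b <;> simp [h]

theorem maskMap_apply (S : Fin (m + n) → Fin (m + n) → Prop) [∀ a b, Decidable (S a b)] (A a b) :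
    maskMap S A a b = if S a b then A a b else 0 := rfl

theorem onMat_entry {π : IndexMat m n ℂ →ₗ[ℂ]
    IndexMat m n ℂ} {a b : Fin (m + n)} {z : ℂ}
    (h : ∀ A, π A a b = z * A a b)
    (M : IndexMat m n N) : onMat π M a b = z • M a b := by
  rw [onMat_apply, Finset.sum_eq_single a, Finset.sum_eq_single b]
  · rw [h, Matrix.single_apply_same, mul_one]
  · intro d _ hd
    rw [h, Matrix.single_apply, if_neg fun e => hd e.2, mul_zero, zero_smul]
  · simp
  · intro c _ hc
    refine Finset.sum_eq_zero fun d _ => ?_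
    rw [h, Matrix.single_apply, if_neg fun e => hc e.1, mul_zero, zero_smul]
  · simp

variable (S : AffSlice m n)

theorem AffSlice.parMat_onMat [SuperAlg N] {c : Bool} {M : IndexMat m n N}
    (h : ParMat c M) : ParMat c (onMat S.proj M) := fun a b => by
  simp only [onMat_apply, map_sum, Finset.smul_sum]
  refine Finset.sum_congr rfl fun e _ => Finset.sum_congr rfl fun d _ => ?_
  by_cases he : S.proj (Matrix.single e d 1) a b = 0
  · simp [he]
  · rw [map_smul, h, S.proj_par _ _ _ _ he, smul_comm]

theorem AffSlice.parMat_rho :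
    ParMat false (constMat (Currents m n) S.base + onMat S.proj (curMat m n)) :=
  (parMat_const S.base_even).add (S.parMat_onMat parMat_curMat)

/-- Restriction to the affine subspace, as an endomorphism of the currents. -/
def AffSlice.rho : DHom m n (Currents m n) := evalHom S.parMat_rho

theorem AffSlice.rho_mat :
    S.rho.mat (curMat m n) = constMat _ S.base + onMat S.proj (curMat m n) := evalHom_mat _

theorem AffSlice.comp_rho_mat [SuperAlg N] (φ : DHom m n N) :
    (φ.comp S.rho).mat (curMat m n) = constMat _ S.base + onMat S.proj (φ.mat (curMat m n)) := by
  rw [DHom.comp_mat, S.rho_mat, φ.mat_add, φ.mat_const, φ.mat_onMat]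

theorem AffSlice.comp_rho_eq [SuperAlg N] {φ : DHom m n N}
    (h : φ.mat (curMat m n) = constMat _ S.base + onMat S.proj (φ.mat (curMat m n))) :
    φ.comp S.rho = φ := DHom.ext_mat (by rw [S.comp_rho_mat, ← h])

/-- The hypotheses say that `S'` is contained in `S`, so restricting to `S` first changes nothing.
-/
theorem AffSlice.rho_comp_rho {S S' : AffSlice m n} (h : S.proj ∘ₗ S'.proj = S'.proj)
    (hb : S.base + S.proj S'.base = S'.base) : S'.rho.comp S.rho = S'.rho := by
  refine S.comp_rho_eq ?_
  rw [S'.rho_mat, onMat_add, onMat_onMat, onMat_const, h, ← add_assoc]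
  congr 1
  conv_lhs => rw [← hb]
  ext a b; simp [constMat]

theorem AffSlice.rho_rho (x : Currents m n) : S.rho.hom (S.rho.hom x) = S.rho.hom x := by
  have h := AffSlice.rho_comp_rho (S := S) (S' := S) (LinearMap.ext S.proj_proj)
    (by rw [S.proj_base, add_zero])
  rw [← DHom.comp_apply, h]

/-! ### The currents of supertrace zero -/

/-- The pairing of a matrix with a matrix of constants. -/
def pair (M : IndexMat m n N) (A : IndexMat m n ℂ) : N :=
  ∑ a, ∑ b, (A a b * eps a b) • M b a

theorem current_eq_pair (A : IndexMat m n ℂ) :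
    current m n A 0 = pair (curMat m n) A := by
  unfold current pair
  refine Finset.sum_congr rfl fun a _ => Finset.sum_congr rfl fun b _ => ?_
  rw [gen_zero_eq, smul_smul, eps_comm]

theorem current_succ (A : IndexMat m n ℂ) (j : ℕ) :
    totalDeriv _ (current m n A j) = current m n A (j + 1) := by
  simp only [current, map_sum, map_smul, totalDeriv_gen]

theorem pair_add (M M' : IndexMat m n N) (A) :
    pair (M + M') A = pair M A + pair M' A := by
  simp only [pair, Matrix.add_apply, smul_add, Finset.sum_add_distrib]

theorem pair_sub (M M' : IndexMat m n N) (A) :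
    pair (M - M') A = pair M A - pair M' A := by
  simp only [pair, Matrix.sub_apply, smul_sub, Finset.sum_sub_distrib]

theorem pair_sub_right (M : IndexMat m n N) (A A') :
    pair M (A - A') = pair M A - pair M A' := by
  simp only [pair, Matrix.sub_apply, sub_mul, sub_smul, Finset.sum_sub_distrib]

theorem current_sub (A A' : IndexMat m n ℂ) :
    current m n (A - A') 0 = current m n A 0 - current m n A' 0 := by
  simp only [current_eq_pair, pair_sub_right]

theorem pair_diagonal (x : N) (A : IndexMat m n ℂ) :
    pair (Matrix.diagonal fun _ => x) A = str m n A • x := by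
  unfold pair str
  rw [Finset.sum_smul]
  refine Finset.sum_congr rfl fun a _ => ?_
  rw [Finset.sum_eq_single a]
  · rw [Matrix.diagonal_apply_eq, eps_self, mul_comm]
  · intro b _ hb
    rw [Matrix.diagonal_apply_ne _ hb, smul_zero]
  · simp

theorem pair_const {E : IndexMat m n ℂ} (hE : IsEvenMat E)
    (A : IndexMat m n ℂ) :
    pair (constMat N E) A = algebraMap ℂ N (str m n (E * A)) := by
  unfold pair str
  simp only [Matrix.mul_apply, Finset.mul_sum, map_sum]
  rw [Finset.sum_comm]
  refine Finset.sum_congr rfl fun b _ => Finset.sum_congr rfl fun a _ => ?_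
  rw [constMat_apply, Algebra.smul_def, ← map_mul]
  congr 1
  by_cases h : E b a = 0
  · simp [h]
  · have h1 : idxOdd m n a = idxOdd m n b := by
      have := hE b a h
      simp only [unitOdd] at this
      revert this; cases idxOdd m n a <;> cases idxOdd m n b <;> simp
    have : eps a b = sgn m n b := by rw [sgn_eq, eps, h1, Bool.and_self]
    rw [this]; ring

theorem DHom.map_current_zero [SuperAlg N] (φ : DHom m n N) (A : IndexMat m n ℂ) :
    φ.hom (current m n A 0) = pair (φ.mat (curMat m n)) A := by
  rw [current_eq_pair]
  simp only [pair, map_sum, map_smul]; rfl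

/-- The adjoint of an operator on matrices. -/
def dualMat (π : IndexMat m n ℂ →ₗ[ℂ] IndexMat m n ℂ)
    (A : IndexMat m n ℂ) : IndexMat m n ℂ :=
  Matrix.of fun c d => eps c d * pair (π (Matrix.single d c 1)) A

theorem sum_sum_comm {ι M : Type*} [Fintype ι] [AddCommMonoid M] (f : ι → ι → ι → ι → M) :
    ∑ a, ∑ b, ∑ c, ∑ d, f a b c d = ∑ c, ∑ d, ∑ a, ∑ b, f a b c d :=
  calc
    _ = ∑ a, ∑ c, ∑ b, ∑ d, f a b c d := Finset.sum_congr rfl fun a _ => Finset.sum_comm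
    _ = ∑ c, ∑ a, ∑ b, ∑ d, f a b c d := Finset.sum_comm
    _ = ∑ c, ∑ a, ∑ d, ∑ b, f a b c d :=
      Finset.sum_congr rfl fun c _ => Finset.sum_congr rfl fun a _ => Finset.sum_comm
    _ = _ := Finset.sum_congr rfl fun c _ => Finset.sum_comm

theorem pair_onMat (M : IndexMat m n N)
    (A : IndexMat m n ℂ) :
    pair (onMat π M) A = pair M (dualMat π A) := by
  have h (d c : Fin (m + n)) : (dualMat π A c d * eps c d) • M d c =
      ∑ a, ∑ b, (A a b * eps a b) • π (Matrix.single d c 1) b a • M d c := by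
    simp only [smul_smul, ← Finset.sum_smul]
    congr 1
    rw [dualMat, Matrix.of_apply, mul_right_comm, eps_mul_self, one_mul]; rfl
  have e : pair M (dualMat π A) = ∑ d, ∑ c, (dualMat π A c d * eps c d) • M d c :=
    Finset.sum_comm
  rw [e]
  simp only [h]
  unfold pair
  simp only [onMat_apply, Finset.smul_sum]
  exact sum_sum_comm _

/-- The subalgebra of the currents of supertrace zero. -/
def slAlg (m n : ℕ) : Subalgebra ℂ (Currents m n) :=
  Algebra.adjoin ℂ {x | ∃ A j, str m n A = 0 ∧ x = current m n A j}

theorem current_mem_sl {A : IndexMat m n ℂ} (h : str m n A = 0) (j : ℕ) :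
    current m n A j ∈ slAlg m n := Algebra.subset_adjoin ⟨A, j, h, rfl⟩

theorem totalDeriv_mem_sl {x : Currents m n} (hx : x ∈ slAlg m n) :
    totalDeriv _ x ∈ slAlg m n := by
  induction hx using Algebra.adjoin_induction with
  | mem x hx => 
    obtain ⟨A, j, hA, rfl⟩ := hx
    rw [current_succ]; exact current_mem_sl hA _
  | algebraMap c => rw [totalDeriv_algebraMap]; exact zero_mem _
  | add x y _ _ hx hy => rw [map_add]; exact add_mem hx hy
  | mul x y hx' hy' hx hy =>
    rw [totalDeriv_mul]; exact add_mem (mul_mem hx hy') (mul_mem hx' hy)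

/-- The matrix differs from a multiple of the identity by a matrix over `slAlg`. -/
def IsSlMat (Y : IndexMat m n (Currents m n)) : Prop :=
  ∃ c : Currents m n, parity _ c = c ∧ ∀ a b,
    (Y - Matrix.diagonal (fun _ => c) : IndexMat m n (Currents m n)) a b ∈
      slAlg m n

theorem pair_mem_sl {M : IndexMat m n (Currents m n)}
    (h : ∀ a b, M a b ∈ slAlg m n) (A) : pair M A ∈ slAlg m n :=
  sum_mem fun a _ => sum_mem fun b _ => Subalgebra.smul_mem _ (h b a) _

/-- A current of supertrace zero does not see multiples of the identity in the current matrix. -/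
theorem DHom.mem_sl {φ : DHom m n (Currents m n)} (h : IsSlMat (φ.mat (curMat m n)))
    {x : Currents m n} (hx : x ∈ slAlg m n) : φ.hom x ∈ slAlg m n := by
  induction hx using Algebra.adjoin_induction with
  | mem x hx => 
    obtain ⟨A, j, hA, rfl⟩ := hx
    induction j with
    | zero =>
      obtain ⟨c, -, hc⟩ := h
      have := pair_mem_sl hc A
      rwa [pair_sub, pair_diagonal, hA, zero_smul, sub_zero, ← φ.map_current_zero] at this
    | succ j ih => rw [← current_succ, φ.map_der]; exact totalDeriv_mem_sl ih
  | algebraMap c => rw [AlgHom.commutes]; exact algebraMap_mem _ _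
  | add x y _ _ hx hy => rw [map_add]; exact add_mem hx hy
  | mul x y hx' hy' hx hy => rw [map_mul]; exact mul_mem hx hy

theorem parity_mem_sl {x : Currents m n} (hx : x ∈ slAlg m n) : parity _ x ∈ slAlg m n := by
  induction hx using Algebra.adjoin_induction with
  | mem x hx => 
    obtain ⟨A, j, hA, rfl⟩ := hx
    have : parity _ (current m n A j) =
        current m n (Matrix.of fun a b => sg (unitOdd m n (a, b)) * A a b) j := by
      simp only [current, map_sum, map_smul, Matrix.of_apply]
      refine Finset.sum_congr rfl fun a _ => Finset.sum_congr rfl fun b _ => ?_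
      rw [← tw_true, tw_gen, Bool.true_and, smul_smul, mul_comm]
    rw [this]
    refine current_mem_sl ?_ _
    rw [← hA]
    refine Finset.sum_congr rfl fun a _ => ?_
    simp [unitOdd]
  | algebraMap c => rw [AlgHom.commutes]; exact algebraMap_mem _ _
  | add x y _ _ hx hy => rw [map_add]; exact add_mem hx hy
  | mul x y hx' hy' hx hy => rw [map_mul]; exact mul_mem hx hy

theorem current_single (a b : Fin (m + n)) (j : ℕ) (z : ℂ) :
    current m n (Matrix.single a b z) j = z • gen _ ((a, b), j) := by
  unfold current
  rw [Finset.sum_eq_single a, Finset.sum_eq_single b]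
  · rw [Matrix.single_apply_same]
  · intro d _ hd
    rw [Matrix.single_apply, if_neg fun e => hd e.2.symm, zero_smul]
  · simp
  · intro c _ hc
    refine Finset.sum_eq_zero fun d _ => ?_
    rw [Matrix.single_apply, if_neg fun e => hc e.1.symm, zero_smul]
  · simp

theorem gen_mem_sl {a b : Fin (m + n)} (h : a ≠ b) (j : ℕ) :
    gen _ ((a, b), j) ∈ slAlg m n := by
  have := current_mem_sl (m := m) (n := n) (A := Matrix.single a b 1) ?_ j
  · rwa [current_single, one_smul] at this
  · refine Finset.sum_eq_zero fun c _ => ?_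
    rw [Matrix.single_apply, if_neg, mul_zero]
    rintro ⟨rfl, rfl⟩; exact h rfl

/-- The multiple of the identity split off is the trace of `J` divided by `m + n`; unlike the
supertrace this also works for `m = n`. -/
theorem isSlMat_curMat : IsSlMat (curMat m n) := by
  refine ⟨((m + n : ℕ) : ℂ)⁻¹ • ∑ c, sgn m n c • gen _ ((c, c), 0), ?_, fun a b => ?_⟩
  · simp only [map_smul, map_sum]
    congr 1
    refine Finset.sum_congr rfl fun c _ => ?_
    rw [← tw_true, tw_gen]
    simp [unitOdd]
  by_cases hab : a = b
  · subst hab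
    have hne : ((m + n : ℕ) : ℂ) ≠ 0 := by
      have := a.pos
      exact_mod_cast this.ne'
    have h := current_mem_sl (m := m) (n := n) (A := Matrix.single a a (sgn m n a) -
      Matrix.diagonal fun c => ((m + n : ℕ) : ℂ)⁻¹ * sgn m n c) ?_ 0
    · rw [current_sub, current_single] at h
      rw [Matrix.sub_apply, curMat_apply, eps_self, Matrix.diagonal_apply_eq]
      convert h using 2
      unfold current
      rw [Finset.smul_sum]
      refine Finset.sum_congr rfl fun c _ => ?_
      rw [Finset.sum_eq_single c]
      · rw [Matrix.diagonal_apply_eq, smul_smul]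
      · intro d _ hd
        rw [Matrix.diagonal_apply_ne' _ hd, zero_smul]
      · simp
    · unfold str
      simp only [Matrix.sub_apply, mul_sub, Finset.sum_sub_distrib, Matrix.diagonal_apply_eq]
      have h1 (c : Fin (m + n)) : sgn m n c * (((m + n : ℕ) : ℂ)⁻¹ * sgn m n c) =
          ((m + n : ℕ) : ℂ)⁻¹ := by rw [mul_left_comm, sgn_mul_self, mul_one]
      rw [Finset.sum_congr rfl fun c _ => h1 c, Finset.sum_const, Finset.card_univ,
        Fintype.card_fin, nsmul_eq_mul, mul_inv_cancel₀ hne, Finset.sum_eq_single a]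
      · rw [Matrix.single_apply_same, sgn_mul_self, sub_self]
      · intro b _ hb
        rw [Matrix.single_apply, if_neg fun e => hb e.1.symm, mul_zero]
      · simp
  · rw [Matrix.sub_apply, Matrix.diagonal_apply_ne _ hab, sub_zero, curMat_apply]
    exact Subalgebra.smul_mem _ (gen_mem_sl (Ne.symm hab) 0) _

theorem onMat_mem_sl {M : IndexMat m n (Currents m n)}
    (h : ∀ a b, M a b ∈ slAlg m n) (a b) : onMat π M a b ∈ slAlg m n := by
  rw [onMat_apply]
  exact sum_mem fun c _ => sum_mem fun d _ => Subalgebra.smul_mem _ (h c d) _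

theorem AffSlice.onMat_diagonal (x : N) :
    onMat S.proj (Matrix.diagonal fun _ => x) = Matrix.diagonal fun _ => x := by
  have : (Matrix.diagonal fun _ => x : IndexMat m n N) =
      Matrix.of fun a b => (1 : IndexMat m n ℂ) a b • x := by
    ext a b
    by_cases h : a = b <;> simp [h]
  rw [this, onMat_smul_const, S.proj_one]

/-- Uses that the projection of an `AffSlice` fixes the identity. -/
theorem AffSlice.isSlMat_rho : IsSlMat (S.rho.mat (curMat m n)) := by
  obtain ⟨c, hc0, hc⟩ := isSlMat_curMat (m := m) (n := n)
  refine ⟨c, hc0, fun a b => ?_⟩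
  rw [S.rho_mat, ← S.onMat_diagonal c, add_sub_assoc, ← onMat_sub]
  exact add_mem (algebraMap_mem _ _) (onMat_mem_sl _ hc a b)

theorem AffSlice.rho_mem_sl {x : Currents m n} (hx : x ∈ slAlg m n) : S.rho.hom x ∈ slAlg m n :=
  DHom.mem_sl S.isSlMat_rho hx

theorem AffSlice.str_dualMat {A : IndexMat m n ℂ} (h : str m n A = 0) :
    str m n (dualMat S.proj A) = 0 := by
  have := pair_onMat S.proj (Matrix.diagonal fun _ => (1 : ℂ)) A
  rw [S.onMat_diagonal, pair_diagonal, pair_diagonal, h] at this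
  simpa using this.symm

/-- The kernel is a differential ideal containing `C`. Conversely `x - ρ(x)` lies in the ideal
generated by `C`: for currents this is `h2`, and the property passes to derivatives, sums and
products. -/
theorem AffSlice.diffIdeal_eq {C : Set (Currents m n)}
    (h1 : ∀ x ∈ C, x ∈ slAlg m n ∧ S.rho.hom x = 0)
    (h2 : ∀ A, str m n A = 0 → current m n (A - dualMat S.proj A) 0 -
      algebraMap ℂ _ (str m n (S.base * A)) ∈ C) (x : Currents m n) :
    x ∈ (affineSl m n).diffIdeal C ↔ x ∈ slAlg m n ∧ S.rho.hom x = 0 := by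
  constructor
  · intro hx
    let I : Submodule ℂ (Currents m n) := Subalgebra.toSubmodule (slAlg m n) ⊓
      LinearMap.ker S.rho.hom.toLinearMap
    have hI : x ∈ I := by
      refine Submodule.mem_sInf.1 hx I ⟨?_, fun y hy => ⟨(h1 y hy).1, (h1 y hy).2⟩, ?_, ?_⟩
      · rintro y ⟨-, hy⟩
        rw [show y = 0 from hy]; exact zero_mem _
      · rintro y ⟨hy, hy'⟩
        refine ⟨totalDeriv_mem_sl hy, ?_⟩
        change S.rho.hom _ = 0
        rw [S.rho.map_der, show S.rho.hom y = 0 from hy', map_zero]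
      · rintro y ⟨hy, hy'⟩ z hz
        have h0 : S.rho.hom y = 0 := hy'
        have hy : y ∈ slAlg m n := hy
        refine ⟨⟨(slAlg m n).mul_mem hy hz, ?_⟩, ⟨(slAlg m n).mul_mem hz hy, ?_⟩⟩ <;> change S.rho.hom _ = 0 <;> simp [h0]
    exact ⟨hI.1, hI.2⟩
  · rintro ⟨hx, hx'⟩
    suffices h : x - S.rho.hom x ∈ (affineSl m n).diffIdeal C by rwa [hx', sub_zero] at h
    clear hx'
    refine Submodule.mem_sInf.2 fun I hI => ?_
    obtain ⟨-, hC, hd, hm⟩ := hI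
    induction hx using Algebra.adjoin_induction with
    | mem x hx =>
      obtain ⟨A, j, hA, rfl⟩ := hx
      induction j with
      | zero =>
        have := hC (h2 A hA)
        rwa [current_sub, current_eq_pair (dualMat _ _), ← pair_onMat, ← pair_const S.base_even,
          sub_sub, add_comm (pair _ _), ← pair_add, ← S.rho_mat, ← S.rho.map_current_zero] at this
      | succ j ih => 
        have := hd _ ih
        rwa [map_sub, ← der_eq _ (S.rho.hom _), ← S.rho.map_der, current_succ] at this
    | algebraMap c => rw [AlgHom.commutes, sub_self]; exact zero_mem _
    | add x y _ _ hx hy =>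
      rw [map_add, add_sub_add_comm]; exact add_mem hx hy
    | mul x y hx' hy' hx hy =>
      have : x * y - S.rho.hom (x * y) = (x - S.rho.hom x) * y +
          S.rho.hom x * (y - S.rho.hom y) := by
        rw [map_mul]; noncomm_ring
      rw [this]
      exact add_mem (hm _ hx _ hy').1 (hm _ hy _ (S.rho_mem_sl hx')).2

end AffineSlices


/-! ### Gradients and derivations under restriction -/

section ChainRule

open Polynomial SuperAlg

variable {m n : ℕ} (S : AffSlice m n)

theorem AffSlice.rho_gen (a b : Fin (m + n)) (j : ℕ) : ∃ c0 : ℂ,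
    S.rho.hom (gen _ ((b, a), j)) = algebraMap ℂ _ c0 + ∑ c, ∑ d,
      (eps a b * eps c d * S.proj (Matrix.single c d 1) a b) • gen (unitOdd m n) ((d, c), j) := by
  induction j with
  | zero =>
    refine ⟨eps a b * S.base a b, ?_⟩
    rw [gen_zero_eq, map_smul, ← S.rho.mat_apply, S.rho_mat, Matrix.add_apply, constMat_apply,
      onMat_apply, smul_add, Algebra.smul_def, ← map_mul, Finset.smul_sum]
    congr 1
    refine Finset.sum_congr rfl fun c _ => ?_
    rw [Finset.smul_sum]
    refine Finset.sum_congr rfl fun d _ => ?_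
    rw [curMat_apply, smul_smul, smul_smul]
    congr 1; ring
  | succ j ih =>
    obtain ⟨c0, h⟩ := ih
    refine ⟨0, ?_⟩
    rw [← totalDeriv_gen _ ((b, a), j), S.rho.map_der, h, der_eq, map_add, totalDeriv_algebraMap,
      map_zero]
    simp only [map_sum, map_smul, totalDeriv_gen]

/-- The chain rule for an affine substitution, which has constant coefficients and preserves
parities. -/
theorem AffSlice.rightGrad_rho (x : Currents m n) (c d : Fin (m + n)) (j : ℕ) :
    rightGrad _ (S.rho.hom x) ((d, c), j) = ∑ a, ∑ b,
      (eps a b * eps c d * S.proj (Matrix.single c d 1) a b) •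
        S.rho.hom (rightGrad _ x ((b, a), j)) := by
  induction x using gen_induction (unitOdd m n) with
  | algebraMap c => simp [AlgHom.commutes]
  | gen u =>
    obtain ⟨⟨b, a⟩, i⟩ := u
    obtain ⟨c0, h⟩ := S.rho_gen a b i
    rw [h]
    simp only [map_add, map_sum, map_smul, rightGrad_algebraMap, rightGrad_gen, zero_add,
      Finsupp.finsetSum_apply, Finsupp.smul_apply, Finsupp.single_apply, Prod.mk.injEq, ite_and]
    by_cases hij : i = j
    · subst hij
      rw [Finset.sum_eq_single c, Finset.sum_eq_single d, Finset.sum_eq_single a,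
        Finset.sum_eq_single b]
      · simp
      · intro b' _ hb; simp [hb.symm]
      · simp
      · intro a' _ ha; simp [ha.symm]
      · simp
      · intro b' _ hb; simp [hb]
      · simp
      · intro a' _ ha; simp [ha]
      · simp
    · simp [hij]
  | add x y hx hy =>
    simp only [map_add, Finsupp.add_apply, hx, hy, smul_add, Finset.sum_add_distrib]
  | mul x y hx hy =>
    simp only [map_mul, rightGrad_mul, hx, hy, map_add, smul_add, Finset.sum_add_distrib,
      Finset.mul_sum, Finset.sum_mul, mul_smul_comm, smul_mul_assoc]
    congr 1
    refine Finset.sum_congr rfl fun a _ => Finset.sum_congr rfl fun b _ => ?_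
    by_cases h : S.proj (Matrix.single c d 1) a b = 0
    · simp [h]
    · have hp : unitOdd m n (b, a) = unitOdd m n (d, c) := by
        rw [unitOdd_comm b a, S.proj_par _ _ _ _ h, unitOdd_comm]
      simp only [hp]
      congr 2
      cases unitOdd m n (d, c)
      · rfl
      · exact (S.rho.map_par y).symm

theorem exists_vgrad_eq (x : Currents m n) : ∃ J : ℕ, ∀ g, vgrad (unitOdd m n) g x =
    ∑ j ∈ Finset.range J, (-1 : ℂ) ^ j • (lamL _ ^ j) (C (rightGrad _ x (g, j))) := by
  classical
  refine ⟨(rightGrad _ x).support.sup (fun u => u.2 + 1), fun g => ?_⟩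
  rw [vgrad_apply, sum_eq_of_support_subset _
    (Finset.univ ×ˢ Finset.range ((rightGrad _ x).support.sup (fun u => u.2 + 1)))]
  · rw [Finset.sum_product, Finset.sum_eq_single g]
    · simp
    · intro g' _ hg; simp [hg]
    · simp
  · intro u hu
    simp only [Finset.mem_product, Finset.mem_univ, true_and, Finset.mem_range]
    exact Nat.lt_of_succ_le (Finset.le_sup (f := fun u : _ × ℕ => u.2 + 1) hu)
  · intro u; simp

/-- A function that vanishes on the affine subspace has zero derivative along its directions: the
gradient is orthogonal to the subspace. -/
theorem AffSlice.sum_vgrad {x : Currents m n} (hx : S.rho.hom x = 0)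
    {v : IndexMat m n ℂ} (hv : S.proj v = v) :
    ∑ a, ∑ b, (eps a b * v a b) • S.rho.onX (vgrad _ (b, a) x) = 0 := by
  have h1 (j : ℕ) : ∑ a, ∑ b, (eps a b * v a b) • S.rho.hom (rightGrad _ x ((b, a), j)) = 0 := by
    have h2 (a b : Fin (m + n)) : eps a b * v a b = ∑ c, ∑ d, (eps c d * v c d) *
        (eps a b * eps c d * S.proj (Matrix.single c d 1) a b) := by
      conv_lhs => rw [← hv, map_matrix_apply]
      simp only [Finset.mul_sum]
      refine Finset.sum_congr rfl fun c _ => Finset.sum_congr rfl fun d _ => ?_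
      have := eps_mul_self c d
      linear_combination (-eps a b * v c d * S.proj (Matrix.single c d 1) a b) * this
    trans ∑ a, ∑ b, ∑ c, ∑ d, ((eps c d * v c d) *
        (eps a b * eps c d * S.proj (Matrix.single c d 1) a b)) •
          S.rho.hom (rightGrad _ x ((b, a), j))
    · refine Finset.sum_congr rfl fun a _ => Finset.sum_congr rfl fun b _ => ?_
      rw [h2 a b]
      simp only [Finset.sum_smul]
    rw [sum_sum_comm]
    refine Finset.sum_eq_zero fun c _ => Finset.sum_eq_zero fun d _ => ?_
    trans (eps c d * v c d) • rightGrad _ (S.rho.hom x) ((d, c), j)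
    · rw [S.rightGrad_rho, Finset.smul_sum]
      refine Finset.sum_congr rfl fun a _ => ?_
      rw [Finset.smul_sum]
      exact Finset.sum_congr rfl fun b _ => mul_smul _ _ _
    · rw [hx, map_zero, Finsupp.zero_apply, smul_zero]
  obtain ⟨J, hJ⟩ := exists_vgrad_eq x
  simp only [hJ, map_sum, map_smul, DHom.onX_lamL_pow, DHom.onX_C, Finset.smul_sum]
  rw [Finset.sum_congr rfl fun a _ => Finset.sum_comm, Finset.sum_comm]
  refine Finset.sum_eq_zero fun j _ => ?_
  trans (-1 : ℂ) ^ j • (lamL _ ^ j) (C (∑ a, ∑ b, (eps a b * v a b) •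
    S.rho.hom (rightGrad _ x ((b, a), j))))
  · simp only [map_sum, ← smul_C, map_smul, Finset.smul_sum]
    exact Finset.sum_congr rfl fun a _ => Finset.sum_congr rfl fun b _ => smul_comm _ _ _
  · rw [h1, map_zero, map_zero, smul_zero]

theorem AffSlice.sum_gradMat (β : Bool) {x : Currents m n} (hx : S.rho.hom x = 0)
    {v : IndexMat m n ℂ} (hv : S.proj v = v) :
    ∑ a, ∑ b, (sg (!β && idxOdd m n b) * v a b) • (gradMat β x).map S.rho.onX b a = 0 := by
  rw [← S.sum_vgrad hx hv]
  refine Finset.sum_congr rfl fun a _ => Finset.sum_congr rfl fun b _ => ?_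
  rw [Matrix.map_apply, gradMat, paramMat_apply, map_smul, smul_smul]
  congr 1
  rw [eps_comm a b]
  linear_combination (v a b * eps b a) * sg_mul_self (!β && idxOdd m n b)

theorem AffSlice.gradMat_eq_zero (β : Bool) {x : Currents m n} (hx : S.rho.hom x = 0)
    {a b : Fin (m + n)} (h : S.proj (Matrix.single a b 1) = Matrix.single a b 1) :
    (gradMat β x).map S.rho.onX b a = 0 := by
  have h1 := S.sum_gradMat β hx h
  rw [Finset.sum_eq_single a, Finset.sum_eq_single b, Matrix.single_apply_same, mul_one] at h1
  · have := congrArg (sg (!β && idxOdd m n b) • ·) h1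
    simpa only [smul_smul, sg_mul_self, one_smul, smul_zero] using this
  · intro d _ hd
    rw [Matrix.single_apply, if_neg fun e => hd e.2.symm, mul_zero, zero_smul]
  · simp
  · intro c _ hc
    refine Finset.sum_eq_zero fun d _ => ?_
    rw [Matrix.single_apply, if_neg fun e => hc e.1.symm, mul_zero, zero_smul]
  · simp

/-- A derivation at a point of the affine subspace that respects the equations of the subspace
depends only on restrictions to it. Both sides are superderivations, so it is enough to compare them
on `J`. -/
theorem SDer.map_rho {P : Pt (unitOdd m n)} {b : Bool} (δ : SDer P b)
    (hP : ∀ x, P.hom (S.rho.hom x) = P.hom x)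
    (h : ∀ a c, δ.map (onMat S.proj (curMat m n) a c) = δ.map (curMat m n a c))
    (x : Currents m n) : δ.map (S.rho.hom x) = δ.map x := by
  let δ' : SDer P b :=
    { map := δ.map ∘ₗ S.rho.hom.toLinearMap
      map_mul := fun y z => by
        simp only [LinearMap.comp_apply, AlgHom.toLinearMap_apply, _root_.map_mul, δ.map_mul, hP]
        congr 2
        have h : tw _ b (S.rho.hom y) = S.rho.hom (tw _ b y) := by
          cases b
          · rfl
          · exact (S.rho.map_par y).symm
        rw [h, hP]
      map_der := fun y => by
        simp only [LinearMap.comp_apply, AlgHom.toLinearMap_apply, S.rho.map_der, der_eq,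
          δ.map_der] }
  refine SDer.ext_mat (δ := δ') (δ' := δ) ?_ x
  ext1 a c
  rw [SDer.mat_apply, SDer.mat_apply]
  congr 1
  change δ.map (S.rho.mat (curMat m n) a c) = _
  rw [S.rho_mat, Matrix.add_apply, map_add, constMat_apply, δ.map_algebraMap, zero_add, h]

end ChainRule

/-! ### Closure of the currents of supertrace zero under the bracket -/

section SpecialLinear

open Polynomial

variable {m n : ℕ} (k : ℂ)

/-- Polynomials in `λ` with coefficients in `slAlg`. -/
def SlX (q : (Currents m n)[X]) : Prop := ∀ j, q.coeff j ∈ slAlg m n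

theorem SlX.mul {q r : (Currents m n)[X]} (hq : SlX q) (hr : SlX r) : SlX (q * r) := fun j => by
  rw [coeff_mul]; exact sum_mem fun i _ => mul_mem (hq _) (hr _)

theorem SlX.add {q r : (Currents m n)[X]} (hq : SlX q) (hr : SlX r) : SlX (q + r) := fun j => by
  rw [coeff_add]; exact add_mem (hq _) (hr _)

theorem SlX.sum {ι : Type*} {s : Finset ι} {f : ι → (Currents m n)[X]} (h : ∀ i ∈ s, SlX (f i)) :
    SlX (∑ i ∈ s, f i) := fun j => by
  rw [finsetSum_coeff]; exact sum_mem fun i hi => h i hi j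

theorem SlX.smul {q : (Currents m n)[X]} (hq : SlX q) (c : ℂ) : SlX (c • q) := fun j => by
  rw [coeff_smul]; exact Subalgebra.smul_mem _ (hq j) _

theorem slX_C {x : Currents m n} (hx : x ∈ slAlg m n) : SlX (C x) := fun j => by
  rw [coeff_C]; split_ifs
  · exact hx
  · exact zero_mem _

theorem slX_X : SlX (X : (Currents m n)[X]) := fun j => by
  rw [coeff_X]; split_ifs
  · exact one_mem _
  · exact zero_mem _

theorem SlX.lamL {q : (Currents m n)[X]} (hq : SlX q) : SlX (lamL _ q) := by
  rw [lamL_apply]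
  refine (slX_X.mul hq).add fun j => ?_
  rw [coeff_dX]; exact totalDeriv_mem_sl (hq j)

theorem SlX.lamL_pow {q : (Currents m n)[X]} (hq : SlX q) (i : ℕ) :
    SlX ((ClassicalW.lamL _ ^ i) q) := by
  induction i with
  | zero => exact hq
  | succ i ih => rw [pow_succ', Module.End.mul_apply]; exact ih.lamL

theorem tw_mem_sl {x : Currents m n} (hx : x ∈ slAlg m n) (b : Bool) : tw _ b x ∈ slAlg m n := by
  cases b
  · exact hx
  · exact parity_mem_sl hx

theorem rightGrad_mem_sl {x : Currents m n} (hx : x ∈ slAlg m n) (u) :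
    rightGrad _ x u ∈ slAlg m n := by
  induction hx using Algebra.adjoin_induction with
  | mem x hx =>
    obtain ⟨A, j, hA, rfl⟩ := hx
    simp only [current, map_sum, map_smul, rightGrad_gen, Finsupp.finsetSum_apply,
      Finsupp.smul_apply, Finsupp.single_apply]
    refine sum_mem fun a _ => sum_mem fun b _ => Subalgebra.smul_mem _ ?_ _
    split_ifs
    · exact one_mem _
    · exact zero_mem _
  | algebraMap c => rw [rightGrad_algebraMap]; exact zero_mem _
  | add x y _ _ hx hy => rw [map_add]; exact add_mem hx hy
  | mul x y hx' hy' hx hy =>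
    rw [rightGrad_mul]
    exact add_mem (mul_mem hx' hy) (mul_mem hx (tw_mem_sl hy' _))

/-- Supercommutators have supertrace zero, so the bracket with any generator of `gl(m|n)`, diagonal
ones included, preserves the subalgebra. -/
theorem slX_genBr (g : Fin (m + n) × Fin (m + n)) {x : Currents m n} (hx : x ∈ slAlg m n) :
    SlX (genBr _ (affineBracket m n k) g x) := by
  have hB := affineBracket_isAffine (m := m) (n := n) k
  induction hx using Algebra.adjoin_induction with
  | mem x hx =>
    obtain ⟨A, j, hA, rfl⟩ := hx
    induction j with
    | zero =>
      have h : genBr _ (affineBracket m n k) g (current m n A 0) =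
          C (∑ a, ∑ b, A a b • affineZero m n g (a, b)) +
            ∑ a, ∑ b, A a b • monomial 1 (algebraMap ℂ _ (affineOne m n k g (a, b))) := by
        simp only [current, map_sum, map_smul, affine_genBr, smul_add, Finset.sum_add_distrib,
          smul_C]
      rw [h]
      refine SlX.add (slX_C ?_) (SlX.sum fun a _ => SlX.sum fun b _ => SlX.smul (fun j => ?_) _)
      · have e : ∑ a, ∑ b, A a b • affineZero m n g (a, b) = current m n
            (Matrix.of fun c d => kron m n c g.1 * A g.2 d -
              sg (unitOdd m n g && unitOdd m n (c, g.1)) * kron m n d g.2 * A c g.1) 0 := by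
          simp only [affineZero, current, smul_sub, sub_smul, Finset.sum_sub_distrib,
            Matrix.of_apply]
          simp [kron, ite_smul, smul_smul, mul_comm]
        rw [e]
        refine current_mem_sl ?_ _
        unfold str
        simp only [Matrix.of_apply, mul_sub, Finset.sum_sub_distrib, sgn_eq]
        simp only [kron, ite_mul, mul_ite, zero_mul, mul_zero, one_mul, mul_one,
          Finset.sum_ite_eq', Finset.mem_univ, if_true]
        simp only [unitOdd]
        cases idxOdd m n g.1 <;> cases idxOdd m n g.2 <;> simp
      · rw [coeff_monomial]; split_ifs
        · exact algebraMap_mem _ _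
        · exact zero_mem _
    | succ j ih => rw [← current_succ, genBr_totalDeriv _ hB.par]; exact ih.lamL
  | algebraMap c => rw [genBr_algebraMap]; exact fun j => by rw [coeff_zero]; exact zero_mem _
  | add x y _ _ hx hy => rw [map_add]; exact hx.add hy
  | mul x y hx' hy' hx hy =>
    rw [genBr_mul _ hB.par]
    exact (hx.mul (slX_C hy')).add ((slX_C (tw_mem_sl hx' _)).mul hy)

theorem slX_lieBracket {x y : Currents m n} (hx : x ∈ slAlg m n) (hy : y ∈ slAlg m n) :
    SlX (lieBracket m n k x y) := by
  rw [lieBracket, bracket_eq_act, Pt.act_apply]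
  refine SlX.sum fun g _ => ?_
  rw [Pt.subst_eq_sum]
  refine SlX.sum fun i _ => SlX.mul ?_ (slX_C (slX_genBr k g hy i))
  obtain ⟨J, hJ⟩ := exists_vgrad_eq x
  rw [hJ]
  exact SlX.lamL_pow (SlX.sum fun j _ =>
    SlX.smul (SlX.lamL_pow (slX_C (rightGrad_mem_sl hx _)) _) _) _

end SpecialLinear


/-! ### The constraint surface and the slices -/

section ConcreteSlices

open Polynomial SuperAlg

variable {m n : ℕ} {N : Type} [Ring N] [Algebra ℂ N] {r r' : Setoid (Fin (m + n))}

theorem idxOdd_eq_iff {a b : Fin (m + n)} :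
    unitOdd m n (a, b) = false ↔ idxOdd m n a = idxOdd m n b := by
  simp only [unitOdd]; cases idxOdd m n a <;> cases idxOdd m n b <;> simp

theorem lower_even (hr : RespectsParity r) (pos : Fin (m + n) → ℕ) :
    IsEvenMat (lower ℂ r pos) := fun a b h => by
  rw [idxOdd_eq_iff]; exact hr a b (lower_grade h).1

theorem constMat_lower (r : Setoid (Fin (m + n))) (pos : Fin (m + n) → ℕ) :
    constMat N (lower ℂ r pos) = lower N r pos := by
  ext a b
  simp only [constMat_apply, lower, Matrix.of_apply]
  split_ifs <;> simp

theorem maskMap_single {S : Fin (m + n) → Fin (m + n) → Prop} [∀ a b, Decidable (S a b)]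
    {a b c d : Fin (m + n)} (h : maskMap S (Matrix.single c d 1) a b ≠ 0) : a = c ∧ b = d := by
  rw [maskMap_apply] at h
  split_ifs at h
  · by_contra hc
    exact h (by rw [Matrix.single_apply, if_neg fun e => hc ⟨e.1.symm, e.2.symm⟩])
  · exact absurd rfl h

/-- The constraints on the current matrix: the entries of grade at most `-1` are fixed. -/
def conSlice (r : Setoid (Fin (m + n))) (pos : Fin (m + n) → ℕ) (hr : RespectsParity r) :
    AffSlice m n where
  base := lower ℂ r pos
  proj := maskMap fun a b => ¬ grade r pos a ≤ grade r pos b - 2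
  base_even := lower_even hr pos
  proj_base := by
    ext a b
    rw [maskMap_apply]
    split_ifs with h
    · rfl
    · by_contra hc
      exact h (lower_grade hc).2.2.le
  proj_proj A := by
    ext a b
    simp only [maskMap_apply]
    split_ifs <;> rfl
  proj_one := by
    ext a b
    rw [maskMap_apply]
    split_ifs with h
    · have : a ≠ b := by rintro rfl; omega
      rw [Matrix.one_apply_ne this]
    · rfl
  proj_par a b c d h := by
    obtain ⟨rfl, rfl⟩ := maskMap_single h; rfl

theorem conSlice_onMat {r : Setoid (Fin (m + n))} {pos : Fin (m + n) → ℕ} (hr : RespectsParity r)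
    (M : IndexMat m n N) (a b : Fin (m + n)) :
    onMat (conSlice r pos hr).proj M a b =
      if grade r pos a ≤ grade r pos b - 2 then 0 else M a b := by
  rw [onMat_entry (z := if grade r pos a ≤ grade r pos b - 2 then 0 else 1)]
  · split_ifs <;> simp
  · intro A
    change maskMap _ A a b = _
    rw [maskMap_apply]
    split_ifs <;> simp

theorem conSlice_add {r : Setoid (Fin (m + n))} {pos : Fin (m + n) → ℕ} (hr : RespectsParity r)
    (M : IndexMat m n N) (a b : Fin (m + n)) :
    (constMat N (conSlice r pos hr).base + onMat (conSlice r pos hr).proj M) a b =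
      if grade r pos a ≤ grade r pos b - 2 then lower N r pos a b else M a b := by
  have e : constMat N (conSlice r pos hr).base = lower N r pos := constMat_lower r pos
  rw [Matrix.add_apply, conSlice_onMat, e]
  split_ifs with h
  · rw [add_zero]
  · rw [add_eq_right]
    by_contra hc
    exact h (lower_grade hc).2.2.le

theorem conSlice_rho_mat {r : Setoid (Fin (m + n))} {pos : Fin (m + n) → ℕ} (hr : RespectsParity r)
    (a b : Fin (m + n)) : (conSlice r pos hr).rho.mat (curMat m n) a b =
      if grade r pos a ≤ grade r pos b - 2 then lower _ r pos a b else curMat m n a b := by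
  rw [AffSlice.rho_mat, conSlice_add]

theorem comp_conSlice [SuperAlg N] {r : Setoid (Fin (m + n))} {pos : Fin (m + n) → ℕ}
    (hr : RespectsParity r) {φ : DHom m n N} (h : ∀ a b, grade r pos a ≤ grade r pos b - 2 →
      φ.mat (curMat m n) a b = lower N r pos a b) : φ.comp (conSlice r pos hr).rho = φ := by
  refine AffSlice.comp_rho_eq _ ?_
  ext1 a b
  rw [conSlice_add]
  split_ifs with hab
  · exact h a b hab
  · rfl

/-- The multiple of the identity split off from the slice directions. -/
def traceAvg (m n : ℕ) : IndexMat m n ℂ →ₗ[ℂ] ℂ where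
  toFun A := (∑ a, traceWeight m n a)⁻¹ * ∑ a, traceWeight m n a * A a a
  map_add' A B := by
    simp only [Matrix.add_apply, mul_add, Finset.sum_add_distrib]
  map_smul' c A := by
    simp only [Matrix.smul_apply, smul_eq_mul, mul_left_comm _ c, ← Finset.mul_sum, RingHom.id_apply]

theorem traceAvg_apply (A : IndexMat m n ℂ) :
    traceAvg m n A = (∑ a, traceWeight m n a)⁻¹ * ∑ a, traceWeight m n a * A a a := rfl

theorem traceAvg_eq {A : IndexMat m n ℂ} {u : ℂ}
    (h : ∑ a, traceWeight m n a • (A a a - u) = 0) (a : Fin (m + n)) : traceAvg m n A = u := by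
  simp only [smul_eq_mul, mul_sub, Finset.sum_sub_distrib, ← Finset.sum_mul] at h
  rw [traceAvg_apply, sub_eq_zero.1 h, inv_mul_cancel_left₀ (sum_traceWeight a)]

-- Collecting the sum over each block at its first element, where the diagonal star entry sits, does
-- not change a weighted trace, because the weight is constant on blocks.
open Classical in
theorem sum_traceWeight_first (hr : RespectsParity r) (f : Fin (m + n) → ℂ) :
    ∑ a, traceWeight m n a * (if blockPos r a = 0 then ∑ c with r.r c a, f c else 0) =
      ∑ c, traceWeight m n c * f c := by
  have e (a : Fin (m + n)) :
      traceWeight m n a * (if blockPos r a = 0 then ∑ c with r.r c a, f c else 0) =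
        ∑ c, if blockPos r a = 0 ∧ r.r c a then traceWeight m n c * f c else 0 := by
    by_cases h : blockPos r a = 0
    · simp only [h, if_true, true_and, Finset.mul_sum]
      rw [Finset.sum_filter]
      refine Finset.sum_congr rfl fun c _ => ?_
      split_ifs with hc
      · rw [traceWeight_congr (hr c a hc)]
      · rfl
    · simp [h]
  simp only [e]
  rw [Finset.sum_comm]
  refine Finset.sum_congr rfl fun c _ => ?_
  obtain ⟨a, hac, ha⟩ := (isPos_blockPos r).exists_eq c (Nat.pos_of_ne_zero fun h => by
    have := blockPos_lt (r := r) c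
    omega)
  rw [Finset.sum_eq_single a]
  · rw [if_pos ⟨ha, r.symm hac⟩]
  · intro b _ hb
    refine if_neg fun h => hb ?_
    exact (isPos_blockPos r).inj b a (r.trans (r.symm h.2) (r.symm hac)) (by rw [h.1, ha])
  · simp

open Classical in
/-- The projection to the slice directions of nonnegative refined grade. -/
def tanProj (r r' : Setoid (Fin (m + n))) :
    IndexMat m n ℂ →ₗ[ℂ] IndexMat m n ℂ where
  toFun A := Matrix.of fun a b =>
    if a = b then traceAvg m n A +
      if blockPos r a = 0 then ∑ c with r.r c a, (A c c - traceAvg m n A) else 0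
    else if IsStar r a b ∧ refGrade r r' b ≤ refGrade r r' a then A a b else 0
  map_add' A B := by
    ext a b
    simp only [Matrix.of_apply, Matrix.add_apply, map_add]
    split_ifs
    · rw [add_add_add_comm, ← Finset.sum_add_distrib]
      simp only [add_sub_add_comm]
    · rw [add_zero, add_zero, add_zero]
    · rfl
    · rw [add_zero]
  map_smul' c A := by
    ext a b
    simp only [Matrix.of_apply, Matrix.smul_apply, map_smul, smul_eq_mul, RingHom.id_apply]
    split_ifs
    · rw [mul_add, Finset.mul_sum]
      simp only [mul_sub]
    · rw [add_zero, add_zero]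
    · rfl
    · rw [mul_zero]

open Classical in
theorem tanProj_diag (A : IndexMat m n ℂ) (a : Fin (m + n)) :
    tanProj r r' A a a = traceAvg m n A +
      if blockPos r a = 0 then ∑ c with r.r c a, (A c c - traceAvg m n A) else 0 := by
  simp [tanProj]

open Classical in
theorem tanProj_ne (A : IndexMat m n ℂ) {a b : Fin (m + n)} (h : a ≠ b) :
    tanProj r r' A a b =
      if IsStar r a b ∧ refGrade r r' b ≤ refGrade r r' a then A a b else 0 := by
  simp [tanProj, h]

/-- On the diagonal the projection splits off the multiple `traceAvg` of the identity and
concentrates the rest of the trace of each block at its first element; the weighted trace of that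
rest is zero. -/
theorem inSlice_tanProj (hr : RespectsParity r) (r' : Setoid (Fin (m + n)))
    (A : IndexMat m n ℂ) : InSlice r (tanProj r r' A) := by
  classical
  refine ⟨fun a b hab hs => ?_, traceAvg m n A, fun a ha => ?_, ?_⟩
  · rw [tanProj_ne A hab, if_neg fun h => hs h.1]
  · dsimp only
    rw [tanProj_diag, if_neg ha, add_zero]
  · simp only [tanProj_diag, add_sub_cancel_left, smul_eq_mul]
    rw [sum_traceWeight_first hr]
    by_cases he : Nonempty (Fin (m + n))
    · obtain ⟨a⟩ := he
      simp only [mul_sub, Finset.sum_sub_distrib, ← Finset.sum_mul, traceAvg_apply]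
      rw [mul_inv_cancel_left₀ (sum_traceWeight a), sub_self]
    · exact Finset.sum_eq_zero fun a _ => absurd ⟨a⟩ he

theorem tanProj_grade (A : IndexMat m n ℂ) {a b : Fin (m + n)}
    (h : refGrade r r' a < refGrade r r' b) : tanProj r r' A a b = 0 := by
  classical
  rw [tanProj_ne A (by rintro rfl; exact lt_irrefl _ h), if_neg fun e => e.2.not_gt h]

theorem tanProj_eq_self {A : IndexMat m n ℂ} (h : InSlice r A)
    (h' : ∀ a b, refGrade r r' a < refGrade r r' b → A a b = 0) : tanProj r r' A = A := by
  classical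
  obtain ⟨h1, u, hu, hu'⟩ := h
  dsimp only at hu
  ext a b
  by_cases hab : a = b
  · subst hab
    have e := traceAvg_eq hu' a
    rw [tanProj_diag, e]
    split_ifs with ha
    · rw [Finset.sum_eq_single a]
      · rw [add_sub_cancel]
      · intro c hc hca
        rw [hu c fun h0 => hca ((isPos_blockPos r).inj c a (Finset.mem_filter.1 hc).2
          (by rw [h0, ha])), sub_self]
      · intro h; exact (h (Finset.mem_filter.2 ⟨Finset.mem_univ a, r.refl a⟩)).elim
    · rw [add_zero, hu a ha]
  · rw [tanProj_ne A hab]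
    split_ifs with hs
    · rfl
    · rw [not_and_or, not_le] at hs
      rcases hs with hs | hs
      · exact (h1 a b hab hs).symm
      · exact (h' a b hs).symm

/-- The part of the horizontal slice of `r` compatible with the constraints of `r'`. -/
def tanSlice (r r' : Setoid (Fin (m + n))) (hr : RespectsParity r) (hr' : RespectsParity r') :
    AffSlice m n where
  base := refLower ℂ r r'
  proj := tanProj r r'
  base_even := lower_even hr' _
  proj_base := by
    classical
    have hd (a : Fin (m + n)) : refLower ℂ r r' a a = 0 := by
      by_contra h
      have := refLower_refGrade h
      omega
    ext a b
    by_cases hab : a = b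
    · subst hab
      rw [tanProj_diag]
      have : traceAvg m n (refLower ℂ r r') = 0 := by simp [traceAvg_apply, hd]
      simp [this, hd]
    · rw [tanProj_ne _ hab]
      split_ifs with h
      · by_contra hc
        have := refLower_refGrade hc
        omega
      · rfl
  proj_proj A := tanProj_eq_self (inSlice_tanProj hr r' A) fun a b h => tanProj_grade A h
  proj_one := by
    refine tanProj_eq_self ⟨fun a b hab _ => Matrix.one_apply_ne hab, 1, fun a _ => by simp,
      by simp⟩ fun a b h => Matrix.one_apply_ne ?_
    rintro rfl; exact lt_irrefl _ h
  proj_par a b c d h := by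
    classical
    by_cases hab : a = b
    · subst hab
      by_cases hcd : c = d
      · subst hcd; simp [unitOdd]
      · exfalso
        refine h ?_
        have : ∀ e, Matrix.single c d (1 : ℂ) e e = 0 := fun e => by
          rw [Matrix.single_apply, if_neg]
          rintro ⟨rfl, rfl⟩; exact hcd rfl
        rw [tanProj_diag, traceAvg_apply]
        simp [this]
    · rw [tanProj_ne _ hab] at h
      split_ifs at h
      · rw [Matrix.single_apply] at h
        split_ifs at h with e
        · rw [e.1, e.2]
        · exact absurd rfl h
      · exact absurd rfl h

theorem InSlice.sum_smul {ι : Type*} (s : Finset ι)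
    {A : ι → IndexMat m n ℂ} (h : ∀ i ∈ s, InSlice r (A i)) (x : ι → N) :
    InSlice r (∑ i ∈ s, Matrix.of fun a b => A i a b • x i) := by
  classical
  induction s using Finset.induction_on with
  | empty => exact ⟨fun a b _ _ => by simp, 0, fun a _ => by simp, by simp⟩
  | insert i s hi ih =>
    obtain ⟨h1, u, hu, hu'⟩ := h i (Finset.mem_insert_self i s)
    obtain ⟨g1, v, hv, hv'⟩ := ih fun j hj => h j (Finset.mem_insert_of_mem hj)
    rw [Finset.sum_insert hi]
    refine ⟨fun a b hab hs => ?_, u • x i + v, fun a ha => ?_, ?_⟩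
    · rw [Matrix.add_apply, g1 a b hab hs, Matrix.of_apply, h1 a b hab hs, zero_smul, add_zero]
    · have := hv a ha
      dsimp only at this hu ⊢
      rw [Matrix.add_apply, this, Matrix.of_apply, hu a ha]
    · simp only [Matrix.add_apply, Matrix.of_apply, add_sub_add_comm, smul_add,
        Finset.sum_add_distrib]
      rw [hv', add_zero]
      simp only [← sub_smul, smul_smul, ← Finset.sum_smul]
      simp only [smul_eq_mul] at hu'
      rw [hu', zero_smul]

theorem inSlice_onMat (hr : RespectsParity r) (r' : Setoid (Fin (m + n)))
    (M : IndexMat m n N) : InSlice r (onMat (tanProj r r') M) := by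
  rw [onMat_eq_sum]
  simp only [← Fintype.sum_prod_type']
  exact InSlice.sum_smul (Finset.univ : Finset (Fin (m + n) × Fin (m + n)))
    (A := fun u => tanProj r r' (Matrix.single u.1 u.2 1)) (fun u _ => inSlice_tanProj hr r' _)
    fun u => M u.1 u.2

theorem onMat_tanProj_grade (M : IndexMat m n N) {a b : Fin (m + n)}
    (h : refGrade r r' a < refGrade r r' b) : onMat (tanProj r r') M a b = 0 := by
  rw [onMat_apply]
  exact Finset.sum_eq_zero fun c _ => Finset.sum_eq_zero fun d _ => by
    rw [tanProj_grade _ h, zero_smul]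

theorem grade_self_le_of_isStar {a b : Fin (m + n)} (h : IsStar r a b) :
    refGrade r r b ≤ refGrade r r a := by
  refine refGrade_le_of_grade ?_
  rw [refPos_self]
  exact grade_of_isStar h

theorem inSlice_refGrade_self {A : IndexMat m n ℂ} (h : InSlice r A)
    (a b : Fin (m + n)) (hab : refGrade r r a < refGrade r r b) : A a b = 0 := by
  refine h.1 a b (by rintro rfl; exact lt_irrefl _ hab) fun hs => ?_
  exact (grade_self_le_of_isStar hs).not_gt hab

/-- Directions of nonnegative refined degree do not meet the entries of degree at most -2: the
constrained slice lies in the constraint surface of `r'`. -/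
theorem tan_comp_con (hr : RespectsParity r) (hr' : RespectsParity r') :
    (tanSlice r r' hr hr').rho.comp (conSlice r' (refPos r r') hr').rho =
      (tanSlice r r' hr hr').rho := by
  refine AffSlice.rho_comp_rho ?_ ?_
  · ext1 A
    ext a b
    rw [LinearMap.comp_apply]
    change maskMap _ (tanProj r r' A) a b = tanProj r r' A a b
    rw [maskMap_apply]
    split_ifs with h
    · rw [tanProj_grade A]
      have h1 := refGrade_le (r := r) (r' := r') a
      have h2 := le_refGrade (r := r) (r' := r') b
      omega
    · rfl
  · have : (tanSlice r r' hr hr').base = (conSlice r' (refPos r r') hr').base := rfl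
    rw [this, AffSlice.proj_base, add_zero]

/-- The lowering matrices of `r'` and `r` differ by a star direction, so the constrained slice lies
in the horizontal slice of `r`. -/
theorem tan_comp_tan (hle : ∀ a b, r.r a b → r'.r a b) (hr : RespectsParity r)
    (hr' : RespectsParity r') : (tanSlice r r' hr hr').rho.comp (tanSlice r r hr hr).rho =
      (tanSlice r r' hr hr').rho := by
  classical
  refine AffSlice.rho_comp_rho ?_ ?_
  · ext1 A
    exact tanProj_eq_self (inSlice_tanProj hr r' A)
      (inSlice_refGrade_self (inSlice_tanProj hr r' A))
  · ext a b
    rw [Matrix.add_apply]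
    change lower ℂ r (refPos r r) a b + tanProj r r (refLower ℂ r r') a b = refLower ℂ r r' a b
    rw [refPos_self]
    have hd (a : Fin (m + n)) : refLower ℂ r r' a a = 0 := by
      by_contra h
      have := refLower_refGrade h
      omega
    have hs {a b : Fin (m + n)} (h : IsStar r a b) : lower ℂ r (blockPos r) a b = 0 := by
      by_contra hc
      have h1 := (lower_grade hc).2.2
      have h2 := grade_of_isStar h
      omega
    by_cases hab : a = b
    · subst hab
      have h1 : traceAvg m n (refLower ℂ r r') = 0 := by simp [traceAvg_apply, hd]
      have h2 : lower ℂ r (blockPos r) a a = 0 := by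
        by_contra hc
        have h1 := (lower_grade hc).2.2
        omega
      rw [tanProj_diag]
      simp [h1, hd, h2]
    · rw [tanProj_ne _ hab]
      by_cases h : IsStar r a b
      · rw [if_pos ⟨h, grade_self_le_of_isStar h⟩, hs h, zero_add]
      · rw [if_neg fun e => h e.1, add_zero, refLower_eq_lower hle (Or.inr h)]

end ConcreteSlices


/-! ### Gauge invariants and their brackets -/

section Invariants

open Polynomial SuperAlg

variable {m n : ℕ} (k : ℂ) {r r' : Setoid (Fin (m + n))} {pos : Fin (m + n) → ℕ}

/-- Invariance, modulo the constraints, under the gauge transformations of positive grade. -/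
def IsInv (r : Setoid (Fin (m + n))) (pos : Fin (m + n) → ℕ) (hr : RespectsParity r)
    (x : Currents m n) : Prop :=
  ∀ a b, grade r pos b < grade r pos a →
    (conSlice r pos hr).rho.onX (genBr _ (affineBracket m n k) (a, b) x) = 0

variable {k} {hr : RespectsParity r}

theorem IsInv.genCoeff {x : Currents m n} (hx : IsInv k r pos hr x) {a b : Fin (m + n)}
    (h : grade r pos b < grade r pos a) (i : ℕ) :
    (conSlice r pos hr).rho.hom (genCoeff (affineBracket m n k) (a, b) i x) = 0 := by
  rw [genCoeff_apply, ← DHom.coeff_onX, hx a b h, coeff_zero]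

theorem IsInv.add {x y : Currents m n} (hx : IsInv k r pos hr x) (hy : IsInv k r pos hr y) :
    IsInv k r pos hr (x + y) := fun a b h => by rw [map_add, map_add, hx a b h, hy a b h, add_zero]

theorem IsInv.smul {x : Currents m n} (hx : IsInv k r pos hr x) (c : ℂ) :
    IsInv k r pos hr (c • x) := fun a b h => by rw [map_smul, map_smul, hx a b h, smul_zero]

theorem isInv_algebraMap (c : ℂ) : IsInv k r pos hr (algebraMap ℂ _ c) := fun a b _ => by
  rw [genBr_algebraMap, map_zero]

theorem IsInv.mul {x y : Currents m n} (hx : IsInv k r pos hr x) (hy : IsInv k r pos hr y) :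
    IsInv k r pos hr (x * y) := fun a b h => by
  rw [genBr_mul _ (affineBracket_isAffine k).par, map_add, map_mul, map_mul, hx a b h, hy a b h,
    zero_mul, mul_zero, add_zero]

theorem IsInv.totalDeriv {x : Currents m n} (hx : IsInv k r pos hr x) :
    IsInv k r pos hr (totalDeriv _ x) := fun a b h => by
  rw [genBr_totalDeriv _ (affineBracket_isAffine k).par, DHom.onX_lamL, hx a b h, map_zero]

theorem IsInv.parity {x : Currents m n} (hx : IsInv k r pos hr x) :
    IsInv k r pos hr (parity _ x) := fun a b h => by
  have h1 := parX_genBr _ (affineBracket_isAffine (m := m) (n := n) k).par (a, b) x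
  have h2 := congrArg (sg (unitOdd m n (a, b)) • ·) h1
  simp only [smul_smul, sg_mul_self, one_smul] at h2
  rw [← h2, map_smul, DHom.onX_parX, hx a b h, map_zero, smul_zero]

theorem IsInv.parPart {x : Currents m n} (hx : IsInv k r pos hr x) (b : Bool) :
    IsInv k r pos hr (parPart _ b x) := (hx.add (hx.parity.smul _)).smul _

theorem actMat_inv {P : Pt (unitOdd m n)} {b : Bool}
    {X : IndexMat m n (Currents m n)[X]}
    (hP : ∀ v, P.hom ((conSlice r pos hr).rho.hom v) = P.hom v)
    (hX : ∀ d c, grade r pos d ≤ grade r pos c → X d c = 0) {y : Currents m n}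
    (hy : IsInv k r pos hr y) : actMat k P b X y = 0 := by
  rw [actMat_apply]
  refine Finset.sum_eq_zero fun g _ => ?_
  by_cases hg : grade r pos g.1 ≤ grade r pos g.2
  · rw [gaugeParam, hX _ _ hg, smul_zero, Pt.subst_zero_left]
  · rw [Pt.subst_eq_sum]
    refine Finset.sum_eq_zero fun i _ => ?_
    dsimp only
    rw [← hP, ← DHom.coeff_onX, hy g.1 g.2 (not_le.1 hg), coeff_zero, map_zero, mul_zero]

/-- A function that vanishes on the constraint surface depends to first order only on the
constrained entries; transposed, these have positive degree in the gradient. -/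
theorem conSlice_gradMat (β : Bool) {x : Currents m n}
    (hx : (conSlice r pos hr).rho.hom x = 0) {d c : Fin (m + n)}
    (h : grade r pos d ≤ grade r pos c) :
    (gradMat β x).map (conSlice r pos hr).rho.onX d c = 0 := by
  refine AffSlice.gradMat_eq_zero _ β hx ?_
  ext a b
  change maskMap _ _ a b = _
  rw [maskMap_apply]
  split_ifs with hab
  · rw [Matrix.single_apply, if_neg]
    rintro ⟨rfl, rfl⟩
    omega
  · rfl

theorem rho_lieBracket_eq_zero {x y : Currents m n}
    (hx : (conSlice r pos hr).rho.hom x = 0) (hy : IsInv k r pos hr y) :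
    (conSlice r pos hr).rho.onX (lieBracket m n k x y) = 0 := by
  rw [onX_lieBracket k _ false]
  refine actMat_inv (fun v => ?_) (fun d c h => conSlice_gradMat false hx h) hy
  rw [lamPt_hom, lamPt_hom, AffSlice.rho_rho]

theorem DHom.onX_antip (ρ : DHom m n (Currents m n)) (q : (Currents m n)[X]) :
    ρ.onX (antip _ q) = antip _ (ρ.onX q) := by
  induction q using Polynomial.induction_on' with
  | add p q hp hq => rw [map_add, map_add, map_add, map_add, hp, hq]
  | monomial i v =>
    have e : ρ.onX (monomial i v) = monomial i (ρ.hom v) := by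
      rw [← C_mul_X_pow_eq_monomial, map_mul, map_pow, onX_X, onX_C, C_mul_X_pow_eq_monomial]
    rw [antip_monomial, e, antip_monomial, neg_lamL_pow, neg_lamL_pow, map_smul, onX_lamL_pow,
      onX_C]

theorem DHom.parMat_onX (ρ : DHom m n (Currents m n)) {c : Bool}
    {X : IndexMat m n (Currents m n)[X]} (hX : ParMat c X) :
    ParMat c (X.map ρ.onX) := fun a b => by
  rw [Matrix.map_apply, parX_eq, ← ρ.onX_parX, ← parX_eq, hX, map_smul]

theorem rho_lieBracket_gen {b : Bool} {y : Currents m n} (hy : IsPar (unitOdd m n) b y)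
    (ρ : DHom m n (Currents m n)) {a c : Fin (m + n)}
    (h : ρ.onX (genBr _ (affineBracket m n k) (a, c) y) = 0) :
    ρ.onX (lieBracket m n k y (gen _ ((a, c), 0))) = 0 := by
  rw [lieBracket, (affineBracket_isAffine k).skew hy, map_neg, map_smul, DHom.onX_antip, h,
    map_zero, smul_zero, neg_zero]

/-- The bracket with an element of parity `b`, restricted along an endomorphism. -/
def bracketSDer (k : ℂ) (ρ : DHom m n (Currents m n)) {b : Bool} {y : Currents m n}
    (hy : IsPar (unitOdd m n) b y) : SDer ρ.pt b :=
  actSDer k ρ.pt (ρ.parMat_onX (parMat_gradMat hy))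

theorem bracketSDer_map (ρ : DHom m n (Currents m n)) {b : Bool} {y : Currents m n}
    (hy : IsPar (unitOdd m n) b y) (x : Currents m n) :
    (bracketSDer k ρ hy).map x = ρ.onX (lieBracket m n k y x) := (onX_lieBracket k ρ b y x).symm

/-- On the constraint surface the bracket with an invariant annihilates the constrained entries, by
skew-symmetry; hence it descends to the surface. -/
theorem bracketSDer_conSlice {b : Bool} {y : Currents m n} (hy : IsPar (unitOdd m n) b y)
    (hy' : IsInv k r pos hr y) (x : Currents m n) :
    (conSlice r pos hr).rho.onX (lieBracket m n k y ((conSlice r pos hr).rho.hom x)) =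
      (conSlice r pos hr).rho.onX (lieBracket m n k y x) := by
  rw [← bracketSDer_map (k := k) _ hy, ← bracketSDer_map (k := k) _ hy]
  refine SDer.map_rho _ _ (fun v => ?_) (fun a c => ?_) x
  · rw [lamPt_hom, lamPt_hom, AffSlice.rho_rho]
  · rw [conSlice_onMat]
    split_ifs with h
    · rw [map_zero, curMat_apply, map_smul, bracketSDer_map,
        rho_lieBracket_gen hy _ (hy' c a (by omega)), smul_zero]
    · rfl

theorem DHom.onX_hasse (ρ : DHom m n (Currents m n)) (i : ℕ) (q : (Currents m n)[X]) :
    ρ.onX (hasse _ i q) = hasse _ i (ρ.onX q) := by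
  ext j
  rw [coeff_onX, coeff_hasse, coeff_hasse, map_mul, map_natCast, coeff_onX]

theorem DHom.onX_eq_zero (ρ : DHom m n (Currents m n)) {q : (Currents m n)[X]} :
    ρ.onX q = 0 ↔ ∀ j, ρ.hom (q.coeff j) = 0 := by
  simp only [Polynomial.ext_iff, coeff_onX, coeff_zero]

theorem lieBracket_add_left (x x' y : Currents m n) :
    lieBracket m n k (x + x') y = lieBracket m n k x y + lieBracket m n k x' y :=
  bracket_add_left _ x x' y

theorem lieBracket_sub_left (x x' y : Currents m n) :
    lieBracket m n k (x - x') y = lieBracket m n k x y - lieBracket m n k x' y := by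
  rw [eq_sub_iff_add_eq, ← lieBracket_add_left, sub_add_cancel]

/-- By the Jacobi identity a variation of `{x_λ y}` is a sum of brackets in which `x` or `y` is
replaced by its variation. The variations vanish on the constraint surface, and so do their brackets
with invariants. -/
theorem IsInv.lieBracket {x y : Currents m n} (hx : IsInv k r pos hr x)
    (hy : IsInv k r pos hr y) (j : ℕ) : IsInv k r pos hr ((lieBracket m n k x y).coeff j) := by
  have key (b : Bool) (x : Currents m n) (hb : IsPar (unitOdd m n) b x)
      (hx : IsInv k r pos hr x) :
      IsInv k r pos hr ((ClassicalW.lieBracket m n k x y).coeff j) := by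
    intro a c hac
    rw [DHom.onX_eq_zero]
    intro i
    have hJ := (affineBracket_isAffine (m := m) (n := n) k).jacobi (a, c) hb y i
    have h1 := congrArg (fun q => (conSlice r pos hr).rho.hom (q.coeff j)) hJ
    simp only [coeff_mapX, genCoeff_apply] at h1
    refine h1.trans ?_
    rw [← DHom.coeff_onX, map_add, map_smul]
    have h2 := bracketSDer_conSlice hb hx (ClassicalW.genCoeff (affineBracket m n k) (a, c) i y)
    rw [hy.genCoeff hac, map_zero, map_zero, genCoeff_apply] at h2
    have h3 : (conSlice r pos hr).rho.onX (bracket _ (affineBracket m n k) x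
      ((genBr _ (affineBracket m n k) (a, c) y).coeff i)) = 0 := h2.symm
    rw [h3, smul_zero, zero_add, map_sum, Finset.sum_eq_zero, coeff_zero]
    intro s _
    rw [DHom.onX_hasse]
    have h4 : (conSlice r pos hr).rho.onX (bracket _ (affineBracket m n k)
      ((genBr _ (affineBracket m n k) (a, c) x).coeff s.1) y) = 0 :=
        rho_lieBracket_eq_zero (hx.genCoeff hac s.1) hy
    rw [h4, map_zero]
  rw [← parPart_add (unitOdd m n) x, lieBracket_add_left, coeff_add]
  exact (key _ _ (isPar_parPart _ _ x) (hx.parPart _)).add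
    (key _ _ (isPar_parPart _ _ x) (hx.parPart _))

end Invariants

/-! ### The ideals and invariants of the statement in terms of restrictions -/

section Identification

open Polynomial SuperAlg

variable {m n : ℕ} {k : ℂ} {r r' : Setoid (Fin (m + n))}

theorem cartanEntry_eq (a : Fin (m + n)) :
    cartanEntry r a = (grade r (blockPos r) a : ℚ) / 2 := by
  unfold cartanEntry grade
  push_cast
  ring

theorem lieBracket_current (A : IndexMat m n ℂ) (x : Currents m n) :
    lieBracket m n k (current m n A 0) x =
      ∑ a, ∑ b, A a b • genBr _ (affineBracket m n k) (a, b) x := by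
  rw [lieBracket, ← bracketL_apply]
  simp only [current, map_sum, map_smul, LinearMap.sum_apply, LinearMap.smul_apply, bracketL_apply]
  rfl

theorem str_single {a b : Fin (m + n)} (h : a ≠ b) (z : ℂ) : str m n (Matrix.single a b z) = 0 := by
  refine Finset.sum_eq_zero fun c _ => ?_
  rw [Matrix.single_apply, if_neg, mul_zero]
  rintro ⟨rfl, rfl⟩; exact h rfl

theorem str_sub (A A' : IndexMat m n ℂ) :
    str m n (A - A') = str m n A - str m n A' := by
  simp only [str, Matrix.sub_apply, mul_sub, Finset.sum_sub_distrib]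

theorem AffSlice.str_base_sub (S : AffSlice m n) (A : IndexMat m n ℂ) :
    str m n (S.base * (A - dualMat S.proj A)) = str m n (S.base * A) := by
  have h := pair_const (N := ℂ) S.base_even (dualMat S.proj A)
  rw [← pair_onMat, onMat_const, S.proj_base] at h
  have h0 : pair (constMat ℂ (0 : IndexMat m n ℂ)) A = 0 :=
    Finset.sum_eq_zero fun a _ => Finset.sum_eq_zero fun b _ => by simp [constMat_apply]
  rw [h0] at h
  rw [mul_sub, str_sub, sub_eq_self]
  exact h.symm

theorem dualMat_eq {π : IndexMat m n ℂ →ₗ[ℂ]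
    IndexMat m n ℂ} {c d : Fin (m + n)}
    (h : π (Matrix.single d c 1) = Matrix.single d c 1)
    (A : IndexMat m n ℂ) : dualMat π A c d = A c d := by
  rw [dualMat, Matrix.of_apply, h, pair, Finset.sum_eq_single c, Finset.sum_eq_single d]
  · rw [Matrix.single_apply_same, smul_eq_mul, mul_one, mul_left_comm, eps_mul_self, mul_one]
  · intro b _ hb
    rw [Matrix.single_apply, if_neg fun e => hb e.1.symm, smul_zero]
  · simp
  · intro a _ ha
    refine Finset.sum_eq_zero fun b _ => ?_
    rw [Matrix.single_apply, if_neg fun e => ha e.2.symm, smul_zero]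
  · simp

theorem mem_constraints (hr : RespectsParity r) (x : Currents m n) :
    x ∈ (affineSl m n).diffIdeal {x | ∃ A, str m n A = 0 ∧
      (∀ a b, A a b ≠ 0 → 1 ≤ cartanEntry r a - cartanEntry r b) ∧
      x = current m n A 0 - algebraMap ℂ _ (str m n (lowering r * A))} ↔
    x ∈ slAlg m n ∧ (conSlice r (blockPos r) hr).rho.hom x = 0 := by
  have hE : (conSlice r (blockPos r) hr).base = lowering r := rfl
  refine AffSlice.diffIdeal_eq _ ?_ ?_ x
  · rintro x ⟨A, hA, hA', rfl⟩
    refine ⟨sub_mem (current_mem_sl hA 0) (algebraMap_mem _ _), ?_⟩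
    rw [map_sub, AlgHom.commutes, DHom.map_current_zero, AffSlice.rho_mat, pair_add,
      pair_const (AffSlice.base_even _), hE, add_sub_cancel_left]
    refine Finset.sum_eq_zero fun a _ => Finset.sum_eq_zero fun b _ => ?_
    by_cases hab : A a b = 0
    · rw [hab, zero_mul, zero_smul]
    · have h := hA' a b hab
      rw [cartanEntry_eq, cartanEntry_eq, ← sub_div, le_div_iff₀ (by norm_num)] at h
      rw [conSlice_onMat, if_pos, smul_zero]
      have : (2 : ℤ) ≤ grade r (blockPos r) a - grade r (blockPos r) b := by
        rw [one_mul] at h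
        exact_mod_cast h
      omega
  · intro A hA
    refine ⟨A - dualMat (conSlice r (blockPos r) hr).proj A, ?_, fun a b hab => ?_, ?_⟩
    · rw [str_sub, hA, AffSlice.str_dualMat _ hA, sub_zero]
    · have h : grade r (blockPos r) b ≤ grade r (blockPos r) a - 2 := by
        by_contra h
        refine hab ?_
        rw [Matrix.sub_apply, dualMat_eq, sub_self]
        ext c d
        change maskMap _ _ c d = _
        rw [maskMap_apply]
        split_ifs with hcd
        · rw [Matrix.single_apply, if_neg]
          rintro ⟨rfl, rfl⟩
          exact h hcd
        · rfl
      rw [cartanEntry_eq, cartanEntry_eq, ← sub_div, le_div_iff₀ (by norm_num)]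
      have : ((grade r (blockPos r) b : ℤ) : ℚ) ≤ (grade r (blockPos r) a : ℚ) - 2 := by
        exact_mod_cast h
      linarith
    · rw [← hE, AffSlice.str_base_sub]

theorem mem_primaryW_den (hr : RespectsParity r) (x : Currents m n) :
    x ∈ (primaryW k r).den ↔ x ∈ slAlg m n ∧ (conSlice r (blockPos r) hr).rho.hom x = 0 :=
  mem_constraints hr x

theorem mem_primaryW_num (hr : RespectsParity r) (x : Currents m n) :
    x ∈ (primaryW k r).num ↔ x ∈ slAlg m n ∧ IsInv k r (blockPos r) hr x := by
  have hc (a b : Fin (m + n)) : 0 < cartanEntry r a - cartanEntry r b ↔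
      grade r (blockPos r) b < grade r (blockPos r) a := by
    rw [cartanEntry_eq, cartanEntry_eq, ← sub_div, div_pos_iff_of_pos_right (by norm_num), sub_pos,
      Int.cast_lt]
  constructor
  · rintro ⟨hx, h⟩
    refine ⟨hx, fun a b hab => ?_⟩
    have hne : a ≠ b := by rintro rfl; exact lt_irrefl _ hab
    rw [DHom.onX_eq_zero]
    intro j
    have h1 := h _ ⟨Matrix.single a b 1, str_single hne 1, fun c d hcd => ?_, rfl⟩ j
    · rw [mem_constraints hr, current_single, one_smul] at h1
      exact h1.2
    · rw [Matrix.single_apply] at hcd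
      split_ifs at hcd with e
      · rw [← e.1, ← e.2, hc]; exact hab
      · exact absurd rfl hcd
  · rintro ⟨hx, h⟩
    refine ⟨hx, ?_⟩
    rintro s ⟨A, hA, hA', rfl⟩ j
    rw [mem_constraints hr]
    refine ⟨slX_lieBracket k (current_mem_sl hA 0) hx j, ?_⟩
    revert j
    rw [← DHom.onX_eq_zero, lieBracket_current]
    simp only [map_sum, map_smul]
    refine Finset.sum_eq_zero fun a _ => Finset.sum_eq_zero fun b _ => ?_
    by_cases hab : A a b = 0
    · rw [hab, zero_smul]
    · rw [h a b ((hc a b).1 (hA' a b hab)), smul_zero]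

theorem onMat_complex (π : IndexMat m n ℂ →ₗ[ℂ]
    IndexMat m n ℂ) (A : IndexMat m n ℂ) :
    onMat π A = π A := by
  ext a b
  rw [map_matrix_apply, onMat_apply]
  simp only [smul_eq_mul, mul_comm]

/-- Signs that turn the supertrace form into the pairing. -/
def signMat (v : IndexMat m n ℂ) : IndexMat m n ℂ :=
  Matrix.of fun a b => sgn m n a * eps a b * v a b

theorem signMat_apply (v : IndexMat m n ℂ) (a b : Fin (m + n)) :
    signMat v a b = sgn m n a * eps a b * v a b := rfl

theorem signMat_diag (v : IndexMat m n ℂ) (a : Fin (m + n)) :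
    signMat v a a = v a a := by
  rw [signMat_apply, eps_self, sgn_mul_self, one_mul]

theorem str_mul_eq_pair (v A : IndexMat m n ℂ) :
    str m n (v * A) = pair (signMat v) A := by
  unfold str pair
  rw [Finset.sum_comm]
  refine Finset.sum_congr rfl fun a _ => ?_
  rw [Matrix.mul_apply, Finset.mul_sum]
  refine Finset.sum_congr rfl fun b _ => ?_
  rw [signMat_apply, smul_eq_mul, eps_comm b a]
  linear_combination (-sgn m n a * v a b * A b a) * eps_mul_self a b

theorem pair_signMat (v A : IndexMat m n ℂ) :
    pair v A = str m n (signMat v * A) := by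
  rw [str_mul_eq_pair]
  congr 1
  ext a b
  rw [signMat_apply, signMat_apply]
  linear_combination (-v a b * sgn m n a ^ 2) * eps_mul_self a b - v a b * sgn_mul_self a

theorem isSliceDirection_iff (v : IndexMat m n ℂ) :
    IsSliceDirection r v ↔ (∀ a b, ¬ IsStar r a b → v a b = 0) ∧
      ∑ a, traceWeight m n a * v a a = 0 := by
  refine and_congr_right fun _ => ?_
  unfold traceWeight
  split_ifs with h
  · simp [Matrix.trace]
  · rfl

theorem IsSliceDirection.signMat {v : IndexMat m n ℂ}
    (h : IsSliceDirection r v) : IsSliceDirection r (signMat v) := by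
  rw [isSliceDirection_iff] at h ⊢
  refine ⟨fun a b hab => by rw [signMat_apply, h.1 a b hab, mul_zero], ?_⟩
  simp only [signMat_diag]
  exact h.2

theorem IsSliceDirection.inSlice {v : IndexMat m n ℂ}
    (h : IsSliceDirection r v) : InSlice r v := by
  rw [isSliceDirection_iff] at h
  refine ⟨fun a b _ hs => h.1 a b hs, 0, fun a ha => h.1 a a ?_, ?_⟩
  · rwa [isStar_diag]
  · simpa using h.2

theorem mem_horizontalIdeal (hr : RespectsParity r) (x : Currents m n) :
    x ∈ horizontalIdeal r ↔ x ∈ slAlg m n ∧ (tanSlice r r hr hr).rho.hom x = 0 := by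
  have hE : (tanSlice r r hr hr).base = lowering r := by
    change lower ℂ r (refPos r r) = _
    rw [refPos_self]; rfl
  refine AffSlice.diffIdeal_eq _ ?_ ?_ x
  · rintro x ⟨A, hA, hA', rfl⟩
    refine ⟨sub_mem (current_mem_sl hA 0) (algebraMap_mem _ _), ?_⟩
    -- `InSlice` allows a multiple of the identity; it pairs to zero with `A` because `A` has
    -- supertrace zero.
    have key {v : IndexMat m n ℂ} (hv : InSlice r v) : pair v A = 0 := by
      obtain ⟨h1, u, hu, hu'⟩ := hv
      have h2 := hA' (signMat (v - Matrix.diagonal fun _ => u)) (IsSliceDirection.signMat ?_)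
      · rwa [← pair_signMat, pair_sub, pair_diagonal, hA, zero_smul, sub_zero] at h2
      · rw [isSliceDirection_iff]
        refine ⟨fun a b hab => ?_, by simpa using hu'⟩
        by_cases e : a = b
        · subst e
          rw [isStar_diag] at hab
          rw [Matrix.sub_apply, Matrix.diagonal_apply_eq, sub_eq_zero]
          exact hu a hab
        · rw [Matrix.sub_apply, Matrix.diagonal_apply_ne _ e, sub_zero, h1 a b e hab]
    rw [map_sub, AlgHom.commutes, DHom.map_current_zero, AffSlice.rho_mat, pair_add,
      pair_const (AffSlice.base_even _), hE, add_sub_cancel_left, pair_onMat]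
    refine Finset.sum_eq_zero fun a _ => Finset.sum_eq_zero fun b _ => ?_
    have : dualMat (tanSlice r r hr hr).proj A a b = eps a b * 0 :=
      congrArg (eps a b * ·) (key (inSlice_tanProj hr r (Matrix.single b a 1)))
    rw [this, mul_zero, zero_mul, zero_smul]
  · intro A hA
    refine ⟨A - dualMat (tanSlice r r hr hr).proj A, ?_, fun v hv => ?_, ?_⟩
    · rw [str_sub, hA, AffSlice.str_dualMat _ hA, sub_zero]
    · have h1 : (tanSlice r r hr hr).proj (signMat v) = signMat v :=
        tanProj_eq_self hv.signMat.inSlice (inSlice_refGrade_self hv.signMat.inSlice)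
      rw [str_mul_eq_pair, pair_sub_right, ← pair_onMat, onMat_complex, h1, sub_self]
    · rw [← hE, AffSlice.str_base_sub]

end Identification


/-! ### Matrices filtered by degree -/

section Degrees

variable {ι : Type} [Fintype ι] {N : Type} [Ring N] (f : ι → ℤ)

/-- The entries of degree less than `e` vanish. -/
def VanishBelow (e : ℤ) (M : Matrix ι ι N) : Prop := ∀ a b, f a - f b < e → M a b = 0

variable {f} {e e' : ℤ} {M M' : Matrix ι ι N}

theorem VanishBelow.mono (h : VanishBelow f e M) (he : e' ≤ e) : VanishBelow f e' M :=
  fun a b hab => h a b (hab.trans_le he)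

theorem VanishBelow.mul (h : VanishBelow f e M) (h' : VanishBelow f e' M') :
    VanishBelow f (e + e') (M * M') := fun a b hab => by
  rw [Matrix.mul_apply]
  refine Finset.sum_eq_zero fun c _ => ?_
  by_cases hc : f a - f c < e
  · rw [h a c hc, zero_mul]
  · rw [h' c b (by omega), mul_zero]

theorem VanishBelow.add (h : VanishBelow f e M) (h' : VanishBelow f e M') :
    VanishBelow f e (M + M') := fun a b hab => by
  rw [Matrix.add_apply, h a b hab, h' a b hab, add_zero]

theorem VanishBelow.neg (h : VanishBelow f e M) : VanishBelow f e (-M) := fun a b hab => by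
  rw [Matrix.neg_apply, h a b hab, neg_zero]

theorem VanishBelow.sub (h : VanishBelow f e M) (h' : VanishBelow f e M') :
    VanishBelow f e (M - M') := sub_eq_add_neg M M' ▸ h.add h'.neg

theorem vanishBelow_one [DecidableEq ι] : VanishBelow f 0 (1 : Matrix ι ι N) := fun a b hab =>
  Matrix.one_apply_ne (by rintro rfl; omega)

theorem exists_vanishBelow (f : ι → ℤ) : ∃ K : ℕ, ∀ a b, f a - f b < K ∧ -(K : ℤ) ≤ f a - f b := by
  obtain ⟨K, hK⟩ := (Set.finite_range fun u : ι × ι => f u.1 - f u.2).bddAbove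
  refine ⟨(K + 1).toNat, fun a b => ⟨?_, ?_⟩⟩
  · have := hK ⟨(a, b), rfl⟩
    simp only at this
    omega
  · have := hK ⟨(b, a), rfl⟩
    simp only at this
    omega

theorem VanishBelow.eq_zero_of_pow [DecidableEq ι] (h : VanishBelow f 1 M) :
    ∃ K : ℕ, M ^ K = 0 := by
  obtain ⟨K, hK⟩ := exists_vanishBelow f
  have h1 (i : ℕ) : VanishBelow f i (M ^ i) := by
    induction i with
    | zero => exact vanishBelow_one
    | succ i ih =>
      rw [pow_succ]
      exact_mod_cast ih.mul h
  refine ⟨K, ?_⟩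
  ext a b
  exact h1 K a b (hK a b).1

/-- Each substitution of the equation into itself raises the known bound for the degree of `D` by 1,
starting from a bound valid for every matrix, until the bound `d` of `A` is reached. -/
theorem VanishBelow.of_add_mul {d : ℤ} {D A x : Matrix ι ι N} (hx : VanishBelow f 1 x)
    (hA : VanishBelow f d A) (h : D = A - D * x) : VanishBelow f d D := by
  obtain ⟨K, hK⟩ := exists_vanishBelow f
  have h1 (i : ℕ) : VanishBelow f (min d (i - K)) D := by
    induction i with
    | zero => exact fun a b hab => absurd (hK a b).2 (by simp at hab; omega)
    | succ i ih =>
      rw [h]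
      refine (hA.mono (min_le_left _ _)).sub ((ih.mul hx).mono ?_)
      push_cast
      omega
  refine (h1 (d + K).toNat).mono ?_
  omega

end Degrees

/-! ### Gauge transformations with coefficients in the currents -/

section GaugeFixing

open Polynomial SuperAlg

variable {m n : ℕ} {r r' : Setoid (Fin (m + n))} {hr : RespectsParity r} {hr' : RespectsParity r'}

/-- A matrix of constants times an element. -/
def tens {N : Type} [Ring N] [Algebra ℂ N] (A : IndexMat m n ℂ) (y : N) :
    IndexMat m n N := Matrix.of fun a b => A a b • y

theorem tens_mul_const {N : Type} [Ring N] [Algebra ℂ N]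
    (A E : IndexMat m n ℂ) (y : N) :
    tens A y * constMat N E = tens (A * E) y := by
  ext a b
  simp only [tens, Matrix.mul_apply, Matrix.of_apply, constMat_apply, Finset.sum_smul]
  refine Finset.sum_congr rfl fun c _ => ?_
  rw [← Algebra.commutes, ← Algebra.smul_def, smul_smul, mul_comm]

theorem const_mul_tens {N : Type} [Ring N] [Algebra ℂ N]
    (A E : IndexMat m n ℂ) (y : N) :
    constMat N E * tens A y = tens (E * A) y := by
  ext a b
  simp only [tens, Matrix.mul_apply, Matrix.of_apply, constMat_apply, Finset.sum_smul]
  refine Finset.sum_congr rfl fun c _ => ?_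
  rw [← Algebra.smul_def, smul_smul]

theorem ParMat.mul_even {N : Type} [Ring N] [Algebra ℂ N] [SuperAlg N] {c : Bool}
    {M M' : IndexMat m n N} (h : ParMat c M) (h' : ParMat false M') :
    ParMat c (M * M') := by
  have := h.mul h'
  rwa [Bool.xor_false] at this

/-- Even matrices over `slAlg` fixed by an endomorphism. -/
structure IsGood (ρ : DHom m n (Currents m n))
    (M : IndexMat m n (Currents m n)) : Prop where
  par : ParMat false M
  sl : ∀ a b, M a b ∈ slAlg m n
  fix : ρ.mat M = M

section Good

variable {ρ : DHom m n (Currents m n)}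
  {M M' : IndexMat m n (Currents m n)}

theorem IsGood.mul (h : IsGood ρ M) (h' : IsGood ρ M') : IsGood ρ (M * M') where
  par := h.par.mul_even h'.par
  sl a b := by
    rw [Matrix.mul_apply]
    exact sum_mem fun c _ => mul_mem (h.sl a c) (h'.sl c b)
  fix := by rw [ρ.mat_mul, h.fix, h'.fix]

theorem IsGood.add (h : IsGood ρ M) (h' : IsGood ρ M') : IsGood ρ (M + M') where
  par := h.par.add h'.par
  sl a b := add_mem (h.sl a b) (h'.sl a b)
  fix := by rw [ρ.mat_add, h.fix, h'.fix]

theorem IsGood.smul (h : IsGood ρ M) (c : ℂ) : IsGood ρ (c • M) where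
  par := h.par.smul c
  sl a b := Subalgebra.smul_mem _ (h.sl a b) c
  fix := by rw [ρ.mat_smul, h.fix]

theorem isGood_one : IsGood ρ 1 where
  par := parMat_one
  sl a b := by
    by_cases hab : a = b
    · subst hab; rw [Matrix.one_apply_eq]; exact one_mem _
    · rw [Matrix.one_apply_ne hab]; exact zero_mem _
  fix := ρ.mat_one

theorem IsGood.pow (h : IsGood ρ M) (i : ℕ) : IsGood ρ (M ^ i) := by
  induction i with
  | zero => exact isGood_one
  | succ i ih => rw [pow_succ]; exact ih.mul h

theorem IsGood.sum {κ : Type*} {s : Finset κ}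
    {M : κ → IndexMat m n (Currents m n)}
    (h : ∀ i ∈ s, IsGood ρ (M i)) : IsGood ρ (∑ i ∈ s, M i) := by
  classical
  induction s using Finset.induction_on with
  | empty =>
    rw [Finset.sum_empty, ← zero_smul ℂ (1 : Matrix _ _ (Currents m n))]
    exact isGood_one.smul 0
  | insert i s hi ih =>
    rw [Finset.sum_insert hi]
    exact (h i (Finset.mem_insert_self i s)).add (ih fun j hj => h j (Finset.mem_insert_of_mem hj))

theorem IsGood.tens (h : IsGood ρ M) {A : IndexMat m n ℂ} {c d : Fin (m + n)}
    (hA : ∀ a b, A a b ≠ 0 → unitOdd m n (a, b) = unitOdd m n (c, d)) :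
    IsGood ρ (ClassicalW.tens A (M c d)) where
  par a b := by
    change SuperAlg.par (A a b • M c d) = _ • A a b • M c d
    by_cases hab : A a b = 0
    · simp [hab]
    · rw [map_smul, h.par, hA a b hab, smul_comm]
  sl a b := Subalgebra.smul_mem _ (h.sl c d) _
  fix := by
    ext1 a b
    change ρ.hom (A a b • M c d) = A a b • M c d
    rw [map_smul, ← ρ.mat_apply, h.fix]

theorem IsGood.exists_inv {f : Fin (m + n) → ℤ} (hx : IsGood ρ M) (h : VanishBelow f 1 M) :
    ∃ y, IsGood ρ y ∧ (1 + M) * y = 1 ∧ y * (1 + M) = 1 := by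
  obtain ⟨K, hK⟩ := h.eq_zero_of_pow
  refine ⟨∑ i ∈ Finset.range K, (-M) ^ i, IsGood.sum fun i _ => IsGood.pow ?_ i, ?_, ?_⟩
  · rw [← neg_one_smul ℂ M]
    exact hx.smul _
  · have := mul_neg_geom_sum (-M) K
    rwa [sub_neg_eq_add, neg_pow, hK, mul_zero, sub_zero] at this
  · have := geom_sum_mul_neg (-M) K
    rwa [sub_neg_eq_add, neg_pow, hK, mul_zero, sub_zero] at this

end Good

/-- A gauge transformation, over the currents, of the constrained current matrix. -/
structure IsGauge (k : ℂ) (hr : RespectsParity r) (hr' : RespectsParity r')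
    (g h Y : IndexMat m n (Currents m n)) : Prop where
  good : IsGood (conSlice r' (refPos r r') hr').rho g
  good_inv : IsGood (conSlice r' (refPos r r') hr').rho h
  mul_inv : g * h = 1
  inv_mul : h * g = 1
  upper : VanishBelow (grade r' (refPos r r')) 1 (g - 1)
  tan : (tanSlice r r' hr hr').rho.mat g = 1
  gauge : Y * g = g * (conSlice r' (refPos r r') hr').rho.mat (curMat m n) - k • matDer g

variable {k : ℂ} {g h Y : IndexMat m n (Currents m n)}

theorem IsGauge.eq (H : IsGauge k hr hr' g h Y) :
    Y = (g * (conSlice r' (refPos r r') hr').rho.mat (curMat m n) - k • matDer g) * h := by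
  rw [← H.gauge, mul_assoc, H.mul_inv, mul_one]

theorem IsGauge.parMat (H : IsGauge k hr hr' g h Y) : ParMat false Y := by
  rw [H.eq]
  exact ((H.good.par.mul_even (DHom.parMat _ parMat_curMat)).sub (H.good.par.der.smul k)).mul_even
    H.good_inv.par

theorem IsGauge.con_mat (H : IsGauge k hr hr' g h Y) :
    (conSlice r' (refPos r r') hr').rho.mat Y = Y := by
  have hJ (M : IndexMat m n (Currents m n)) :
      (conSlice r' (refPos r r') hr').rho.mat ((conSlice r' (refPos r r') hr').rho.mat M) =
        (conSlice r' (refPos r r') hr').rho.mat M := by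
    ext1 a b
    exact AffSlice.rho_rho _ _
  rw [H.eq, DHom.mat_mul, DHom.mat_sub, DHom.mat_mul, DHom.mat_smul, DHom.mat_matDer, hJ,
    H.good.fix, H.good_inv.fix]

/-- The current matrix already has the desired form on the slice and `g` restricts to 1 there, so
the transformed matrix has the same restriction. -/
theorem IsGauge.tan_mat (H : IsGauge k hr hr' g h Y) :
    (tanSlice r r' hr hr').rho.mat Y = (tanSlice r r' hr hr').rho.mat (curMat m n) := by
  have h1 := congrArg (tanSlice r r' hr hr').rho.mat H.gauge
  rw [DHom.mat_mul, DHom.mat_sub, DHom.mat_mul, DHom.mat_smul, DHom.mat_matDer, H.tan, matDer_one,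
    smul_zero, sub_zero, mul_one, one_mul, ← DHom.comp_mat, tan_comp_con] at h1
  exact h1

theorem diagonal_comm {c : Currents m n} (hc : parity _ c = c)
    (M : IndexMat m n (Currents m n)) :
    M * Matrix.diagonal (fun _ => c) = Matrix.diagonal (fun _ => c) * M := by
  ext1 a b
  rw [Matrix.mul_diagonal, Matrix.diagonal_mul]
  have : IsPar (unitOdd m n) false c := by rw [IsPar, hc, sg_false, one_smul]
  rw [this.mul_comm, tw_false]

theorem IsGauge.isSlMat (H : IsGauge k hr hr' g h Y) : ∃ c : Currents m n, parity _ c = c ∧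
    ∀ a b, (Y - Matrix.diagonal (fun _ => c) : IndexMat m n (Currents m n))
      a b ∈ slAlg m n := by
  obtain ⟨c, hc, hc'⟩ := (conSlice r' (refPos r r') hr').isSlMat_rho
  refine ⟨c, hc, ?_⟩
  have e : Y - Matrix.diagonal (fun _ => c) =
      (g * ((conSlice r' (refPos r r') hr').rho.mat (curMat m n) - Matrix.diagonal (fun _ => c)) -
        k • matDer g) * h := by
    rw [mul_sub, diagonal_comm hc, sub_right_comm, sub_mul, ← H.eq, mul_assoc, H.mul_inv, mul_one]
  rw [e]
  intro a b
  rw [Matrix.mul_apply]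
  refine sum_mem fun i _ => mul_mem (sub_mem ?_ (Subalgebra.smul_mem _
    (totalDeriv_mem_sl (H.good.sl a i)) k)) (H.good_inv.sl i b)
  rw [Matrix.mul_apply]
  exact sum_mem fun j _ => mul_mem (H.good.sl a j) (hc' j i)

/-- `Y` has entries of supertrace zero only up to a multiple of the identity. The projection fixes
this multiple, so it drops out of the defect. -/
theorem IsGauge.defect_mem (H : IsGauge k hr hr' g h Y) :
    IsGood (conSlice r' (refPos r r') hr').rho
      (Y - constMat _ (refLower ℂ r r') - onMat (tanProj r r') Y) := by
  refine ⟨(H.parMat.sub (parMat_const (lower_even hr' _))).sub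
    ((tanSlice r r' hr hr').parMat_onMat H.parMat), fun a b => ?_, ?_⟩
  · obtain ⟨c, -, hc⟩ := H.isSlMat
    have h1 := (tanSlice r r' hr hr').onMat_diagonal c
    have h2 := onMat_sub (tanProj r r') Y (Matrix.diagonal fun _ => c)
    have h3 := sub_mem (sub_mem (hc a b) ((slAlg m n).algebraMap_mem (refLower ℂ r r' a b)))
      (onMat_mem_sl (tanProj r r') hc a b)
    rw [h2] at h3
    change onMat (tanProj r r') (Matrix.diagonal fun _ => c) = _ at h1
    rw [h1] at h3
    simp only [Matrix.sub_apply, constMat_apply] at h3 ⊢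
    convert h3 using 1
    abel
  · rw [DHom.mat_sub, DHom.mat_sub, DHom.mat_const, DHom.mat_onMat, H.con_mat]

theorem IsGauge.tan_defect (H : IsGauge k hr hr' g h Y) : (tanSlice r r' hr hr').rho.mat
    (Y - constMat _ (refLower ℂ r r') - onMat (tanProj r r') Y) = 0 := by
  have e : onMat (tanProj r r') (constMat (Currents m n) (refLower ℂ r r')) = 0 := by
    rw [onMat_const]
    change constMat _ ((tanSlice r r' hr hr').proj (tanSlice r r' hr hr').base) = 0
    rw [(tanSlice r r' hr hr').proj_base]
    ext a b; simp [constMat_apply]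
  have e2 : tanProj r r' ∘ₗ tanProj r r' = tanProj r r' :=
    LinearMap.ext (tanSlice r r' hr hr').proj_proj
  rw [DHom.mat_sub, DHom.mat_sub, DHom.mat_const, DHom.mat_onMat, H.tan_mat, AffSlice.rho_mat]
  change constMat _ (refLower ℂ r r') + onMat (tanProj r r') _ - _ -
    onMat (tanProj r r') (constMat _ (refLower ℂ r r') + onMat (tanProj r r') _) = 0
  rw [onMat_add, onMat_onMat, e, e2, zero_add, add_sub_cancel_left, sub_self]

theorem onMat_tanProj_vanish {e : ℤ} {N : Type} [Ring N] [Algebra ℂ N] (f : Fin (m + n) → ℤ)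
    {M : IndexMat m n N} (h : VanishBelow f e M) :
    VanishBelow f e (onMat (tanProj r r') M) := by
  classical
  intro a b hab
  rw [onMat_apply]
  refine Finset.sum_eq_zero fun c _ => Finset.sum_eq_zero fun d _ => ?_
  by_cases hcd : f c - f d < e
  · rw [h c d hcd, smul_zero]
  · have : tanProj r r' (Matrix.single c d 1) a b = 0 := by
      by_cases e1 : a = b
      · subst e1
        have : ∀ e, Matrix.single c d (1 : ℂ) e e = 0 := fun e => by
          rw [Matrix.single_apply, if_neg]
          rintro ⟨rfl, rfl⟩; omega
        rw [tanProj_diag, traceAvg_apply]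
        simp [this]
      · rw [tanProj_ne _ e1]
        split_ifs
        · rw [Matrix.single_apply, if_neg]
          rintro ⟨rfl, rfl⟩; omega
        · rfl
    rw [this, zero_smul]

end GaugeFixing


/-! ### Existence of the gauge fixing transformation -/

section GaugeExistence

open Polynomial SuperAlg

variable {m n : ℕ} {r r' : Setoid (Fin (m + n))} {hr : RespectsParity r} {hr' : RespectsParity r'}
  {k : ℂ} {g h Y : IndexMat m n (Currents m n)}

theorem VanishBelow.sum {ι κ N : Type} [Fintype ι] [Ring N] {f : ι → ℤ} {e : ℤ} {s : Finset κ}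
    {M : κ → Matrix ι ι N} (h : ∀ i ∈ s, VanishBelow f e (M i)) :
    VanishBelow f e (∑ i ∈ s, M i) := fun a b hab => by
  rw [Matrix.sum_apply]
  exact Finset.sum_eq_zero fun i hi => h i hi a b hab

theorem vanishBelow_refLower : VanishBelow (grade r' (refPos r r')) (-2)
    (constMat (Currents m n) (refLower ℂ r r')) := fun a b hab => by
  rw [constMat_apply]
  by_cases h : refLower ℂ r r' a b = 0
  · rw [h, map_zero]
  · have := (lower_grade h).2.2
    omega

theorem VanishBelow.matDer {f : Fin (m + n) → ℤ} {e : ℤ} {N : Type} [Ring N] [Algebra ℂ N]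
    [SuperAlg N] {M : IndexMat m n N} (h : VanishBelow f e M) :
    VanishBelow f e (ClassicalW.matDer M) := fun a b hab => by
  rw [ClassicalW.matDer, Matrix.map_apply, h a b hab, map_zero]

theorem VanishBelow.smul {f : Fin (m + n) → ℤ} {e : ℤ} {N : Type} [Ring N] [Algebra ℂ N]
    {M : IndexMat m n N} (h : VanishBelow f e M) (c : ℂ) :
    VanishBelow f e (c • M) := fun a b hab => by
  rw [Matrix.smul_apply, h a b hab, smul_zero]

theorem IsGauge.mul (H : IsGauge k hr hr' g h Y)
    {x y : IndexMat m n (Currents m n)}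
    (hx : IsGood (conSlice r' (refPos r r') hr').rho x)
    (hy : IsGood (conSlice r' (refPos r r') hr').rho y) (h1 : (1 + x) * y = 1)
    (h2 : y * (1 + x) = 1) (hx1 : VanishBelow (grade r' (refPos r r')) 1 x)
    (hx2 : (tanSlice r r' hr hr').rho.mat x = 0) :
    IsGauge k hr hr' ((1 + x) * g) (h * y) (((1 + x) * Y - k • matDer x) * y) where
  good := (isGood_one.add hx).mul H.good
  good_inv := H.good_inv.mul hy
  mul_inv := by rw [mul_assoc, ← mul_assoc g, H.mul_inv, one_mul, h1]
  inv_mul := by rw [mul_assoc, ← mul_assoc y, h2, one_mul, H.inv_mul]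
  upper := by
    have e : (1 + x) * g - 1 = (g - 1) + x * g := by noncomm_ring
    have hg : VanishBelow (grade r' (refPos r r')) 0 g := by
      have := (H.upper.mono (by norm_num : (0 : ℤ) ≤ 1)).add vanishBelow_one
      rwa [sub_add_cancel] at this
    rw [e]
    exact H.upper.add (hx1.mul hg)
  tan := by
    rw [DHom.mat_mul, DHom.mat_add, DHom.mat_one, hx2, H.tan, add_zero, one_mul]
  gauge := by
    rw [mul_assoc, ← mul_assoc y, h2, one_mul, sub_mul, mul_assoc, H.gauge, matDer_mul, matDer_add,
      matDer_one, zero_add, mul_sub, smul_add, ← mul_assoc, mul_smul_comm, smul_mul_assoc]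
    abel

theorem tens_add {N : Type} [Ring N] [Algebra ℂ N] (A B : IndexMat m n ℂ)
    (y : N) : tens (A + B) y = tens A y + tens B y := by
  ext a b; simp [tens, add_smul]

theorem tens_sub {N : Type} [Ring N] [Algebra ℂ N] (A B : IndexMat m n ℂ)
    (y : N) : tens (A - B) y = tens A y - tens B y := by
  ext a b; simp [tens, sub_smul]

/-- One step of the recursion: each matrix unit in the degree `d` part of the defect `z` is moved
into the slice by a commutator with `E`. The commutators combine to a parameter `x` of degree at
least `d + 2`, and the transformation `1 + x` changes the defect in degree `d` as required and
otherwise only in higher degree. -/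
theorem IsGauge.step (hle : ∀ a b, r.r a b → r'.r a b) {d : ℤ} (hd : -1 ≤ d)
    (H : IsGauge k hr hr' g h Y)
    (hY : VanishBelow (grade r' (refPos r r')) (-1) (Y - constMat _ (refLower ℂ r r')))
    (hz : VanishBelow (grade r' (refPos r r')) d
      (Y - constMat _ (refLower ℂ r r') - onMat (tanProj r r') Y)) :
    ∃ g h Y, IsGauge k hr hr' g h Y ∧
      VanishBelow (grade r' (refPos r r')) (-1) (Y - constMat _ (refLower ℂ r r')) ∧
      VanishBelow (grade r' (refPos r r')) (d + 1)
        (Y - constMat _ (refLower ℂ r r') - onMat (tanProj r r') Y) := by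
  classical
  have good_z := H.defect_mem
  have tan_z := H.tan_defect
  set f := grade r' (refPos r r') with hf
  set E := constMat (Currents m n) (refLower ℂ r r') with hE
  set z := Y - E - onMat (tanProj r r') Y with hzdef
  have hEx := fun (u : Fin (m + n) × Fin (m + n)) (hu : f u.1 - f u.2 = d) =>
    exists_comm_mem_slice hle hr hr' (c := u.1) (d := u.2)
      (by change f u.2 - 1 ≤ f u.1; omega)
  choose! B T hB1 hB2 hB3 hB4 using hEx
  let s : Finset (Fin (m + n) × Fin (m + n)) := {u | f u.1 - f u.2 = d}
  have hs {u} : u ∈ s ↔ f u.1 - f u.2 = d := by simp [s]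
  set x := ∑ u ∈ s, tens (B u) (z u.1 u.2) with hxdef
  have hx : IsGood (conSlice r' (refPos r r') hr').rho x := IsGood.sum fun u hu =>
    good_z.tens fun a b hab => (hB1 u (hs.1 hu) a b hab).2
  have hxv : VanishBelow f (d + 2) x := VanishBelow.sum fun u hu a b hab => by
    change B u a b • z u.1 u.2 = 0
    by_cases h0 : B u a b = 0
    · rw [h0, zero_smul]
    · have h1 := (hB1 u (hs.1 hu) a b h0).1
      rw [← hf] at h1
      have h2 := hs.1 hu
      omega
  have hxt : (tanSlice r r' hr hr').rho.mat x = 0 := by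
    ext1 a b
    rw [DHom.mat_apply, hxdef, Matrix.sum_apply, map_sum]
    refine Finset.sum_eq_zero fun u _ => ?_
    change (tanSlice r r' hr hr').rho.hom (B u a b • z u.1 u.2) = 0
    rw [map_smul, ← DHom.mat_apply, tan_z, Matrix.zero_apply, smul_zero]
  have hx1 : VanishBelow f 1 x := hxv.mono (by omega)
  obtain ⟨y, hy, h1, h2⟩ := hx.exists_inv hx1
  refine ⟨_, _, _, H.mul hx hy h1 h2 hx1 hxt, ?_⟩
  set Y1 := ((1 + x) * Y - k • matDer x) * y with hY1
  set D := Y1 - Y with hD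
  have hY1' : Y1 = Y + D := by rw [hD]; abel
  have hYv : VanishBelow f (-2) Y := by
    have := (hY.mono (by norm_num : (-2 : ℤ) ≤ -1)).add (vanishBelow_refLower (r := r) (r' := r'))
    rwa [sub_add_cancel] at this
  -- The equation `Y1 (1 + x) = (1 + x) Y - k x'`, solved for the change `D`.
  have hDeq : D = (x * Y - Y * x - k • matDer x) - D * x := by
    have e : Y1 * (1 + x) = (1 + x) * Y - k • matDer x := by
      rw [hY1, mul_assoc, h2, mul_one]
    rw [hY1'] at e
    have e' : Y + D + (Y + D) * x = Y + x * Y - k • matDer x := by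
      rw [mul_add, mul_one, add_mul 1 x, one_mul] at e
      exact e
    have : D = (Y + D + (Y + D) * x) - (Y + D) * x - Y := by abel
    rw [e'] at this
    have e3 : (Y + D) * x = Y * x + D * x := add_mul Y D x
    rw [e3] at this
    refine this.trans ?_
    abel
  have hDv : VanishBelow f d D := by
    refine hx1.of_add_mul (((((hxv.mul hYv).mono ?_)).sub ((hYv.mul hxv).mono ?_)).sub
      ((hxv.matDer.smul k).mono ?_)) hDeq <;> omega
  -- `F` is the leading part of `D`: replacing `Y` by `E` and dropping the derivative and the
  -- quadratic term only affects higher degrees.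
  set F := x * E - E * x with hF
  have hDF : VanishBelow f (d + 1) (D - F) := by
    have e : D - F = x * (Y - E) - (Y - E) * x - k • matDer x - D * x := by
      conv_lhs => rw [hDeq, hF]
      noncomm_ring
    rw [e]
    refine ((((hxv.mul hY).mono ?_).sub ((hY.mul hxv).mono ?_)).sub
      ((hxv.matDer.smul k).mono ?_)).sub ((hDv.mul hx1).mono ?_) <;> omega
  refine ⟨?_, ?_⟩
  · have e : Y1 - E = (Y - E) + D := by rw [hY1']; abel
    rw [e]
    exact hY.add (hDv.mono hd)
  -- The part of degree `d` of the defect.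
  set w := ∑ u ∈ s, tens (Matrix.single u.1 u.2 (1 : ℂ)) (z u.1 u.2) with hw
  have hwapp (a b : Fin (m + n)) : w a b = if (a, b) ∈ s then z a b else 0 := by
    rw [hw, Matrix.sum_apply]
    split_ifs with hab
    · rw [Finset.sum_eq_single (a, b)]
      · simp [tens]
      · rintro ⟨a', b'⟩ _ hu
        simp only [tens, Matrix.of_apply]
        rw [Matrix.single_apply, if_neg, zero_smul]
        rintro ⟨rfl, rfl⟩; exact hu rfl
      · intro h; exact absurd hab h
    · refine Finset.sum_eq_zero fun u hu => ?_
      simp only [tens, Matrix.of_apply]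
      rw [Matrix.single_apply, if_neg, zero_smul]
      rintro ⟨rfl, rfl⟩; exact hab hu
  have hzw : VanishBelow f (d + 1) (z - w) := fun a b hab => by
    rw [Matrix.sub_apply, hwapp]
    split_ifs with h0
    · rw [sub_self]
    · rw [hs] at h0
      dsimp only at h0
      rw [hz a b (by omega), sub_zero]
  have hU : w + F = ∑ u ∈ s, tens (T u) (z u.1 u.2) := by
    rw [hw, hF, hxdef, Finset.sum_mul, Finset.mul_sum, ← Finset.sum_sub_distrib,
      ← Finset.sum_add_distrib]
    refine Finset.sum_congr rfl fun u hu => ?_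
    rw [hB2 u (hs.1 hu), tens_mul_const, const_mul_tens, tens_add, tens_sub]
  -- By the choice of `B`, the sum `w + F` is a combination of slice directions, so the projection
  -- removes it from the defect.
  have hpU : onMat (tanProj r r') (w + F) = w + F := by
    rw [hU, onMat_sum]
    refine Finset.sum_congr rfl fun u hu => ?_
    have := onMat_smul_const (tanProj r r') (z u.1 u.2) (T u)
    rw [tanProj_eq_self (hB3 u (hs.1 hu)) (hB4 u (hs.1 hu))] at this
    exact this
  have hpE : onMat (tanProj r r') E = 0 := by
    rw [hE, onMat_const]
    change constMat _ ((tanSlice r r' hr hr').proj (tanSlice r r' hr hr').base) = 0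
    rw [(tanSlice r r' hr hr').proj_base]
    ext a b; simp [constMat_apply]
  have hpz : onMat (tanProj r r') z = 0 := by
    have e2 : tanProj r r' ∘ₗ tanProj r r' = tanProj r r' :=
      LinearMap.ext (tanSlice r r' hr hr').proj_proj
    rw [hzdef, onMat_sub, onMat_sub, hpE, sub_zero, onMat_onMat, e2, sub_self]
  have e : Y1 - E - onMat (tanProj r r') Y1 = (z - w) + (D - F) -
      onMat (tanProj r r') (D - F) - onMat (tanProj r r') (z - w) := by
    have e1 : onMat (tanProj r r') D = onMat (tanProj r r') (D - F) + onMat (tanProj r r') (w + F) -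
        onMat (tanProj r r') w := by
      rw [← onMat_add, ← onMat_sub]
      congr 1
      abel
    have e2 : onMat (tanProj r r') w = -onMat (tanProj r r') (z - w) := by
      rw [onMat_sub, hpz, zero_sub, neg_neg]
    rw [hY1', onMat_add, e1, e2, hpU, hzdef]
    abel
  rw [e]
  exact ((hzw.add hDF).sub (onMat_tanProj_vanish f hDF)).sub (onMat_tanProj_vanish f hzw)

theorem exists_isGauge (hle : ∀ a b, r.r a b → r'.r a b) (k : ℂ) (hr : RespectsParity r)
    (hr' : RespectsParity r') : ∃ g h Y, IsGauge k hr hr' g h Y ∧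
      Y = constMat _ (refLower ℂ r r') + onMat (tanProj r r') Y := by
  have key (i : ℕ) : ∃ g h Y, IsGauge k hr hr' g h Y ∧
      VanishBelow (grade r' (refPos r r')) (-1) (Y - constMat _ (refLower ℂ r r')) ∧
      VanishBelow (grade r' (refPos r r')) (i - 1)
        (Y - constMat _ (refLower ℂ r r') - onMat (tanProj r r') Y) := by
    induction i with
    | zero =>
      -- The constraints fix everything of degree at most -2, so the recursion can start at degree
      -- -1 with `g = 1`.
      have h1 : VanishBelow (grade r' (refPos r r')) (-1)
          ((conSlice r' (refPos r r') hr').rho.mat (curMat m n) -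
            constMat _ (refLower ℂ r r')) := fun a b hab => by
        rw [Matrix.sub_apply, conSlice_rho_mat, if_pos (by omega), constMat_lower, sub_self]
      refine ⟨1, 1, (conSlice r' (refPos r r') hr').rho.mat (curMat m n),
        ⟨isGood_one, isGood_one, mul_one _, mul_one _, ?_, DHom.mat_one _, ?_⟩, h1, ?_⟩
      · rw [sub_self]; exact fun a b _ => rfl
      · rw [matDer_one, smul_zero, sub_zero, mul_one, one_mul]
      · refine (h1.mono (by norm_num)).sub fun a b hab => onMat_tanProj_grade _ ?_
        have h2 := refGrade_le (r := r) (r' := r') a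
        have h3 := le_refGrade (r := r) (r' := r') b
        push_cast at hab
        omega
    | succ i ih =>
      obtain ⟨g, h, Y, H, hY, hz⟩ := ih
      have := H.step hle (by omega) hY hz
      rw [sub_add_cancel] at this
      rwa [Nat.cast_succ, add_sub_cancel_right]
  obtain ⟨K, hK⟩ := exists_vanishBelow (grade r' (refPos r r'))
  -- All degrees are below `K`, so a defect of degree at least `K` is zero.
  obtain ⟨g, h, Y, H, -, hz⟩ := key (K + 1)
  refine ⟨g, h, Y, H, ?_⟩
  rw [← sub_eq_zero, ← sub_sub]
  ext1 a b
  refine hz a b ?_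
  have := (hK a b).1
  push_cast
  omega

end GaugeExistence


/-! ### Variation of the gauge fixed matrix -/

section GaugeVariation

open Polynomial SuperAlg

/-- If `Y` is the transform of `J` by `A` and `J` varies with parameter `X₀`, then `Y` varies with
parameter `(A X₀ - D) A⁻¹`. Here `A'` is the inverse of `A`, `J'` and `Y'` are the variations, `D`
is the variation of `A`, and `G`, `dD`, `dX0`, `dX1` are derivatives; `e1` is the variation of the
gauge relation `e2`, and `e4` the derivative of `e3`. -/
theorem gauge_algebra {R : Type*} [Ring R] [Algebra ℂ R] (k : ℂ)
    {A A' J J' X' X₀ dX1 dX0 Y Y' G D dD : R} (hA : A * A' = 1)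
    (e1 : Y' * A + Y * D = D * J + A * J' - k • dD) (e2 : Y * A = A * J - k • G)
    (e3 : X' * A = A * X₀ - D) (e4 : dX1 * A + X' * G = G * X₀ + A * dX0 - dD)
    (e5 : J' = J * X₀ - X₀ * J + k • dX0) : Y' = Y * X' - X' * Y + k • dX1 := by
  have key : Y' * A = (Y * X' - X' * Y + k • dX1) * A := by
    rw [add_mul, sub_mul, mul_assoc Y, mul_assoc X', e2, e3, smul_mul_assoc,
      eq_sub_of_add_eq e4, eq_sub_of_add_eq e1, e5, mul_sub, mul_sub, ← mul_assoc Y, e2,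
      ← mul_assoc X', e3]
    simp only [mul_add, mul_sub, sub_mul, mul_smul_comm, smul_mul_assoc, smul_sub, smul_add,
      mul_assoc]
    abel
  have := congrArg (· * A') key
  simpa only [mul_assoc, hA, mul_one] using this

variable {m n : ℕ} {r r' : Setoid (Fin (m + n))} {hr : RespectsParity r} {hr' : RespectsParity r'}
  {k : ℂ} {g h Y : IndexMat m n (Currents m n)}

theorem Pt.map_mul (P : Pt (unitOdd m n))
    (M M' : IndexMat m n (Currents m n)) :
    (M * M').map P.hom = M.map P.hom * M'.map P.hom := Matrix.map_mul

theorem Pt.nab_hom_matMul (P : Pt (unitOdd m n))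
    (M : IndexMat m n (Currents m n))
    (X : IndexMat m n (Currents m n)[X]) :
    (M.map P.hom * X).map P.nab = (matDer M).map P.hom * X + M.map P.hom * X.map P.nab := by
  ext1 a b
  simp only [Matrix.map_apply, Matrix.mul_apply, Matrix.add_apply, map_sum, P.nab_hom_mul,
    Finset.sum_add_distrib]
  rfl

theorem Pt.nab_matMul_hom (P : Pt (unitOdd m n))
    (M : IndexMat m n (Currents m n))
    (X : IndexMat m n (Currents m n)[X]) :
    (X * M.map P.hom).map P.nab = X.map P.nab * M.map P.hom + X * (matDer M).map P.hom := by
  ext1 a b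
  simp only [Matrix.map_apply, Matrix.mul_apply, Matrix.add_apply, map_sum, P.nab_mul_hom,
    Finset.sum_add_distrib]
  rfl

/-- The gauge parameters of a variation, transported by a gauge transformation. -/
def transport {P : Pt (unitOdd m n)} {b : Bool} (δ : SDer P b)
    (g h : IndexMat m n (Currents m n))
    (X₀ : IndexMat m n (Currents m n)[X]) :
    IndexMat m n (Currents m n)[X] :=
  (g.map P.hom * X₀ - δ.mat g) * h.map P.hom

theorem IsGauge.variation (H : IsGauge k hr hr' g h Y) {P : Pt (unitOdd m n)} {b : Bool}
    (δ : SDer P b) {X₀ : IndexMat m n (Currents m n)[X]}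
    (hδ : δ.mat ((conSlice r' (refPos r r') hr').rho.mat (curMat m n)) =
      ((conSlice r' (refPos r r') hr').rho.mat (curMat m n)).map P.hom * X₀ -
        X₀ * ((conSlice r' (refPos r r') hr').rho.mat (curMat m n)).map P.hom +
          k • X₀.map P.nab) :
    δ.mat Y = Y.map P.hom * transport δ g h X₀ - transport δ g h X₀ * Y.map P.hom +
      k • (transport δ g h X₀).map P.nab := by
  have e3 : transport δ g h X₀ * g.map P.hom = g.map P.hom * X₀ - δ.mat g := by
    rw [transport, mul_assoc, ← Pt.map_mul, H.inv_mul,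
      Matrix.map_one _ (map_zero _) (map_one _), mul_one]
  have hg := H.gauge
  refine gauge_algebra k (A := g.map P.hom) (A' := h.map P.hom) (G := (matDer g).map P.hom)
    (D := δ.mat g) (dD := (δ.mat g).map P.nab) ?_ ?_ ?_ e3 ?_ hδ
  · rw [← Pt.map_mul, H.mul_inv, Matrix.map_one _ (map_zero _) (map_one _)]
  · rw [← δ.mat_mul H.parMat, hg, δ.mat_sub, δ.mat_mul H.good.par, δ.mat_smul, δ.mat_matDer]
  · rw [← Pt.map_mul, hg]
    ext1 a b
    simp only [Matrix.map_apply, Matrix.sub_apply, Matrix.smul_apply, map_sub, map_smul,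
      ← Pt.map_mul]
  · rw [← Pt.nab_matMul_hom, e3, ← Pt.nab_hom_matMul]
    ext1 a b
    simp only [Matrix.map_apply, Matrix.sub_apply, map_sub]

/-- The homomorphism to the gauge fixed current matrix. -/
def IsGauge.hom (H : IsGauge k hr hr' g h Y) : DHom m n (Currents m n) := evalHom H.parMat

theorem IsGauge.hom_mat (H : IsGauge k hr hr' g h Y) : H.hom.mat (curMat m n) = Y :=
  evalHom_mat H.parMat

theorem IsGauge.tan_hom (H : IsGauge k hr hr' g h Y) :
    (tanSlice r r' hr hr').rho.comp H.hom = (tanSlice r r' hr hr').rho :=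
  DHom.ext_mat (by rw [DHom.comp_mat, H.hom_mat, H.tan_mat])

theorem IsGauge.con_hom (H : IsGauge k hr hr' g h Y) :
    (conSlice r' (refPos r r') hr').rho.comp H.hom = H.hom :=
  DHom.ext_mat (by rw [DHom.comp_mat, H.hom_mat, H.con_mat])

theorem IsGauge.hom_tan (H : IsGauge k hr hr' g h Y)
    (hY : Y = constMat _ (refLower ℂ r r') + onMat (tanProj r r') Y) :
    H.hom.comp (tanSlice r r' hr hr').rho = H.hom := by
  refine AffSlice.comp_rho_eq _ ?_
  rw [H.hom_mat]; exact hY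

theorem IsGauge.hom_mem_sl (H : IsGauge k hr hr' g h Y) {x : Currents m n} (hx : x ∈ slAlg m n) :
    H.hom.hom x ∈ slAlg m n := 
  DHom.mem_sl (by rw [H.hom_mat]; exact H.isSlMat) hx

end GaugeVariation


/-! ### Invariance under finite gauge transformations -/

section Path

open Polynomial SuperAlg

variable {m n : ℕ}

/-- Evaluation of polynomials in a parameter. -/
def evalAt (z : ℂ) : (Currents m n)[X] →ₐ[ℂ] Currents m n where
  toRingHom := eval₂RingHom' (RingHom.id _) (algebraMap ℂ _ z) fun a => (Algebra.commutes z a).symm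
  commutes' c := by
    change eval₂ _ _ (C (algebraMap ℂ (Currents m n) c)) = _
    rw [eval₂_C]; rfl

theorem evalAt_monomial (z : ℂ) (i : ℕ) (v : Currents m n) :
    evalAt z (monomial i v) = z ^ i • v := by
  change eval₂ _ _ (monomial i v) = _
  rw [eval₂_monomial, RingHom.id_apply, ← map_pow, ← Algebra.commutes, ← Algebra.smul_def]

theorem evalAt_C (z : ℂ) (v : Currents m n) : evalAt z (C v) = v := by
  rw [← monomial_zero_left, evalAt_monomial, pow_zero, one_smul]

theorem evalAt_dX (z : ℂ) (q : (Currents m n)[X]) :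
    evalAt z (dX _ q) = totalDeriv _ (evalAt z q) := by
  induction q using Polynomial.induction_on' with
  | add p q hp hq => simp only [map_add, hp, hq]
  | monomial i v => rw [dX_monomial, evalAt_monomial, evalAt_monomial, map_smul]

theorem evalAt_parX (z : ℂ) (q : (Currents m n)[X]) :
    evalAt z (parX _ q) = parity _ (evalAt z q) := by
  induction q using Polynomial.induction_on' with
  | add p q hp hq => simp only [map_add, hp, hq]
  | monomial i v =>
    have : parX (unitOdd m n) (monomial i v) = monomial i (parity _ v) := by
      ext j; rw [coeff_parX, coeff_monomial, coeff_monomial]; split_ifs <;> simp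
    rw [this, evalAt_monomial, evalAt_monomial, map_smul]

theorem evalAt_eq_of_derivative_eq_zero {q : (Currents m n)[X]} (h : derivative q = 0) (z z' : ℂ) :
    evalAt z q = evalAt z' q := by
  have : q = C (q.coeff 0) := by
    ext j
    rw [coeff_C]
    split_ifs with hj
    · rw [hj]
    · obtain ⟨i, rfl⟩ := Nat.exists_eq_succ_of_ne_zero hj
      have h1 := congrArg (coeff · i) h
      simp only [coeff_derivative, coeff_zero] at h1
      have h2 : ((i : ℂ) + 1) • q.coeff (i + 1) = 0 := by
        rw [Algebra.smul_def, Algebra.commutes, map_add, map_natCast, map_one, h1]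
      exact (smul_eq_zero.1 h2).resolve_left (Nat.cast_add_one_ne_zero i)
  rw [this, evalAt_C, evalAt_C]

/-- A homomorphism to polynomials in a parameter, evaluated at a point. -/
def DHom.evalAt (φ : DHom m n (Currents m n)[X]) (z : ℂ) : DHom m n (Currents m n) where
  hom := (ClassicalW.evalAt z).comp φ.hom
  map_der x := by rw [AlgHom.comp_apply, φ.map_der]; exact evalAt_dX z _
  map_par x := by rw [AlgHom.comp_apply, φ.map_par]; exact evalAt_parX z _

theorem totalDeriv_natCast_add_one (j : ℕ) :
    totalDeriv (unitOdd m n) ((j : Currents m n) + 1) = 0 := by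
  have := totalDeriv_algebraMap (unitOdd m n) ((j : ℂ) + 1)
  rwa [map_add, map_natCast, map_one] at this

/-- The derivative with respect to the parameter. -/
def DHom.velocity (φ : DHom m n (Currents m n)[X]) : SDer φ.pathPt false where
  map := (derivative.restrictScalars ℂ) ∘ₗ φ.hom.toLinearMap
  map_mul y z := by
    change derivative (φ.hom (y * z)) = derivative (φ.hom y) * φ.hom z +
      φ.hom y * derivative (φ.hom z)
    rw [_root_.map_mul, derivative_mul]
  map_der y := by
    change derivative (φ.hom _) = dX _ (derivative (φ.hom y))
    rw [φ.map_der, derX_eq]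
    ext j
    rw [coeff_derivative, coeff_dX, coeff_dX, coeff_derivative, totalDeriv_mul,
      totalDeriv_natCast_add_one, mul_zero, add_zero]

theorem VanishBelow.exists_inv {f : Fin (m + n) → ℤ} {N : Type} [Ring N] [Algebra ℂ N] [SuperAlg N]
    {M : IndexMat m n N} (h : VanishBelow f 1 M) (hM : ParMat false M) :
    ∃ y, ParMat false y ∧ (1 + M) * y = 1 ∧ y * (1 + M) = 1 := by
  obtain ⟨K, hK⟩ := h.eq_zero_of_pow
  have hp (i : ℕ) : ParMat false ((-M) ^ i) := by
    induction i with
    | zero => exact parMat_one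
    | succ i ih => rw [pow_succ]; exact ih.mul_even hM.neg
  refine ⟨∑ i ∈ Finset.range K, (-M) ^ i, fun a b => ?_, ?_, ?_⟩
  · rw [Matrix.sum_apply, map_sum, Finset.smul_sum]
    exact Finset.sum_congr rfl fun i _ => hp i a b
  · have := mul_neg_geom_sum (-M) K
    rwa [sub_neg_eq_add, neg_pow, hK, mul_zero, sub_zero] at this
  · have := geom_sum_mul_neg (-M) K
    rwa [sub_neg_eq_add, neg_pow, hK, mul_zero, sub_zero] at this

theorem VanishBelow.inv {f : Fin (m + n) → ℤ} {N : Type} [Ring N]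
    {M y : IndexMat m n N} (h : VanishBelow f 1 M) (hy : y * (1 + M) = 1) :
    VanishBelow f 0 y :=
  h.of_add_mul vanishBelow_one (by rw [mul_add, mul_one] at hy; exact eq_sub_of_add_eq hy)

/-- A gauge transformation by `1 + x` changes a matrix of degree at least -2 only in degree at least
-1, so the constraints are preserved. -/
theorem VanishBelow.defect {f : Fin (m + n) → ℤ} {N : Type} [Ring N] [Algebra ℂ N] [SuperAlg N]
    {x J Z : IndexMat m n N} {k : ℂ} (hx : VanishBelow f 1 x)
    (hJ : VanishBelow f (-2) J) (hZ : Z * (1 + x) = (1 + x) * J - k • ClassicalW.matDer x) :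
    VanishBelow f (-1) (Z - J) := by
  have hD : Z - J = (x * J - J * x - k • ClassicalW.matDer x) - (Z - J) * x := by
    have e : Z + Z * x = J + x * J - k • ClassicalW.matDer x := by
      rw [mul_add, mul_one, add_mul 1 x, one_mul] at hZ
      exact hZ
    rw [sub_mul]
    nth_rewrite 1 [eq_sub_of_add_eq e]
    abel
  have h1 : VanishBelow f (-1) (x * J) := (hx.mul hJ).mono (by norm_num)
  have h2 : VanishBelow f (-1) (J * x) := (hJ.mul hx).mono (by norm_num)
  have h3 : VanishBelow f (-1) (k • ClassicalW.matDer x) := (hx.matDer.smul k).mono (by norm_num : (-1 : ℤ) ≤ 1)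
  exact hx.of_add_mul ((h1.sub h2).sub h3) hD

theorem matDer_map_evalAt (z : ℂ) (M : IndexMat m n (Currents m n)[X]) :
    (matDer M).map (evalAt z) = matDer (M.map (evalAt z)) := by
  ext1 a b
  exact evalAt_dX z _

variable {r r' : Setoid (Fin (m + n))} {hr : RespectsParity r} {hr' : RespectsParity r'}
  {k : ℂ} {g h Y : IndexMat m n (Currents m n)}

theorem vanishBelow_con (r : Setoid (Fin (m + n))) (hr' : RespectsParity r') :
    VanishBelow (grade r' (refPos r r')) (-1)
      ((conSlice r' (refPos r r') hr').rho.mat (curMat m n) -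
        constMat _ (refLower ℂ r r')) := fun a b hab => by
  rw [Matrix.sub_apply, conSlice_rho_mat, if_pos (by omega), constMat_lower, sub_self]

theorem matDer_derivative (M : IndexMat m n (Currents m n)[X]) :
    (matDer M).map derivative = matDer (M.map derivative) := by
  ext1 a b
  change derivative (dX _ (M a b)) = dX _ (derivative (M a b))
  ext j
  rw [coeff_derivative, coeff_dX, coeff_dX, coeff_derivative, totalDeriv_mul,
    totalDeriv_natCast_add_one, mul_zero, add_zero]

theorem map_derivative_mul (M M' : IndexMat m n (Currents m n)[X]) :
    (M * M').map derivative = M.map derivative * M' + M * M'.map derivative := by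
  ext1 a b
  simp only [Matrix.map_apply, Matrix.mul_apply, Matrix.add_apply, map_sum, derivative_mul,
    Finset.sum_add_distrib]

/-- The derivative of an invariant along a path of gauge transformations vanishes. -/
theorem DHom.velocity_eq_zero (φ : DHom m n (Currents m n)[X]) {pos : Fin (m + n) → ℕ}
    (hcon : φ.comp (conSlice r' pos hr').rho = φ)
    {G G' J : IndexMat m n (Currents m n)[X]} (hG : ParMat false G)
    (hG' : ParMat false G') (h1 : G * G' = 1) (h2 : G' * G = 1)
    (hZ : φ.mat (curMat m n) * G = G * J - k • matDer G) (hJ : J.map derivative = 0)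
    (hv : VanishBelow (grade r' pos) 1 (G.map derivative * G'))
    {y : Currents m n} (hy : IsInv k r' pos hr' y) : φ.velocity.map y = 0 := by
  set u := G.map derivative with hu
  have hup : ParMat false u := fun a b => by
    have h := congrArg derivative (hG a b)
    rw [derivative_smul] at h
    refine Eq.trans ?_ h
    change parX _ (derivative (G a b)) = derivative (parX _ (G a b))
    ext j
    simp [coeff_derivative]
  -- The logarithmic derivative of `G` generates the path: this is `gauge_algebra` with `J` constant
  -- and `X₀ = 0`. The parameter has positive degree, so invariants do not vary.
  have hX : ParMat false (-(u * G')) := (hup.mul_even hG').neg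
  have hvel : φ.velocity.mat (curMat m n) = (actSDer k φ.pathPt hX).mat (curMat m n) := by
    have e1 : φ.velocity.mat (curMat m n) = (φ.mat (curMat m n)).map derivative := by
      ext1 a b
      rw [SDer.mat_apply, Bool.false_and, sg_false, one_smul]; rfl
    have e2 : (curMat m n).map φ.pathPt.hom = φ.mat (curMat m n) := rfl
    rw [actSDer_mat, e1, e2]
    refine gauge_algebra k (A := G) (A' := G') (J := J) (J' := 0) (X₀ := 0) (dX0 := 0)
      (G := matDer G) (D := u) (dD := matDer u) h1 ?_ hZ ?_ ?_ ?_
    · have e3 := map_derivative_mul (φ.mat (curMat m n)) G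
      have e4 := map_derivative_mul G J
      rw [hJ, mul_zero, add_zero] at e4
      rw [mul_zero, add_zero, ← e3, hZ, ← e4, ← matDer_derivative]
      ext1 a b
      simp only [Matrix.map_apply, Matrix.sub_apply, Matrix.smul_apply, map_sub]
      congr 1
      exact derivative_smul _ _
    · rw [neg_mul, mul_assoc, h2, mul_one, mul_zero, zero_sub]
    · have e4 : matDer (-(u * G') * G) = -matDer u := by
        rw [neg_mul, mul_assoc, h2, mul_one]
        ext1 a b
        exact map_neg (SuperAlg.der (N := (Currents m n)[X])) _
      rw [matDer_mul] at e4
      rw [mul_zero, mul_zero, add_zero, zero_sub]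
      exact e4
    · rw [mul_zero, zero_mul, sub_zero, smul_zero, add_zero]
  rw [SDer.ext_mat hvel, actSDer_map]
  refine actMat_inv (fun v => ?_) (fun d c hdc => ?_) hy
  · change (φ.comp (conSlice r' pos hr').rho).hom v = φ.hom v
    rw [hcon]
  · exact hv.neg d c (by omega)

/-- Invariants do not change under finite gauge transformations. -/
theorem IsGauge.hom_eq (H : IsGauge k hr hr' g h Y) {y : Currents m n}
    (hy : IsInv k r' (refPos r r') hr' y) :
    H.hom.hom y = (conSlice r' (refPos r r') hr').rho.hom y := by
  set f := grade r' (refPos r r') with hf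
  set J₀ := (conSlice r' (refPos r r') hr').rho.mat (curMat m n) with hJ₀
  set E := constMat (Currents m n) (refLower ℂ r r') with hE
  -- The path `1 + t (g - 1)`, with `t` the polynomial variable, joins the identity to `g`.
  -- Transforming the constrained current matrix by it gives `J₀` at `t = 0` and `Y` at `t = 1`.
  let x : IndexMat m n (Currents m n)[X] := (g - 1).map (monomial 1)
  let u : IndexMat m n (Currents m n)[X] := (g - 1).map C
  let J : IndexMat m n (Currents m n)[X] := J₀.map C
  have hg1 : ParMat false (g - 1) := H.good.par.sub parMat_one
  have hx : ParMat false x := fun a b => by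
    have : parX (unitOdd m n) (monomial 1 ((g - 1) a b)) = monomial 1 (parity _ ((g - 1) a b)) := by
      ext j; rw [coeff_parX, coeff_monomial, coeff_monomial]; split_ifs <;> simp
    change parX _ (monomial 1 ((g - 1) a b)) = _ • monomial 1 ((g - 1) a b)
    rw [this, ← par_eq, hg1, ← smul_monomial]
  have hu : ParMat false u := fun a b => by
    change parX _ (C ((g - 1) a b)) = _ • C ((g - 1) a b)
    rw [parX_C, ← par_eq, hg1, smul_C]
  have hJ : ParMat false J := fun a b => by
    change parX _ (C (J₀ a b)) = _ • C (J₀ a b)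
    rw [parX_C, ← par_eq, DHom.parMat _ parMat_curMat, smul_C]
  have hxv : VanishBelow f 1 x := fun a b hab => by
    change monomial 1 ((g - 1) a b) = 0
    rw [H.upper a b hab, map_zero]
  have huv : VanishBelow f 1 u := fun a b hab => by
    change C ((g - 1) a b) = 0
    rw [H.upper a b hab, map_zero]
  obtain ⟨y', hy', h1, h2⟩ := hxv.exists_inv hx
  have hg : ParMat false (1 + x) := parMat_one.add hx
  set Z := ((1 + x) * J - k • matDer x) * y' with hZ
  have hZp : ParMat false Z := ((hg.mul_even hJ).sub (hx.der.smul k)).mul_even hy'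
  have hZg : Z * (1 + x) = (1 + x) * J - k • matDer x := by rw [hZ, mul_assoc, h2, mul_one]
  have hev (z : ℂ) : x.map (evalAt z) = z • (g - 1) := by
    ext1 a b
    exact (evalAt_monomial z 1 _).trans (by rw [pow_one]; rfl)
  have hevJ (z : ℂ) : J.map (evalAt z) = J₀ := by
    ext1 a b
    exact evalAt_C z _
  have hevZ (z : ℂ) : Z.map (evalAt z) * (1 + z • (g - 1)) =
      (1 + z • (g - 1)) * J₀ - k • matDer (z • (g - 1)) := by
    have e1 : (1 + x).map (evalAt z) = 1 + z • (g - 1) := by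
      rw [← hev, ← Matrix.map_one (evalAt z) (map_zero _) (map_one _)]
      ext1 a b
      exact map_add (evalAt z) _ _
    rw [← hev, ← matDer_map_evalAt, hev, ← e1, ← hevJ z, ← Matrix.map_mul, ← Matrix.map_mul, hZg]
    ext1 a b
    simp only [Matrix.map_apply, Matrix.sub_apply, Matrix.smul_apply, map_sub, map_smul]
  let φ := evalHom hZp
  have hφ : φ.mat (curMat m n) = Z := evalHom_mat hZp
  have hφz (z : ℂ) : (φ.evalAt z).mat (curMat m n) = Z.map (evalAt z) := by
    rw [← hφ]; rfl
  have hφ0 : φ.evalAt 0 = (conSlice r' (refPos r r') hr').rho := DHom.ext_mat <| by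
    have := hevZ 0
    rw [zero_smul, add_zero, mul_one, one_mul, ← zero_smul ℂ (1 : Matrix _ _ (Currents m n))] at this
    rw [hφz, this, zero_smul]
    ext1 a b
    simp [matDer, hJ₀]
  have hφ1 : φ.evalAt 1 = H.hom := DHom.ext_mat <| by
    have := hevZ 1
    rw [one_smul, add_sub_cancel] at this
    have e : matDer (g - 1) = matDer g := by
      have := matDer_add (g - 1) 1
      rwa [matDer_one, add_zero, sub_add_cancel, eq_comm] at this
    rw [e, ← H.gauge] at this
    have h3 := congrArg (· * h) this
    simp only [mul_assoc, H.mul_inv, mul_one] at h3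
    rw [hφz, h3, H.hom_mat]
  have hJv : VanishBelow f (-1) (J - constMat _ (refLower ℂ r r')) := fun a b hab => by
    have := vanishBelow_con r hr' a b hab
    rw [Matrix.sub_apply, sub_eq_zero] at this
    rw [Matrix.sub_apply, sub_eq_zero]
    exact congrArg C this
  have hJv2 : VanishBelow f (-2) J := fun a b hab => by
    have e := hJv a b (by omega)
    rw [Matrix.sub_apply, sub_eq_zero] at e
    have e2 : E a b = 0 := vanishBelow_refLower a b hab
    rw [e]
    change C (E a b) = 0
    rw [e2, map_zero]
  have hDv : VanishBelow f (-1) (Z - J) := hxv.defect hJv2 hZg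
  have hcon : φ.comp (conSlice r' (refPos r r') hr').rho = φ := comp_conSlice hr' fun a b hab => by
    have e := (hDv.add hJv) a b (by change f a ≤ f b - 2 at hab; omega)
    rw [sub_add_sub_cancel, Matrix.sub_apply, sub_eq_zero, constMat_lower] at e
    rw [hφ, e]
  have hdg : (1 + x).map derivative = u := by
    ext1 a b
    change derivative ((1 : Matrix _ _ (Currents m n)[X]) a b + monomial 1 ((g - 1) a b)) =
      C ((g - 1) a b)
    rw [map_add, derivative_monomial]
    by_cases hab : a = b
    · subst hab; simp
    · simp [Matrix.one_apply_ne hab]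
  have hzero : φ.velocity.map y = 0 := by
    refine φ.velocity_eq_zero hcon hg hy' h1 h2 (J := J)
      (by rw [hφ, matDer_add, matDer_one, zero_add]; exact hZg) ?_ ?_ hy
    · ext1 a b
      exact derivative_C
    · rw [hdg]
      exact huv.mul (hxv.inv h2)
  have hfin := evalAt_eq_of_derivative_eq_zero hzero 1 0
  rw [← hφ1, ← hφ0]
  exact hfin

end Path


/-! ### Restriction to the horizontal slice is bijective -/

section Restriction

open Polynomial SuperAlg

variable {m n : ℕ} {r r' : Setoid (Fin (m + n))} {hr : RespectsParity r} {hr' : RespectsParity r'}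
  {k : ℂ} {g h Y : IndexMat m n (Currents m n)}

theorem DHom.id_onX (q : (Currents m n)[X]) : (DHom.id m n).onX q = q := by
  ext j; rw [DHom.coeff_onX]; rfl

theorem parMat_actSDer {P : Pt (unitOdd m n)} {b : Bool}
    {X : IndexMat m n (Currents m n)[X]} (hX : ParMat b X)
    {M : IndexMat m n (Currents m n)} (hM : ParMat false M) :
    ParMat b ((actSDer k P hX).mat M) := fun a c => by
  have h : IsPar (unitOdd m n) (unitOdd m n (a, c)) (M a c) := by
    have := hM a c
    rwa [Bool.false_xor] at this
  have e : IsParX (unitOdd m n) (xor b (unitOdd m n (a, c))) (actMat k P b X (M a c)) := by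
    rw [actMat_apply]
    refine IsParX.sum _ fun u _ => ?_
    have h1 := P.isParX_subst (isParX_gaugeParam hX u)
      (isParX_genBr _ (affineBracket_isAffine (m := m) (n := n) k).par u h)
    convert h1 using 1
    cases b <;> cases unitOdd m n u <;> cases unitOdd m n (a, c) <;> rfl
  exact e.smul _

/-- The variation of the constrained current matrix. -/
theorem actSDer_conMat {pos : Fin (m + n) → ℕ} {φ : DHom m n (Currents m n)}
    (hφ : φ.comp (conSlice r' pos hr').rho = φ) {b : Bool}
    {X₀ : IndexMat m n (Currents m n)[X]} (hX₀ : ParMat b X₀)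
    (h0 : ∀ a c, grade r' pos a ≤ grade r' pos c - 2 →
      actMat k φ.pt b X₀ (curMat m n a c) = 0) :
    (actSDer k φ.pt hX₀).mat ((conSlice r' pos hr').rho.mat (curMat m n)) =
      ((conSlice r' pos hr').rho.mat (curMat m n)).map φ.pt.hom * X₀ -
        X₀ * ((conSlice r' pos hr').rho.mat (curMat m n)).map φ.pt.hom + k • X₀.map φ.pt.nab := by
  have e : ((conSlice r' pos hr').rho.mat (curMat m n)).map φ.pt.hom =
      (curMat m n).map φ.pt.hom := by
    ext1 a c
    exact congrArg (fun ψ : DHom m n (Currents m n) => C (ψ.hom (curMat m n a c))) hφ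
  rw [e, ← actSDer_mat k hX₀]
  ext1 a c
  rw [SDer.mat_apply, SDer.mat_apply, conSlice_rho_mat]
  split_ifs with h
  · rw [actSDer_map, actSDer_map, h0 a c h, ← constMat_lower, constMat_apply]
    exact congrArg _ ((actSDer k φ.pt hX₀).map_algebraMap _)
  · rfl

theorem IsGauge.parMat_transport (H : IsGauge k hr hr' g h Y) {P : Pt (unitOdd m n)} {b : Bool}
    {X₀ : IndexMat m n (Currents m n)[X]} (hX₀ : ParMat b X₀) :
    ParMat b (transport (actSDer k P hX₀) g h X₀) := by
  have hP {M : IndexMat m n (Currents m n)} (hM : ParMat false M) :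
      ParMat false (M.map P.hom) := fun a c => by
    rw [Matrix.map_apply, parX_eq, P.parX_hom, ← par_eq, hM, map_smul]
  refine ParMat.mul_even (ParMat.sub ?_ (parMat_actSDer hX₀ H.good.par)) (hP H.good_inv.par)
  have := (hP H.good.par).mul hX₀
  rwa [Bool.false_xor] at this

/-- Both sides are superderivations in `y`, so it suffices to compare them on the current matrix,
where this is `IsGauge.variation`. -/
theorem IsGauge.act_hom (H : IsGauge k hr hr' g h Y) {φ : DHom m n (Currents m n)}
    (hφ : φ.comp (conSlice r' (refPos r r') hr').rho = φ) {b : Bool}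
    {X₀ : IndexMat m n (Currents m n)[X]} (hX₀ : ParMat b X₀)
    (h0 : ∀ a c, grade r' (refPos r r') a ≤ grade r' (refPos r r') c - 2 →
      actMat k φ.pt b X₀ (curMat m n a c) = 0) (y : Currents m n) :
    actMat k φ.pt b X₀ (H.hom.hom y) =
      actMat k (φ.comp H.hom).pt b (transport (actSDer k φ.pt hX₀) g h X₀) y := by
  have hv := H.variation (actSDer k φ.pt hX₀) (actSDer_conMat hφ hX₀ h0)
  have eid : ((DHom.id m n).comp φ).comp H.hom = φ.comp H.hom := rfl
  have e1 : ((actSDer k φ.pt hX₀).conj (DHom.id m n) H.hom (φ.comp H.hom) eid).map y =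
      (actSDer k (φ.comp H.hom).pt (H.parMat_transport (P := φ.pt) hX₀)).map y := by
    refine SDer.ext_mat ?_ y
    rw [actSDer_mat]
    have e2 : (curMat m n).map (φ.comp H.hom).pt.hom = Y.map φ.pt.hom := by
      ext1 a c
      exact congrArg (fun M : Matrix _ _ (Currents m n) => C (φ.hom (M a c))) H.hom_mat
    rw [e2]
    refine Eq.trans ?_ hv
    ext1 a c
    rw [SDer.mat_apply, SDer.mat_apply, SDer.conj_map, DHom.id_onX, ← DHom.mat_apply, H.hom_mat]
  rw [SDer.conj_map, DHom.id_onX] at e1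
  exact e1

theorem SDer.vanishBelow {f : Fin (m + n) → ℤ} {e : ℤ} {P : Pt (unitOdd m n)} {b : Bool}
    (δ : SDer P b) {M : IndexMat m n (Currents m n)}
    (h : VanishBelow f e (M - 1)) : VanishBelow f e (δ.mat M) := fun a c hac => by
  have e : δ.mat M = δ.mat (M - 1) := by
    rw [δ.mat_sub, ← constMat_one, δ.mat_const, sub_zero]
  rw [e, δ.mat_apply, h a c hac, map_zero, smul_zero]

theorem VanishBelow.map {f : Fin (m + n) → ℤ} {e : ℤ} {N N' : Type} [Ring N] [Ring N']
    {M : IndexMat m n N} (h : VanishBelow f e M) (φ : N →+ N') :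
    VanishBelow f e (M.map φ) := fun a c hac => by
  rw [Matrix.map_apply, h a c hac, map_zero]

theorem IsGauge.vanishBelow_transport (H : IsGauge k hr hr' g h Y) {P : Pt (unitOdd m n)}
    {b : Bool} (δ : SDer P b) {X₀ : IndexMat m n (Currents m n)[X]}
    (hX₀ : VanishBelow (grade r' (refPos r r')) 1 X₀) :
    VanishBelow (grade r' (refPos r r')) 1 (transport δ g h X₀) := by
  have hg : VanishBelow (grade r' (refPos r r')) 0 g := by
    have := (H.upper.mono (by norm_num : (0 : ℤ) ≤ 1)).add vanishBelow_one
    rwa [sub_add_cancel] at this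
  have hh : VanishBelow (grade r' (refPos r r')) 0 h :=
    H.upper.inv (by rw [add_sub_cancel]; exact H.inv_mul)
  exact ((((hg.map P.hom.toRingHom.toAddMonoidHom).mul hX₀).mono (by norm_num)).sub
    (δ.vanishBelow H.upper)).mul (hh.map P.hom.toRingHom.toAddMonoidHom)

theorem vanishBelow_conMat (r : Setoid (Fin (m + n))) (hr' : RespectsParity r') :
    VanishBelow (grade r' (refPos r r')) (-2)
      ((conSlice r' (refPos r r') hr').rho.mat (curMat m n)) := by
  have := ((vanishBelow_con r hr').mono (by norm_num : (-2 : ℤ) ≤ -1)).add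
    (vanishBelow_refLower (r := r) (r' := r'))
  rwa [sub_add_cancel] at this

theorem vanishBelow_unitParam {f : Fin (m + n) → ℤ} {d c : Fin (m + n)} (hdc : f c < f d) :
    VanishBelow f 1 (unitParam d c : IndexMat m n (Currents m n)[X]) :=
  fun a b hab => by
    refine unitParam_apply_ne ?_
    rintro ⟨⟩
    omega

theorem AffSlice.rho_comp_self (S : AffSlice m n) : S.rho.comp S.rho = S.rho := by
  refine DHom.ext_mat ?_
  ext1 a b
  exact S.rho_rho _

/-- Parameters of positive degree move a matrix of degree at least -2 only in degree at least -1: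
gauge transformations preserve the constraints. -/
theorem actMat_unitParam (hr' : RespectsParity r') {d c : Fin (m + n)}
    (hdc : grade r' (refPos r r') c < grade r' (refPos r r') d) {a b : Fin (m + n)}
    (hab : grade r' (refPos r r') a ≤ grade r' (refPos r r') b - 2) :
    actMat k (conSlice r' (refPos r r') hr').rho.pt (unitOdd m n (d, c)) (unitParam d c)
      (curMat m n a b) = 0 := by
  have hX₀ := vanishBelow_unitParam (m := m) (n := n) hdc
  set ρ := (conSlice r' (refPos r r') hr').rho
  have hp := parMat_unitParam (m := m) (n := n) d c
  have e := actSDer_mat k (P := ρ.pt) hp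
  have hJ : VanishBelow (grade r' (refPos r r')) (-2) ((curMat m n).map ρ.pt.hom) :=
    (vanishBelow_conMat r hr').map (C : Currents m n →+* _).toAddMonoidHom
  have hv : VanishBelow (grade r' (refPos r r')) (-1)
      ((actSDer k ρ.pt hp).mat (curMat m n)) := by
    rw [e]
    refine (((hJ.mul hX₀).mono (by norm_num)).sub ((hX₀.mul hJ).mono (by norm_num))).add
      (((hX₀.map ρ.pt.nab.toAddMonoidHom).smul k).mono (by norm_num))
  rw [← actSDer_map k hp, SDer.map_entry, hv a b (by omega), smul_zero]

/-- A variation of `J` moves `Y` by a gauge transformation with the transported parameter. Since `Y`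
stays in the slice, this variation is a slice direction, and transversality forces the parameter to
vanish. -/
theorem IsGauge.isInv_hom (H : IsGauge k hr hr g h Y)
    (hY : Y = constMat _ (refLower ℂ r r) + onMat (tanProj r r) Y) (y : Currents m n) :
    IsInv k r (refPos r r) hr (H.hom.hom y) := by
  intro d c hdc
  set ρ := (conSlice r (refPos r r) hr).rho with hρdef
  have hρ : ρ.comp ρ = ρ := AffSlice.rho_comp_self _
  have hX₀ := vanishBelow_unitParam (m := m) (n := n) hdc
  have hp := parMat_unitParam (m := m) (n := n) d c
  have h0 (a b : Fin (m + n)) (hab : grade r (refPos r r) a ≤ grade r (refPos r r) b - 2) :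
      actMat k ρ.pt (unitOdd m n (d, c)) (unitParam d c) (curMat m n a b) = 0 :=
    actMat_unitParam hr hdc hab
  rw [onX_genBr, H.act_hom hρ hp h0]
  set X := transport (actSDer k ρ.pt hp) g h (unitParam d c) with hXdef
  have hXv : VanishBelow (grade r (refPos r r)) 1 X := H.vanishBelow_transport _ hX₀
  have hv := H.variation (actSDer k ρ.pt hp) (actSDer_conMat hρ hp h0)
  have hX0 : X = 0 := by
    refine slice_transverse hr (Y := Y.map ρ.pt.hom) (D := k • X.map ρ.pt.nab)
      (fun a b hab => hXv a b ?_) (fun a b hab => ?_) (fun a b hab => ?_)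
      (fun a => sg (unitOdd m n (d, c) && idxOdd m n a)) (fun a b hab => by rw [hr a b hab])
      (fun a => ?_) ?_
    · rw [refPos_self]; omega
    · have h1 : Y a b = lower _ r (blockPos r) a b := by
        rw [hY, Matrix.add_apply, constMat_lower, refPos_self,
          (inSlice_onMat hr r Y).1 a b (by rintro rfl; exact lt_irrefl _ hab)
            (fun hs => (grade_of_isStar hs).not_gt hab), add_zero]
      rw [Matrix.map_apply, h1, ← constMat_lower (N := Currents m n), constMat_apply,
        ← constMat_lower (N := (Currents m n)[X]), constMat_apply]
      exact ρ.pt.hom.commutes _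
    · rw [Matrix.smul_apply, Matrix.map_apply, hab, map_zero, smul_zero]
    · unfold sg; split_ifs <;> norm_num
    · rw [← hv]
      have e : (Matrix.of fun a b => sg (unitOdd m n (d, c) && idxOdd m n a) •
          (actSDer k ρ.pt hp).mat Y a b) = onMat (tanProj r r) (Y.map (actSDer k ρ.pt hp).map) := by
        rw [← onMat_map]
        ext1 a b
        rw [Matrix.of_apply, ← SDer.map_entry, Matrix.map_apply]
        conv_lhs => rw [hY]
        rw [Matrix.add_apply, map_add, constMat_apply, SDer.map_algebraMap, zero_add]
      rw [e]
      exact inSlice_onMat hr r _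
  rw [hX0, actMat_apply]
  refine Finset.sum_eq_zero fun u _ => ?_
  rw [gaugeParam, Matrix.zero_apply, smul_zero, Pt.subst_zero_left]

/-- The inverse of restriction substitutes the gauge fixed matrix `Y` for `J`; injectivity holds
because this substitution does not change invariants on the constraint surface. -/
theorem isGaugeFixing (k : ℂ) (hr : RespectsParity r) :
    IsGaugeFixing (primaryW k r) (horizontalIdeal r) := by
  obtain ⟨g, h, Y, H, hY⟩ := exists_isGauge (r := r) (r' := r) (fun _ _ e => e) k hr hr
  have hpos := refPos_self r
  refine ⟨fun x hx => ?_, fun y hy => ⟨H.hom.hom y, ?_, ?_⟩⟩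
  · rw [mem_primaryW_num hr, ← hpos] at hx
    rw [mem_primaryW_den hr, mem_horizontalIdeal hr, ← hpos]
    refine and_congr_right fun _ => ⟨fun h0 => ?_, fun h0 => ?_⟩
    · rw [← tan_comp_con, DHom.comp_apply, h0, map_zero]
    · rw [← H.hom_eq hx.2, ← H.hom_tan hY, DHom.comp_apply, h0, map_zero]
  · rw [mem_primaryW_num hr, ← hpos]
    exact ⟨H.hom_mem_sl hy, H.isInv_hom hY y⟩
  · rw [mem_horizontalIdeal hr]
    refine ⟨sub_mem (H.hom_mem_sl hy) hy, ?_⟩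
    rw [map_sub, ← DHom.comp_apply, H.tan_hom, sub_self]

end Restriction


/-! ### Comparison of gradients along the constrained slice -/

section SecondaryTangent

open Polynomial SuperAlg

variable {m n : ℕ} {r r' : Setoid (Fin (m + n))} {hr : RespectsParity r} {hr' : RespectsParity r'}
  {k : ℂ} {g h Y : IndexMat m n (Currents m n)}

theorem DHom.onX_comp (φ ψ : DHom m n (Currents m n)) (q : (Currents m n)[X]) :
    (φ.comp ψ).onX q = φ.onX (ψ.onX q) := by
  ext j; simp only [DHom.coeff_onX]; rfl

theorem IsInv.bracket_cur {pos : Fin (m + n) → ℕ} {b : Bool} {x : Currents m n}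
    (hx : IsInv k r pos hr x) (hp : IsPar (unitOdd m n) b x) {φ : DHom m n (Currents m n)}
    (hφ : φ.comp (conSlice r pos hr).rho = φ) {a c : Fin (m + n)}
    (h : grade r pos a < grade r pos c) :
    φ.onX (ClassicalW.lieBracket m n k x (curMat m n a c)) = 0 := by
  rw [← hφ, DHom.onX_comp, curMat_apply, map_smul, map_smul, rho_lieBracket_gen hp _ (hx c a h),
    smul_zero, map_zero]

theorem actMat_sub {P : Pt (unitOdd m n)} {b : Bool}
    (X X' : IndexMat m n (Currents m n)[X]) (y : Currents m n) :
    actMat k P b (X - X') y = actMat k P b X y - actMat k P b X' y := by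
  rw [eq_sub_iff_add_eq, ← actMat_add, sub_add_cancel]

theorem actSDer_mat_apply {P : Pt (unitOdd m n)} {b : Bool}
    {X : IndexMat m n (Currents m n)[X]} (hX : ParMat b X) {a c : Fin (m + n)}
    (h : actMat k P b X (curMat m n a c) = 0) :
    ((curMat m n).map P.hom * X - X * (curMat m n).map P.hom + k • X.map P.nab) a c = 0 := by
  rw [← actSDer_mat k hX, SDer.mat_apply, actSDer_map, h, smul_zero]

theorem gradMat_sub (b : Bool) (x y : Currents m n) : gradMat b (x - y) =
    gradMat b x - gradMat b y := by
  ext1 a c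
  simp only [gradMat, paramMat_apply, map_sub, smul_sub, Matrix.sub_apply]

/-- Inside a diagonal block the star entries form the first row and thus have nonnegative refined
degree. Hence the secondary constraints concern off-diagonal blocks only. -/
theorem refGrade_le_of_isStar (hle : ∀ a b, r.r a b → r'.r a b) {a b : Fin (m + n)}
    (hs : IsStar r a b) (hab : r.r a b) : refGrade r r' b ≤ refGrade r r' a := by
  have h0 : blockPos r a = 0 := by
    rcases hs with hs | hs
    · exact hs.2.1
    · exact absurd (blockLE_of_rel hab) hs.1
  have hmin : a ≤ b := by
    by_contra hlt
    have h1 : b ∈ {c | r.r c a ∧ c < a} := ⟨r.symm hab, not_le.1 hlt⟩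
    rw [blockPos, Set.ncard_eq_zero (Set.toFinite _)] at h0
    rw [h0] at h1
    exact h1
  refine refGrade_le_of_grade ?_
  have h2 : refPos r r' a ≤ refPos r r' b := by
    refine Set.ncard_le_ncard (fun c hc => ⟨r'.trans hc.1 (hle a b hab), lt_of_lt_of_le hc.2 ?_⟩)
      (Set.toFinite _)
    rw [Prod.Lex.toLex_le_toLex, blockMin_eq_iff.2 hab]
    exact Or.inr ⟨rfl, hmin⟩
  unfold grade
  rw [blockSize_congr (hle a b hab)]
  omega

theorem tanProj_single {a c : Fin (m + n)} (hs : IsStar r c a) (hne : c ≠ a)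
    (hac : refGrade r r' a ≤ refGrade r r' c) :
    tanProj r r' (Matrix.single c a 1) = Matrix.single c a 1 := by
  refine tanProj_eq_self ⟨fun d e hde hs' => ?_, 0, fun d hd => ?_, ?_⟩ fun d e hde => ?_
  · rw [Matrix.single_apply, if_neg]
    rintro ⟨rfl, rfl⟩; exact hs' hs
  · dsimp only
    rw [Matrix.single_apply, if_neg]
    rintro ⟨rfl, rfl⟩; exact hne rfl
  · refine Finset.sum_eq_zero fun d _ => ?_
    dsimp only
    rw [Matrix.single_apply, if_neg, sub_zero, smul_zero]
    rintro ⟨rfl, rfl⟩; exact hne rfl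
  · rw [Matrix.single_apply, if_neg]
    rintro ⟨rfl, rfl⟩; omega

section Entries

variable {N : Type} [Ring N] [Algebra ℂ N]

open Classical in
theorem onMat_tanProj_ne (M : IndexMat m n N) {a b : Fin (m + n)}
    (h : a ≠ b) : onMat (tanProj r r') M a b =
      if IsStar r a b ∧ refGrade r r' b ≤ refGrade r r' a then M a b else 0 := by
  rw [onMat_entry (z := if IsStar r a b ∧ refGrade r r' b ≤ refGrade r r' a then 1 else 0)]
  · split_ifs <;> simp
  · intro A
    rw [tanProj_ne A h]
    split_ifs <;> simp

theorem onMat_tanProj_diag (M : IndexMat m n N) (a : Fin (m + n)) :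
    onMat (tanProj r r') M a a = onMat (tanProj r r) M a a := by
  classical
  simp only [onMat_apply, tanProj_diag]

end Entries

theorem DHom.comp_assoc (φ ψ χ : DHom m n (Currents m n)) :
    (φ.comp ψ).comp χ = φ.comp (ψ.comp χ) := rfl

theorem tan_comp_con_self (hle : ∀ a b, r.r a b → r'.r a b) (hr : RespectsParity r)
    (hr' : RespectsParity r') :
    (tanSlice r r' hr hr').rho.comp (conSlice r (refPos r r) hr).rho =
      (tanSlice r r' hr hr').rho := by
  rw [← tan_comp_tan hle hr hr', DHom.comp_assoc, tan_comp_con]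

theorem IsGauge.tan_comp_hom (hle : ∀ a b, r.r a b → r'.r a b) (H : IsGauge k hr hr g h Y) :
    (tanSlice r r' hr hr').rho.comp H.hom = (tanSlice r r' hr hr').rho := by
  rw [← tan_comp_tan hle hr hr', DHom.comp_assoc, H.tan_hom]

theorem tan_mat_lower (hle : ∀ a b, r.r a b → r'.r a b) (hr : RespectsParity r)
    (hr' : RespectsParity r') {a b : Fin (m + n)} (h : ¬ IsStar r a b) (hab : a ≠ b) :
    (tanSlice r r' hr hr').rho.mat (curMat m n) a b =
      algebraMap ℂ _ (lower ℂ r (blockPos r) a b) := by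
  classical
  rw [AffSlice.rho_mat, Matrix.add_apply]
  change constMat _ (refLower ℂ r r') a b + onMat (tanProj r r') _ a b = _
  rw [onMat_tanProj_ne _ hab, if_neg fun e => h e.1, add_zero, constMat_apply,
    refLower_eq_lower hle (Or.inr h)]

theorem tan_mat_grade (hr : RespectsParity r) (hr' : RespectsParity r') {a b : Fin (m + n)}
    (h : refGrade r r' a < refGrade r r' b) :
    (tanSlice r r' hr hr').rho.mat (curMat m n) a b =
      algebraMap ℂ _ (refLower ℂ r r' a b) := by
  rw [AffSlice.rho_mat, Matrix.add_apply]
  change constMat _ (refLower ℂ r r') a b + onMat (tanProj r r') _ a b = _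
  rw [onMat_tanProj_grade _ h, add_zero, constMat_apply]

theorem IsGauge.eq_lower (H : IsGauge k hr hr g h Y)
    (hY : Y = constMat _ (refLower ℂ r r) + onMat (tanProj r r) Y) {a b : Fin (m + n)}
    (h : ¬ IsStar r a b) (hab : a ≠ b) :
    H.hom.hom (curMat m n a b) = algebraMap ℂ _ (lower ℂ r (blockPos r) a b) := by
  classical
  rw [← DHom.mat_apply, H.hom_mat, hY, Matrix.add_apply, onMat_tanProj_ne _ hab,
    if_neg fun e => h e.1, add_zero, constMat_apply]
  exact congrArg (fun p => algebraMap ℂ _ (lower ℂ r p a b)) (refPos_self r)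

/-- On the constrained slice, bracketing `x` with the invariant extending `z` is a variation of `z`
that keeps the current matrix in the horizontal slice of `r`; the transported parameter realises it.
-/
theorem IsGauge.tan_act (hle : ∀ a b, r.r a b → r'.r a b) (H : IsGauge k hr hr g h Y) {b : Bool}
    {x : Currents m n} (hxp : IsPar (unitOdd m n) b x) (hx : IsInv k r (refPos r r) hr x)
    (z : Currents m n) :
    actMat k (tanSlice r r' hr hr').rho.pt b
      (transport (bracketSDer k (tanSlice r r' hr hr').rho hxp) g h
        ((gradMat b x).map (tanSlice r r' hr hr').rho.onX)) z =
      (tanSlice r r' hr hr').rho.onX (lieBracket m n k x (H.hom.hom z)) := by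
  have hTc := tan_comp_con_self hle hr hr'
  have hTh : (tanSlice r r' hr hr').rho.comp H.hom = _ := H.tan_comp_hom hle
  rw [onX_lieBracket k _ b, H.act_hom hTc (DHom.parMat_onX _ (parMat_gradMat hxp)), hTh]
  · rfl
  · intro a c hac
    rw [← onX_lieBracket]
    exact hx.bracket_cur hxp hTc (by omega)

/-- The transported gauge parameters of an invariant of the smaller reduction agree, up to positive
refined grade, with the gauge parameters of an invariant of the larger one with the same
restriction. -/
theorem IsGauge.tangent (hle : ∀ a b, r.r a b → r'.r a b) (H : IsGauge k hr hr g h Y)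
    (hY : Y = constMat _ (refLower ℂ r r) + onMat (tanProj r r) Y) {b : Bool} {x y : Currents m n}
    (hxp : IsPar (unitOdd m n) b x) (hyp : IsPar (unitOdd m n) b y)
    (hx : IsInv k r (refPos r r) hr x) (hy : IsInv k r' (refPos r r') hr' y)
    (hxy : (tanSlice r r' hr hr').rho.hom x = (tanSlice r r' hr hr').rho.hom y)
    {a c : Fin (m + n)} (hac : refGrade r r' a ≤ refGrade r r' c) :
    (transport (bracketSDer k (tanSlice r r' hr hr').rho hxp) g h
        ((gradMat b x).map (tanSlice r r' hr hr').rho.onX) -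
      (gradMat b y).map (tanSlice r r' hr hr').rho.onX) a c = 0 := by
  set S := tanSlice r r' hr hr' with hS
  set T := S.rho with hT
  set δ := bracketSDer k T hxp with hδ
  set X₀ := (gradMat b x).map T.onX with hX₀
  set Xy := (gradMat b y).map T.onX with hXy
  set Z := transport δ g h X₀ - Xy with hZ
  have hX₀p : ParMat b X₀ := T.parMat_onX (parMat_gradMat hxp)
  have hXyp : ParMat b Xy := T.parMat_onX (parMat_gradMat hyp)
  have hZp : ParMat b Z := (H.parMat_transport (P := T.pt) hX₀p).sub hXyp
  have hTc : T.comp (conSlice r (refPos r r) hr).rho = T := tan_comp_con_self hle hr hr'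
  have hTc' : T.comp (conSlice r' (refPos r r') hr').rho = T := tan_comp_con hr hr'
  have hact (z : Currents m n) : actMat k T.pt b (transport δ g h X₀) z =
      actMat k T.pt b X₀ (H.hom.hom z) := by
    rw [hX₀, ← onX_lieBracket]
    exact H.tan_act hle hxp hx z
  have hgrade (z : Fin (m + n)) : grade r (refPos r r) z = grade r (blockPos r) z := by
    rw [refPos_self]
  have hTg : g.map T.pt.hom = 1 := by
    have h1 : T.mat g = 1 := by
      rw [← DHom.mat_one T, ← H.tan, ← DHom.comp_mat, tan_comp_tan hle hr hr']
    have h2 : g.map T.pt.hom = (T.mat g).map C := rfl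
    rw [h2, h1, Matrix.map_one C C_0 C_1]
  have hThinv : h.map T.pt.hom = 1 := by
    have := congrArg (Matrix.map · T.pt.hom) H.mul_inv
    simpa only [Pt.map_mul, hTg, one_mul, Matrix.map_one _ (map_zero T.pt.hom) (map_one T.pt.hom)]
      using this
  -- On the constrained slice `g` is 1, so transport alters the parameter only by the variation of
  -- `g`, which has positive `r`-degree. In nonpositive `r`-degree `Z` is thus the gradient of `x -
  -- y`, which vanishes on the slice, and is orthogonal to its directions.
  have hdiff {a c : Fin (m + n)} (hac : grade r (refPos r r) a ≤ grade r (refPos r r) c) :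
      Z a c = (gradMat b (x - y)).map T.onX a c := by
    rw [hZ, transport, hTg, hThinv, one_mul, mul_one, Matrix.sub_apply, Matrix.sub_apply,
      δ.vanishBelow H.upper a c (by omega), sub_zero, gradMat_sub, hX₀, hXy]
    exact (map_sub T.onX _ _).symm
  have hxy0 : T.hom (x - y) = 0 := by rw [map_sub, hxy, sub_self]
  have hJ (a c : Fin (m + n)) : (curMat m n).map T.pt.hom a c = C (T.mat (curMat m n) a c) := rfl
  refine tangent_grade hle hr (J := (curMat m n).map T.pt.hom) (D := k • Z.map T.pt.nab)
    (fun a c hac => ?_) (fun a c hac => ?_) (fun a c hac => ?_) (fun a c hac hs => ?_)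
    (fun a c hne hs hac => ?_) (fun a => sg (!b && idxOdd m n a)) (fun a c hac => by
      rw [hr a c hac]) (fun a => ?_) (fun w hw => ?_) a c hac
  · rw [hJ, tan_mat_lower hle hr hr' (fun hs => (grade_of_isStar hs).not_gt hac)
      (by rintro rfl; exact lt_irrefl _ hac), ← constMat_lower (N := (Currents m n)[X])]
    rfl
  · rw [hJ, tan_mat_grade hr hr' (by omega)]
    have : refLower ℂ r r' a c = 0 := by
      by_contra hne
      have := refLower_refGrade hne
      omega
    rw [this, map_zero, C_0]
  · rw [Matrix.smul_apply, Matrix.map_apply, hac, map_zero, smul_zero]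
  · refine actSDer_mat_apply hZp ?_
    -- The entries outside the star positions and of negative refined degree are moved neither by
    -- `x`, since `Y` is constant there, nor by `y`, by its invariance.
    have e1 : actMat k T.pt b X₀ (H.hom.hom (curMat m n a c)) = 0 := by
      rw [H.eq_lower hY hs (by rintro rfl; exact lt_irrefl _ hac)]
      exact (actSDer k T.pt hX₀p).map_algebraMap _
    have e2 : actMat k T.pt b Xy (curMat m n a c) = 0 := by
      rw [hXy, ← onX_lieBracket]
      exact hy.bracket_cur hyp hTc' (refGrade_lt_grade hac)
    rw [hZ, actMat_sub, hact, e1, e2, sub_zero]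
  · rw [hdiff (by rw [hgrade, hgrade]; exact grade_of_isStar hs)]
    refine S.gradMat_eq_zero b hxy0 ?_
    exact tanProj_single hs hne.symm hac
  · unfold sg; split_ifs <;> norm_num
  · have h1 := S.sum_gradMat b hxy0 (v := Matrix.diagonal w) (tanProj_eq_self
      ⟨fun d e hde _ => Matrix.diagonal_apply_ne _ hde, by simpa using hw⟩
      fun d e hde => Matrix.diagonal_apply_ne _ (by rintro rfl; exact lt_irrefl _ hde))
    rw [← h1]
    refine Finset.sum_congr rfl fun d _ => ?_
    rw [Finset.sum_eq_single d, Matrix.diagonal_apply_eq, hdiff le_rfl]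
    · intro e _ he
      rw [Matrix.diagonal_apply_ne _ he.symm, mul_zero, zero_smul]
    · simp

end SecondaryTangent


/-! ### Brackets on the constrained slice -/

section SecondaryBracket

open Polynomial SuperAlg

variable {m n : ℕ} {r r' : Setoid (Fin (m + n))} {hr : RespectsParity r} {hr' : RespectsParity r'}
  {k : ℂ} {g h Y : IndexMat m n (Currents m n)}

theorem lieBracket_parPart (x y : Currents m n) :
    lieBracket m n k x y = lieBracket m n k (parPart _ false x) y +
      lieBracket m n k (parPart _ true x) y := by
  rw [← lieBracket_add_left, parPart_add]

theorem DHom.hom_parPart (φ : DHom m n (Currents m n)) (b : Bool) (x : Currents m n) :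
    φ.hom (parPart _ b x) = parPart _ b (φ.hom x) := by
  change φ.hom ((2 : ℂ)⁻¹ • (x + sg b • parity _ x)) =
    (2 : ℂ)⁻¹ • (φ.hom x + sg b • parity _ (φ.hom x))
  rw [map_smul, map_add, map_smul, φ.map_par]
  rfl

/-- By `IsGauge.tangent` the parameters belonging to `x` and `y` differ by one of positive
`r'`-degree, under which `z` is invariant. -/
theorem IsGauge.onX_bracket (hle : ∀ a b, r.r a b → r'.r a b) (H : IsGauge k hr hr g h Y)
    (hY : Y = constMat _ (refLower ℂ r r) + onMat (tanProj r r) Y) {x y z : Currents m n}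
    (hx : IsInv k r (refPos r r) hr x) (hy : IsInv k r' (refPos r r') hr' y)
    (hxy : (tanSlice r r' hr hr').rho.hom x = (tanSlice r r' hr hr').rho.hom y)
    (hz : IsInv k r' (refPos r r') hr' z) :
    (tanSlice r r' hr hr').rho.onX (lieBracket m n k x (H.hom.hom z)) =
      (tanSlice r r' hr hr').rho.onX (lieBracket m n k y z) := by
  have key (b : Bool) : (tanSlice r r' hr hr').rho.onX
      (lieBracket m n k (parPart _ b x) (H.hom.hom z)) =
        (tanSlice r r' hr hr').rho.onX (lieBracket m n k (parPart _ b y) z) := by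
    have hxp := isPar_parPart (p := unitOdd m n) b x
    have hyp := isPar_parPart (p := unitOdd m n) b y
    rw [← H.tan_act hle hxp (hx.parPart b), onX_lieBracket k _ b, ← sub_eq_zero, ← actMat_sub]
    refine actMat_inv (pos := refPos r r') (hr := hr') (fun v => ?_) (fun d c hdc => ?_) hz
    · change C ((tanSlice r r' hr hr').rho.hom _) = C ((tanSlice r r' hr hr').rho.hom v)
      rw [← DHom.comp_apply, tan_comp_con]
    · refine H.tangent hle hY hxp hyp (hx.parPart b) (hy.parPart b) ?_ (refGrade_le_of_grade hdc)
      rw [DHom.hom_parPart, DHom.hom_parPart, hxy]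
  rw [lieBracket_parPart x, lieBracket_parPart y, map_add, map_add, key, key]

/-- The flow of an `x` that has a partner `y` is tangent to the constrained slice, so the bracket
depends only on the restriction of `z`. What has to be checked is that the star entries of negative
refined degree do not move. -/
theorem IsGauge.onX_bracket_tan (hle : ∀ a b, r.r a b → r'.r a b) (H : IsGauge k hr hr g h Y)
    (hY : Y = constMat _ (refLower ℂ r r) + onMat (tanProj r r) Y) {x : Currents m n}
    (hx : IsInv k r (refPos r r) hr x) {y : Currents m n} (hy : IsInv k r' (refPos r r') hr' y)
    (hxy : (tanSlice r r' hr hr').rho.hom x = (tanSlice r r' hr hr').rho.hom y)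
    (z : Currents m n) :
    (tanSlice r r' hr hr').rho.onX (lieBracket m n k x
      (H.hom.hom ((tanSlice r r' hr hr').rho.hom z))) =
      (tanSlice r r' hr hr').rho.onX (lieBracket m n k x (H.hom.hom z)) := by
  classical
  set S := tanSlice r r' hr hr' with hS
  set T := S.rho with hT
  have key (b : Bool) : T.onX (lieBracket m n k (parPart _ b x) (H.hom.hom (T.hom z))) =
        T.onX (lieBracket m n k (parPart _ b x) (H.hom.hom z)) := by
    have hxp := isPar_parPart (p := unitOdd m n) b x
    set X := transport (bracketSDer k T hxp) g h ((gradMat b (parPart _ b x)).map T.onX) with hX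
    have hXp : ParMat b X :=
      H.parMat_transport (P := T.pt) (T.parMat_onX (parMat_gradMat hxp))
    have hyp := isPar_parPart (p := unitOdd m n) b y
    set G := (gradMat b (parPart _ b y)).map T.onX with hG
    have hGp : ParMat b G := T.parMat_onX (parMat_gradMat hyp)
    have hZp : ParMat b (X - G) := hXp.sub hGp
    have hXv : VanishBelow (refGrade r r') 2 (X - G) := fun a c hac => by
      have h1 := refGrade_odd (r := r) (r' := r') a
      have h2 := refGrade_odd (r := r) (r' := r') c
      exact H.tangent hle hY hxp hyp (hx.parPart b) (hy.parPart b)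
        (by rw [DHom.hom_parPart, DHom.hom_parPart, hxy]) (by omega)
    have hJv : VanishBelow (refGrade r r') (-2) ((curMat m n).map T.pt.hom) := fun a c hac => by
      change C (T.mat (curMat m n) a c) = 0
      rw [hT, hS, tan_mat_grade hr hr' (by omega)]
      have : refLower ℂ r r' a c = 0 := by
        by_contra hne
        have := refLower_refGrade hne
        omega
      rw [this, map_zero, C_0]
    let δ := actSDer k T.pt hXp
    have hδ (v : Currents m n) :
        δ.map v = T.onX (lieBracket m n k (parPart _ b x) (H.hom.hom v)) :=
      H.tan_act hle hxp (hx.parPart b) v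
    have hself (a c : Fin (m + n)) :
        δ.map (onMat (tanProj r r) (curMat m n) a c) = δ.map (curMat m n a c) := by
      have e1 : H.hom.hom (onMat (tanProj r r) (curMat m n) a c) =
          H.hom.hom (curMat m n a c) - algebraMap ℂ _ (refLower ℂ r r a c) := by
        rw [← DHom.mat_apply, ← DHom.mat_apply, DHom.mat_onMat, H.hom_mat, eq_sub_iff_add_eq',
          ← constMat_apply, ← Matrix.add_apply, ← hY]
      have e2 : T.onX (lieBracket m n k (parPart _ b x)
          (algebraMap ℂ _ (refLower ℂ r r a c))) = 0 := by
        rw [← bracketSDer_map T hxp, SDer.map_algebraMap]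
      rw [hδ, hδ, e1, map_sub, map_sub, e2, sub_zero]
    rw [← hδ, ← hδ]
    refine SDer.map_rho S δ (fun v => ?_) (fun a c => ?_) z
    · exact congrArg C (S.rho_rho v)
    · change δ.map (onMat (tanProj r r') _ a c) = _
      by_cases hac : a = c
      · subst hac
        rw [onMat_tanProj_diag, hself]
      · rw [onMat_tanProj_ne _ hac]
        split_ifs with hs
        · rfl
        · rw [map_zero]
          by_cases hs' : IsStar r a c
          · have hlt : refGrade r r' a < refGrade r r' c := not_le.1 fun e => hs ⟨hs', e⟩
            -- `X - G` has refined degree at least 2 and `J` at least -2, so their commutator has no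
            -- part of negative refined degree. The remaining parameter `G`, the gradient of `y`,
            -- does not move this entry because `y` is invariant.
            have h0 : (actSDer k T.pt hZp).mat (curMat m n) a c = 0 := by
              rw [actSDer_mat]
              refine (((hJv.mul hXv).mono ?_).sub ((hXv.mul hJv).mono ?_)).add
                (((hXv.map T.pt.nab.toAddMonoidHom).smul k).mono ?_) a c (e := 0) (by omega) <;>
                norm_num
            have h1 : actMat k T.pt b (X - G) (curMat m n a c) = 0 := by
              rw [← actSDer_map k hZp, SDer.map_entry, h0, smul_zero]
            have h2 : actMat k T.pt b G (curMat m n a c) = 0 := by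
              rw [hG, ← onX_lieBracket k T b]
              exact (hy.parPart b).bracket_cur hyp (tan_comp_con hr hr') (refGrade_lt_grade hlt)
            rw [actMat_sub, h2, sub_zero] at h1
            exact h1.symm
          · rw [← hself, onMat_tanProj_ne _ hac, if_neg fun e => hs' e.1, map_zero]
  rw [lieBracket_parPart x, lieBracket_parPart x, map_add, map_add, key, key]

end SecondaryBracket


/-! ### The ideal of the secondary constraints -/

section SecondaryIdeal

open Polynomial SuperAlg

variable {m n : ℕ} {r r' : Setoid (Fin (m + n))} {hr : RespectsParity r} {hr' : RespectsParity r'}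
  {k : ℂ} {g h Y : IndexMat m n (Currents m n)}

/-- The star entries of negative refined grade. -/
def reductionEntries (r r' : Setoid (Fin (m + n))) : Set (Fin (m + n) × Fin (m + n)) :=
  {s | IsStar r s.1 s.2 ∧ ¬ r.r s.1 s.2 ∧ refGrade r r' s.1 < refGrade r r' s.2}

/-- The values of these entries on the slice. -/
def reductionValue (r r' : Setoid (Fin (m + n))) (s : Fin (m + n) × Fin (m + n)) : ℂ :=
  sgn m n s.1 * eps s.1 s.2 * refLower ℂ r r' s.1 s.2

theorem entry_eq (s : Fin (m + n) × Fin (m + n)) :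
    entry s = (sgn m n s.1 * eps s.1 s.2) • curMat m n s.1 s.2 := by
  rw [entry, gen_zero_eq, smul_smul]

theorem IsGauge.mem_num (H : IsGauge k hr hr g h Y)
    (hY : Y = constMat _ (refLower ℂ r r) + onMat (tanProj r r) Y) {x : Currents m n}
    (hx : x ∈ slAlg m n) : H.hom.hom x ∈ (primaryW k r).num := by
  rw [mem_primaryW_num hr, ← refPos_self r]
  exact ⟨H.hom_mem_sl hx, H.isInv_hom hY x⟩

theorem mem_num_iff (hr : RespectsParity r) (x : Currents m n) :
    x ∈ (primaryW k r).num ↔ x ∈ slAlg m n ∧ IsInv k r (refPos r r) hr x := by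
  rw [mem_primaryW_num hr, refPos_self]

theorem mem_den_iff (hr : RespectsParity r) (x : Currents m n) :
    x ∈ (primaryW k r).den ↔ x ∈ slAlg m n ∧ (conSlice r (refPos r r) hr).rho.hom x = 0 := by
  rw [mem_primaryW_den hr, refPos_self]

theorem entry_mem_sl {s : Fin (m + n) × Fin (m + n)} (h : s.1 ≠ s.2) : entry s ∈ slAlg m n :=
  Subalgebra.smul_mem _ (gen_mem_sl h.symm 0) _

theorem IsGauge.hom_entry_sub (H : IsGauge k hr hr g h Y) (hle : ∀ a b, r.r a b → r'.r a b)
    {s : Fin (m + n) × Fin (m + n)} (hs : refGrade r r' s.1 < refGrade r r' s.2) :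
    (tanSlice r r' hr hr').rho.hom
      (H.hom.hom (entry s) - algebraMap ℂ _ (reductionValue r r' s)) = 0 := by
  have h1 := tan_mat_grade hr hr' hs
  rw [map_sub, ← DHom.comp_apply, H.tan_comp_hom hle, entry_eq, map_smul, ← DHom.mat_apply, h1,
    AlgHom.commutes, reductionValue, map_mul, Algebra.smul_def, sub_self]

/-- Diagonal entries, and star entries of nonnegative refined degree, are not affected by the
restriction; entries off the star positions have the same constant value before and after; the
remaining star entries differ from their values by a multiple of a constraint. -/
theorem IsGauge.cur_sub_mem (H : IsGauge k hr hr g h Y) (hle : ∀ a b, r.r a b → r'.r a b)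
    (hY : Y = constMat _ (refLower ℂ r r) + onMat (tanProj r r) Y) (I : Submodule ℂ (Currents m n))
    (hI : ∀ s ∈ reductionEntries r r',
      H.hom.hom (entry s) - algebraMap ℂ _ (reductionValue r r' s) ∈ I) (a b : Fin (m + n)) :
    H.hom.hom (curMat m n a b) -
      H.hom.hom ((tanSlice r r' hr hr').rho.hom (curMat m n a b)) ∈ I := by
  classical
  have e0 (a : Fin (m + n)) (q : Setoid (Fin (m + n))) : refLower ℂ r q a a = 0 := by
    by_contra h
    have := refLower_refGrade h
    omega
  have e1 : H.hom.hom ((tanSlice r r' hr hr').rho.hom (curMat m n a b)) =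
      algebraMap ℂ _ (refLower ℂ r r' a b) + onMat (tanProj r r') Y a b := by
    rw [← DHom.mat_apply, ← DHom.mat_apply, AffSlice.rho_mat, DHom.mat_add, DHom.mat_const,
      DHom.mat_onMat, H.hom_mat]
    rfl
  have e2 : H.hom.hom (curMat m n a b) = Y a b := by rw [← DHom.mat_apply, H.hom_mat]
  rw [e1, e2]
  by_cases hab : a = b
  · subst hab
    have e3 := congrFun (congrFun hY a) a
    rw [Matrix.add_apply, constMat_apply, e0, map_zero, zero_add] at e3
    rw [e0, map_zero, zero_add, onMat_tanProj_diag, ← e3, sub_self]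
    exact zero_mem _
  rw [onMat_tanProj_ne _ hab]
  by_cases hs : IsStar r a b
  · by_cases hg : refGrade r r' b ≤ refGrade r r' a
    · have e4 : refLower ℂ r r' a b = 0 := by
        by_contra h
        have := refLower_refGrade h
        omega
      rw [if_pos ⟨hs, hg⟩, e4, map_zero, zero_add, sub_self]
      exact zero_mem _
    · have hK : (a, b) ∈ reductionEntries r r' :=
        ⟨hs, fun e => hg (refGrade_le_of_isStar hle hs e), not_le.1 hg⟩
      have h1 := I.smul_mem (sgn m n a * eps a b) (hI _ hK)
      rw [if_neg fun e => hg e.2, add_zero]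
      have e5 : sgn m n a * eps a b * (sgn m n a * eps a b) = 1 := by
        linear_combination sgn_mul_self a * (eps a b * eps a b) + eps_mul_self a b
      rw [entry_eq, map_smul, e2, reductionValue, smul_sub, smul_smul, e5, one_smul,
        Algebra.smul_def, ← map_mul, ← mul_assoc, e5, one_mul] at h1
      exact h1
  · have e3 := congrFun (congrFun hY a) b
    rw [Matrix.add_apply, constMat_apply, onMat_tanProj_ne _ hab, if_neg fun e => hs e.1,
      add_zero] at e3
    have e6 : refLower ℂ r r a b = refLower ℂ r r' a b := by
      rw [refLower_eq_lower hle (Or.inr hs), refLower_eq_lower (fun _ _ e => e) (Or.inr hs)]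
    rw [if_neg fun e => hs e.1, add_zero, e3, e6, sub_self]
    exact zero_mem _

/-- The argument of `AffSlice.diffIdeal_eq`, carried out inside the algebra of invariants:
restriction to the constrained slice changes the extension of a polynomial by an element of the
ideal, and an invariant differs from the extension of its restriction by a representative of zero.
-/
theorem IsGauge.mem_reductionIdeal (H : IsGauge k hr hr g h Y) (hle : ∀ a b, r.r a b → r'.r a b)
    (hr' : RespectsParity r')
    (hY : Y = constMat _ (refLower ℂ r r) + onMat (tanProj r r) Y) (x : Currents m n) :
    x ∈ (primaryW k r).diffIdeal {x | ∃ s ∈ reductionEntries r r',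
      x = H.hom.hom (entry s) - algebraMap ℂ _ (reductionValue r r' s)} ↔
    x ∈ (primaryW k r).num ∧ (tanSlice r r' hr hr').rho.hom x = 0 := by
  set T := (tanSlice r r' hr hr').rho with hT
  constructor
  · intro hx
    refine Submodule.mem_sInf.1 hx ((primaryW k r).num ⊓ LinearMap.ker T.hom.toLinearMap)
      ⟨fun z hz => ⟨hz.1, ?_⟩, ?_, fun z hz => ⟨?_, ?_⟩, fun z hz y hy => ⟨⟨?_, ?_⟩, ⟨?_, ?_⟩⟩⟩
    · have h1 := ((mem_den_iff hr z).1 hz.2).2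
      change T.hom z = 0
      rw [hT, ← tan_comp_con_self hle hr hr', DHom.comp_apply, h1, map_zero]
    · rintro _ ⟨s, hs, rfl⟩
      refine ⟨sub_mem (H.mem_num hY (entry_mem_sl ?_)) ?_, H.hom_entry_sub hle hs.2.2⟩
      · intro e
        exact hs.2.1 (e ▸ r.refl _)
      · rw [mem_num_iff hr]
        exact ⟨(slAlg m n).algebraMap_mem _, isInv_algebraMap _⟩
    · have h1 := (mem_num_iff hr z).1 hz.1
      exact (mem_num_iff hr _).2 ⟨totalDeriv_mem_sl h1.1, h1.2.totalDeriv⟩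
    · change T.hom (totalDeriv _ z) = 0
      rw [T.map_der, show T.hom z = 0 from hz.2, map_zero]
    · have h1 := (mem_num_iff hr z).1 hz.1
      have h2 := (mem_num_iff hr y).1 hy
      exact (mem_num_iff hr _).2 ⟨mul_mem h1.1 h2.1, h1.2.mul h2.2⟩
    · change T.hom (z * y) = 0
      rw [map_mul, show T.hom z = 0 from hz.2, zero_mul]
    · have h1 := (mem_num_iff hr z).1 hz.1
      have h2 := (mem_num_iff hr y).1 hy
      exact (mem_num_iff hr _).2 ⟨mul_mem h2.1 h1.1, h2.2.mul h1.2⟩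
    · change T.hom (y * z) = 0
      rw [map_mul, show T.hom z = 0 from hz.2, mul_zero]
  · rintro ⟨hx, hx0⟩
    refine Submodule.mem_sInf.2 fun I hI => ?_
    obtain ⟨hI1, hI2, hI3, hI4⟩ := hI
    have hxs := (mem_num_iff hr x).1 hx
    have key (y : Currents m n) (hy : y ∈ slAlg m n) : H.hom.hom y - H.hom.hom (T.hom y) ∈ I := by
      induction hy using Algebra.adjoin_induction with
      | mem y hy =>
        obtain ⟨A, j, hA, rfl⟩ := hy
        induction j with
        | zero =>
          have e : H.hom.hom (current m n A 0) - H.hom.hom (T.hom (current m n A 0)) =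
              ∑ a, ∑ b, (A a b * eps b a) • (H.hom.hom (curMat m n b a) -
                H.hom.hom (T.hom (curMat m n b a))) := by
            simp only [current, gen_zero_eq, map_sum, map_smul, smul_smul, smul_sub,
              Finset.sum_sub_distrib]
          rw [e]
          exact sum_mem fun a _ => sum_mem fun b _ => I.smul_mem _
            (H.cur_sub_mem hle hY I (fun s hs => hI2 ⟨s, hs, rfl⟩) b a)
        | succ j ih =>
          have e := hI3 _ ih
          rw [map_sub] at e
          rw [← current_succ, T.map_der, der_eq, H.hom.map_der, H.hom.map_der]
          exact e
      | algebraMap c => rw [T.hom.commutes, sub_self]; exact zero_mem _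
      | add y z _ _ hy hz =>
        rw [map_add, map_add, map_add, add_sub_add_comm]
        exact add_mem hy hz
      | mul y z hy' hz' hy hz =>
        have e : H.hom.hom (y * z) - H.hom.hom (T.hom (y * z)) =
            (H.hom.hom y - H.hom.hom (T.hom y)) * H.hom.hom z +
              H.hom.hom (T.hom y) * (H.hom.hom z - H.hom.hom (T.hom z)) := by
          rw [map_mul, map_mul, map_mul, sub_mul, mul_sub]
          abel
        rw [e]
        exact add_mem (hI4 _ hy _ (H.mem_num hY hz')).1
          (hI4 _ hz _ (H.mem_num hY (AffSlice.rho_mem_sl _ hy'))).2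
    have h1 := key x hxs.1
    rw [hx0, map_zero, sub_zero] at h1
    have h2 : x - H.hom.hom x ∈ I := hI1 ⟨sub_mem hx (H.mem_num hY hxs.1), by
      refine (mem_den_iff hr _).2 ⟨sub_mem hxs.1 (H.hom_mem_sl hxs.1), ?_⟩
      rw [map_sub, ← DHom.comp_apply, H.con_hom, H.hom_eq hxs.2, sub_self]⟩
    have := add_mem h2 h1
    rwa [sub_add_cancel] at this

end SecondaryIdeal


/-! ### Elements that commute with the constraints are invariant for `r'` -/

section SecondaryInvariants

open Polynomial SuperAlg

variable {m n : ℕ} {r r' : Setoid (Fin (m + n))} {hr : RespectsParity r} {hr' : RespectsParity r'}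
  {k : ℂ} {g h Y g' h' Y' : IndexMat m n (Currents m n)}

theorem DHom.subst_eq_zero (ψ : DHom m n (Currents m n)) {q : (Currents m n)[X]}
    (h : ψ.onX q = 0) (c : (Currents m n)[X]) : ψ.pt.subst c q = 0 := by
  rw [Pt.subst_eq_sum]
  refine Finset.sum_eq_zero fun j _ => ?_
  dsimp only
  rw [lamPt_hom, (ψ.onX_eq_zero.1 h) j, C_0, mul_zero]

theorem DHom.onX_eq_zero_of_comp {φ ψ : DHom m n (Currents m n)} (hψ : ψ.comp φ = ψ)
    {q : (Currents m n)[X]} (h : φ.onX q = 0) : ψ.onX q = 0 := by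
  rw [← hψ, DHom.onX_comp, h, map_zero]

theorem isPar_entry (s : Fin (m + n) × Fin (m + n)) :
    IsPar (unitOdd m n) (unitOdd m n s) (entry s) := by
  have h := isPar_gen (unitOdd m n) ((s.2, s.1), 0)
  have e : unitOdd m n (s.2, s.1) = unitOdd m n s := unitOdd_comm _ _
  dsimp only at h
  rw [e] at h
  rw [IsPar, entry, map_smul, show parity _ _ = _ from h, smul_comm]

theorem DHom.isPar {φ : DHom m n (Currents m n)} {b : Bool} {x : Currents m n}
    (h : IsPar (unitOdd m n) b x) : IsPar (unitOdd m n) b (φ.hom x) := by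
  rw [IsPar, ← par_eq, ← φ.map_par, show parity _ x = _ from h, map_smul]

theorem vgrad_entry (u s : Fin (m + n) × Fin (m + n)) :
    vgrad (unitOdd m n) u (entry s) = if (s.2, s.1) = u then C (algebraMap ℂ _ (sgn m n s.1)) else 0 := by
  classical
  rw [entry, map_smul, vgrad_apply, rightGrad_gen, Finsupp.sum_single_index]
  · dsimp only
    split_ifs with h
    · rw [pow_zero, pow_zero, one_smul, Module.End.one_apply, Algebra.algebraMap_eq_smul_one,
        ← smul_C, C_1]
    · rw [smul_zero]
  · split_ifs <;> simp

/-- The gauge parameters removed by the secondary constraints. -/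
def starParam (ψ : DHom m n (Currents m n)) (w : Fin (m + n) × Fin (m + n) → Currents m n)
    (c : Fin (m + n) × Fin (m + n) → (Currents m n)[X]) (K : Finset (Fin (m + n) × Fin (m + n)))
    (u : Fin (m + n) × Fin (m + n)) : (Currents m n)[X] :=
  ∑ s ∈ K, ψ.pt.subst (c s) (vgrad _ u (w s))

/-- Associativity of substitution: acting with these parameters is bracketing with the `w s` and
substituting into the coefficients `c s`. -/
theorem act_starParam (ψ : DHom m n (Currents m n))
    (w : Fin (m + n) × Fin (m + n) → Currents m n)
    (c : Fin (m + n) × Fin (m + n) → (Currents m n)[X]) (K : Finset (Fin (m + n) × Fin (m + n)))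
    (x : Currents m n) : ψ.pt.act (affineBracket m n k) (starParam ψ w c K) x =
      ∑ s ∈ K, ψ.pt.subst (c s) (lieBracket m n k (w s) x) := by
  rw [Pt.act_apply]
  simp only [starParam, Pt.subst_sum_left]
  rw [Finset.sum_comm]
  refine Finset.sum_congr rfl fun s _ => ?_
  rw [lieBracket, bracket_eq_act, Pt.act_apply, map_sum]
  simp only [Pt.subst_subst]

/-- `w s` and the entry `s` agree on the slice, so their gradients agree in the positions dual to
slice directions, and the gradient of an entry is a single constant. -/
theorem starParam_eq {ψ : DHom m n (Currents m n)}
    {w : Fin (m + n) × Fin (m + n) → Currents m n}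
    {c : Fin (m + n) × Fin (m + n) → (Currents m n)[X]} {K : Finset (Fin (m + n) × Fin (m + n))}
    {S : AffSlice m n} (hS : ψ.comp S.rho = ψ) (hw : ∀ s ∈ K, S.rho.hom (w s - entry s) = 0)
    {a b : Fin (m + n)} (hab : S.proj (Matrix.single a b 1) = Matrix.single a b 1) :
    starParam ψ w c K (b, a) = if (a, b) ∈ K then sgn m n a • c (a, b) else 0 := by
  classical
  have h1 (s) (hs : s ∈ K) : ψ.pt.subst (c s) (vgrad _ (b, a) (w s)) =
      if s = (a, b) then sgn m n a • c (a, b) else 0 := by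
    have h2 : S.rho.onX (vgrad _ (b, a) (w s - entry s)) = 0 := by
      have := S.gradMat_eq_zero true (hw s hs) hab
      rw [Matrix.map_apply, gradMat, paramMat_apply, Bool.not_true, Bool.false_and, sg_false,
        one_mul, map_smul] at this
      have := congrArg (eps b a • ·) this
      simpa only [smul_smul, eps_mul_self, one_smul, smul_zero] using this
    have h3 := ψ.subst_eq_zero (DHom.onX_eq_zero_of_comp hS h2) (c s)
    rw [map_sub, map_sub, sub_eq_zero] at h3
    rw [h3, vgrad_entry]
    by_cases e : s = (a, b)
    · subst e
      rw [if_pos rfl, if_pos rfl, Pt.subst_C, lamPt_hom, AlgHom.commutes,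
        Algebra.algebraMap_eq_smul_one, ← smul_C, C_1, mul_smul_comm, mul_one]
    · rw [if_neg e, if_neg, map_zero]
      intro h4
      exact e (Prod.ext (Prod.mk.inj h4).2 (Prod.mk.inj h4).1)
  rw [starParam, Finset.sum_congr rfl h1, Finset.sum_ite_eq']

theorem sum_starParam {ψ : DHom m n (Currents m n)}
    {w : Fin (m + n) × Fin (m + n) → Currents m n}
    {c : Fin (m + n) × Fin (m + n) → (Currents m n)[X]} {K : Finset (Fin (m + n) × Fin (m + n))}
    {S : AffSlice m n} (hS : ψ.comp S.rho = ψ) (hw : ∀ s ∈ K, S.rho.hom (w s - entry s) = 0)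
    (hK : ∀ s ∈ K, s.1 ≠ s.2) {v : Fin (m + n) → ℂ}
    (hv : S.proj (Matrix.diagonal v) = Matrix.diagonal v) :
    ∑ a, (eps a a * v a) • starParam ψ w c K (a, a) = 0 := by
  simp only [starParam, Finset.smul_sum]
  rw [Finset.sum_comm]
  refine Finset.sum_eq_zero fun s hs => ?_
  simp only [← map_smul]
  rw [← map_sum]
  refine ψ.subst_eq_zero (DHom.onX_eq_zero_of_comp hS ?_) _
  have h1 := S.sum_vgrad (hw s hs) hv
  rw [map_sum, ← h1]
  refine Finset.sum_congr rfl fun a _ => ?_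
  have e : vgrad (unitOdd m n) (a, a) (w s - entry s) = vgrad _ (a, a) (w s) := by
    rw [map_sub, vgrad_entry, if_neg, sub_zero]
    intro e
    exact hK s hs (by rw [(Prod.mk.inj e).1, (Prod.mk.inj e).2])
  rw [Finset.sum_eq_single a, Matrix.diagonal_apply_eq, e]
  · rw [map_smul, map_smul]
  · intro b _ hb
    rw [Matrix.diagonal_apply_ne _ hb.symm, mul_zero, zero_smul]
  · exact fun h => absurd (Finset.mem_univ _) h

theorem isParX_starParam (ψ : DHom m n (Currents m n)) {b : Bool}
    {w : Fin (m + n) × Fin (m + n) → Currents m n}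
    {c : Fin (m + n) × Fin (m + n) → (Currents m n)[X]} {K : Finset (Fin (m + n) × Fin (m + n))}
    (hw : ∀ s, IsPar (unitOdd m n) (unitOdd m n s) (w s))
    (hc : ∀ s, IsParX (unitOdd m n) (xor b (unitOdd m n s)) (c s))
    (u : Fin (m + n) × Fin (m + n)) :
    IsParX (unitOdd m n) (xor b (unitOdd m n u)) (starParam ψ w c K u) := by
  refine IsParX.sum _ fun s _ => ?_
  have := ψ.pt.isParX_subst (hc s) (isParX_vgrad u (hw s))
  convert this using 1
  cases b <;> cases unitOdd m n s <;> cases unitOdd m n u <;> rfl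

/-- Invariants of the smaller reduction that commute with the secondary constraints become
invariants of the larger reduction. -/
theorem IsGauge.isInv_hom_second (hle : ∀ a b, r.r a b → r'.r a b) (H : IsGauge k hr hr g h Y)
    (hY : Y = constMat _ (refLower ℂ r r) + onMat (tanProj r r) Y)
    (H' : IsGauge k hr hr' g' h' Y')
    (hY' : Y' = constMat _ (refLower ℂ r r') + onMat (tanProj r r') Y') {x : Currents m n}
    (hx : IsInv k r (refPos r r) hr x)
    (hK : ∀ s ∈ reductionEntries r r', (tanSlice r r' hr hr').rho.onX
      (lieBracket m n k (H.hom.hom (entry s)) x) = 0) :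
    IsInv k r' (refPos r r') hr' (H'.hom.hom x) := by
  classical
  intro d c hdc
  set ρ := (conSlice r' (refPos r r') hr').rho with hρdef
  have hρ : ρ.comp ρ = ρ := AffSlice.rho_comp_self _
  have hp := parMat_unitParam (m := m) (n := n) d c
  have h0 (a b : Fin (m + n)) (hab : grade r' (refPos r r') a ≤ grade r' (refPos r r') b - 2) :
      actMat k ρ.pt (unitOdd m n (d, c)) (unitParam d c) (curMat m n a b) = 0 :=
    actMat_unitParam hr' hdc hab
  have hact (z : Currents m n) := H'.act_hom hρ hp h0 z
  have hXv := H'.vanishBelow_transport (actSDer k ρ.pt hp)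
    (vanishBelow_unitParam (m := m) (n := n) hdc)
  have hXp := H'.parMat_transport (P := ρ.pt) (k := k) hp
  rw [H'.con_hom] at hact
  rw [onX_genBr, hact]
  set X := transport (actSDer k ρ.pt hp) g' h' (unitParam d c) with hX
  set b := unitOdd m n (d, c) with hb
  set Ψ := H'.hom with hΨ
  have hΨT : Ψ.comp (tanSlice r r' hr hr').rho = Ψ := H'.hom_tan hY'
  have hΨc : Ψ.comp (conSlice r (refPos r r) hr).rho = Ψ := by
    rw [← hΨT, DHom.comp_assoc, tan_comp_con_self hle]
  have hΨS : Ψ.comp (tanSlice r r hr hr).rho = Ψ := by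
    rw [← hΨT, DHom.comp_assoc, tan_comp_tan hle]
  have hcur (a c : Fin (m + n)) : Ψ.hom (curMat m n a c) = Y' a c := by
    rw [← DHom.mat_apply, H'.hom_mat]
  have hlow {a c : Fin (m + n)} (hac : refGrade r r' a < refGrade r r' c) :
      Y' a c = algebraMap ℂ _ (refLower ℂ r r' a c) := by
    rw [hY', Matrix.add_apply, onMat_tanProj_grade _ hac, add_zero, constMat_apply]
  have hstar {a c : Fin (m + n)} (hac : ¬ IsStar r a c) (hne : a ≠ c) :
      Y' a c = algebraMap ℂ _ (lower ℂ r (blockPos r) a c) := by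
    rw [hY', Matrix.add_apply, onMat_tanProj_ne _ hne, if_neg fun e => hac e.1, add_zero,
      constMat_apply, refLower_eq_lower hle (Or.inr hac)]
  have hconst {a c : Fin (m + n)} {z : ℂ} (hz : Y' a c = algebraMap ℂ _ z) :
      actMat k Ψ.pt b X (curMat m n a c) = 0 := by
    rw [← hact, hcur, hz]
    exact (actSDer k ρ.pt hp).map_algebraMap _
  -- `Y'` is constant in negative refined degree, so the transported parameter has positive refined
  -- degree and not merely positive `r'`-degree.
  have hhalf : ∀ a c, refGrade r r' a ≤ refGrade r r' c → X a c = 0 := by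
    refine half_step (Y := (curMat m n).map Ψ.pt.hom) (D := k • X.map Ψ.pt.nab)
      (fun a c hac => hXv a c (by omega)) (fun a c hac => ?_) (fun a c hac => ?_)
      (fun a c hac => actSDer_mat_apply hXp (hconst (hlow hac)))
    · rw [Matrix.map_apply, lamPt_hom, hcur, hlow hac]
      exact congrFun (congrFun (constMat_lower (N := (Currents m n)[X]) r' (refPos r r')) a) c
    · rw [Matrix.smul_apply, Matrix.map_apply, hac, map_zero, smul_zero]
  let K : Finset (Fin (m + n) × Fin (m + n)) := {s | s ∈ reductionEntries r r'}
  have hKmem {s} : s ∈ K ↔ s ∈ reductionEntries r r' := by simp [K]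
  let w := fun s : Fin (m + n) × Fin (m + n) => H.hom.hom (entry s)
  -- By `starParam_eq` these coefficients reproduce the parameter `X` at the transposes of the
  -- positions in `K`. The difference `z` vanishes there, and at the transposes of the other star
  -- entries `X` itself vanishes by `hhalf`.
  let γ := fun s : Fin (m + n) × Fin (m + n) => sgn m n s.1 • gaugeParam b X (s.2, s.1)
  have hwp (s) : IsPar (unitOdd m n) (unitOdd m n s) (w s) := DHom.isPar (isPar_entry s)
  have hw (s) : (tanSlice r r hr hr).rho.hom (w s - entry s) = 0 := by
    rw [map_sub, ← DHom.comp_apply, H.tan_hom, sub_self]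
  have hγ (s) : IsParX (unitOdd m n) (xor b (unitOdd m n s)) (γ s) := by
    have := (isParX_gaugeParam hXp (s.2, s.1)).smul (sgn m n s.1)
    rwa [show unitOdd m n (s.2, s.1) = unitOdd m n s from unitOdd_comm _ _] at this
  let z := fun u => gaugeParam b X u - starParam Ψ w γ K u
  let Z := paramMat b z
  have hZp : ParMat b Z := parMat_paramMat _ _ fun u =>
    (isParX_gaugeParam hXp u).sub (isParX_starParam Ψ hwp hγ u)
  have hZact (y : Currents m n) : actMat k Ψ.pt b X y = actMat k Ψ.pt b Z y +
      ∑ s ∈ K, Ψ.pt.subst (γ s) (lieBracket m n k (w s) y) := by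
    rw [← act_starParam, actMat, actMat, gaugeParam_paramMat, ← Pt.act_add_left]
    congr 2
    ext1 u
    exact (sub_add_cancel _ _).symm
  have hle' : ∀ a b, r.r a b → r.r a b := fun _ _ e => e
  -- For the pair `(r, r)` this says that `Z` has positive `r`-degree. Thus varying `x` by `X`
  -- splits into a gauge variation for `r`, under which `x` is invariant, and brackets with the
  -- constraints, which vanish by `hK`.
  have hZ := tangent_grade hle' hr (J := (curMat m n).map Ψ.pt.hom) (X := Z)
    (D := k • Z.map Ψ.pt.nab) (fun a c hac => ?_) (fun a c hac => ?_) (fun a c hac => ?_)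
    (fun a c hac hs => ?_) (fun a c hne hs _ => ?_) (fun a => sg (!b && idxOdd m n a))
    (fun a c hac => by rw [hr a c hac]) (fun a => ?_) (fun v hv => ?_)
  · rw [hZact x, Finset.sum_eq_zero fun s hs => Ψ.subst_eq_zero
      (DHom.onX_eq_zero_of_comp hΨT (hK s (hKmem.1 hs))) (γ s), add_zero]
    refine actMat_inv (pos := refPos r r) (hr := hr) (fun v => ?_)
      (fun d c hdc => hZ d c (refGrade_le_of_grade hdc)) hx
    change C (Ψ.hom _) = C (Ψ.hom v)
    rw [← DHom.comp_apply, hΨc]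
  · rw [Matrix.map_apply, lamPt_hom, hcur, hstar (fun hs => (grade_of_isStar hs).not_gt hac)
      (by rintro rfl; exact lt_irrefl _ hac), ← constMat_lower (N := (Currents m n)[X])]
    rfl
  · rw [Matrix.map_apply, lamPt_hom, hcur, hstar (fun hs => by
      have := grade_self_le_of_isStar hs
      omega) (by rintro rfl; omega)]
    have : lower ℂ r (blockPos r) a c = 0 := by
      by_contra hne
      have := lower_refGrade hle' hne
      omega
    rw [this, map_zero, C_0]
  · rw [Matrix.smul_apply, Matrix.map_apply, hac, map_zero, smul_zero]
  · refine actSDer_mat_apply hZp ?_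
    have h1 := hZact (curMat m n a c)
    rw [hconst (hstar hs (by rintro rfl; exact lt_irrefl _ hac)), Finset.sum_eq_zero fun s _ =>
      Ψ.subst_eq_zero ((H.isInv_hom hY (entry s)).bracket_cur (hwp s) hΨc
        (refGrade_lt_grade hac)) (γ s), add_zero] at h1
    exact h1.symm
  · have h1 := starParam_eq (w := w) (c := γ) (K := K) hΨS (fun s _ => hw s)
      (tanProj_single hs hne.symm (grade_self_le_of_isStar hs))
    have h2 : z (a, c) = 0 := by
      change gaugeParam b X (a, c) - starParam Ψ w γ K (a, c) = 0
      rw [h1]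
      split_ifs with hm
      · change _ - sgn m n c • sgn m n c • gaugeParam b X (a, c) = 0
        rw [smul_smul, sgn_mul_self, one_smul, sub_self]
      · rw [sub_zero, gaugeParam]
        dsimp only
        rw [hhalf a c, smul_zero]
        by_contra hlt
        refine hm (hKmem.2 ⟨hs, fun e => hlt (refGrade_le_of_isStar hle hs e), not_le.1 hlt⟩)
    change (sg (!b && idxOdd m n a) * eps a c) • z (a, c) = 0
    rw [h2, smul_zero]
  · unfold sg; split_ifs <;> norm_num
  · have h1 := sum_starParam (w := w) (c := γ) (K := K) hΨS (fun s _ => hw s)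
      (fun s hs e => (hKmem.1 hs).2.1 (e ▸ r.refl _)) (v := v) (tanProj_eq_self
      ⟨fun d e hde _ => Matrix.diagonal_apply_ne _ hde, by simpa using hv⟩
      fun d e hde => Matrix.diagonal_apply_ne _ (by rintro rfl; exact lt_irrefl _ hde))
    have h2 (a : Fin (m + n)) : (sg (!b && idxOdd m n a) * v a) • Z a a =
        -((eps a a * v a) • starParam Ψ w γ K (a, a)) := by
      have h3 : z (a, a) = -starParam Ψ w γ K (a, a) := by
        change gaugeParam b X (a, a) - starParam Ψ w γ K (a, a) = _
        rw [gaugeParam]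
        dsimp only
        rw [hhalf a a le_rfl, smul_zero, zero_sub]
      change (sg (!b && idxOdd m n a) * v a) • (sg (!b && idxOdd m n a) * eps a a) • z (a, a) = _
      rw [h3, smul_smul, smul_neg]
      congr 2
      linear_combination (v a * eps a a) * sg_mul_self (!b && idxOdd m n a)
    rw [Finset.sum_congr rfl fun a _ => h2 a, Finset.sum_neg_distrib, h1, neg_zero]

end SecondaryInvariants


/-! ### The reduced algebra as a relation with invariants for `r'` -/

section SecondaryReduction

open Polynomial SuperAlg

variable {m n : ℕ} {r r' : Setoid (Fin (m + n))} {hr : RespectsParity r} {hr' : RespectsParity r'}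
  {k : ℂ} {g h Y g' h' Y' : IndexMat m n (Currents m n)}

theorem lieBracket_algebraMap (x : Currents m n) (c : ℂ) :
    lieBracket m n k x (algebraMap ℂ _ c) = 0 := by
  rw [lieBracket, bracket, LinearMap.comp_apply, leftGrad_algebraMap, map_zero]

theorem algebraMap_lieBracket (c : ℂ) (x : Currents m n) :
    lieBracket m n k (algebraMap ℂ _ c) x = 0 := by
  rw [lieBracket, bracket_eq_act, Pt.act_apply]
  refine Finset.sum_eq_zero fun g _ => ?_
  have : vgrad (unitOdd m n) g (algebraMap ℂ (Currents m n) c) = 0 := by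
    rw [vgrad_apply, rightGrad_algebraMap, Finsupp.sum_zero_index]
  rw [this, Pt.subst_zero_left]

theorem IsInv.onX_lieBracket_congr {pos : Fin (m + n) → ℕ} {x z z' : Currents m n}
    (hx : IsInv k r pos hr x) {φ : DHom m n (Currents m n)}
    (hφ : φ.comp (conSlice r pos hr).rho = φ)
    (h : (conSlice r pos hr).rho.hom z = (conSlice r pos hr).rho.hom z') :
    φ.onX (ClassicalW.lieBracket m n k x z) = φ.onX (ClassicalW.lieBracket m n k x z') := by
  have key (z : Currents m n) : φ.onX (ClassicalW.lieBracket m n k x z) =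
      φ.onX (ClassicalW.lieBracket m n k x ((conSlice r pos hr).rho.hom z)) := by
    have (b : Bool) := bracketSDer_conSlice (isPar_parPart (p := unitOdd m n) b x) (hx.parPart b) z
    rw [← hφ, DHom.onX_comp, DHom.onX_comp, lieBracket_parPart x, lieBracket_parPart x]
    simp only [map_add, this]
  rw [key z, key z', h]

variable (k hr hr') in
/-- The invariants `x` of the smaller and `y` of the larger reduction that agree on the slice. -/
structure Agree (x y : Currents m n) : Prop where
  left_mem : x ∈ slAlg m n
  right_mem : y ∈ slAlg m n
  left_inv : IsInv k r (refPos r r) hr x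
  right_inv : IsInv k r' (refPos r r') hr' y
  eq : (tanSlice r r' hr hr').rho.hom x = (tanSlice r r' hr hr').rho.hom y

theorem agree_algebraMap (c : ℂ) : Agree hr hr' k (algebraMap ℂ _ c) (algebraMap ℂ _ c) :=
  ⟨algebraMap_mem _ c, algebraMap_mem _ c, isInv_algebraMap c, isInv_algebraMap c, rfl⟩

theorem Agree.mul {x y x' y' : Currents m n} (h : Agree hr hr' k x y)
    (h' : Agree hr hr' k x' y') : Agree hr hr' k (x * x') (y * y') :=
  ⟨mul_mem h.1 h'.1, mul_mem h.2 h'.2, h.3.mul h'.3, h.4.mul h'.4, by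
    rw [map_mul, map_mul, h.5, h'.5]⟩

theorem Agree.totalDeriv {x y : Currents m n} (h : Agree hr hr' k x y) :
    Agree hr hr' k (totalDeriv _ x) (totalDeriv _ y) :=
  ⟨totalDeriv_mem_sl h.1, totalDeriv_mem_sl h.2, h.3.totalDeriv, h.4.totalDeriv, by
    rw [DHom.map_der, DHom.map_der, h.5]⟩

theorem Agree.parity {x y : Currents m n} (h : Agree hr hr' k x y) :
    Agree hr hr' k (parity _ x) (parity _ y) :=
  ⟨parity_mem_sl h.1, parity_mem_sl h.2, h.3.parity, h.4.parity, by
    rw [DHom.map_par, DHom.map_par, h.5]⟩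

/-- Write `W z` for the extension of `z` to an invariant and `T` for restriction. On the slice, `{x,
x'} = {x, W x'} = {x, W (T x')} = {x, W (T y')} = {x, W y'} = {y, y'}`. -/
theorem Agree.onX_eq (hle : ∀ a b, r.r a b → r'.r a b) (H : IsGauge k hr hr g h Y)
    (hY : Y = constMat _ (refLower ℂ r r) + onMat (tanProj r r) Y) {x y x' y' : Currents m n}
    (h : Agree hr hr' k x y) (h' : Agree hr hr' k x' y') :
    (tanSlice r r' hr hr').rho.onX (lieBracket m n k x x') =
      (tanSlice r r' hr hr').rho.onX (lieBracket m n k y y') := by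
  rw [h.3.onX_lieBracket_congr (z' := H.hom.hom x') (tan_comp_con_self hle hr hr'),
    ← H.onX_bracket_tan hle hY h.3 h.4 h.5, h'.5, H.onX_bracket_tan hle hY h.3 h.4 h.5,
    H.onX_bracket hle hY h.3 h.4 h.5 h'.4]
  rw [← DHom.comp_apply, H.con_hom, H.hom_eq h'.3]

theorem Agree.lieBracket (hle : ∀ a b, r.r a b → r'.r a b) (H : IsGauge k hr hr g h Y)
    (hY : Y = constMat _ (refLower ℂ r r) + onMat (tanProj r r) Y) {x y x' y' : Currents m n}
    (h : Agree hr hr' k x y) (h' : Agree hr hr' k x' y') (j : ℕ) :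
    Agree hr hr' k ((ClassicalW.lieBracket m n k x x').coeff j)
      ((ClassicalW.lieBracket m n k y y').coeff j) :=
  ⟨slX_lieBracket k h.1 h'.1 j, slX_lieBracket k h.2 h'.2 j, h.3.lieBracket h'.3 j,
    h.4.lieBracket h'.4 j, by rw [← DHom.coeff_onX, h.onX_eq hle H hY h', DHom.coeff_onX]⟩

theorem IsGauge.agree_hom (H : IsGauge k hr hr g h Y)
    (hY : Y = constMat _ (refLower ℂ r r) + onMat (tanProj r r) Y) (hle : ∀ a b, r.r a b → r'.r a b)
    {y : Currents m n} (hy : y ∈ slAlg m n) (hy' : IsInv k r' (refPos r r') hr' y) :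
    Agree hr hr' k (H.hom.hom y) y :=
  ⟨H.hom_mem_sl hy, hy, H.isInv_hom hY y, hy', by rw [← DHom.comp_apply, H.tan_comp_hom hle]⟩

/-- On the constrained slice the constrained invariant is constant, so its partner is a constant. As
constants are central, the constraints are first class and commute, modulo the ideal, with
everything that has a partner. -/
theorem IsGauge.agree_entry (H : IsGauge k hr hr g h Y)
    (hY : Y = constMat _ (refLower ℂ r r) + onMat (tanProj r r) Y) (hle : ∀ a b, r.r a b → r'.r a b)
    {s : Fin (m + n) × Fin (m + n)} (hs : s ∈ reductionEntries r r') :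
    Agree hr hr' k (H.hom.hom (entry s)) (algebraMap ℂ _ (reductionValue r r' s)) := by
  have h1 := (mem_num_iff hr _).1 (H.mem_num hY (entry_mem_sl fun e => hs.2.1 (e ▸ r.refl _)))
  have h2 := H.hom_entry_sub (hr' := hr') hle hs.2.2
  rw [map_sub, sub_eq_zero] at h2
  exact ⟨h1.1, algebraMap_mem _ _, h1.2, isInv_algebraMap _, h2⟩

variable (k r r') in
/-- The constraints of the secondary reduction. -/
def secondaryConstraints (w : Fin (m + n) × Fin (m + n) → Currents m n) : Set (Currents m n) :=
  {x | ∃ s ∈ reductionEntries r r', x = w s - algebraMap ℂ _ (reductionValue r r' s)}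

theorem IsGauge.isFirstClass (H : IsGauge k hr hr g h Y) (hle : ∀ a b, r.r a b → r'.r a b)
    (hr' : RespectsParity r') (hY : Y = constMat _ (refLower ℂ r r) + onMat (tanProj r r) Y)
    {s t : Fin (m + n) × Fin (m + n)} (hs : s ∈ reductionEntries r r')
    (ht : t ∈ reductionEntries r r') (j : ℕ) :
    (lieBracket m n k (H.hom.hom (entry s)) (H.hom.hom (entry t))).coeff j ∈
      (primaryW k r).diffIdeal (secondaryConstraints r r' fun s => H.hom.hom (entry s)) := by
  have h := (H.agree_entry (hr' := hr') hY hle hs).lieBracket hle H hY (H.agree_entry hY hle ht) j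
  refine (H.mem_reductionIdeal hle hr' hY _).2 ⟨(mem_num_iff hr _).2 ⟨h.1, h.3⟩, ?_⟩
  rw [h.5, lieBracket_algebraMap, coeff_zero, map_zero]

/-- The partner of `x` is obtained by substituting the gauge fixed matrix of the pair `(r, r')`; its
invariance is `IsGauge.isInv_hom_second`. -/
theorem IsGauge.mem_reduce_num (H : IsGauge k hr hr g h Y) (hle : ∀ a b, r.r a b → r'.r a b)
    (hY : Y = constMat _ (refLower ℂ r r) + onMat (tanProj r r) Y)
    (H' : IsGauge k hr hr' g' h' Y')
    (hY' : Y' = constMat _ (refLower ℂ r r') + onMat (tanProj r r') Y') (x : Currents m n) :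
    x ∈ ((primaryW k r).reduce k (secondaryConstraints r r' fun s => H.hom.hom (entry s))
      (secondaryConstraints r r' fun s => H.hom.hom (entry s))).num ↔
    ∃ y, Agree hr hr' k x y := by
  constructor
  · rintro ⟨hx, hC⟩
    have hx' := (mem_num_iff hr x).1 hx
    refine ⟨H'.hom.hom x, hx'.1, H'.hom_mem_sl hx'.1, hx'.2,
      H.isInv_hom_second hle hY H' hY' hx'.2 fun s hs => ?_, by rw [← DHom.comp_apply, H'.tan_hom]⟩
    rw [DHom.onX_eq_zero]
    intro j
    have h1 := ((H.mem_reductionIdeal hle hr' hY _).1 (hC _ ⟨s, hs, rfl⟩ j)).2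
    rwa [lieBracket_sub_left, algebraMap_lieBracket, sub_zero] at h1
  · rintro ⟨y, hxy⟩
    refine ⟨(mem_num_iff hr x).2 ⟨hxy.1, hxy.3⟩, ?_⟩
    rintro _ ⟨s, hs, rfl⟩ j
    have h := (H.agree_entry (hr' := hr') hY hle hs).lieBracket hle H hY hxy j
    rw [lieBracket_sub_left, algebraMap_lieBracket, sub_zero]
    refine (H.mem_reductionIdeal hle hr' hY _).2 ⟨(mem_num_iff hr _).2 ⟨h.1, h.3⟩, ?_⟩
    rw [h.5, algebraMap_lieBracket, coeff_zero, map_zero]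

theorem IsGauge.tan_eq_zero_iff (H' : IsGauge k hr hr' g' h' Y')
    (hY' : Y' = constMat _ (refLower ℂ r r') + onMat (tanProj r r') Y') {y : Currents m n}
    (hy : IsInv k r' (refPos r r') hr' y) :
    (tanSlice r r' hr hr').rho.hom y = 0 ↔ (conSlice r' (refPos r r') hr').rho.hom y = 0 := by
  constructor <;> intro h0
  · rw [← H'.hom_eq hy, ← H'.hom_tan hY', DHom.comp_apply, h0, map_zero]
  · rw [← tan_comp_con hr hr', DHom.comp_apply, h0, map_zero]

end SecondaryReduction


/-! ### Automorphisms that permute indices of the same parity -/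

section Permutation

open Polynomial SuperAlg

variable {m n : ℕ} {θ : Equiv.Perm (Fin (m + n))} (hθ : ∀ a, idxOdd m n (θ a) = idxOdd m n a)
  {k : ℂ}

include hθ in
theorem unitOdd_perm (a b : Fin (m + n)) : unitOdd m n (θ a, θ b) = unitOdd m n (a, b) := by
  rw [unitOdd, hθ, hθ]; rfl

/-- The endomorphism of the currents that permutes the indices. -/
def permHom : DHom m n (Currents m n) :=
  evalHom (Y := (curMat m n).submatrix θ θ) fun a b => by
    rw [Matrix.submatrix_apply, parMat_curMat (θ a) (θ b), unitOdd_perm hθ]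

theorem permHom_mat : (permHom hθ).mat (curMat m n) = (curMat m n).submatrix θ θ := evalHom_mat _

theorem permHom_gen (a b : Fin (m + n)) (j : ℕ) :
    (permHom hθ).hom (gen _ ((a, b), j)) = gen _ ((θ a, θ b), j) := by
  have h := (DHom.id m n).map_gen (θ a) (θ b) j
  change gen _ ((θ a, θ b), j) = _ • der^[j] (curMat m n (θ b) (θ a)) at h
  rw [DHom.map_gen, ← DHom.mat_apply, permHom_mat, h, eps, eps, hθ, hθ]
  rfl

theorem permHom_comp {η : Equiv.Perm (Fin (m + n))} (hη : ∀ a, idxOdd m n (η a) = idxOdd m n a)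
    (h : ∀ a, θ (η a) = a) (x : Currents m n) :
    (permHom hθ).hom ((permHom hη).hom x) = x := by
  have : (permHom hθ).comp (permHom hη) = DHom.id m n := DHom.ext_mat (by
    rw [DHom.comp_mat, permHom_mat]
    ext1 a b
    change (permHom hθ).mat (curMat m n) (η a) (η b) = curMat m n a b
    rw [permHom_mat, Matrix.submatrix_apply, h, h])
  rw [← DHom.comp_apply, this]; rfl

theorem permHom_mem_sl {x : Currents m n} (hx : x ∈ slAlg m n) :
    (permHom hθ).hom x ∈ slAlg m n := by
  refine DHom.mem_sl ?_ hx
  rw [permHom_mat]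
  obtain ⟨c, hc, h⟩ := isSlMat_curMat (m := m) (n := n)
  refine ⟨c, hc, fun a b => ?_⟩
  have := h (θ a) (θ b)
  rw [Matrix.sub_apply, Matrix.diagonal_apply] at this ⊢
  simp only [θ.injective.eq_iff] at this
  exact this

theorem permHom_affineBracket (a b c d : Fin (m + n)) :
    (permHom hθ).onX (affineBracket m n k (a, b) (c, d)) =
      affineBracket m n k (θ a, θ b) (θ c, θ d) := by
  have e (i : ℕ) (v : Currents m n) :
      (permHom hθ).onX (monomial i v) = monomial i ((permHom hθ).hom v) := by
    rw [← C_mul_X_pow_eq_monomial, map_mul, map_pow, DHom.onX_X, DHom.onX_C,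
      C_mul_X_pow_eq_monomial]
  unfold affineBracket
  dsimp only
  rw [map_add, e, e, map_sub, map_smul, AlgHom.commutes, unitOdd_perm hθ, unitOdd_perm hθ]
  simp only [θ.injective.eq_iff, sgn, hθ]
  congr 3
  · split_ifs
    · exact permHom_gen hθ _ _ _
    · exact map_zero _
  · congr 1
    split_ifs
    · exact permHom_gen hθ _ _ _
    · exact map_zero _

theorem DHom.map_tw (φ : DHom m n (Currents m n)) (b : Bool) (x : Currents m n) :
    φ.hom (tw _ b x) = tw _ b (φ.hom x) := by
  cases b
  · simp
  · rw [tw_true, tw_true, φ.map_par]; rfl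

theorem permHom_genBr (a b : Fin (m + n)) (y : Currents m n) :
    genBr _ (affineBracket m n k) (θ a, θ b) ((permHom hθ).hom y) =
      (permHom hθ).onX (genBr _ (affineBracket m n k) (a, b) y) := by
  have hB := (affineBracket_isAffine (m := m) (n := n) k).par
  induction y using gen_induction with
  | algebraMap c => rw [AlgHom.commutes, genBr_algebraMap, genBr_algebraMap, map_zero]
  | gen u =>
    obtain ⟨⟨c, d⟩, j⟩ := u
    rw [permHom_gen, genBr_gen, genBr_gen, DHom.onX_lamL_pow, permHom_affineBracket]
  | add x y hx hy => rw [map_add, map_add, map_add, map_add, hx, hy]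
  | mul x y hx hy =>
    rw [map_mul, genBr_mul _ hB, genBr_mul _ hB, map_add, map_mul, map_mul, hx, hy, DHom.onX_C,
      DHom.onX_C, DHom.map_tw, unitOdd_perm hθ]

theorem permHom_rightGrad (a b : Fin (m + n)) (j : ℕ) (x : Currents m n) :
    rightGrad _ ((permHom hθ).hom x) ((θ a, θ b), j) =
      (permHom hθ).hom (rightGrad _ x ((a, b), j)) := by
  classical
  induction x using gen_induction with
  | algebraMap c => rw [AlgHom.commutes, rightGrad_algebraMap]; exact (map_zero _).symm
  | gen u =>
    obtain ⟨⟨c, d⟩, i⟩ := u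
    rw [permHom_gen, rightGrad_gen, rightGrad_gen, Finsupp.single_apply, Finsupp.single_apply,
      apply_ite (permHom hθ).hom, map_one, map_zero]
    simp only [Prod.mk.injEq, θ.injective.eq_iff]
  | add x y hx hy => rw [map_add, map_add, map_add, Finsupp.add_apply, Finsupp.add_apply, map_add, hx, hy]
  | mul x y hx hy =>
    rw [map_mul, rightGrad_mul, rightGrad_mul, map_add, map_mul, map_mul, hx, hy, DHom.map_tw,
      unitOdd_perm hθ]

theorem permHom_vgrad (a b : Fin (m + n)) (x : Currents m n) :
    vgrad _ (θ a, θ b) ((permHom hθ).hom x) = (permHom hθ).onX (vgrad _ (a, b) x) := by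
  classical
  let e : ((Fin (m + n) × Fin (m + n)) × ℕ) ≃ ((Fin (m + n) × Fin (m + n)) × ℕ) :=
    (θ.prodCongr θ).prodCongr (Equiv.refl ℕ)
  have h : rightGrad _ ((permHom hθ).hom x) =
      ((rightGrad _ x).mapRange (permHom hθ).hom (map_zero _)).equivMapDomain e := by
    ext1 u
    obtain ⟨⟨⟨c, d⟩, j⟩, rfl⟩ := e.surjective u
    rw [Finsupp.equivMapDomain_apply, e.symm_apply_apply, Finsupp.mapRange_apply]
    exact permHom_rightGrad hθ c d j x
  rw [vgrad_apply, vgrad_apply, h, Finsupp.sum_equivMapDomain, Finsupp.sum_mapRange_index,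
    Finsupp.sum, Finsupp.sum, map_sum]
  · refine Finset.sum_congr rfl fun u _ => ?_
    obtain ⟨⟨c, d⟩, j⟩ := u
    change (if (θ c, θ d) = (θ a, θ b) then (-1 : ℂ) ^ j • (lamL _ ^ j) (C _) else 0) = _
    simp only [Prod.mk.injEq, θ.injective.eq_iff]
    split_ifs
    · rw [map_smul, DHom.onX_lamL_pow, DHom.onX_C]
    · rw [map_zero]
  · intro u
    split_ifs <;> simp

theorem DHom.subst_onX (φ : DHom m n (Currents m n)) (c q : (Currents m n)[X]) :
    (idPt _).subst c (φ.onX q) = φ.pt.subst c q := by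
  induction q using Polynomial.induction_on' with
  | add p q hp hq => rw [map_add, map_add, map_add, hp, hq]
  | monomial i v =>
    have e : φ.onX (monomial i v) = monomial i (φ.hom v) := by
      rw [← C_mul_X_pow_eq_monomial, map_mul, map_pow, onX_X, onX_C, C_mul_X_pow_eq_monomial]
    rw [e, Pt.subst_monomial, Pt.subst_monomial]; rfl

theorem permHom_lieBracket (x y : Currents m n) :
    lieBracket m n k ((permHom hθ).hom x) ((permHom hθ).hom y) =
      (permHom hθ).onX (lieBracket m n k x y) := by
  rw [lieBracket, lieBracket, bracket_eq_act, bracket_eq_act, Pt.act_apply, Pt.act_apply, map_sum,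
    ← (θ.prodCongr θ).sum_comp]
  refine Finset.sum_congr rfl fun u _ => ?_
  obtain ⟨a, b⟩ := u
  change (idPt _).subst (vgrad _ (θ a, θ b) _) (genBr _ _ (θ a, θ b) _) = _
  rw [permHom_vgrad, permHom_genBr, DHom.subst_onX]
  exact ((permHom hθ).onX_subst (DHom.id m n) _ _).symm

variable {r : Setoid (Fin (m + n))} {hr : RespectsParity r} {pos pos' : Fin (m + n) → ℕ}

/-- A permutation inside the blocks that carries one numbering to the other also carries the grading
and the lowering matrix along. -/
theorem permHom_conSlice (hrel : ∀ a, r.r (θ a) a) (hpos : ∀ a, pos' (θ a) = pos a) :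
    (permHom hθ).comp (conSlice r pos hr).rho = (conSlice r pos' hr).rho.comp (permHom hθ) := by
  have hg (a : Fin (m + n)) : grade r pos' (θ a) = grade r pos a := by
    unfold grade
    rw [hpos, blockSize_congr (hrel a)]
  have hrr (a b : Fin (m + n)) : r.r (θ a) (θ b) ↔ r.r a b :=
    ⟨fun h => r.trans' (r.symm' (hrel a)) (r.trans' h (hrel b)),
      fun h => r.trans' (hrel a) (r.trans' h (r.symm' (hrel b)))⟩
  refine DHom.ext_mat ?_
  rw [DHom.comp_mat, DHom.comp_mat, permHom_mat]
  ext1 a b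
  rw [DHom.mat_apply, conSlice_rho_mat]
  change _ = (conSlice r pos' hr).rho.mat (curMat m n) (θ a) (θ b)
  rw [conSlice_rho_mat, hg, hg]
  split_ifs
  · simp only [lower, Matrix.of_apply]
    rw [apply_ite (permHom hθ).hom, map_one, map_zero]
    classical
    exact if_congr (by rw [hpos, hpos]; exact and_congr_left' (hrr a b).symm) rfl rfl
  · rw [← DHom.mat_apply, permHom_mat]; rfl

theorem IsInv.permHom (hrel : ∀ a, r.r (θ a) a) (hpos : ∀ a, pos' (θ a) = pos a)
    {x : Currents m n} (hx : IsInv k r pos hr x) :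
    IsInv k r pos' hr ((ClassicalW.permHom hθ).hom x) := by
  intro a b hab
  obtain ⟨a, rfl⟩ := θ.surjective a
  obtain ⟨b, rfl⟩ := θ.surjective b
  rw [permHom_genBr, ← DHom.onX_comp, ← permHom_conSlice hθ hrel hpos, DHom.onX_comp, hx a b,
    map_zero]
  unfold grade at hab ⊢
  rwa [hpos, hpos, blockSize_congr (hrel a), blockSize_congr (hrel b)] at hab

theorem IsPos.exists_perm (h : IsPos r pos) (h' : IsPos r pos') :
    ∃ θ : Equiv.Perm (Fin (m + n)), (∀ a, r.r (θ a) a) ∧ ∀ a, pos' (θ a) = pos a := by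
  choose f hf hf' using fun a => h'.exists_eq a (h.lt a)
  have hinj : Function.Injective f := fun a b hab => h.inj a b
    (r.trans' (r.symm' (hf a)) (hab ▸ hf b)) (by rw [← hf', hab, hf'])
  exact ⟨Equiv.ofBijective f (Finite.injective_iff_bijective.1 hinj), hf, hf'⟩

end Permutation


/-! ### The isomorphism and the theorem -/

section Isomorphism

open SuperAlg

variable {m n : ℕ} {k : ℂ}

/-- Two subquotients with the same image under restriction maps whose kernels are the spaces of
representatives of zero. -/
theorem Subquotient.isomorphic_of_maps {Q Q' : Subquotient m n} {V : Type*} [AddCommGroup V]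
    [Module ℂ V] (f f' : Currents m n →ₗ[ℂ] V) (hf : ∀ x ∈ Q.num, x ∈ Q.den ↔ f x = 0)
    (hf' : ∀ x ∈ Q'.num, x ∈ Q'.den ↔ f' x = 0) (him : ∀ x ∈ Q.num, ∃ y ∈ Q'.num, f x = f' y)
    (him' : ∀ y ∈ Q'.num, ∃ x ∈ Q.num, f x = f' y) {R : Currents m n → Currents m n → Prop}
    (hR : ∀ x y, R x y ↔ x ∈ Q.num ∧ y ∈ Q'.num ∧ f x = f' y) (h_one : R 1 1)
    (h_mul : ∀ x y x' y', R x y → R x' y' → R (x * x') (y * y'))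
    (h_der : ∀ x y, R x y → R (totalDeriv (unitOdd m n) x) (totalDeriv (unitOdd m n) y))
    (h_par : ∀ x y, R x y → R (parity (unitOdd m n) x) (parity (unitOdd m n) y))
    (h_br : ∀ x y x' y', R x y → R x' y' → ∀ j,
      R ((lieBracket m n k x x').coeff j) ((lieBracket m n k y y').coeff j)) :
    Q.Isomorphic k Q' := by
  have hk : Q.den.submoduleOf Q.num = LinearMap.ker (f.domRestrict Q.num) := by
    ext x; exact hf x x.2
  have hk' : Q'.den.submoduleOf Q'.num = LinearMap.ker (f'.domRestrict Q'.num) := by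
    ext x; exact hf' x x.2
  have hrange : LinearMap.range (f.domRestrict Q.num) = LinearMap.range (f'.domRestrict Q'.num) := by
    ext v
    constructor
    · rintro ⟨⟨x, hx⟩, rfl⟩
      obtain ⟨y, hy, h⟩ := him x hx
      exact ⟨⟨y, hy⟩, h.symm⟩
    · rintro ⟨⟨y, hy⟩, rfl⟩
      obtain ⟨x, hx, h⟩ := him' y hy
      exact ⟨⟨x, hx⟩, h⟩
  let e := (Submodule.quotEquivOfEq _ _ hk).trans (f.domRestrict Q.num).quotKerEquivRange
  let e' := (Submodule.quotEquivOfEq _ _ hk').trans (f'.domRestrict Q'.num).quotKerEquivRange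
  refine ⟨(e.trans (LinearEquiv.ofEq _ _ hrange)).trans e'.symm, R, fun x y => ?_, h_one, h_mul,
    h_der, h_par, h_br⟩
  rw [hR]
  constructor
  · rintro ⟨hx, hy, h⟩
    refine ⟨hx, hy, ?_⟩
    rw [LinearEquiv.trans_apply, LinearEquiv.symm_apply_eq]
    exact Subtype.ext h
  · rintro ⟨hx, hy, h⟩
    rw [LinearEquiv.trans_apply, LinearEquiv.symm_apply_eq] at h
    exact ⟨hx, hy, congrArg Subtype.val h⟩

section LieStructure

attribute [local instance] LieRing.ofAssociativeRing

/-- The matrices supported in the blocks. -/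
def blockDiagonalLie (r : Setoid (Fin (m + n))) :
    LieSubalgebra ℂ (IndexMat m n ℂ) where
  carrier := {A | ∀ a b, ¬ r.r a b → A a b = 0}
  add_mem' {A B} hA hB a b h := by rw [Matrix.add_apply, hA a b h, hB a b h, add_zero]
  zero_mem' _ _ _ := rfl
  smul_mem' c A hA a b h := by rw [Matrix.smul_apply, hA a b h, smul_zero]
  lie_mem' {A B} hA hB a b h := by
    have key {A B : IndexMat m n ℂ} (hA : ∀ a b, ¬ r.r a b → A a b = 0)
        (hB : ∀ a b, ¬ r.r a b → B a b = 0) : (A * B) a b = 0 := by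
      rw [Matrix.mul_apply]
      refine Finset.sum_eq_zero fun c _ => ?_
      by_cases hc : r.r a c
      · rw [hB c b fun hcb => h (r.trans' hc hcb), mul_zero]
      · rw [hA a c hc, zero_mul]
    rw [Ring.lie_def, Matrix.sub_apply, key hA hB, key hB hA, sub_zero]

/-- The matrices supported in the blocks of `r'` form a Lie algebra containing `regularSubalgebra
r'`, hence the root vector `E_{ab}`. -/
theorem rel_of_regularSubalgebra_le {r r' : Setoid (Fin (m + n))}
    (h : regularSubalgebra r ≤ regularSubalgebra r') (a b : Fin (m + n)) (hab : r.r a b) :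
    r'.r a b := by
  by_cases hne : a = b
  · exact hne ▸ r'.refl' a
  have h1 : Matrix.single a b (1 : ℂ) ∈ regularSubalgebra r :=
    LieSubalgebra.subset_lieSpan ⟨a, b, hne, hab, rfl⟩
  have h2 : regularSubalgebra r' ≤ blockDiagonalLie r' := by
    refine LieSubalgebra.lieSpan_le.2 ?_
    rintro _ ⟨c, d, -, hcd, rfl⟩ x y hxy
    rw [Matrix.single_apply, if_neg]
    rintro ⟨rfl, rfl⟩
    exact hxy hcd
  by_contra hc
  have h3 := h2 (h h1) a b hc
  rw [Matrix.single_apply_same] at h3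
  exact one_ne_zero h3

end LieStructure

variable {r r' : Setoid (Fin (m + n))} {hr : RespectsParity r} {hr' : RespectsParity r'}
  {g h Y g' h' Y' : IndexMat m n (Currents m n)}

/-- Both algebras are embedded by restriction to the constrained slice, the second one after the
permutation that replaces the standard numbering of the blocks of `r'` by `refPos`. The images
coincide and the operations agree by the properties of `Agree`. -/
theorem IsGauge.reduce_isomorphic (H : IsGauge k hr hr g h Y) (hle : ∀ a b, r.r a b → r'.r a b)
    (hY : Y = constMat _ (refLower ℂ r r) + onMat (tanProj r r) Y)
    (H' : IsGauge k hr hr' g' h' Y')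
    (hY' : Y' = constMat _ (refLower ℂ r r') + onMat (tanProj r r') Y') :
    ((primaryW k r).reduce k (secondaryConstraints r r' fun s => H.hom.hom (entry s))
      (secondaryConstraints r r' fun s => H.hom.hom (entry s))).Isomorphic k
        (primaryW k r') := by
  obtain ⟨θ, hrel, hpos⟩ := (isPos_refPos r r').exists_perm (isPos_blockPos r')
  have hrel' (a) : r'.r (θ.symm a) a := by
    have := hrel (θ.symm a)
    rw [θ.apply_symm_apply] at this
    exact r'.symm' this
  have hpos' (a) : refPos r r' (θ.symm a) = blockPos r' a := by
    rw [← hpos, θ.apply_symm_apply]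
  have hθ (a) : idxOdd m n (θ a) = idxOdd m n a := hr' _ _ (hrel a)
  have hη (a) : idxOdd m n (θ.symm a) = idxOdd m n a := hr' _ _ (hrel' a)
  set φ := permHom hθ with hφ
  set ψ := permHom hη with hψ
  have hψφ (x : Currents m n) : ψ.hom (φ.hom x) = x := permHom_comp hη hθ θ.symm_apply_apply x
  have hφψ (x : Currents m n) : φ.hom (ψ.hom x) = x := permHom_comp hθ hη θ.apply_symm_apply x
  have hnum (y : Currents m n) : y ∈ (primaryW k r').num ↔
      ψ.hom y ∈ slAlg m n ∧ IsInv k r' (refPos r r') hr' (ψ.hom y) := by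
    rw [mem_primaryW_num hr']
    refine ⟨fun hy => ⟨permHom_mem_sl hη hy.1, hy.2.permHom hη hrel' hpos'⟩, fun hy => ?_⟩
    rw [← hφψ y]
    exact ⟨permHom_mem_sl hθ hy.1, hy.2.permHom hθ hrel hpos⟩
  have hnumQ := H.mem_reduce_num hle hY H' hY'
  have hR (x y : Currents m n) : Agree hr hr' k x (ψ.hom y) ↔
      x ∈ ((primaryW k r).reduce k (secondaryConstraints r r' fun s => H.hom.hom (entry s))
        (secondaryConstraints r r' fun s => H.hom.hom (entry s))).num ∧ y ∈ (primaryW k r').num ∧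
      (tanSlice r r' hr hr').rho.hom x = (tanSlice r r' hr hr').rho.hom (ψ.hom y) := by
    refine ⟨fun h => ⟨(hnumQ x).2 ⟨_, h⟩, (hnum y).2 ⟨h.2, h.4⟩, h.5⟩, fun h => ?_⟩
    obtain ⟨h1, h2, h3⟩ := h
    obtain ⟨z, hz⟩ := (hnumQ x).1 h1
    exact ⟨hz.1, ((hnum y).1 h2).1, hz.3, ((hnum y).1 h2).2, h3⟩
  refine Subquotient.isomorphic_of_maps (tanSlice r r' hr hr').rho.hom.toLinearMap
    ((tanSlice r r' hr hr').rho.hom.toLinearMap ∘ₗ ψ.hom.toLinearMap)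
    (R := fun x y => Agree hr hr' k x (ψ.hom y)) (fun x hx => ?_) (fun y hy => ?_) (fun x hx => ?_)
    (fun y hy => ?_) hR ?_ (fun x y x' y' h1 h2 => ?_) (fun x y h => ?_) (fun x y h => ?_)
    (fun x y x' y' h1 h2 j => ?_)
  · refine (H.mem_reductionIdeal hle hr' hY x).trans (and_iff_right hx.1)
  · have h1 := (hnum y).1 hy
    change _ ↔ (tanSlice r r' hr hr').rho.hom (ψ.hom y) = 0
    rw [H'.tan_eq_zero_iff hY' h1.2, mem_primaryW_den hr',
      and_iff_right ((mem_primaryW_num hr' y).1 hy).1]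
    have e : (conSlice r' (refPos r r') hr').rho.hom (ψ.hom y) =
        ψ.hom ((conSlice r' (blockPos r') hr').rho.hom y) :=
      congrArg (fun f : DHom m n (Currents m n) => f.hom y)
        (permHom_conSlice hη (hr := hr') hrel' hpos').symm
    rw [e]
    refine ⟨fun h => by rw [h, map_zero], fun h => ?_⟩
    rw [← hφψ ((conSlice r' (blockPos r') hr').rho.hom y), h, map_zero]
  · obtain ⟨y, hy⟩ := (hnumQ x).1 hx
    refine ⟨φ.hom y, (hnum _).2 ?_, ?_⟩
    · rw [hψφ]; exact ⟨hy.2, hy.4⟩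
    · change _ = (tanSlice r r' hr hr').rho.hom (ψ.hom (φ.hom y))
      rw [hψφ]; exact hy.5
  · have h1 := (hnum y).1 hy
    have h2 := H.agree_hom hY hle h1.1 h1.2
    exact ⟨_, (hnumQ _).2 ⟨_, h2⟩, h2.5⟩
  · have := agree_algebraMap (hr := hr) (hr' := hr') (k := k) 1
    rw [map_one] at this
    change Agree hr hr' k 1 (ψ.hom 1)
    rwa [map_one]
  · rw [map_mul]
    exact h1.mul h2
  · rw [ψ.map_der]
    exact h.totalDeriv
  · rw [ψ.map_par]
    exact h.parity
  · rw [← DHom.coeff_onX, ← permHom_lieBracket]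
    exact h1.lieBracket hle H hY h2 j

end Isomorphism

end ClassicalW
end

open ClassicalW in
theorem mainTheorem5 (m n : ℕ) (k : ℂ) (r r' : Setoid (Fin (m + n)))
    (hr : RespectsParity r) (hr' : RespectsParity r')
    (hH : regularSubalgebra r ≤ regularSubalgebra r') :
    IsGaugeFixing (primaryW k r) (horizontalIdeal r) ∧
    ∃ (K : Set (Fin (m + n) × Fin (m + n))) (χ : Fin (m + n) × Fin (m + n) → ℂ)
      (w : Fin (m + n) × Fin (m + n) → Currents m n),
      (∀ s ∈ K, IsStar r s.1 s.2 ∧ ¬ r.r s.1 s.2 ∧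
        w s ∈ (primaryW k r).num ∧ w s - entry s ∈ horizontalIdeal r) ∧
      (∀ s ∈ K, ∀ t ∈ K, ∀ j, (lieBracket m n k (w s) (w t)).coeff j ∈
        (primaryW k r).diffIdeal {x | ∃ s ∈ K, x = w s - algebraMap ℂ _ (χ s)}) ∧
      ((primaryW k r).reduce k
        {x | ∃ s ∈ K, x = w s - algebraMap ℂ _ (χ s)}
        {x | ∃ s ∈ K, x = w s - algebraMap ℂ _ (χ s)}).Isomorphic k (primaryW k r') := by
  have hle := rel_of_regularSubalgebra_le hH
  obtain ⟨g, h, Y, H, hY⟩ := exists_isGauge (r := r) (r' := r) (fun _ _ e => e) k hr hr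
  obtain ⟨g', h', Y', H', hY'⟩ := exists_isGauge hle k hr hr'
  -- `K` consists of the star entries of negative refined degree and `χ` of their values, up to
  -- sign, in the lowering matrix of `r'`. The invariant extending an entry is obtained by
  -- substituting the gauge fixed matrix `Y` for `J`.
  refine ⟨isGaugeFixing k hr, reductionEntries r r', reductionValue r r',
    fun s => H.hom.hom (entry s), fun s hs => ⟨hs.1, hs.2.1, ?_, ?_⟩,
    fun s hs t ht j => H.isFirstClass hle hr' hY hs ht j, H.reduce_isomorphic hle hY H' hY'⟩
  · exact H.mem_num hY (entry_mem_sl fun e => hs.2.1 (e ▸ r.refl _))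
  · have h1 : entry s ∈ slAlg m n := entry_mem_sl fun e => hs.2.1 (e ▸ r.refl _)
    rw [mem_horizontalIdeal hr, map_sub, ← DHom.comp_apply, H.tan_hom, sub_self]
    exact ⟨sub_mem (H.hom_mem_sl h1) h1, rfl⟩
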